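/- **Setting.** There are $n\ge 1$ bidders and one seller (player $0$), finite nonempty sets $\mathcal S,\mathcal A$ of states and actions of sizes $S,A$, and a transition kernel $P$ with $P(s'|s,a)\ge\alpha>0$ for all $s,a,s'$. In round $t=1,2,\dots$ the seller draws $a^t$ from his current policy at $s^t$. Then the realized rewards $r_i^t$ ($0\le i\le n$) are drawn independently from fixed laws $\mathcal D_i(s^t,a^t)$ on $[0,c_i]$ with means $r_i(s^t,a^t)$, where $c_0=c_{\max}$ and $c_i=1$ for $i\ge1$. Each bidder reports a value $b_i^t\in[0,1]$ that may depend on anything that has happened so far, bidder $i$ is charged $p_i^t$, and $s^{t+1}\sim P(\cdot|s^t,a^t)$. Put $R=\sum_{j\ge0} r_j$, $R_{-i}=R-r_i$, $u_i^t=r_i^t-p_i^t$ ($i\ge 1$) and $u_0^t=r_0^t+\sum_{i\ge1}p_i^t$. For a stationary policy $\pi$ let $J(\pi;r)=\lim_T\frac1T\mathbb E_\pi\sum_{t\le T}r(s^t,a^t)$. The offline VCG outcome is $\pi^*\in\arg\max_\pi J(\pi;R)$ and $p_i^*(s,a)=\max_\pi J(\pi;R_{-i})-R_{-i}(s,a)$.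 A bidder is truthful if $b_i^t=r_i^t$ always, and stationary if $b_i^t$ is a sample from a fixed law depending only on $(s^t,a^t)$. **Algorithm IHMDP-VCG** (parameters $\alpha$, $\delta$, $\zeta\in(0,1)$, $c_{\max}$). Let $\Delta$ be the set of $q\ge0$ on $\mathcal S\times\mathcal A\times\mathcal S$ with total mass $1$ and $\sum_{s',a}q(s',a,s)=\sum_{a,s'}q(s,a,s')$. For a set $\mathcal P$ of kernels let $\Delta_\delta(\mathcal P)$ be the set of $q\in\Delta$ with $\rho_q(s,a):=\sum_{s'}q(s,a,s')\ge\delta$ for all $(s,a)$ and $q(s,a,s')=P'(s'|s,a)\rho_q(s,a)$ for some $P'\in\mathcal P$. Write $\langle q,r\rangle=\sum_{s,a}\rho_q(s,a)r(s,a)$. Episode $k=1,2,\dots$ has a mixing phase of $d^{[k]}=\lceil\frac{\log k}{\alpha S}\rceil$ rounds with charges $0$, then a stationary phase of $l^{[k]}=\lceil\frac{\max\{4,\sqrt k\}\log(ASk/\zeta)}{\alpha\delta}\rceil$ rounds with charges $\hat p^{[k]}_i(s^t,a^t)$. Throughout the episode the policy is $\pi^{[k]}(a|s)=\rho_q(s,a)/\sum_{a'}\rho_q(s,a')$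 with $q=\hat q^{[k]}$ (arbitrary where the denominator is $0$). Initially $\hat q^{[1]}\equiv\frac1{AS^2}$ and $\hat p^{[1]}\equiv1$. Let $N^{[k]}(s,a)$ and $N^{[k]}(s,a,s')$ be the visit counts up to the end of episode $k$, let $\bar P^{[k]}(s'|s,a)=N^{[k]}(s,a,s')/\max\{1,N^{[k]}(s,a)\}$, and let $\bar r_i^{[k]}(s,a)$ be the sum of the values reported by $i$ at the visits to $(s,a)$ (for $i=0$, of the seller's realized rewards) divided by $\max\{1,N^{[k]}(s,a)\}$. Let $\mathcal P^{[0]}$ be the set of all kernels and let $\mathcal P^{[k]}$ be the set of $P'\in\mathcal P^{[k-1]}$ with $$P'(s'|s,a)-\bar P^{[k]}(s'|s,a)\le 2\sqrt{\tfrac{\bar P^{[k]}(s'|s,a)\log(ASk/\zeta)}{\max\{1,N^{[k]}(s,a)-1\}}}+\tfrac{14\log(ASk/\zeta)}{3\max\{1,N^{[k]}(s,a)-1\}}$$ for all $s,a,s'$. With $\beta^{[k]}=\sqrt{2\log(ASkn/\zeta)/\max\{1,N^{[k]}\}}$ put $\hat r_i^{[k]}=\min\{c_i,\bar r_i^{[k]}+c_i\beta^{[k]}\}$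 and $\check r_i^{[k]}=\max\{0,\bar r_i^{[k]}-c_i\beta^{[k]}\}$, and let $\hat R^{[k]},\hat R_{-i}^{[k]},\check R_{-i}^{[k]}$ be the corresponding sums. After episode $k$, choose $\hat q^{[k+1]}$ and $\hat q_{-i}^{[k+1]}$ maximizing $\langle q,\hat R^{[k]}\rangle$, respectively $\langle q,\hat R_{-i}^{[k]}\rangle$, over $\Delta_\delta(\mathcal P^{[k]})$. Ties are broken arbitrarily, and arbitrary elements of $\Delta$ are chosen if this set is empty. Set $\hat p_i^{[k+1]}(s,a)=\langle\hat q_{-i}^{[k+1]},\hat R_{-i}^{[k]}\rangle-\check R_{-i}^{[k]}(s,a)$. **Conventions.** "With probability at least $1-x$" (where $x<1$) means that there is an event $G$ with $\Pr(G)\ge1-x$ such that the statement holds for all $T$ in question when the expectations $\mathbb E$ in it are replaced by $\mathbb E[\,\cdot\,|G]$. The regrets are $$\mathrm{Reg}^{SW}(T)=TJ(\pi^*;R)-\mathbb E\sum_{t\le T}\sum_{i=0}^n r_i^t,\qquad \mathrm{Reg}^{SELL}(T)=TJ\Big(\pi^*;r_0+\sum_i p_i^*\Big)-\mathbb E\sum_{t\le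 T}u_0^t,$$ $$\mathrm{Reg}^{BID}(T)=T\sum_{i\ge1} J(\pi^*;r_i-p^*_i)-\mathbb E\sum_{t\le T}\sum_{i\ge1}u_i^t .$$ **Theorem.** There is a function $D$ of $(\varepsilon_0,\alpha_0,S,A,n)$ ($\varepsilon_0,\alpha_0$ rational, $D$ rational), computable by a Turing machine in time polynomial in the bit length of its input, and for every $c_{\max}\ge0$ there are constants $C>0$ and $m\in\mathbb N$ depending only on $c_{\max}$, such that the following holds for all auctions as above, all real $\varepsilon,\zeta\in(0,1)$, and all rationals $0<\varepsilon_0\le\varepsilon$ and $0<\alpha_0\le\alpha$. Put $\delta=D(\varepsilon_0,\alpha_0,S,A,n)$. Then $\delta\in(0,1)$, and with probability at least $1-C\zeta\,(1+\log\frac{AS}{\alpha\delta})^m$ (that is, $1-O(\zeta)$, with an implied constant that is polylogarithmic in $AS/(\alpha\delta)$) each of the following statements holds. 1. If all bidders are truthful, then for all integers $T\ge\frac{8}{\alpha\delta}\log\frac{AS}{\zeta}$, with $L=(1+\log(ASTn/\zeta))^m$, $$\mathrm{Reg}^{SW}(T)\le CL\,\big(\varepsilon Tn+\alpha^{-4/3}\delta^{-1/3}S^{-1/2}T^{2/3}n\big).$$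 2. Under the same assumptions, $\mathrm{Reg}^{SELL}(T)\le CL\,\big(\varepsilon Tn^2+\alpha^{-4/3}\delta^{-1/3}S^{-1/2}T^{2/3}n^2\big)$. 3. Under the same assumptions, $\mathrm{Reg}^{BID}(T)$ has the same bound as in 2. 4. (Approximate efficiency.) If all bidders are truthful, then $\limsup_{T\to\infty}\frac1T\mathrm{Reg}^{SW}(T)\le Cn\varepsilon$. 5. (Approximate individual rationality.) If bidder $i$ is truthful and the other bidders behave arbitrarily, then $\liminf_{T\to\infty}\frac1T\mathbb E\sum_{t\le T}u_i^t\ge0$. 6. (Approximate truthfulness.) If $u_i^t$ and $\tilde u_i^t$ are the utilities of bidder $i$ in two runs (on a common probability space) in which she is truthful and arbitrary, respectively, and each other bidder uses the same stationary strategy in both runs, then $\limsup_{T\to\infty}\frac1T\mathbb E\sum_{t\le T}(\tilde u_i^t-u_i^t)\le0$. -/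

import Mathlib

open MeasureTheory ProbabilityTheory Filter Topology
open scoped NNRat

noncomputable section

namespace DynVCG

/-! ### Polynomial-time computability

Numbers are written in binary, each one followed by the separator `none`;
a nonnegative rational is written as its numerator and denominator in lowest terms. -/

/-- The word that lists some natural numbers in binary. -/
def numWord (l : List ℕ) : List (Option Bool) :=
  l.flatMap fun x => (Computability.encodeNat x).map some ++ [none]

/-- The word of an input `(ε₀, α₀, |S|, |A|, n)`. -/
def inputWord (x : ℚ≥0 × ℚ≥0 × ℕ × ℕ × ℕ) : List (Option Bool) :=
  numWord [x.1.num, x.1.den, x.2.1.num, x.2.1.den, x.2.2.1, x.2.2.2.1, x.2.2.2.2]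

/-- The word of a nonnegative rational output. -/
def ratWord (x : ℚ≥0) : List (Option Bool) :=
  numWord [x.num, x.den]

/-- Computability by a Turing machine in time polynomial in the bit length of the input. -/
def PolyTimeComputable (f : ℚ≥0 × ℚ≥0 × ℕ × ℕ × ℕ → ℚ≥0) : Prop :=
  Nonempty (Turing.TM2ComputableInPolyTime inputWord ratWord f)

/-! ### The auction as a Markov decision process

The players are `Fin (n + 1)`: player `0` is the seller, and bidder `i : Fin n` is player
`i.succ`. -/

/-- The upper bound `c_i` of the rewards of player `i`. -/
def rewardCap {n : ℕ} (cmax : ℝ) (i : Fin (n + 1)) : ℝ :=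
  if i = 0 then cmax else 1

/-- A sequential auction: a transition kernel, and for each player and each state-action pair the
distribution of the realized reward. -/
structure AuctionMDP (S A : Type*) [Fintype S] (n : ℕ) (cmax : ℝ) where
  trans : S → A → S → ℝ
  trans_mem : ∀ s a, trans s a ∈ stdSimplex ℝ S
  rewardLaw : Fin (n + 1) → S → A → Measure ℝ
  rewardLaw_prob : ∀ i s a, IsProbabilityMeasure (rewardLaw i s a)
  rewardLaw_supp : ∀ i s a, ∀ᵐ x ∂(rewardLaw i s a), x ∈ Set.Icc 0 (rewardCap cmax i)

/-- The reward function `r_i(s, a)`, the mean of the realized reward. -/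
def AuctionMDP.reward {S A : Type*} [Fintype S] {n : ℕ} {cmax : ℝ} (M : AuctionMDP S A n cmax)
    (i : Fin (n + 1)) (s : S) (a : A) : ℝ :=
  ∫ x, x ∂(M.rewardLaw i s a)

/-- `R = ∑_j f_j`. -/
def total {S A : Type*} {n : ℕ} (f : Fin (n + 1) → S → A → ℝ) (s : S) (a : A) : ℝ :=
  ∑ j, f j s a

/-- `R_{-i} = ∑_{j ≠ i} f_j` for a bidder `i`. -/
def totalExcept {S A : Type*} {n : ℕ} (f : Fin (n + 1) → S → A → ℝ) (i : Fin n) (s : S) (a : A) :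
    ℝ :=
  ∑ j ∈ Finset.univ.erase i.succ, f j s a

/-- Stationary allocation policies. -/
def IsPolicy {S A : Type*} [Fintype A] (π : S → A → ℝ) : Prop :=
  ∀ s, π s ∈ stdSimplex ℝ A

open Classical in
/-- The distribution of the state after `t` transitions from `s₀` under the policy `π`. -/
def stateDist {S A : Type*} [Fintype S] [Fintype A] (P : S → A → S → ℝ) (π : S → A → ℝ) (s₀ : S) :
    ℕ → S → ℝ
  | 0 => fun y => if y = s₀ then 1 else 0
  | t + 1 => fun y => ∑ x, ∑ a, stateDist P π s₀ t x * π x a * P x a y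

/-- The expected average payoff `J(π; r)` from the initial state `s₀`. -/
def avgPayoff {S A : Type*} [Fintype S] [Fintype A] (P : S → A → S → ℝ) (s₀ : S) (π : S → A → ℝ)
    (r : S → A → ℝ) : ℝ :=
  limUnder atTop fun T : ℕ =>
    (1 / (T : ℝ)) * ∑ t ∈ Finset.range T, ∑ s, ∑ a, stateDist P π s₀ t s * π s a * r s a

/-- `π` maximizes `J(·; r)` among the stationary policies. -/
def IsOptimalPolicy {S A : Type*} [Fintype S] [Fintype A] (P : S → A → S → ℝ) (s₀ : S)
    (r : S → A → ℝ) (π : S → A → ℝ) : Prop :=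
  IsPolicy π ∧ ∀ π', IsPolicy π' → avgPayoff P s₀ π' r ≤ avgPayoff P s₀ π r

/-- `(π, p)` is an outcome of the offline infinite-horizon VCG mechanism with truthful bids;
`πEx i` is the policy `π*_{-i}`. -/
structure IsOfflineVCG {S A : Type*} [Fintype S] [Fintype A] {n : ℕ} {cmax : ℝ}
    (M : AuctionMDP S A n cmax) (s₀ : S) (π : S → A → ℝ) (πEx : Fin n → S → A → ℝ)
    (p : Fin n → S → A → ℝ) : Prop where
  alloc : IsOptimalPolicy M.trans s₀ (total M.reward) π
  allocEx : ∀ i, IsOptimalPolicy M.trans s₀ (totalExcept M.reward i) (πEx i)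
  pay : ∀ i s a, p i s a =
    avgPayoff M.trans s₀ (πEx i) (totalExcept M.reward i) - totalExcept M.reward i s a

/-! ### Occupancy measures -/

/-- `ρ(s, a) = ∑_{s'} q(s, a, s')`. -/
def saFreq {S A : Type*} [Fintype S] (q : S → A → S → ℝ) (s : S) (a : A) : ℝ :=
  ∑ s', q s a s'

/-- `ν(s) = ∑_a ρ(s, a)`. -/
def stateFreq {S A : Type*} [Fintype S] [Fintype A] (q : S → A → S → ℝ) (s : S) : ℝ :=
  ∑ a, saFreq q s a

/-- The polytope `Δ` of occupancy measures. -/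
def occ (S A : Type*) [Fintype S] [Fintype A] : Set (S → A → S → ℝ) :=
  {q | (∀ s a s', 0 ≤ q s a s') ∧ ∑ s, ∑ a, ∑ s', q s a s' = 1 ∧
    ∀ s, ∑ s', ∑ a, q s' a s = ∑ a, ∑ s', q s a s'}

/-- The polytope `Δ(P)`. -/
def occOf {S A : Type*} [Fintype S] [Fintype A] (P : S → A → S → ℝ) : Set (S → A → S → ℝ) :=
  {q ∈ occ S A | ∀ s a s', q s a s' = P s a s' * saFreq q s a}

/-- `Δ_δ(K)`: the `q` in `⋃_{P ∈ K} Δ(P)` that give weight at least `δ` to each `(s, a)`. -/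
def shrunkOcc {S A : Type*} [Fintype S] [Fintype A] (δ : ℝ) (K : Set (S → A → S → ℝ)) :
    Set (S → A → S → ℝ) :=
  {q | (∃ P ∈ K, q ∈ occOf P) ∧ ∀ s a, δ ≤ saFreq q s a}

/-- `⟨q, r⟩` for a reward function `r(s, a, s') = r(s, a)`. -/
def pairing {S A : Type*} [Fintype S] [Fintype A] (q : S → A → S → ℝ) (r : S → A → ℝ) : ℝ :=
  ∑ s, ∑ a, ∑ s', q s a s' * r s a

/-- `π` is a policy induced by `q`: any distribution is allowed in a state of weight zero. -/
def Induces {S A : Type*} [Fintype S] [Fintype A] (q : S → A → S → ℝ) (π : S → A → ℝ) : Prop :=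
  IsPolicy π ∧ ∀ s a, stateFreq q s ≠ 0 → π s a = saFreq q s a / stateFreq q s

/-- `q` is a result of maximizing `⟨q, r⟩` over the feasible set `K`, with ties broken arbitrarily;
if the program is infeasible, then `q` may be any occupancy measure. -/
def IsLPChoice {S A : Type*} [Fintype S] [Fintype A] (K : Set (S → A → S → ℝ)) (r : S → A → ℝ)
    (q : S → A → S → ℝ) : Prop :=
  q ∈ occ S A ∧ (K.Nonempty → q ∈ K ∧ ∀ q' ∈ K, pairing q' r ≤ pairing q r)

/-! ### The learning algorithm IHMDP-VCG: schedule and estimates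

Rounds and episodes are numbered from `1`. -/

/-- The parameters of the algorithm. -/
structure Params where
  alpha : ℝ
  delta : ℝ
  zeta : ℝ
  cmax : ℝ

/-- `log(|A| |S| k / ζ)`. -/
def logTerm (S A : Type*) [Fintype S] [Fintype A] (pr : Params) (k : ℕ) : ℝ :=
  Real.log ((Fintype.card A : ℝ) * Fintype.card S * k / pr.zeta)

/-- The length `d^{[k]}` of the mixing phase. -/
def mixLen (S : Type*) [Fintype S] (pr : Params) (k : ℕ) : ℕ :=
  ⌈Real.log k / (pr.alpha * Fintype.card S)⌉₊

/-- The length `l^{[k]}` of the stationary phase. -/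
def statLen (S A : Type*) [Fintype S] [Fintype A] (pr : Params) (k : ℕ) : ℕ :=
  ⌈max 4 (√(k : ℝ)) * logTerm S A pr k / (pr.alpha * pr.delta)⌉₊

/-- The first round `τ^{[k]}` of episode `k`. -/
def epStart (S A : Type*) [Fintype S] [Fintype A] (pr : Params) (k : ℕ) : ℕ :=
  1 + ∑ j ∈ Finset.Ico 1 k, (mixLen S pr j + statLen S A pr j)

/-- What the seller observes: states, actions, and in each round the reported rewards
(entry `0` is the seller's own reward). -/
structure Observation (S A : Type*) (n : ℕ) where
  state : ℕ → S
  action : ℕ → A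
  report : ℕ → Fin (n + 1) → ℝ

section Estimates

variable {S A : Type*} [Fintype S] [Fintype A] {n : ℕ} (pr : Params) (h : Observation S A n)

open Classical in
/-- `N^{[k]}(s, a)`, the visits up to the end of episode `k`. -/
def visits (k : ℕ) (s : S) (a : A) : ℕ :=
  ((Finset.Ico 1 (epStart S A pr (k + 1))).filter
    fun t => h.state t = s ∧ h.action t = a).card

open Classical in
/-- `N^{[k]}(s, a, s')`. -/
def visitsTo (k : ℕ) (s : S) (a : A) (s' : S) : ℕ :=
  ((Finset.Ico 1 (epStart S A pr (k + 1))).filter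
    fun t => h.state t = s ∧ h.action t = a ∧ h.state (t + 1) = s').card

/-- The empirical transition kernel. -/
def empTrans (k : ℕ) (s : S) (a : A) (s' : S) : ℝ :=
  visitsTo pr h k s a s' / max 1 (visits pr h k s a : ℝ)

/-- The Bernstein radius `ε^{[k]}(s, a, s')`. -/
def transRadius (k : ℕ) (s : S) (a : A) (s' : S) : ℝ :=
  2 * √(empTrans pr h k s a s' * logTerm S A pr k / max 1 ((visits pr h k s a : ℝ) - 1)) +
    14 * logTerm S A pr k / (3 * max 1 ((visits pr h k s a : ℝ) - 1))

/-- The confidence set `P^{[k]}` for the transition kernel. -/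
def confSet : ℕ → Set (S → A → S → ℝ)
  | 0 => {P | ∀ s a, P s a ∈ stdSimplex ℝ S}
  | k + 1 => confSet k ∩ {P | ∀ s a s',
      P s a s' - empTrans pr h (k + 1) s a s' ≤ transRadius pr h (k + 1) s a s'}

open Classical in
/-- The empirical reward function of player `i`. -/
def empReward (k : ℕ) (i : Fin (n + 1)) (s : S) (a : A) : ℝ :=
  (∑ t ∈ Finset.Ico 1 (epStart S A pr (k + 1)),
    if h.state t = s ∧ h.action t = a then h.report t i else 0) / max 1 (visits pr h k s a : ℝ)

/-- The confidence radius `β^{[k]}(s, a)`. -/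
def rewardRadius (k : ℕ) (s : S) (a : A) : ℝ :=
  √(2 * Real.log ((Fintype.card A : ℝ) * Fintype.card S * k * n / pr.zeta) /
    max 1 (visits pr h k s a : ℝ))

/-- The upper confidence bound for the reward of player `i`. -/
def ucb (k : ℕ) (i : Fin (n + 1)) (s : S) (a : A) : ℝ :=
  min (rewardCap pr.cmax i)
    (empReward pr h k i s a + rewardCap pr.cmax i * rewardRadius pr h k s a)

/-- The lower confidence bound for the reward of player `i`. -/
def lcb (k : ℕ) (i : Fin (n + 1)) (s : S) (a : A) : ℝ :=
  max 0 (empReward pr h k i s a - rewardCap pr.cmax i * rewardRadius pr h k s a)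

/-- The feasible set `Δ_δ(P^{[k]})` of the linear programs solved at the end of episode `k`. -/
def feasible (k : ℕ) : Set (S → A → S → ℝ) :=
  shrunkOcc pr.delta (confSet pr h k)

end Estimates

/-! ### Runs of the online auction -/

/-- The random quantities of an online auction on a sample space `Ω`. In round `t` the information
available is `pre t` when the action is drawn (it includes the current state), `mid t` when the
rewards are drawn (it includes the action), and `post t` when the next state is drawn (it includes
the rewards and the bids). All of these may contain private information and private coins.
`occup k` and `occupEx k i` are the occupancy measures `q^{[k]}` and `q_{-i}^{[k]}` of the seller,
and `alloc k` is his allocation policy in episode `k`. -/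
structure OnlineProcess (S A : Type*) (n : ℕ) (Ω : Type*) where
  pre : ℕ → MeasurableSpace Ω
  mid : ℕ → MeasurableSpace Ω
  post : ℕ → MeasurableSpace Ω
  state : ℕ → Ω → S
  action : ℕ → Ω → A
  reward : ℕ → Fin (n + 1) → Ω → ℝ
  bid : ℕ → Fin n → Ω → ℝ
  pay : ℕ → Fin n → Ω → ℝ
  occup : ℕ → Ω → S → A → S → ℝ
  occupEx : ℕ → Fin n → Ω → S → A → S → ℝ
  alloc : ℕ → Ω → S → A → ℝ

/-- The observations of the seller: his own rewards, and the bids in place of the bidders' rewards. -/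
def OnlineProcess.obs {S A : Type*} {n : ℕ} {Ω : Type*} (X : OnlineProcess S A n Ω) (ω : Ω) :
    Observation S A n where
  state t := X.state t ω
  action t := X.action t ω
  report t := Fin.cons (X.reward t 0 ω) fun i => X.bid t i ω

/-- The process obeys the auction `M`. The bids of a round are arbitrary in `[0, 1]`, chosen on the
information available before the next state is drawn. -/
structure IsOnlineAuction {S A : Type*} [Fintype S] {n : ℕ} {cmax : ℝ}
    (M : AuctionMDP S A n cmax) {Ω : Type*} [mΩ : MeasurableSpace Ω] (μ : Measure Ω)
    (X : OnlineProcess S A n Ω) : Prop where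
  pre_le_mid : ∀ t, X.pre t ≤ X.mid t
  mid_le_post : ∀ t, X.mid t ≤ X.post t
  post_le_pre : ∀ t, X.post t ≤ X.pre (t + 1)
  post_le : ∀ t, X.post t ≤ mΩ
  state_meas : ∀ t ≥ 1, ∀ s, MeasurableSet[X.pre t] {ω | X.state t ω = s}
  action_meas : ∀ t ≥ 1, ∀ a, MeasurableSet[X.mid t] {ω | X.action t ω = a}
  reward_meas : ∀ t ≥ 1, ∀ i, Measurable[X.post t] (X.reward t i)
  bid_meas : ∀ t ≥ 1, ∀ i, Measurable[X.post t] (X.bid t i)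
  bid_mem : ∀ t ≥ 1, ∀ i, ∀ᵐ ω ∂μ, X.bid t i ω ∈ Set.Icc (0 : ℝ) 1
  reward_law : ∀ t ≥ 1, ∀ B : Set (Fin (n + 1) → ℝ), MeasurableSet B →
    μ⟦{ω | (fun i => X.reward t i ω) ∈ B} | X.mid t⟧ =ᵐ[μ]
      fun ω => (Measure.pi fun i => M.rewardLaw i (X.state t ω) (X.action t ω)).real B
  state_law : ∀ t ≥ 1, ∀ s,
    μ⟦{ω | X.state (t + 1) ω = s} | X.post t⟧ =ᵐ[μ]
      fun ω => M.trans (X.state t ω) (X.action t ω) s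

/-- The seller runs IHMDP-VCG with parameters `pr`. -/
structure FollowsIHMDPVCG {S A : Type*} [Fintype S] [Fintype A] {n : ℕ} (pr : Params)
    {Ω : Type*} [MeasurableSpace Ω] (μ : Measure Ω) (X : OnlineProcess S A n Ω) : Prop where
  occup_meas : ∀ k ≥ 1, ∀ s a s',
    Measurable[X.pre (epStart S A pr k)] fun ω => X.occup k ω s a s'
  occupEx_meas : ∀ k ≥ 1, ∀ i s a s',
    Measurable[X.pre (epStart S A pr k)] fun ω => X.occupEx k i ω s a s'
  alloc_meas : ∀ k ≥ 1, ∀ s a,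
    Measurable[X.pre (epStart S A pr k)] fun ω => X.alloc k ω s a
  occup_one : ∀ ω s a s', X.occup 1 ω s a s' =
    1 / ((Fintype.card A : ℝ) * (Fintype.card S : ℝ) ^ 2)
  occup_succ : ∀ k ≥ 1, ∀ ω,
    IsLPChoice (feasible pr (X.obs ω) k) (total (ucb pr (X.obs ω) k)) (X.occup (k + 1) ω)
  occupEx_succ : ∀ k ≥ 1, ∀ i ω,
    IsLPChoice (feasible pr (X.obs ω) k) (totalExcept (ucb pr (X.obs ω) k) i)
      (X.occupEx (k + 1) i ω)
  alloc_induced : ∀ k ≥ 1, ∀ ω, Induces (X.occup k ω) (X.alloc k ω)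
  action_law : ∀ k ≥ 1, ∀ t ∈ Finset.Ico (epStart S A pr k) (epStart S A pr (k + 1)), ∀ a,
    μ⟦{ω | X.action t ω = a} | X.pre t⟧ =ᵐ[μ] fun ω => X.alloc k ω (X.state t ω) a
  pay_mixing : ∀ k ≥ 1,
    ∀ t ∈ Finset.Ico (epStart S A pr k) (epStart S A pr k + mixLen S pr k), ∀ i ω,
      X.pay t i ω = 0
  pay_first : ∀ t ∈ Finset.Ico (epStart S A pr 1 + mixLen S pr 1) (epStart S A pr 2), ∀ i ω,
    X.pay t i ω = 1
  pay_succ : ∀ k ≥ 1,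
    ∀ t ∈ Finset.Ico (epStart S A pr (k + 1) + mixLen S pr (k + 1)) (epStart S A pr (k + 2)),
      ∀ i ω, X.pay t i ω =
        pairing (X.occupEx (k + 1) i ω) (totalExcept (ucb pr (X.obs ω) k) i) -
          totalExcept (lcb pr (X.obs ω) k) i (X.state t ω) (X.action t ω)

/-- Bidder `i` reports her realized reward in each round. -/
def IsTruthful {S A : Type*} {n : ℕ} {Ω : Type*} (X : OnlineProcess S A n Ω) (i : Fin n) : Prop :=
  ∀ t ≥ 1, ∀ ω, X.bid t i ω = X.reward t i.succ ω

/-- In each round, bidder `i` reports a sample from the distribution `B (s^t) (a^t)`. -/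
def IsStationaryBidder {S A : Type*} {n : ℕ} {Ω : Type*} [MeasurableSpace Ω] (μ : Measure Ω)
    (X : OnlineProcess S A n Ω) (i : Fin n) (B : S → A → Measure ℝ) : Prop :=
  ∀ t ≥ 1, ∀ E : Set ℝ, MeasurableSet E →
    μ⟦{ω | X.bid t i ω ∈ E} | X.mid t⟧ =ᵐ[μ] fun ω => (B (X.state t ω) (X.action t ω)).real E

/-! ### Performance measures

Expectations are taken with respect to a measure `ν`. -/

section Performance

variable {S A : Type*} {n : ℕ} {Ω : Type*} [MeasurableSpace Ω] (ν : Measure Ω)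
  (X : OnlineProcess S A n Ω)

/-- The realized utility `u_0^t` of the seller. -/
def sellerUtil (t : ℕ) (ω : Ω) : ℝ := X.reward t 0 ω + ∑ i, X.pay t i ω

/-- The realized utility `u_i^t` of bidder `i`. -/
def bidderUtil (t : ℕ) (i : Fin n) (ω : Ω) : ℝ := X.reward t i.succ ω - X.pay t i ω

variable [Fintype S] [Fintype A] {cmax : ℝ} (M : AuctionMDP S A n cmax) (s₀ : S)
  (π : S → A → ℝ) (p : Fin n → S → A → ℝ)

/-- The social welfare regret with respect to the policy `π`. -/
def regSW (T : ℕ) : ℝ :=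
  T * avgPayoff M.trans s₀ π (total M.reward) -
    ∫ ω, ∑ t ∈ Finset.Icc 1 T, ∑ i, X.reward t i ω ∂ν

/-- The seller's regret with respect to `(π, p)`. -/
def regSELL (T : ℕ) : ℝ :=
  T * avgPayoff M.trans s₀ π (fun s a => M.reward 0 s a + ∑ i, p i s a) -
    ∫ ω, ∑ t ∈ Finset.Icc 1 T, sellerUtil X t ω ∂ν

/-- The bidders' regret with respect to `(π, p)`. -/
def regBID (T : ℕ) : ℝ :=
  T * ∑ i : Fin n, avgPayoff M.trans s₀ π (fun s a => M.reward i.succ s a - p i s a) -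
    ∫ ω, ∑ t ∈ Finset.Icc 1 T, ∑ i, bidderUtil X t i ω ∂ν

end Performance

/-- `limsup f ≤ c` for a real sequence. -/
def LimsupLE (f : ℕ → ℝ) (c : ℝ) : Prop :=
  ∀ η > 0, ∀ᶠ T in atTop, f T ≤ c + η

/-- `liminf f ≥ c` for a real sequence. -/
def LiminfGE (f : ℕ → ℝ) (c : ℝ) : Prop :=
  ∀ η > 0, ∀ᶠ T in atTop, c - η ≤ f T

/-- With probability at least `1 - x`: there is an event `G` of at least this probability, such
that `φ` holds when expectations are taken conditionally on `G`. (Void if `x ≥ 1`.) -/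
def WithFailure {Ω : Type*} [MeasurableSpace Ω] (μ : Measure Ω) (x : ℝ)
    (φ : Measure Ω → Prop) : Prop :=
  x < 1 → ∃ G : Set Ω, MeasurableSet G ∧ 1 - x ≤ μ.real G ∧ φ (μ[|G])

section Desiderata

variable {S A : Type*} {n : ℕ} {Ω : Type*} [MeasurableSpace Ω] (ν : Measure Ω)
  (X : OnlineProcess S A n Ω)

/-- `c`-approximate efficiency: `lim Reg_SW(T) / T ≤ c`, for a run with truthful bidders. -/
def ApproxEfficient [Fintype S] [Fintype A] {cmax : ℝ} (M : AuctionMDP S A n cmax) (s₀ : S)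
    (π : S → A → ℝ) (c : ℝ) : Prop :=
  LimsupLE (fun T => 1 / (T : ℝ) * regSW ν X M s₀ π T) c

/-- Approximate individual rationality for bidder `i`, for a run in which she is truthful. -/
def ApproxRational (i : Fin n) : Prop :=
  LiminfGE (fun T => 1 / (T : ℝ) * ∫ ω, ∑ t ∈ Finset.Icc 1 T, bidderUtil X t i ω ∂ν) 0

/-- Approximate truthfulness for bidder `i`, who is truthful in the run `X` and arbitrary in the
run `Y`. -/
def ApproxTruthful (Y : OnlineProcess S A n Ω) (i : Fin n) : Prop :=
  LimsupLE (fun T => 1 / (T : ℝ) *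
    ∫ ω, ∑ t ∈ Finset.Icc 1 T, (bidderUtil Y t i ω - bidderUtil X t i ω) ∂ν) 0

end Desiderata

/-- `ε T N + α^{-4/3} δ^{-1/3} |S|^{-1/2} T^{2/3} N`. -/
def regretRate (S : Type*) [Fintype S] (ε α δ : ℝ) (T : ℕ) (N : ℝ) : ℝ :=
  ε * T * N + α ^ (-(4 / 3) : ℝ) * δ ^ (-(1 / 3) : ℝ) * (Fintype.card S : ℝ) ^ (-(1 / 2) : ℝ) *
    (T : ℝ) ^ (2 / 3 : ℝ) * N

end DynVCG

end

open DynVCG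

/-!
The seller works with optimistic estimates of the rewards and with occupancy measures that are
feasible for a confidence set of kernels and visit each pair `(s, a)` with frequency at least `δ`.
The proof shows that all confidence bounds hold simultaneously with high probability, and that on
this event everything the seller computes is close to its counterpart for the true kernel.

*Single policies.* Since all transition probabilities are at least `α`, the Poisson equation of
every policy has a solution bounded by `F / (α |S|)`, for payoffs bounded by `F`
(`exists_isPoisson`). It describes the average payoff over an arbitrary segment of rounds up to
deviations of visit counts from their conditional means (`abs_sum_sub_le_deviation`), and it reduces
the difference between the value of an occupancy measure in the seller's program and the average
payoff of its policy under the true kernel to the error in the kernel (`pairing_sub_avgPayoff`,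
`GoodPath.abs_pairing_sub_avgPayoff_le`).

*The good event.* The counts and the sums of reports, compensated, are bounded by exponential
supermartingales. As the number of visits is random, a geometric grid of exponents is used
(`measure_two_mul_sqrt_lt_le`), and the size of this grid is where the polylogarithmic factor of the
failure probability comes from. Every policy in use takes each action with probability at least `δ`,
and each state is reached with probability at least `α` in each round, so that after `t` rounds each
pair has been visited at least `α δ t / 8` times, as soon as this bound is not trivial. The union
over all episodes and pairs costs `O(ζ)` (`measure_not_goodPath_le`). The bounds concern only those
players whose reports have known means, such as the truthful bidders; the behaviour of the others
is arbitrary.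

*Regret and rationality.* The true kernel always belongs to the confidence set, so that the values
of the seller's programs are at least those for the true kernel (`GoodPath.avgPayoff_le_pairing`,
`GoodPath.shrunkValue_le`), apart from the loss due to the constraint `δ ≤ ρ(s, a)`, which is of
order `ε` by the choice of `δ` (`Admissible.shrinkLoss_le`). Each regret and each utility is then
bounded by a single estimate (`integral_sum_ge`): a bound for the average payoff of the policy of
each episode yields a bound for the expected payoff in `T` rounds, up to the error `learnErr`. This
error contains the precision of the estimates, the deviations within the phases, the mixing phases
and the first episode. It is of the order of the rate in the theorem (`Admissible.learnErr_le_rate`)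
and is sublinear in `T` (`Admissible.tendsto_learnErr`). Conditioning on the good event at most
doubles the deviations, since its probability is at least one half.

*Truthfulness.* Fix the means of the reports of the other players. A truthful bidder obtains, per
round and in the limit, the difference between the optimal welfare with and without her, both taken
in the program for the true kernel with the constraint `δ ≤ ρ(s, a)` (`GoodRun.externality_le`).
Whatever she reports, the policies are almost feasible for this program, and the constant part of
her charge is at least the optimal welfare of the others. Hence her utility cannot exceed the same
difference (`GoodRun.le_externality`). There is no loss of order `ε` here, because both values are
subject to the same constraint.

*The parameter `δ`.* It is `4 ^ (-ℓ)`, where `ℓ` is the length of the input, which a machine writes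
down in one pass over the input (`polyTimeComputable_threshold`). It is small enough, as a number is
bounded by two to the power of its length (`threshold_le`). If the claimed failure probability is
not below one, then there is nothing to prove; otherwise `ζ ≤ 1 / 100`
(`admissible_of_lt_one`).
-/

namespace DynVCG

set_option linter.unusedSectionVars false

/-! ### The threshold as a polynomial-time computable function -/

/-- The threshold `δ`: with `ℓ` the length of the input word, it is `4⁻ˡ`. It is dominated by every
quadratic expression in the input that the analysis needs, and a machine can write it down while
it reads the input once. -/
def threshold (x : ℚ≥0 × ℚ≥0 × ℕ × ℕ × ℕ) : ℚ≥0 :=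
  1 / 4 ^ (inputWord x).length

/-- The machine for `threshold`: stack `false` holds the input and stack `true` the output. It
pushes the denominator `4 ^ ℓ` (least significant bit on top, so the leading `1` goes first), two
zeros for each input symbol, and finally the numerator `1`. The label is `true` at the start, and
the state records whether the last `pop` met the end of the input. -/
def thresholdMachine : Turing.FinTM2 where
  K := Bool
  k₀ := false
  k₁ := true
  Γ _ := Option Bool
  Λ := Bool
  main := true
  σ := Bool
  initialState := false
  m
    | true => .push true (fun _ => none) <| .push true (fun _ => some true) <| .goto fun _ => false
    | false => .pop false (fun _ o => o.isNone) <| .branch id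
        (.push true (fun _ => none) <| .push true (fun _ => some true) <|
          .load (fun _ => false) .halt)
        (.push true (fun _ => some false) <| .push true (fun _ => some false) <|
          .goto fun _ => false)

/-- The two stacks with contents `l` and `o`. -/
def stackPair (l o : List (Option Bool)) : Bool → List (Option Bool)
  | false => l
  | true => o

/-- What the machine writes on an input of length `ℓ`, above what the output stack holds already. -/
def zeros (l : ℕ) (o : List (Option Bool)) : List (Option Bool) :=
  List.replicate (2 * l) (some false) ++ o

theorem thresholdMachine_start (l : List (Option Bool)) :
    thresholdMachine.step ⟨some true, false, stackPair l []⟩ =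
      some ⟨some false, false, stackPair l [some true, none]⟩ := by
  change some (Turing.TM2.Cfg.mk (some false) false _) = _
  congr 2
  funext b; cases b <;> rfl

theorem thresholdMachine_cons (a : Option Bool) (l o : List (Option Bool)) :
    thresholdMachine.step ⟨some false, false, stackPair (a :: l) o⟩ =
      some ⟨some false, false, stackPair l (some false :: some false :: o)⟩ := by
  change some (Turing.TM2.Cfg.mk (some false) false _) = _
  congr 2
  funext b; cases b <;> rfl

theorem thresholdMachine_nil (o : List (Option Bool)) :
    thresholdMachine.step ⟨some false, false, stackPair [] o⟩ =
      some ⟨none, false, stackPair [] (some true :: none :: o)⟩ := by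
  change some (Turing.TM2.Cfg.mk none false _) = _
  congr 2
  funext b; cases b <;> rfl

theorem thresholdMachine_loop (l o : List (Option Bool)) :
    (flip Bind.bind thresholdMachine.step)^[l.length + 1]
        (some ⟨some false, false, stackPair l o⟩) =
      some ⟨none, false, stackPair [] (some true :: none :: zeros l.length o)⟩ := by
  induction l generalizing o with
  | nil => exact thresholdMachine_nil o
  | cons a l ih =>
    rw [List.length_cons, Function.iterate_succ_apply]
    have : flip Bind.bind thresholdMachine.step (some ⟨some false, false, stackPair (a :: l) o⟩) =
        some ⟨some false, false, stackPair l (some false :: some false :: o)⟩ :=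
      thresholdMachine_cons a l o
    rw [this, ih]
    congr 4
    simp only [zeros, mul_add, List.replicate_add, mul_one, List.append_assoc]
    rfl

theorem encodePosNum_ofNat_two_pow (j : ℕ) :
    Computability.encodeNat (2 ^ j) = List.replicate j false ++ [true] := by
  induction j with
  | zero => rfl
  | succ j ih =>
    have h : ((2 ^ (j + 1) : ℕ) : Num) = Num.bit0 ((2 ^ j : ℕ) : Num) := by
      rw [← Num.to_nat_inj]
      simp [pow_succ, mul_comm, Num.cast_bit0, two_mul]
    unfold Computability.encodeNat at ih ⊢
    rw [h]
    cases hn : ((2 ^ j : ℕ) : Num) with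
    | zero =>
      have := congrArg (fun n : Num => (n : ℕ)) hn
      rw [Num.to_of_nat] at this
      exact absurd this (by positivity)
    | pos p =>
      rw [hn] at ih
      change false :: Computability.encodePosNum p = _
      rw [show Computability.encodePosNum p = _ from ih]
      rfl

theorem ratWord_threshold (x : ℚ≥0 × ℚ≥0 × ℕ × ℕ × ℕ) :
    ratWord (threshold x) =
      some true :: none :: zeros (inputWord x).length [some true, none] := by
  have hpos : (0 : ℕ) < 4 ^ (inputWord x).length := by positivity
  have h1 : (threshold x).num = 1 ∧ (threshold x).den = 4 ^ (inputWord x).length := by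
    have h : threshold x = ((4 ^ (inputWord x).length : ℕ) : ℚ≥0)⁻¹ := by
      simp [threshold]
    rw [h]
    have hc : (((4 ^ (inputWord x).length : ℕ) : ℚ≥0)⁻¹ : ℚ≥0) =
        (((4 ^ (inputWord x).length : ℕ) : ℚ)⁻¹ : ℚ) := by push_cast; rfl
    constructor
    · have := Rat.inv_natCast_num_of_pos hpos
      rw [← hc, NNRat.num_coe] at this
      exact_mod_cast this
    · have := Rat.inv_natCast_den_of_pos hpos
      rwa [← hc, NNRat.den_coe] at this
  have h2 : (4 : ℕ) ^ (inputWord x).length = 2 ^ (2 * (inputWord x).length) := by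
    rw [pow_mul]; norm_num
  have h3 : Computability.encodeNat 1 = [true] := rfl
  rw [ratWord, h1.1, h1.2, h2, numWord]
  simp [h3, encodePosNum_ofNat_two_pow, zeros]

theorem polyTimeComputable_threshold : PolyTimeComputable threshold := by
  refine ⟨⟨⟨thresholdMachine, Equiv.refl _, Equiv.refl _⟩, Polynomial.X + 2, fun x => ?_⟩⟩
  -- one step to write the leading digit of the denominator, one for each input symbol, and one at
  -- the end of the input
  refine ⟨⟨(inputWord x).length + 2, ?_⟩, ?_⟩
  · have hid : ∀ l : List (Option Bool), List.map (Equiv.refl (Option Bool)).invFun l = l :=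
      fun l => List.map_id l
    have hin : Turing.initList thresholdMachine (inputWord x) =
        ⟨some true, false, stackPair (inputWord x) []⟩ := by
      unfold Turing.initList
      congr 1
      funext b; cases b <;> rfl
    have hout : Turing.haltList thresholdMachine (ratWord (threshold x)) =
        ⟨none, false, stackPair [] (ratWord (threshold x))⟩ := by
      unfold Turing.haltList
      congr 1
      funext b; cases b <;> rfl
    have hstart : flip Bind.bind thresholdMachine.step
        (some ⟨some true, false, stackPair (inputWord x) []⟩) =
        some ⟨some false, false, stackPair (inputWord x) [some true, none]⟩ :=
      thresholdMachine_start _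
    refine (congrArg (fun c => (flip Bind.bind thresholdMachine.step)^[(inputWord x).length + 2]
      (some c)) ((congrArg (Turing.initList thresholdMachine) (hid _)).trans hin)).trans
      (Eq.trans ?_ (congrArg some
        ((congrArg (Turing.haltList thresholdMachine) (hid _)).trans hout)).symm)
    rw [Function.iterate_succ_apply, hstart, thresholdMachine_loop, ratWord_threshold]
  · simp

theorem lt_two_pow_length_encodeNat (n : ℕ) : n < 2 ^ (Computability.encodeNat n).length := by
  have hpos : ∀ p : PosNum, (p : ℕ) < 2 ^ (Computability.encodePosNum p).length := by
    intro p
    induction p with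
    | one => simp [Computability.encodePosNum]
    | bit0 p ih =>
      simp only [Computability.encodePosNum, List.length_cons, pow_succ, PosNum.cast_bit0]
      omega
    | bit1 p ih =>
      simp only [Computability.encodePosNum, List.length_cons, pow_succ, PosNum.cast_bit1]
      omega
  have h := Num.to_of_nat n
  unfold Computability.encodeNat
  cases hn : (n : Num) with
  | zero =>
    rw [hn] at h
    simp only [Computability.encodeNum, List.length_nil, pow_zero]
    have : n = 0 := by rw [← h]; rfl
    omega
  | pos p =>
    rw [hn] at h
    have := hpos p
    simp only [Computability.encodeNum]
    have h' : (p : ℕ) = n := h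
    omega

/-- A number `n` and its separator take so many symbols that `2 n ≤ 2 ^ symbols`. -/
theorem prod_le_two_pow_length_numWord (l : List ℕ) :
    (l.map fun n => 2 * n).prod ≤ 2 ^ (numWord l).length := by
  induction l with
  | nil => simp [numWord]
  | cons a l ih =>
    have h : (numWord (a :: l)).length = (Computability.encodeNat a).length + 1 +
        (numWord l).length := by
      simp [numWord]
      ring
    rw [h, List.map_cons, List.prod_cons, pow_add, pow_succ]
    refine Nat.mul_le_mul ?_ ih
    have := lt_two_pow_length_encodeNat a
    omega

/-- The only size estimate for the threshold that is used. -/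
theorem threshold_le (ε₀ α₀ : ℚ≥0) (s a n : ℕ) (hε : 0 < ε₀) (hα : 0 < α₀) (hs : 1 ≤ s)
    (ha : 1 ≤ a) (hn : 1 ≤ n) :
    (threshold (ε₀, α₀, s, a, n) : ℝ) ≤ (ε₀ * α₀ / (128 * (s * a * n))) ^ 2 := by
  -- the factors `2` of the seven numbers multiply to `128`
  have key := prod_le_two_pow_length_numWord
    [ε₀.num, ε₀.den, α₀.num, α₀.den, s, a, n]
  set len := (inputWord (ε₀, α₀, s, a, n)).length with hlen
  have key' : (128 * (s * a * n) : ℝ) * (ε₀.den * α₀.den) ≤ 2 ^ len := by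
    have h1 : 1 ≤ ε₀.num := Nat.one_le_iff_ne_zero.2 (by simpa using hε.ne')
    have h2 : 1 ≤ α₀.num := Nat.one_le_iff_ne_zero.2 (by simpa using hα.ne')
    have h3 : 128 * (s * a * n) * (ε₀.den * α₀.den) ≤ 2 ^ len := by
      refine le_trans ?_ key
      simp only [List.map_cons, List.map_nil, List.prod_cons, List.prod_nil]
      calc 128 * (s * a * n) * (ε₀.den * α₀.den)
          = 128 * (s * a * n) * (ε₀.den * α₀.den) * (1 * 1) := by ring
        _ ≤ 128 * (s * a * n) * (ε₀.den * α₀.den) * (ε₀.num * α₀.num) :=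
            Nat.mul_le_mul le_rfl (Nat.mul_le_mul h1 h2)
        _ = _ := by ring
    exact_mod_cast h3
  -- a positive rational is at least the reciprocal of its denominator
  have hfrac : ∀ q : ℚ≥0, 0 < q → 1 / (q.den : ℝ) ≤ (q : ℝ) := by
    intro q hq
    have hq1 : 1 ≤ q.num := Nat.one_le_iff_ne_zero.2 (by simpa using hq.ne')
    have hd : (0 : ℝ) < q.den := by exact_mod_cast q.den_pos
    have h : (q : ℝ) = q.num / q.den := by
      rw [NNRat.cast_def]
    rw [h]
    gcongr
    exact_mod_cast hq1
  have hd1 : (0 : ℝ) < ε₀.den := by exact_mod_cast ε₀.den_pos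
  have hd2 : (0 : ℝ) < α₀.den := by exact_mod_cast α₀.den_pos
  have hs' : (1 : ℝ) ≤ s := by exact_mod_cast hs
  have ha' : (1 : ℝ) ≤ a := by exact_mod_cast ha
  have hn' : (1 : ℝ) ≤ n := by exact_mod_cast hn
  have hcast : (threshold (ε₀, α₀, s, a, n) : ℝ) = (1 / 2 ^ len) ^ 2 := by
    simp only [threshold, ← hlen]
    push_cast
    rw [div_pow, one_pow, ← pow_mul, mul_comm len 2, pow_mul]
    norm_num
  rw [hcast]
  refine pow_le_pow_left₀ (by positivity) ?_ 2
  calc (1 : ℝ) / 2 ^ len ≤ 1 / ((128 * (s * a * n) : ℝ) * (ε₀.den * α₀.den)) :=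
        one_div_le_one_div_of_le (by positivity) key'
    _ = (1 / (ε₀.den : ℝ)) * (1 / α₀.den) / (128 * (s * a * n)) := by field_simp
    _ ≤ _ := by
        gcongr
        · exact hfrac _ hε
        · exact hfrac _ hα

theorem threshold_pos (x : ℚ≥0 × ℚ≥0 × ℕ × ℕ × ℕ) : 0 < (threshold x : ℝ) := by
  unfold threshold
  push_cast
  positivity

/-! ### Average payoffs and the Poisson equation -/

section Ergodic

variable {S A : Type*} [Fintype S] [Fintype A]

/-- A transition kernel all of whose entries are at least `α > 0`. -/
structure IsMixing (P : S → A → S → ℝ) (α : ℝ) : Prop where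
  mem : ∀ s a, P s a ∈ stdSimplex ℝ S
  pos : 0 < α
  le : ∀ s a s', α ≤ P s a s'

variable {P : S → A → S → ℝ} {α : ℝ} {π : S → A → ℝ}

theorem IsMixing.mul_card_le_one [Nonempty S] [Nonempty A] (hP : IsMixing P α) :
    α * Fintype.card S ≤ 1 := by
  obtain ⟨s⟩ := ‹Nonempty S›
  obtain ⟨a⟩ := ‹Nonempty A›
  rw [← (hP.mem s a).2]
  calc α * Fintype.card S = ∑ _s' : S, α := by simp [mul_comm]
    _ ≤ _ := Finset.sum_le_sum fun s' _ => hP.le s a s'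

theorem IsMixing.mul_card_pos [Nonempty S] (hP : IsMixing P α) : 0 < α * Fintype.card S :=
  mul_pos hP.pos (by exact_mod_cast Fintype.card_pos)

/-- `g` and `h` solve the Poisson equation of the policy `π` for the reward `r`. -/
def IsPoisson (P : S → A → S → ℝ) (π : S → A → ℝ) (r : S → A → ℝ) (g : ℝ) (h : S → ℝ) : Prop :=
  ∀ s, g + h s = ∑ a, π s a * (r s a + ∑ s', P s a s' * h s')

theorem abs_sum_mul_le {ι : Type*} (s : Finset ι) (w f : ι → ℝ) (c : ℝ) (hw : ∀ i ∈ s, 0 ≤ w i)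
    (hf : ∀ i ∈ s, |f i| ≤ c) : |∑ i ∈ s, w i * f i| ≤ (∑ i ∈ s, w i) * c := by
  rw [Finset.sum_mul]
  refine (Finset.abs_sum_le_sum_abs _ _).trans (Finset.sum_le_sum fun i hi => ?_)
  rw [abs_mul, abs_of_nonneg (hw i hi)]
  exact mul_le_mul_of_nonneg_left (hf i hi) (hw i hi)

/-- Subtracting the common lower bound `α` from the kernel leaves a contraction; its fixed point
solves the Poisson equation with `g = α ∑ h`, and it is bounded by `F / (α |S|)`. -/
theorem exists_isPoisson [Nonempty S] [Nonempty A] (hP : IsMixing P α) (hπ : IsPolicy π)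
    {r : S → A → ℝ} {F : ℝ} (hr : ∀ s a, |r s a| ≤ F) :
    ∃ g h, IsPoisson P π r g h ∧ ∀ s, |h s| ≤ F / (α * Fintype.card S) := by
  set K : ℝ := 1 - α * Fintype.card S with hK
  have hK0 : 0 ≤ K := by rw [hK]; linarith [hP.mul_card_le_one]
  have hK1 : K < 1 := by rw [hK]; linarith [hP.mul_card_pos]
  have hrow : ∀ s a, ∑ s', (P s a s' - α) = K := by
    intro s a
    rw [Finset.sum_sub_distrib, (hP.mem s a).2]
    simp [hK, mul_comm]
  have hbd : ∀ (f : S → ℝ) (c : ℝ), (∀ s, |f s| ≤ c) → ∀ s a,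
      |∑ s', (P s a s' - α) * f s'| ≤ K * c := by
    intro f c hf s a
    rw [← hrow s a]
    exact abs_sum_mul_le _ _ _ _ (fun s' _ => by linarith [hP.le s a s']) fun s' _ => hf s'
  -- Subtracting `α` from every transition probability turns the averaging operator into a
  -- contraction with factor `K = 1 - α |S|`. Its fixed point `h` solves the Poisson equation: the
  -- term that was subtracted is the constant `g = α ∑ h`.
  let T : (S → ℝ) → S → ℝ := fun f s => ∑ a, π s a * (r s a + ∑ s', (P s a s' - α) * f s')
  have hT : ContractingWith ⟨K, hK0⟩ T := by
    refine ⟨by exact_mod_cast hK1, LipschitzWith.of_dist_le_mul fun f f' => ?_⟩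
    rw [dist_pi_le_iff (by positivity)]
    intro s
    have h1 : T f s - T f' s = ∑ a, π s a * ∑ s', (P s a s' - α) * (f s' - f' s') := by
      simp only [T, ← Finset.sum_sub_distrib]
      refine Finset.sum_congr rfl fun a _ => ?_
      rw [← mul_sub]
      congr 1
      rw [add_sub_add_left_eq_sub, ← Finset.sum_sub_distrib]
      exact Finset.sum_congr rfl fun s' _ => by ring
    rw [Real.dist_eq, h1]
    refine (abs_sum_mul_le _ _ _ (K * dist f f') (fun a _ => (hπ s).1 a) fun a _ => ?_).trans ?_
    · exact hbd _ _ (fun s' => by rw [← Real.dist_eq]; exact dist_le_pi_dist f f' s') s a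
    · rw [(hπ s).2, one_mul]
      exact le_rfl
  obtain ⟨h, hfix, -⟩ := hT.exists_fixedPoint 0 (edist_ne_top _ _)
  have hF0 : 0 ≤ F := by
    obtain ⟨s⟩ := ‹Nonempty S›
    obtain ⟨a⟩ := ‹Nonempty A›
    exact (abs_nonneg _).trans (hr s a)
  -- hence `‖h‖ ≤ F / (1 - K)`
  have hnorm : ‖h‖ ≤ F + K * ‖h‖ := by
    rw [pi_norm_le_iff_of_nonneg (by positivity)]
    intro s
    have h1 : h s = T h s := (congrFun hfix s).symm
    rw [Real.norm_eq_abs, h1]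
    refine (abs_sum_mul_le _ _ _ (F + K * ‖h‖) (fun a _ => (hπ s).1 a) fun a _ => ?_).trans ?_
    · refine (abs_add_le _ _).trans (add_le_add (hr s a) (hbd h ‖h‖ (fun s' => ?_) s a))
      rw [← Real.norm_eq_abs]; exact norm_le_pi_norm h s'
    · rw [(hπ s).2, one_mul]
  refine ⟨α * ∑ s, h s, h, fun s => ?_, fun s => ?_⟩
  · have h1 : h s = T h s := (congrFun hfix s).symm
    have h2 : ∀ a, ∑ s', P s a s' * h s' = ∑ s', (P s a s' - α) * h s' + α * ∑ s', h s' := by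
      intro a
      rw [Finset.mul_sum, ← Finset.sum_add_distrib]
      exact Finset.sum_congr rfl fun s' _ => by ring
    simp only [h2, ← add_assoc, mul_add _ _ (α * _)]
    rw [Finset.sum_add_distrib, ← Finset.sum_mul, (hπ s).2, one_mul, add_comm]
    congr 1
  · rw [le_div_iff₀ hP.mul_card_pos]
    have h3 : |h s| ≤ ‖h‖ := by rw [← Real.norm_eq_abs]; exact norm_le_pi_norm h s
    have h4 : ‖h‖ * (α * Fintype.card S) ≤ F := by rw [hK] at hnorm; linarith
    exact (mul_le_mul_of_nonneg_right h3 hP.mul_card_pos.le).trans h4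

theorem stateDist_mem (hP : ∀ s a, P s a ∈ stdSimplex ℝ S) (hπ : IsPolicy π) (s₀ : S) (t : ℕ) :
    stateDist P π s₀ t ∈ stdSimplex ℝ S := by
  induction t with
  | zero =>
    refine ⟨fun s => ?_, ?_⟩
    · simp only [stateDist]; split_ifs <;> norm_num
    · classical simp [stateDist]
  | succ t ih =>
    refine ⟨fun s => ?_, ?_⟩
    · simp only [stateDist]
      exact Finset.sum_nonneg fun x _ => Finset.sum_nonneg fun a _ =>
        mul_nonneg (mul_nonneg (ih.1 x) ((hπ x).1 a)) ((hP x a).1 s)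
    · simp only [stateDist]
      rw [Finset.sum_comm]
      have : ∀ x, ∑ y, ∑ a, stateDist P π s₀ t x * π x a * P x a y = stateDist P π s₀ t x := by
        intro x
        rw [Finset.sum_comm]
        simp only [← Finset.mul_sum, (hP x _).2, mul_one, (hπ x).2]
      simp only [this, ih.2]

/-- The expected payoff of `T` rounds telescopes along a solution of the Poisson equation. -/
theorem sum_payoff_eq (hP : ∀ s a, P s a ∈ stdSimplex ℝ S) (hπ : IsPolicy π)
    {r : S → A → ℝ} {g : ℝ} {h : S → ℝ} (hh : IsPoisson P π r g h) (s₀ : S) (T : ℕ) :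
    ∑ t ∈ Finset.range T, ∑ s, ∑ a, stateDist P π s₀ t s * π s a * r s a =
      T * g + h s₀ - ∑ s, stateDist P π s₀ T s * h s := by
  induction T with
  | zero => classical simp [stateDist]
  | succ T ih =>
    rw [Finset.sum_range_succ, ih]
    have h1 : ∑ s, stateDist P π s₀ (T + 1) s * h s =
        ∑ x, stateDist P π s₀ T x * ∑ a, π x a * ∑ s, P x a s * h s := by
      simp only [stateDist, Finset.sum_mul, Finset.mul_sum]
      rw [Finset.sum_comm]
      refine Finset.sum_congr rfl fun x _ => ?_
      rw [Finset.sum_comm]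
      exact Finset.sum_congr rfl fun a _ => Finset.sum_congr rfl fun s _ => by ring
    have h2 : ∑ s, ∑ a, stateDist P π s₀ T s * π s a * r s a =
        ∑ s, stateDist P π s₀ T s * ∑ a, π s a * r s a := by
      simp only [Finset.mul_sum]
      exact Finset.sum_congr rfl fun x _ => Finset.sum_congr rfl fun a _ => by ring
    have h3 : ∑ s, stateDist P π s₀ T s * (g + h s) =
        ∑ s, stateDist P π s₀ T s * ∑ a, π s a * r s a +
        ∑ x, stateDist P π s₀ T x * ∑ a, π x a * ∑ s, P x a s * h s := by
      rw [← Finset.sum_add_distrib]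
      refine Finset.sum_congr rfl fun x _ => ?_
      rw [hh x, ← mul_add, ← Finset.sum_add_distrib]
      simp only [mul_add]
    simp only [mul_add, Finset.sum_add_distrib, ← Finset.sum_mul,
      (stateDist_mem hP hπ s₀ T).2, one_mul] at h3
    rw [h1, h2]
    push_cast
    linarith

/-- In particular `J` is a true limit: the boundary terms of the telescoping sum are at most
`2 ‖h‖`. -/
theorem tendsto_payoff_of_isPoisson (hP : ∀ s a, P s a ∈ stdSimplex ℝ S) (hπ : IsPolicy π)
    {r : S → A → ℝ} {g : ℝ} {h : S → ℝ} (hh : IsPoisson P π r g h) (s₀ : S) :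
    Tendsto (fun T : ℕ => (1 / (T : ℝ)) *
      ∑ t ∈ Finset.range T, ∑ s, ∑ a, stateDist P π s₀ t s * π s a * r s a) atTop (𝓝 g) := by
  have hb : ∀ T : ℕ, |h s₀ - ∑ s, stateDist P π s₀ T s * h s| ≤ 2 * ‖h‖ := by
    intro T
    have h1 : ∀ s, |h s| ≤ ‖h‖ := fun s => by
      rw [← Real.norm_eq_abs]; exact norm_le_pi_norm h s
    have h2 := abs_sum_mul_le Finset.univ _ h ‖h‖
      (fun s _ => (stateDist_mem hP hπ s₀ T).1 s) fun s _ => h1 s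
    rw [(stateDist_mem hP hπ s₀ T).2, one_mul] at h2
    exact (abs_sub _ _).trans (by linarith [h1 s₀])
  have h0 : Tendsto (fun T : ℕ => (1 / (T : ℝ)) *
      (h s₀ - ∑ s, stateDist P π s₀ T s * h s)) atTop (𝓝 0) := by
    refine squeeze_zero_norm (fun T => ?_) (tendsto_const_div_atTop_nhds_zero_nat (2 * ‖h‖))
    rw [Real.norm_eq_abs, abs_mul, abs_of_nonneg (by positivity), div_mul_eq_mul_div, one_mul]
    gcongr
    exact hb T
  have h1 : Tendsto (fun T : ℕ => g + (1 / (T : ℝ)) *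
      (h s₀ - ∑ s, stateDist P π s₀ T s * h s)) atTop (𝓝 (g + 0)) := h0.const_add g
  rw [add_zero] at h1
  refine h1.congr' ?_
  filter_upwards [eventually_gt_atTop 0] with T hT
  have hT' : (T : ℝ) ≠ 0 := by positivity
  rw [sum_payoff_eq hP hπ hh]
  field_simp
  ring

/-- So a solution of the Poisson equation determines `J`, independently of the initial state. -/
theorem avgPayoff_eq_of_isPoisson (hP : ∀ s a, P s a ∈ stdSimplex ℝ S) (hπ : IsPolicy π)
    {r : S → A → ℝ} {g : ℝ} {h : S → ℝ} (hh : IsPoisson P π r g h) (s₀ : S) :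
    avgPayoff P s₀ π r = g :=
  (tendsto_payoff_of_isPoisson hP hπ hh s₀).limUnder_eq

section

variable [Nonempty S] [Nonempty A] (hP : IsMixing P α) (hπ : IsPolicy π) (s₀ : S)
include hP hπ

theorem exists_bias {r : S → A → ℝ} {F : ℝ} (hr : ∀ s a, |r s a| ≤ F) :
    ∃ h, IsPoisson P π r (avgPayoff P s₀ π r) h ∧ ∀ s, |h s| ≤ F / (α * Fintype.card S) := by
  obtain ⟨g, h, hh, hb⟩ := exists_isPoisson hP hπ hr
  exact ⟨h, by rwa [avgPayoff_eq_of_isPoisson hP.mem hπ hh s₀], hb⟩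

theorem exists_isPoisson_avgPayoff (r : S → A → ℝ) :
    ∃ h, IsPoisson P π r (avgPayoff P s₀ π r) h := by
  obtain ⟨F, hF⟩ : ∃ F, ∀ s a, |r s a| ≤ F :=
    ⟨∑ s, ∑ a, |r s a|, fun s a =>
      (Finset.single_le_sum (f := fun a => |r s a|) (fun _ _ => abs_nonneg _)
        (Finset.mem_univ a)).trans
      (Finset.single_le_sum (f := fun s => ∑ a, |r s a|)
        (fun _ _ => Finset.sum_nonneg fun _ _ => abs_nonneg _) (Finset.mem_univ s))⟩
  obtain ⟨h, hh, -⟩ := exists_bias hP hπ s₀ hF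
  exact ⟨h, hh⟩

theorem avgPayoff_add (r r' : S → A → ℝ) :
    avgPayoff P s₀ π (fun s a => r s a + r' s a) = avgPayoff P s₀ π r + avgPayoff P s₀ π r' := by
  obtain ⟨h, hh⟩ := exists_isPoisson_avgPayoff hP hπ s₀ r
  obtain ⟨h', hh'⟩ := exists_isPoisson_avgPayoff hP hπ s₀ r'
  refine avgPayoff_eq_of_isPoisson (h := fun s => h s + h' s) hP.mem hπ (fun s => ?_) s₀
  have e := hh s
  have e' := hh' s
  simp only [mul_add, Finset.sum_add_distrib] at e e' ⊢
  linarith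

theorem avgPayoff_mul (c : ℝ) (r : S → A → ℝ) :
    avgPayoff P s₀ π (fun s a => c * r s a) = c * avgPayoff P s₀ π r := by
  obtain ⟨h, hh⟩ := exists_isPoisson_avgPayoff hP hπ s₀ r
  refine avgPayoff_eq_of_isPoisson (h := fun s => c * h s) hP.mem hπ (fun s => ?_) s₀
  rw [← mul_add, hh s, Finset.mul_sum]
  refine Finset.sum_congr rfl fun a _ => ?_
  have : ∑ s', P s a s' * (c * h s') = c * ∑ s', P s a s' * h s' := by
    rw [Finset.mul_sum]; exact Finset.sum_congr rfl fun s' _ => by ring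
  rw [this]; ring

theorem avgPayoff_const (c : ℝ) : avgPayoff P s₀ π (fun _ _ => c) = c := by
  refine avgPayoff_eq_of_isPoisson (h := 0) hP.mem hπ (fun s => ?_) s₀
  simp [← Finset.sum_mul, (hπ s).2]

theorem avgPayoff_sub (r r' : S → A → ℝ) :
    avgPayoff P s₀ π (fun s a => r s a - r' s a) = avgPayoff P s₀ π r - avgPayoff P s₀ π r' := by
  have h := avgPayoff_add hP hπ s₀ r fun s a => (-1) * r' s a
  rw [avgPayoff_mul hP hπ] at h
  simp only [neg_one_mul, ← sub_eq_add_neg] at h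
  exact h

theorem avgPayoff_sum {ι : Type*} (I : Finset ι) (r : ι → S → A → ℝ) :
    avgPayoff P s₀ π (fun s a => ∑ i ∈ I, r i s a) = ∑ i ∈ I, avgPayoff P s₀ π (r i) := by
  classical
  induction I using Finset.induction_on with
  | empty => simpa using avgPayoff_const hP hπ s₀ 0
  | insert i I hi ih =>
    simp only [Finset.sum_insert hi]
    rw [avgPayoff_add hP hπ, ih]

theorem avgPayoff_nonneg {r : S → A → ℝ} (hr : ∀ s a, 0 ≤ r s a) : 0 ≤ avgPayoff P s₀ π r := by
  obtain ⟨h, hh⟩ := exists_isPoisson_avgPayoff hP hπ s₀ r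
  refine ge_of_tendsto (tendsto_payoff_of_isPoisson hP.mem hπ hh s₀)
    (Eventually.of_forall fun T => mul_nonneg (by positivity)
      (Finset.sum_nonneg fun t _ => Finset.sum_nonneg fun s _ => Finset.sum_nonneg fun a _ =>
        mul_nonneg (mul_nonneg ((stateDist_mem hP.mem hπ s₀ t).1 s) ((hπ s).1 a)) (hr s a)))

theorem avgPayoff_mono {r r' : S → A → ℝ} (h : ∀ s a, r s a ≤ r' s a) :
    avgPayoff P s₀ π r ≤ avgPayoff P s₀ π r' := by
  have := avgPayoff_nonneg hP hπ s₀ (r := fun s a => r' s a - r s a)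
    fun s a => sub_nonneg.2 (h s a)
  rw [avgPayoff_sub hP hπ] at this
  linarith

theorem avgPayoff_le {r : S → A → ℝ} {c : ℝ} (h : ∀ s a, r s a ≤ c) : avgPayoff P s₀ π r ≤ c := by
  have := avgPayoff_mono hP hπ s₀ (r' := fun _ _ => c) h
  rwa [avgPayoff_const hP hπ] at this

theorem le_avgPayoff {r : S → A → ℝ} {c : ℝ} (h : ∀ s a, c ≤ r s a) : c ≤ avgPayoff P s₀ π r := by
  have := avgPayoff_mono hP hπ s₀ (r := fun _ _ => c) h
  rwa [avgPayoff_const hP hπ] at this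

theorem abs_avgPayoff_le {r : S → A → ℝ} {c : ℝ} (h : ∀ s a, |r s a| ≤ c) :
    |avgPayoff P s₀ π r| ≤ c :=
  abs_le.2 ⟨le_avgPayoff hP hπ s₀ fun s a => (abs_le.1 (h s a)).1,
    avgPayoff_le hP hπ s₀ fun s a => (abs_le.1 (h s a)).2⟩

end

/-! ### Occupancy measures of policies -/

theorem pairing_eq (q : S → A → S → ℝ) (r : S → A → ℝ) :
    pairing q r = ∑ s, ∑ a, saFreq q s a * r s a := by
  simp only [pairing, saFreq, Finset.sum_mul]

theorem saFreq_nonneg {q : S → A → S → ℝ} (hq : q ∈ occ S A) (s : S) (a : A) : 0 ≤ saFreq q s a :=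
  Finset.sum_nonneg fun s' _ => hq.1 s a s'

theorem sum_saFreq {q : S → A → S → ℝ} (hq : q ∈ occ S A) : ∑ s, ∑ a, saFreq q s a = 1 :=
  hq.2.1

theorem pairing_const {q : S → A → S → ℝ} (hq : q ∈ occ S A) (c : ℝ) :
    pairing q (fun _ _ => c) = c := by
  rw [pairing_eq]
  simp only [← Finset.sum_mul, sum_saFreq hq, one_mul]

theorem pairing_mono {q : S → A → S → ℝ} (hq : q ∈ occ S A) {r r' : S → A → ℝ}
    (h : ∀ s a, r s a ≤ r' s a) : pairing q r ≤ pairing q r' := by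
  rw [pairing_eq, pairing_eq]
  exact Finset.sum_le_sum fun s _ => Finset.sum_le_sum fun a _ =>
    mul_le_mul_of_nonneg_left (h s a) (saFreq_nonneg hq s a)

theorem pairing_le {q : S → A → S → ℝ} (hq : q ∈ occ S A) {r : S → A → ℝ} {c : ℝ}
    (h : ∀ s a, r s a ≤ c) : pairing q r ≤ c :=
  (pairing_mono hq h).trans (pairing_const hq c).le

theorem le_pairing {q : S → A → S → ℝ} (hq : q ∈ occ S A) {r : S → A → ℝ} {c : ℝ}
    (h : ∀ s a, c ≤ r s a) : c ≤ pairing q r :=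
  (pairing_const hq c).ge.trans (pairing_mono hq h)

theorem abs_pairing_le {q : S → A → S → ℝ} (hq : q ∈ occ S A) {r : S → A → ℝ} {c : ℝ}
    (h : ∀ s a, |r s a| ≤ c) : |pairing q r| ≤ c :=
  abs_le.2 ⟨le_pairing hq fun s a => (abs_le.1 (h s a)).1,
    pairing_le hq fun s a => (abs_le.1 (h s a)).2⟩

theorem saFreq_eq_of_induces {q : S → A → S → ℝ} (hq : q ∈ occ S A) (hi : Induces q π) (s : S)
    (a : A) : saFreq q s a = stateFreq q s * π s a := by
  by_cases h : stateFreq q s = 0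
  · rw [h, zero_mul]
    exact (Finset.sum_eq_zero_iff_of_nonneg fun a _ => saFreq_nonneg hq s a).1 h a
      (Finset.mem_univ a)
  · rw [hi.2 s a h, mul_div_cancel₀ _ h]

/-- Integrating the Poisson equation against `q`, which is stationary for `P'`, leaves only the
effect of `P' - P` on the bias function. -/
theorem pairing_sub_avgPayoff
    {P' q : S → A → S → ℝ} (hq : q ∈ occOf P') (hi : Induces q π) {r : S → A → ℝ} {g : ℝ}
    {h : S → ℝ} (hh : IsPoisson P π r g h) :
    pairing q r - g = ∑ s, ∑ a, saFreq q s a * ∑ s', (P' s a s' - P s a s') * h s' := by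
  have h1 : ∑ s, stateFreq q s * (g + h s) =
      ∑ s, ∑ a, saFreq q s a * (r s a + ∑ s', P s a s' * h s') := by
    refine Finset.sum_congr rfl fun s _ => ?_
    rw [hh s, Finset.mul_sum]
    refine Finset.sum_congr rfl fun a _ => ?_
    rw [saFreq_eq_of_induces hq.1 hi, mul_assoc]
  -- conservation of the flow `q`
  have h2 : ∑ s, ∑ a, saFreq q s a * ∑ s', P' s a s' * h s' = ∑ s, stateFreq q s * h s := by
    calc ∑ s, ∑ a, saFreq q s a * ∑ s', P' s a s' * h s'
        = ∑ s, ∑ a, ∑ s', q s a s' * h s' := by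
          refine Finset.sum_congr rfl fun s _ => Finset.sum_congr rfl fun a _ => ?_
          rw [Finset.mul_sum]
          refine Finset.sum_congr rfl fun s' _ => ?_
          rw [hq.2 s a s']; ring
      _ = ∑ s', (∑ s, ∑ a, q s a s') * h s' := by
          simp only [Finset.sum_mul]
          rw [Finset.sum_comm_cycle]
      _ = ∑ s, stateFreq q s * h s := by
          refine Finset.sum_congr rfl fun s' _ => ?_
          rw [hq.1.2.2 s']
          rfl
  have h3 : ∑ s, stateFreq q s = 1 := hq.1.2.1
  simp only [mul_add, Finset.sum_add_distrib, ← Finset.sum_mul, h3, one_mul] at h1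
  simp only [sub_mul, Finset.sum_sub_distrib, mul_sub, h2]
  rw [pairing_eq]
  linarith

/-- The occupancy measure of the policy `π` under the kernel `P`. -/
noncomputable def policyOcc (P : S → A → S → ℝ) (s₀ : S) (π : S → A → ℝ) (s : S) (a : A) (s' : S) :
    ℝ :=
  open Classical in
  P s a s' * avgPayoff P s₀ π fun x b => if x = s ∧ b = a then 1 else 0

section

variable [Nonempty S] [Nonempty A] (hP : IsMixing P α) (hπ : IsPolicy π) (s₀ : S)
include hP

open Classical in
theorem saFreq_policyOcc (s : S) (a : A) : saFreq (policyOcc P s₀ π) s a =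
    avgPayoff P s₀ π fun x b => if x = s ∧ b = a then 1 else 0 := by
  simp only [saFreq, policyOcc, ← Finset.sum_mul, (hP.mem s a).2, one_mul]

include hπ

theorem pairing_policyOcc (r : S → A → ℝ) : pairing (policyOcc P s₀ π) r = avgPayoff P s₀ π r := by
  classical
  rw [pairing_eq]
  simp only [saFreq_policyOcc hP, mul_comm _ (r _ _), ← avgPayoff_mul hP hπ, ← avgPayoff_sum hP hπ]
  congr 1
  funext x b
  simp [ite_and]

theorem policyOcc_mem : policyOcc P s₀ π ∈ occOf P := by
  classical
  refine ⟨⟨fun s a s' => ?_, ?_, fun s => ?_⟩, fun s a s' => ?_⟩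
  · exact mul_nonneg ((hP.mem s a).1 s') (avgPayoff_nonneg hP hπ s₀ fun x b => by
      split_ifs <;> norm_num)
  · have h := pairing_policyOcc hP hπ s₀ fun _ _ => 1
    rw [avgPayoff_const hP hπ] at h
    simpa [pairing] using h
  · -- the indicator of `s` solves the Poisson equation for the net flow out of `s`
    have h1 : ∑ s', ∑ a, policyOcc P s₀ π s' a s = avgPayoff P s₀ π fun x b => P x b s := by
      rw [← pairing_policyOcc hP hπ, pairing_eq]
      simp only [saFreq_policyOcc hP, policyOcc, mul_comm]
    have h2 : ∑ a, ∑ s', policyOcc P s₀ π s a s' =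
        avgPayoff P s₀ π fun x _ => if x = s then 1 else 0 := by
      rw [← pairing_policyOcc hP hπ, pairing_eq]
      simp [saFreq]
    have h3 : avgPayoff P s₀ π (fun x b => (if x = s then 1 else 0) - P x b s) = 0 := by
      refine avgPayoff_eq_of_isPoisson (h := fun x => if x = s then 1 else 0) hP.mem hπ
        (fun x => ?_) s₀
      simp [(hπ x).2]
    rw [avgPayoff_sub hP hπ] at h3
    rw [h1, h2]
    linarith
  · rw [saFreq_policyOcc hP]
    rfl

theorem le_saFreq_policyOcc {c : ℝ} (hc : ∀ s a, c ≤ π s a) (hc0 : 0 ≤ c) (s : S) (a : A) :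
    α * c ≤ saFreq (policyOcc P s₀ π) s a := by
  classical
  have hq := policyOcc_mem hP hπ s₀
  have h1 : saFreq (policyOcc P s₀ π) s a = stateFreq (policyOcc P s₀ π) s * π s a := by
    have h2 : stateFreq (policyOcc P s₀ π) s =
        avgPayoff P s₀ π fun x _ => if x = s then 1 else 0 := by
      rw [← pairing_policyOcc hP hπ, pairing_eq]
      simp [stateFreq]
    -- a payoff whose mean under `π` vanishes in each state has average `0`
    have h3 : avgPayoff P s₀ π (fun x b => (if x = s ∧ b = a then 1 else 0) -
        π s a * (if x = s then 1 else 0)) = 0 := by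
      refine avgPayoff_eq_of_isPoisson (h := 0) hP.mem hπ (fun x => ?_) s₀
      by_cases hx : x = s
      · subst hx
        simp [mul_sub, ← Finset.sum_mul, (hπ x).2]
      · simp [hx]
    rw [avgPayoff_sub hP hπ, avgPayoff_mul hP hπ] at h3
    rw [saFreq_policyOcc hP, h2]
    linarith
  -- each transition leads to `s` with probability at least `α`
  have h4 : α ≤ stateFreq (policyOcc P s₀ π) s := by
    have h5 : stateFreq (policyOcc P s₀ π) s = ∑ s', ∑ a, policyOcc P s₀ π s' a s :=
      (hq.1.2.2 s).symm
    rw [h5]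
    calc α = ∑ s', ∑ a, α * saFreq (policyOcc P s₀ π) s' a := by
          simp only [← Finset.mul_sum, sum_saFreq hq.1, mul_one]
      _ ≤ _ := Finset.sum_le_sum fun s' _ => Finset.sum_le_sum fun b _ => by
          rw [hq.2 s' b s]
          exact mul_le_mul_of_nonneg_right (hP.le s' b s) (saFreq_nonneg hq.1 s' b)
  rw [h1]
  exact mul_le_mul h4 (hc s a) hc0 (hP.pos.le.trans h4)

end

/-- An occupancy measure that misses the threshold `δ` by at most `κ` can be pushed above it by
mixing with the occupancy measure of the uniform policy, at a cost proportional to `κ`. -/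
theorem exists_mem_shrunkOcc [Nonempty S] [Nonempty A] (hP : IsMixing P α)
    {K : Set (S → A → S → ℝ)} (hK : P ∈ K) {δ κ : ℝ}
    (hδ : δ ≤ α / (2 * Fintype.card A)) (hκ : 0 ≤ κ) (hκ' : κ ≤ α / (2 * Fintype.card A))
    {q : S → A → S → ℝ} (hq : q ∈ occOf P) (hqδ : ∀ s a, δ - κ ≤ saFreq q s a) :
    ∃ q' ∈ shrunkOcc δ K, ∀ (r : S → A → ℝ) (F : ℝ), (∀ s a, |r s a| ≤ F) →
      pairing q r - 4 * Fintype.card A / α * κ * F ≤ pairing q' r := by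
  have hA : (0 : ℝ) < Fintype.card A := by exact_mod_cast Fintype.card_pos
  obtain ⟨s₀⟩ := ‹Nonempty S›
  have hα := hP.pos
  set u : S → A → ℝ := fun _ _ => 1 / (Fintype.card A : ℝ) with hu
  have hupol : IsPolicy u := fun s => ⟨fun a => by simp only [hu]; positivity, by simp [hu, hA.ne']⟩
  have : Nonempty S := ⟨s₀⟩
  set qu := policyOcc P s₀ u
  have hqu : qu ∈ occOf P := policyOcc_mem hP hupol s₀
  have hqu' : ∀ s a, α / Fintype.card A ≤ saFreq qu s a := fun s a => by
    have := le_saFreq_policyOcc hP hupol s₀ (c := 1 / (Fintype.card A : ℝ)) (fun _ _ => le_rfl)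
      (by positivity) s a
    rwa [mul_one_div] at this
  -- The uniform policy has frequencies at least `α / |A|`, twice the bound for `δ`; with weight `η`
  -- for its occupancy measure, the excess `η α / (2 |A|)` is exactly `κ`.
  set η : ℝ := 2 * Fintype.card A / α * κ with hη
  have hη0 : 0 ≤ η := by positivity
  have hη1 : η ≤ 1 := by
    calc η ≤ 2 * Fintype.card A / α * (α / (2 * Fintype.card A)) := by rw [hη]; gcongr
      _ = 1 := by field_simp
  set q' : S → A → S → ℝ := fun s a s' => (1 - η) * q s a s' + η * qu s a s' with hq'
  have hfreq : ∀ s a, saFreq q' s a = (1 - η) * saFreq q s a + η * saFreq qu s a := by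
    intro s a
    simp only [saFreq, hq', Finset.sum_add_distrib, Finset.mul_sum]
  refine ⟨q', ⟨⟨P, hK, ⟨fun s a s' => ?_, ?_, fun s => ?_⟩, fun s a s' => ?_⟩, fun s a => ?_⟩,
    fun r F hr => ?_⟩
  · exact add_nonneg (mul_nonneg (by linarith) (hq.1.1 s a s')) (mul_nonneg hη0 (hqu.1.1 s a s'))
  · simp only [hq', Finset.sum_add_distrib, ← Finset.mul_sum, hq.1.2.1, hqu.1.2.1]
    ring
  · simp only [hq', Finset.sum_add_distrib, ← Finset.mul_sum, hq.1.2.2 s, hqu.1.2.2 s]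
  · rw [hfreq, hq']
    simp only
    rw [hq.2 s a s', hqu.2 s a s']
    ring
  · rw [hfreq]
    have h1 : η * (α / (2 * Fintype.card A)) = κ := by rw [hη]; field_simp
    have h2 : (1 - η) * (δ - κ) ≤ (1 - η) * saFreq q s a :=
      mul_le_mul_of_nonneg_left (hqδ s a) (by linarith)
    have h3 : η * (α / Fintype.card A) ≤ η * saFreq qu s a :=
      mul_le_mul_of_nonneg_left (hqu' s a) hη0
    have h4 : α / Fintype.card A = 2 * (α / (2 * Fintype.card A)) := by field_simp
    have h5 : η * δ ≤ η * (α / (2 * Fintype.card A)) := mul_le_mul_of_nonneg_left hδ hη0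
    rw [h4] at h3
    nlinarith [mul_nonneg hη0 hκ]
  · have h1 : pairing q' r = (1 - η) * pairing q r + η * pairing qu r := by
      simp only [pairing_eq, hfreq, Finset.mul_sum, ← Finset.sum_add_distrib]
      exact Finset.sum_congr rfl fun s _ => Finset.sum_congr rfl fun a _ => by ring
    have h2 := (abs_le.1 (abs_pairing_le hq.1 hr)).2
    have h3 := (abs_le.1 (abs_pairing_le hqu.1 hr)).1
    have h4 : 4 * Fintype.card A / α * κ * F = η * (2 * F) := by rw [hη]; ring
    rw [h1, h4]
    nlinarith

end Ergodic

/-! ### Concentration of adapted sums around their compensators -/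

section Concentration

variable {Ω : Type*} [mΩ : MeasurableSpace Ω] {μ : Measure Ω} [IsProbabilityMeasure μ]

/-- The random variables `Z t ∈ [0, 1]`, `t ≥ 1`, are adapted (`Z t` is known at time `t + 1`), and
`p t` is the conditional expectation of `Z t` at time `t`. -/
structure IsCompensated (μ : Measure Ω) (F : ℕ → MeasurableSpace Ω) (Z p : ℕ → Ω → ℝ) : Prop where
  mono : ∀ t ≥ 1, F t ≤ F (t + 1)
  le : ∀ t ≥ 1, F t ≤ mΩ
  meas : ∀ t ≥ 1, Measurable[F (t + 1)] (Z t)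
  meas_comp : ∀ t ≥ 1, Measurable[F t] (p t)
  mem : ∀ t ≥ 1, ∀ᵐ ω ∂μ, Z t ω ∈ Set.Icc (0 : ℝ) 1
  comp_mem : ∀ t ≥ 1, ∀ ω, p t ω ∈ Set.Icc (0 : ℝ) 1
  condExp : ∀ t ≥ 1, μ[Z t | F t] =ᵐ[μ] p t

variable {F : ℕ → MeasurableSpace Ω} {Z p : ℕ → Ω → ℝ}

theorem integrable_of_bounded {f : Ω → ℝ} (hf : Measurable f) {C : ℝ} (hC : ∀ᵐ ω ∂μ, |f ω| ≤ C) :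
    Integrable f μ :=
  Integrable.of_bound hf.aestronglyMeasurable C hC

theorem IsCompensated.integrable (h : IsCompensated μ F Z p) {t : ℕ} (ht : 1 ≤ t) :
    Integrable (Z t) μ := by
  refine integrable_of_bounded (C := 1) ((h.meas t ht).mono (h.le _ (by omega)) le_rfl) ?_
  filter_upwards [h.mem t ht] with ω hω
  rw [abs_of_nonneg hω.1]; exact hω.2

theorem IsCompensated.integrable_comp (h : IsCompensated μ F Z p) {t : ℕ} (ht : 1 ≤ t) :
    Integrable (p t) μ := by
  refine integrable_of_bounded (C := 1) ((h.meas_comp t ht).mono (h.le _ ht) le_rfl) ?_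
  refine Eventually.of_forall fun ω => ?_
  rw [abs_of_nonneg (h.comp_mem t ht ω).1]; exact (h.comp_mem t ht ω).2

theorem IsCompensated.integral_mul (h : IsCompensated μ F Z p) {t : ℕ} (ht : 1 ≤ t) {W : Ω → ℝ}
    (hW : Measurable[F t] W) {C : ℝ} (hC : ∀ᵐ ω ∂μ, |W ω| ≤ C) :
    ∫ ω, W ω * Z t ω ∂μ = ∫ ω, W ω * p t ω ∂μ := by
  have hint : Integrable (W * Z t) μ :=
    (h.integrable ht).bdd_mul (c := C)
      (hW.mono (h.le t ht) le_rfl).aestronglyMeasurable (by simpa [Real.norm_eq_abs] using hC)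
  have h1 := condExp_mul_of_stronglyMeasurable_left (μ := μ) hW.stronglyMeasurable hint
    (h.integrable ht)
  calc ∫ ω, W ω * Z t ω ∂μ = ∫ ω, (μ[W * Z t | F t]) ω ∂μ := (integral_condExp (h.le t ht)).symm
    _ = ∫ ω, W ω * p t ω ∂μ := by
      refine integral_congr_ae ?_
      filter_upwards [h1, h.condExp t ht] with ω h1 h2
      rw [h1, Pi.mul_apply, h2]

/-- The convex exponential lies below its chord over `[0, 1]`. -/
theorem exp_neg_mul_le (lam : ℝ) {z : ℝ} (hz : z ∈ Set.Icc (0 : ℝ) 1) :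
    Real.exp (-lam * z) ≤ 1 - z * (1 - Real.exp (-lam)) := by
  have := convexOn_exp.2 (Set.mem_univ 0) (Set.mem_univ (-lam)) (sub_nonneg.2 hz.2) hz.1 (by ring)
  simp only [smul_eq_mul, mul_zero, zero_add, Real.exp_zero, mul_one] at this
  rw [mul_comm]
  linarith

/-- The exponential supermartingale. -/
theorem IsCompensated.integral_prod_le_one (h : IsCompensated μ F Z p) (lam : ℝ) {c : ℕ → Ω → ℝ}
    {C : ℝ} (hc : ∀ t ≥ 1, Measurable[F t] (c t)) (hc0 : ∀ t ≥ 1, ∀ ω, 0 ≤ c t ω)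
    (hcC : ∀ t ≥ 1, ∀ ω, c t ω ≤ C)
    (hle : ∀ t ≥ 1, ∀ ω, c t ω * (1 - p t ω * (1 - Real.exp (-lam))) ≤ 1) (T : ℕ) :
    ∫ ω, ∏ t ∈ Finset.Ico 1 T, (c t ω * Real.exp (-lam * Z t ω)) ∂μ ≤ 1 ∧
      Measurable[F (max 1 T)] (fun ω => ∏ t ∈ Finset.Ico 1 T, (c t ω * Real.exp (-lam * Z t ω))) ∧
      ∃ B, ∀ᵐ ω ∂μ, |∏ t ∈ Finset.Ico 1 T, (c t ω * Real.exp (-lam * Z t ω))| ≤ B := by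
  -- measurability and boundedness of the product are carried along in the induction
  rcases Nat.eq_zero_or_pos T with rfl | hT
  · simp only [zero_le, Finset.Ico_eq_empty_of_le, Finset.prod_empty]
    exact ⟨by simp, measurable_const, 1, by simp⟩
  induction T, hT using Nat.le_induction with
  | base =>
    simp only [Finset.Ico_self, Finset.prod_empty]
    exact ⟨by simp, measurable_const, 1, by simp⟩
  | succ T hT ih =>
    have hT1 : 1 ≤ T := hT
    obtain ⟨ih1, ih2, B, hB⟩ := ih
    rw [max_eq_right hT1] at ih2
    rw [max_eq_right (by omega)]
    simp only [Finset.prod_Ico_succ_top hT1]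
    set W : Ω → ℝ := fun ω => ∏ t ∈ Finset.Ico 1 T, (c t ω * Real.exp (-lam * Z t ω)) with hW
    have hW0 : ∀ ω, 0 ≤ W ω := fun ω => Finset.prod_nonneg fun t ht =>
      mul_nonneg (hc0 t (Finset.mem_Ico.1 ht).1 ω) (Real.exp_pos _).le
    have hWm := ih2.mono (h.le T hT1) le_rfl
    have hcm := (hc T hT1).mono (h.le T hT1) le_rfl
    have hWc : ∀ᵐ ω ∂μ, |W ω * c T ω| ≤ B * C := by
      filter_upwards [hB] with ω hω
      rw [abs_mul, abs_of_nonneg (hc0 T hT1 ω)]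
      exact mul_le_mul hω (hcC T hT1 ω) (hc0 T hT1 ω) ((abs_nonneg _).trans hω)
    have hYb : ∀ᵐ ω ∂μ, |W ω * (c T ω * Real.exp (-lam * Z T ω))| ≤ B * C * Real.exp |lam| := by
      filter_upwards [hWc, h.mem T hT1] with ω h1 h2
      rw [← mul_assoc, abs_mul, Real.abs_exp]
      refine mul_le_mul h1 (Real.exp_le_exp.2 ?_) (Real.exp_pos _).le ((abs_nonneg _).trans h1)
      calc -lam * Z T ω ≤ |lam * Z T ω| := by rw [neg_mul]; exact neg_le_abs _
        _ ≤ |lam| := by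
          rw [abs_mul, abs_of_nonneg h2.1]
          exact mul_le_of_le_one_right (abs_nonneg _) h2.2
    have hYm : Measurable[F (T + 1)] fun ω => W ω * (c T ω * Real.exp (-lam * Z T ω)) := by
      have hexp : Measurable[F (T + 1)] fun ω => Real.exp (-lam * Z T ω) :=
        Real.measurable_exp.comp ((h.meas T hT1).const_mul _)
      exact (ih2.mono (h.mono T hT1) le_rfl).mul
        (((hc T hT1).mono (h.mono T hT1) le_rfl).mul hexp)
    have hWcm : Measurable[F T] fun ω => W ω * c T ω := ih2.mul (hc T hT1)
    refine ⟨le_trans ?_ ih1, hYm, _, hYb⟩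
    have hi1 : Integrable (fun ω => W ω * c T ω) μ := integrable_of_bounded (hWm.mul hcm) hWc
    have hi2 : Integrable (fun ω => W ω * c T ω * Z T ω) μ :=
      (h.integrable hT1).bdd_mul (c := B * C) (hWm.mul hcm).aestronglyMeasurable
        (by simpa [Real.norm_eq_abs] using hWc)
    have hi3 : Integrable (fun ω => W ω * c T ω * p T ω) μ :=
      (h.integrable_comp hT1).bdd_mul (c := B * C) (hWm.mul hcm).aestronglyMeasurable
        (by simpa [Real.norm_eq_abs] using hWc)
    set κ : ℝ := 1 - Real.exp (-lam)
    -- The chord bound makes the last factor affine in `Z T`, so that `Z T` may be replaced by its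
    -- compensator `p T`.
    calc ∫ ω, W ω * (c T ω * Real.exp (-lam * Z T ω)) ∂μ
        ≤ ∫ ω, (W ω * c T ω - κ * (W ω * c T ω * Z T ω)) ∂μ := by
          refine integral_mono_ae (integrable_of_bounded
            (hYm.mono (h.le _ (by omega)) le_rfl) hYb) (hi1.sub (hi2.const_mul κ)) ?_
          filter_upwards [h.mem T hT1] with ω hω
          have h1 := exp_neg_mul_le lam hω
          have h2 := mul_le_mul_of_nonneg_left h1 (mul_nonneg (hW0 ω) (hc0 T hT1 ω))
          calc W ω * (c T ω * Real.exp (-lam * Z T ω))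
              = W ω * c T ω * Real.exp (-lam * Z T ω) := by ring
            _ ≤ W ω * c T ω * (1 - Z T ω * κ) := h2
            _ = _ := by ring
      _ = ∫ ω, (W ω * c T ω - κ * (W ω * c T ω * p T ω)) ∂μ := by
          rw [integral_sub hi1 (hi2.const_mul κ), integral_sub hi1 (hi3.const_mul κ),
            integral_const_mul, integral_const_mul, h.integral_mul hT1 hWcm hWc]
      _ ≤ ∫ ω, W ω ∂μ := by
          refine integral_mono (hi1.sub (hi3.const_mul κ)) (integrable_of_bounded hWm hB)
            fun ω => ?_
          have h2 := mul_le_mul_of_nonneg_left (hle T hT1 ω) (hW0 ω)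
          simp only
          calc W ω * c T ω - κ * (W ω * c T ω * p T ω)
              = W ω * (c T ω * (1 - p T ω * κ)) := by ring
            _ ≤ W ω := by rw [mul_one] at h2; exact h2

/-- Markov's inequality for the exponential supermartingale. The predictable `v t` dominates the
logarithm of the conditional moment generating function of `p t - Z t`. -/
theorem IsCompensated.measure_exp_le (h : IsCompensated μ F Z p) (lam : ℝ) {v : ℕ → Ω → ℝ}
    {C : ℝ} (hv : ∀ t ≥ 1, Measurable[F t] (v t)) (hvC : ∀ t ≥ 1, ∀ ω, |v t ω| ≤ C)
    (hle : ∀ t ≥ 1, ∀ ω, 1 - p t ω * (1 - Real.exp (-lam)) ≤ Real.exp (-lam * p t ω + v t ω))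
    (T : ℕ) (u : ℝ) :
    μ.real {ω | u ≤ lam * ∑ t ∈ Finset.Ico 1 T, (p t ω - Z t ω) - ∑ t ∈ Finset.Ico 1 T, v t ω} ≤
      Real.exp (-u) := by
  obtain ⟨h1, h2, B, h3⟩ := h.integral_prod_le_one lam
    (c := fun t ω => Real.exp (lam * p t ω - v t ω)) (C := Real.exp (|lam| + C))
    (fun t ht => Real.measurable_exp.comp (((h.meas_comp t ht).const_mul lam).sub (hv t ht)))
    (fun t _ ω => (Real.exp_pos _).le)
    (fun t ht ω => by
      refine Real.exp_le_exp.2 ?_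
      have h1 : lam * p t ω ≤ |lam| := by
        refine (le_abs_self _).trans ?_
        rw [abs_mul, abs_of_nonneg (h.comp_mem t ht ω).1]
        exact mul_le_of_le_one_right (abs_nonneg _) (h.comp_mem t ht ω).2
      linarith [neg_abs_le (v t ω), hvC t ht ω])
    (fun t ht ω => by
      refine (mul_le_mul_of_nonneg_left (hle t ht ω) (Real.exp_pos _).le).trans ?_
      rw [← Real.exp_add, ← Real.exp_zero]
      exact Real.exp_le_exp.2 (by linarith)) T
  set f : Ω → ℝ := fun ω => ∏ t ∈ Finset.Ico 1 T,
    (Real.exp (lam * p t ω - v t ω) * Real.exp (-lam * Z t ω))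
  have hf : ∀ ω, f ω = Real.exp (lam * ∑ t ∈ Finset.Ico 1 T, (p t ω - Z t ω) -
      ∑ t ∈ Finset.Ico 1 T, v t ω) := by
    intro ω
    rw [Finset.mul_sum, ← Finset.sum_sub_distrib, Real.exp_sum]
    refine Finset.prod_congr rfl fun t _ => ?_
    rw [← Real.exp_add]; congr 1; ring
  have hint : Integrable f μ :=
    integrable_of_bounded (h2.mono (h.le _ (le_max_left _ _)) le_rfl) h3
  have h4 := mul_meas_ge_le_integral_of_nonneg (μ := μ)
    (Eventually.of_forall fun ω => by rw [hf]; exact (Real.exp_pos _).le) hint (Real.exp u)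
  have h5 : {ω | Real.exp u ≤ f ω} = {ω | u ≤ lam * ∑ t ∈ Finset.Ico 1 T, (p t ω - Z t ω) -
      ∑ t ∈ Finset.Ico 1 T, v t ω} := by
    ext ω; simp only [Set.mem_ofPred_eq, hf, Real.exp_le_exp]
  rw [h5] at h4
  rw [Real.exp_neg, ← one_div, le_div_iff₀ (Real.exp_pos _), mul_comm]
  exact h4.trans h1

/-- Chernoff bound for the lower tail. -/
theorem IsCompensated.measure_chernoff_le (h : IsCompensated μ F Z p) {lam : ℝ} (hl : 0 ≤ lam)
    (T : ℕ) (u : ℝ) :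
    μ.real {ω | u ≤ lam * ∑ t ∈ Finset.Ico 1 T, (p t ω - Z t ω) -
      lam ^ 2 / 2 * ∑ t ∈ Finset.Ico 1 T, p t ω} ≤ Real.exp (-u) := by
  simp only [Finset.mul_sum _ _ (lam ^ 2 / 2)]
  refine h.measure_exp_le lam (C := lam ^ 2 / 2)
    (fun t ht => (h.meas_comp t ht).const_mul _) (fun t ht ω => ?_) (fun t ht ω => ?_) T u
  · rw [abs_mul, abs_of_nonneg (h.comp_mem t ht ω).1, abs_of_nonneg (by positivity)]
    exact mul_le_of_le_one_right (by positivity) (h.comp_mem t ht ω).2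
  · have h1 : Real.exp (-lam) ≤ 1 - lam + lam ^ 2 / 2 := by
      rcases hl.eq_or_lt with rfl | hl
      · simp
      have h2 := Real.quadratic_le_exp_of_nonneg hl.le
      rw [Real.exp_neg, inv_le_comm₀ (Real.exp_pos _) (by nlinarith [sq_nonneg (lam - 1)])]
      refine le_trans ?_ h2
      rw [inv_le_iff_one_le_mul₀ (by nlinarith [sq_nonneg (lam - 1)])]
      nlinarith [pow_pos hl 4]
    have h3 := Real.add_one_le_exp (-lam * p t ω + lam ^ 2 / 2 * p t ω)
    nlinarith [(h.comp_mem t ht ω).1]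

/-- Hoeffding's lemma for the law on `{0, 1}` with mean `q`. -/
theorem one_sub_add_mul_exp_le {q : ℝ} (hq : q ∈ Set.Icc (0 : ℝ) 1) (x : ℝ) :
    1 - q + q * Real.exp x ≤ Real.exp (q * x + x ^ 2 / 8) := by
  let P : Measure Bool := ENNReal.ofReal (1 - q) • Measure.dirac false +
    ENNReal.ofReal q • Measure.dirac true
  have hP : IsProbabilityMeasure P := ⟨by
    simp only [P, Measure.coe_add, Measure.coe_smul, Pi.add_apply, Pi.smul_apply,
      measure_univ, smul_eq_mul, mul_one]
    rw [← ENNReal.ofReal_add (by linarith [hq.2]) hq.1]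
    simp⟩
  have hint : ∀ f : Bool → ℝ, ∫ b, f b ∂P = (1 - q) * f false + q * f true := by
    intro f
    have i1 := Measure.smul_finite (Measure.dirac false) (c := ENNReal.ofReal (1 - q)) (by simp)
    have i2 := Measure.smul_finite (Measure.dirac true) (c := ENNReal.ofReal q) (by simp)
    rw [integral_add_measure Integrable.of_finite Integrable.of_finite, integral_smul_measure,
      integral_smul_measure, integral_dirac, integral_dirac,
      ENNReal.toReal_ofReal (by linarith [hq.2]), ENNReal.toReal_ofReal hq.1]
    rfl
  let X : Bool → ℝ := fun b => if b then 1 else 0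
  have hX := hasSubgaussianMGF_of_mem_Icc (μ := P) (X := X) (a := 0) (b := 1)
    (measurable_of_finite X).aemeasurable
    (Eventually.of_forall fun b => by cases b <;> simp [X])
  have hle := hX.mgf_le x
  have hm : ∫ b, X b ∂P = q := by rw [hint]; simp [X]
  simp only [mgf, hm] at hle
  rw [hint] at hle
  simp only [X, Bool.false_eq_true, if_false, if_true] at hle
  have h2 : Real.exp (x * (0 - q)) = Real.exp (-(q * x)) := by congr 1; ring
  have h3 : Real.exp (x * (1 - q)) = Real.exp (-(q * x)) * Real.exp x := by
    rw [← Real.exp_add]; congr 1; ring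
  have h4 : ((((‖(1 : ℝ) - 0‖₊ / 2) ^ 2 : NNReal) : ℝ) * x ^ 2 / 2) = x ^ 2 / 8 := by
    simp; ring
  rw [h2, h3, h4] at hle
  have h5 : Real.exp (q * x) * ((1 - q) * Real.exp (-(q * x)) +
      q * (Real.exp (-(q * x)) * Real.exp x)) = 1 - q + q * Real.exp x := by
    have : Real.exp (q * x) * Real.exp (-(q * x)) = 1 := by rw [← Real.exp_add]; simp
    linear_combination (1 - q + q * Real.exp x) * this
  rw [← h5, Real.exp_add]
  exact mul_le_mul_of_nonneg_left hle (Real.exp_pos _).le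

/-- Hoeffding bound for sums that are gated by the predictable indicators `g t`. -/
theorem IsCompensated.measure_hoeffding_le (h : IsCompensated μ F Z p) {g : ℕ → Ω → ℝ}
    (hg : ∀ t ≥ 1, Measurable[F t] (g t)) (hg01 : ∀ t ≥ 1, ∀ ω, g t ω = 0 ∨ g t ω = 1)
    (hgp : ∀ t ≥ 1, ∀ ω, g t ω = 0 → p t ω = 0) (lam : ℝ) (T : ℕ) (u : ℝ) :
    μ.real {ω | u ≤ lam * ∑ t ∈ Finset.Ico 1 T, (p t ω - Z t ω) -
      lam ^ 2 / 8 * ∑ t ∈ Finset.Ico 1 T, g t ω} ≤ Real.exp (-u) := by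
  simp only [Finset.mul_sum _ _ (lam ^ 2 / 8)]
  refine h.measure_exp_le lam (C := lam ^ 2 / 8)
    (fun t ht => (hg t ht).const_mul _) (fun t ht ω => ?_) (fun t ht ω => ?_) T u
  · rcases hg01 t ht ω with h0 | h1
    · rw [h0]; simp; positivity
    · rw [h1, mul_one, abs_of_nonneg (by positivity)]
  · rcases hg01 t ht ω with h0 | h1
    · rw [h0, hgp t ht ω h0]; simp
    · rw [h1]
      have := one_sub_add_mul_exp_le (h.comp_mem t ht ω) (-lam)
      have h2 : p t ω * -lam + (-lam) ^ 2 / 8 = -lam * p t ω + lam ^ 2 / 8 * 1 := by ring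
      rw [h2] at this
      linarith

/-- The increments `Z t - p t` are orthogonal. -/
theorem IsCompensated.integral_sq_le (h : IsCompensated μ F Z p) {a : ℕ} (ha : 1 ≤ a) (l : ℕ) :
    (Measurable[F (a + l)] fun ω => ∑ t ∈ Finset.Ico a (a + l), (Z t ω - p t ω)) ∧
    (∀ᵐ ω ∂μ, |∑ t ∈ Finset.Ico a (a + l), (Z t ω - p t ω)| ≤ l) ∧
    ∫ ω, (∑ t ∈ Finset.Ico a (a + l), (Z t ω - p t ω)) ^ 2 ∂μ ≤ l := by
  induction l with
  | zero => simp only [add_zero, Finset.Ico_self, Finset.sum_empty]; simp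
  | succ l ih =>
    obtain ⟨ih1, ih2, ih3⟩ := ih
    simp only [← add_assoc, Finset.sum_Ico_succ_top (Nat.le_add_right a l)]
    set t := a + l with ht_def
    have ht : 1 ≤ t := by omega
    set W : Ω → ℝ := fun ω => ∑ t ∈ Finset.Ico a t, (Z t ω - p t ω)
    have hZm := h.meas t ht
    have hpm := h.meas_comp t ht
    have hD : ∀ᵐ ω ∂μ, |Z t ω - p t ω| ≤ 1 := by
      filter_upwards [h.mem t ht] with ω hω
      have := h.comp_mem t ht ω
      exact abs_le.2 ⟨by linarith [hω.1, this.2], by linarith [hω.2, this.1]⟩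
    have hle := h.le t ht
    have hle' := h.le (t + 1) (by omega)
    have hDm : Measurable[F (t + 1)] fun ω => Z t ω - p t ω :=
      hZm.sub (hpm.mono (h.mono t ht) le_rfl)
    refine ⟨(ih1.mono (h.mono t ht) le_rfl).add hDm, ?_, ?_⟩
    · filter_upwards [ih2, hD] with ω h1 h2
      push_cast
      exact (abs_add_le _ _).trans (add_le_add h1 h2)
    · have hWm := ih1.mono hle le_rfl
      have hDm' := hDm.mono hle' le_rfl
      have i1 : Integrable (fun ω => W ω ^ 2) μ := by
        refine integrable_of_bounded (C := (l : ℝ) ^ 2) (hWm.pow_const 2) ?_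
        filter_upwards [ih2] with ω h1
        rw [abs_pow]; gcongr
      have i2 : Integrable (fun ω => W ω * (Z t ω - p t ω)) μ := by
        refine integrable_of_bounded (C := (l : ℝ) * 1) (hWm.mul hDm') ?_
        filter_upwards [ih2, hD] with ω h1 h2
        rw [abs_mul]; gcongr
      have i3 : Integrable (fun ω => (Z t ω - p t ω) ^ 2) μ := by
        refine integrable_of_bounded (C := 1 ^ 2) (hDm'.pow_const 2) ?_
        filter_upwards [hD] with ω h1
        rw [abs_pow]; gcongr
      have i4 : Integrable (fun ω => W ω * Z t ω) μ :=
        (h.integrable ht).bdd_mul (c := (l : ℝ)) hWm.aestronglyMeasurable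
          ih2
      have i5 : Integrable (fun ω => W ω * p t ω) μ :=
        (h.integrable_comp ht).bdd_mul (c := (l : ℝ)) hWm.aestronglyMeasurable
          ih2
      -- the cross term vanishes since `W` is known at time `t`
      have e0 : ∫ ω, W ω * (Z t ω - p t ω) ∂μ = 0 := by
        simp only [mul_sub]
        rw [integral_sub i4 i5, h.integral_mul ht ih1 ih2, sub_self]
      have e1 : ∫ ω, (Z t ω - p t ω) ^ 2 ∂μ ≤ 1 := by
        calc ∫ ω, (Z t ω - p t ω) ^ 2 ∂μ ≤ ∫ _, (1 : ℝ) ∂μ := by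
              refine integral_mono_ae i3 (integrable_const _) ?_
              filter_upwards [hD] with ω h1
              exact (sq_le_one_iff_abs_le_one _).2 h1
          _ = 1 := by simp
      have e2 : ∀ ω, (W ω + (Z t ω - p t ω)) ^ 2 =
          W ω ^ 2 + 2 * (W ω * (Z t ω - p t ω)) + (Z t ω - p t ω) ^ 2 := fun ω => by ring
      calc ∫ ω, (W ω + (Z t ω - p t ω)) ^ 2 ∂μ
          = ∫ ω, (W ω ^ 2 + 2 * (W ω * (Z t ω - p t ω)) + (Z t ω - p t ω) ^ 2) ∂μ :=
            integral_congr_ae (Eventually.of_forall e2)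
        _ = ∫ ω, W ω ^ 2 ∂μ + ∫ ω, (Z t ω - p t ω) ^ 2 ∂μ := by
            have i12 : Integrable (fun ω => W ω ^ 2 + 2 * (W ω * (Z t ω - p t ω))) μ :=
              i1.add (i2.const_mul 2)
            rw [integral_add i12 i3, integral_add i1 (i2.const_mul 2),
              integral_const_mul, e0, mul_zero, add_zero]
        _ ≤ _ := by push_cast; exact add_le_add ih3 e1

/-- Jensen's inequality `E |X| ≤ √(E X²)`, from the variance of `|X|`. -/
theorem integral_abs_le_sqrt {X : Ω → ℝ} (hX : Integrable X μ)
    (hX2 : Integrable (fun ω => X ω ^ 2) μ) {c : ℝ} (hc : ∫ ω, X ω ^ 2 ∂μ ≤ c) :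
    ∫ ω, |X ω| ∂μ ≤ √c := by
  set m := ∫ ω, |X ω| ∂μ
  refine Real.le_sqrt_of_sq_le (le_trans ?_ hc)
  have h1 : 0 ≤ ∫ ω, (|X ω| - m) ^ 2 ∂μ := integral_nonneg fun ω => sq_nonneg _
  have h2 : ∀ ω, (|X ω| - m) ^ 2 = X ω ^ 2 - 2 * m * |X ω| + m ^ 2 := fun ω => by
    rw [sub_sq, sq_abs]; ring
  have i1 : Integrable (fun ω => X ω ^ 2 - 2 * m * |X ω|) μ := hX2.sub (hX.abs.const_mul (2 * m))
  rw [integral_congr_ae (Eventually.of_forall h2), integral_add i1 (integrable_const _),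
    integral_sub hX2 (hX.abs.const_mul _), integral_const_mul] at h1
  simp only [integral_const, probReal_univ, smul_eq_mul, one_mul] at h1
  have : ∫ ω, |X ω| ∂μ = m := rfl
  rw [this] at h1
  nlinarith

theorem IsCompensated.integrable_abs_sum (h : IsCompensated μ F Z p) {a : ℕ} (ha : 1 ≤ a)
    (b : ℕ) : Integrable (fun ω => |∑ t ∈ Finset.Ico a b, (Z t ω - p t ω)|) μ :=
  (integrable_finsetSum _ fun _ ht =>
    (h.integrable (ha.trans (Finset.mem_Ico.1 ht).1)).sub
      (h.integrable_comp (ha.trans (Finset.mem_Ico.1 ht).1))).abs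

theorem IsCompensated.integral_abs_sum_le (h : IsCompensated μ F Z p) {a : ℕ} (ha : 1 ≤ a)
    (b : ℕ) : ∫ ω, |∑ t ∈ Finset.Ico a b, (Z t ω - p t ω)| ∂μ ≤ √((b - a : ℕ) : ℝ) := by
  rcases le_total b a with hab | hab
  · simp [Finset.Ico_eq_empty_of_le hab]
  obtain ⟨l, rfl⟩ := Nat.exists_eq_add_of_le hab
  obtain ⟨h1, h2, h3⟩ := h.integral_sq_le ha l
  have hm := h1.mono (h.le (a + l) (by omega)) le_rfl
  rw [Nat.add_sub_cancel_left]
  refine integral_abs_le_sqrt (integrable_of_bounded hm h2)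
    (integrable_of_bounded (C := (l : ℝ) ^ 2) (hm.pow_const 2) ?_) h3
  filter_upwards [h2] with ω h2
  rw [abs_pow]
  gcongr

/-- The number of scales needed to cover the range `[1, T]` in `le_two_mul_sqrt_of_forall_scale`. -/
noncomputable def scaleCount (L T : ℝ) : ℕ := ⌈2 * √L * Real.log T⌉₊ + 1

/-- Peeling: a tail bound with the optimal parameter for each of the scales `ρ ^ j` with
`ρ = 1 + 1 / (2 √L)` gives the bound `2 √(L V)` for random `V`. The scales are so dense that only
`1 / 2` is lost in the exponent `2 L`. -/
theorem le_two_mul_sqrt_of_forall_scale {L T D V : ℝ} (hL : 1 ≤ L) (hV : V ∈ Set.Icc 1 T)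
    (h : ∀ j < scaleCount L T, (2 * √L / (1 + 1 / (2 * √L)) ^ j) * D -
      (2 * √L / (1 + 1 / (2 * √L)) ^ j) ^ 2 / 2 * V < 2 * L - 1 / 2) :
    D ≤ 2 * √(L * V) := by
  set x := √L with hx
  have hx1 : 1 ≤ x := Real.one_le_sqrt.2 hL
  have hxL : x ^ 2 = L := Real.sq_sqrt (by linarith)
  set ρ := 1 + 1 / (2 * x) with hρ
  have hρ1 : 1 < ρ := by rw [hρ]; linarith [show 0 < 1 / (2 * x) by positivity]
  set y := √V with hy
  have hy1 : 1 ≤ y := Real.one_le_sqrt.2 hV.1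
  have hyV : y ^ 2 = V := Real.sq_sqrt (by linarith [hV.1])
  -- the scale `j` with `ρ ^ j ≤ √V < ρ ^ (j + 1)`
  obtain ⟨j, hj, hj'⟩ := exists_nat_pow_near hy1 hρ1
  have hlogρ : 1 / (4 * x) ≤ Real.log ρ := by
    have h1 : 1 / (2 * x) ≤ 1 := by
      rw [div_le_one (by positivity)]; linarith
    have h2 := Real.one_sub_inv_le_log_of_pos (show 0 < ρ by linarith)
    refine le_trans ?_ h2
    have h3 : 1 - ρ⁻¹ = 1 / (2 * x + 1) := by rw [hρ]; field_simp; ring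
    rw [h3]
    exact one_div_le_one_div_of_le (by positivity) (by linarith)
  have hjlt : j < scaleCount L T := by
    have h1 : (j : ℝ) * Real.log ρ ≤ Real.log y := by
      rw [← Real.log_pow]
      exact Real.log_le_log (by positivity) hj
    have h2 : Real.log y ≤ Real.log T / 2 := by
      rw [hy, Real.log_sqrt (by linarith [hV.1])]
      have := Real.log_le_log (by linarith [hV.1]) hV.2
      linarith
    have h3 : (j : ℝ) * (1 / (4 * x)) ≤ j * Real.log ρ :=
      mul_le_mul_of_nonneg_left hlogρ (Nat.cast_nonneg _)
    have h4 : (j : ℝ) ≤ 2 * x * Real.log T := by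
      have h5 : (j : ℝ) * (1 / (4 * x)) ≤ Real.log T / 2 := by linarith
      have h6 : (j : ℝ) = j * (1 / (4 * x)) * (4 * x) := by field_simp
      rw [h6]
      nlinarith
    unfold scaleCount
    have := h4.trans (Nat.le_ceil _)
    have : j ≤ ⌈2 * √L * Real.log T⌉₊ := by exact_mod_cast this
    omega
  have hkey := h j hjlt
  set z := ρ ^ j with hz
  have hz0 : 0 < z := by positivity
  have hyz : y ≤ z * ρ := by rw [hz, ← pow_succ]; exact hj'.le
  rw [Real.sqrt_mul (by linarith), ← hx, ← hy]
  by_contra hcon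
  push Not at hcon
  have hbad : (2 * x / z) * (2 * (x * y)) - (2 * x / z) ^ 2 / 2 * y ^ 2 < 2 * x ^ 2 - 1 / 2 := by
    have : (2 * x / z) * (2 * (x * y)) < (2 * x / z) * D :=
      mul_lt_mul_of_pos_left hcon (by positivity)
    rw [hyV, hxL]
    linarith
  -- the loss due to the mismatch `e` of the scale is `2 L (e - 1)² ≤ 1 / 2`
  set e := y / z with he
  have he1 : 1 ≤ e := by rw [he, one_le_div hz0]; exact hj
  have he2 : e ≤ 1 + 1 / (2 * x) := by rw [he, div_le_iff₀ hz0, mul_comm, ← hρ]; exact hyz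
  have h7 : (2 * x / z) * (2 * (x * y)) - (2 * x / z) ^ 2 / 2 * y ^ 2 =
      2 * x ^ 2 - 2 * x ^ 2 * (e - 1) ^ 2 := by
    rw [he]; field_simp; ring
  rw [h7] at hbad
  have h8 : x * (e - 1) ≤ 1 / 2 := by
    have : x * (e - 1) ≤ x * (1 / (2 * x)) := mul_le_mul_of_nonneg_left (by linarith) (by linarith)
    have h9 : x * (1 / (2 * x)) = 1 / 2 := by field_simp
    linarith
  have h10 : 0 ≤ x * (e - 1) := mul_nonneg (by linarith) (by linarith)
  nlinarith

/-- The tail bound of the peeling argument. -/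
theorem measure_two_mul_sqrt_lt_le {L T : ℝ} (hL : 1 ≤ L) {D V : Ω → ℝ}
    (h : ∀ lam : ℝ, 0 < lam → ∀ u,
      μ.real {ω | u ≤ lam * D ω - lam ^ 2 / 2 * V ω} ≤ Real.exp (-u)) :
    μ.real {ω | V ω ∈ Set.Icc 1 T ∧ 2 * √(L * V ω) < D ω} ≤
      scaleCount L T * Real.exp (-(2 * L - 1 / 2)) := by
  have hx : 0 < √L := Real.sqrt_pos.2 (by linarith)
  set lam : ℕ → ℝ := fun j => 2 * √L / (1 + 1 / (2 * √L)) ^ j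
  have hsub : {ω | V ω ∈ Set.Icc 1 T ∧ 2 * √(L * V ω) < D ω} ⊆
      ⋃ j ∈ Finset.range (scaleCount L T),
        {ω | 2 * L - 1 / 2 ≤ lam j * D ω - lam j ^ 2 / 2 * V ω} := by
    rintro ω ⟨h1, h2⟩
    by_contra hcon
    simp only [Set.mem_iUnion, Finset.mem_range, Set.mem_ofPred_eq, exists_prop, not_exists,
      not_and, not_le] at hcon
    exact absurd (le_two_mul_sqrt_of_forall_scale hL h1 hcon) (not_le.2 h2)
  calc _ ≤ μ.real (⋃ j ∈ Finset.range (scaleCount L T),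
        {ω | 2 * L - 1 / 2 ≤ lam j * D ω - lam j ^ 2 / 2 * V ω})  :=
        measureReal_mono hsub (measure_ne_top _ _)
    _ ≤ ∑ j ∈ Finset.range (scaleCount L T),
        μ.real {ω | 2 * L - 1 / 2 ≤ lam j * D ω - lam j ^ 2 / 2 * V ω} :=
      measureReal_biUnion_finset_le _ _
    _ ≤ ∑ _j ∈ Finset.range (scaleCount L T), Real.exp (-(2 * L - 1 / 2)) :=
      Finset.sum_le_sum fun j _ => h _ (by positivity) _
    _ = _ := by simp

end Concentration

/-! ### The episode schedule -/

section Schedule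

variable (S A : Type*) [Fintype S] [Fintype A] [Nonempty S] [Nonempty A]

/-- The standing assumptions on the parameters. The bound on `ζ` only serves to make all logarithms
at least `4`; a larger `ζ` makes the failure probability trivial. -/
structure Admissible (pr : Params) : Prop where
  alpha_pos : 0 < pr.alpha
  alpha_mul_le : pr.alpha * Fintype.card S ≤ 1
  delta_pos : 0 < pr.delta
  delta_le : pr.delta ≤ pr.alpha / (2 * Fintype.card A)
  zeta_pos : 0 < pr.zeta
  zeta_le : pr.zeta ≤ 1 / 100
  cmax_nonneg : 0 ≤ pr.cmax

variable {S A} {pr : Params}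

theorem one_le_card_cast (X : Type*) [Fintype X] [Nonempty X] : (1 : ℝ) ≤ Fintype.card X := by
  exact_mod_cast Fintype.card_pos

theorem Admissible.alpha_le_one (hp : Admissible S A pr) : pr.alpha ≤ 1 := by
  nlinarith [hp.alpha_mul_le, hp.alpha_pos, one_le_card_cast S]

theorem Admissible.delta_le_half (hp : Admissible S A pr) : pr.delta ≤ 1 / 2 := by
  refine hp.delta_le.trans ?_
  have := one_le_card_cast A
  rw [div_le_div_iff₀ (by positivity) (by norm_num)]
  linarith [hp.alpha_le_one]

theorem Admissible.mul_pos (hp : Admissible S A pr) : 0 < pr.alpha * pr.delta :=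
  _root_.mul_pos hp.alpha_pos hp.delta_pos

theorem Admissible.mul_le_half (hp : Admissible S A pr) : pr.alpha * pr.delta ≤ 1 / 2 := by
  nlinarith [hp.alpha_le_one, hp.delta_le_half, hp.delta_pos, hp.alpha_pos]

theorem four_le_log {x : ℝ} (hx : 100 ≤ x) : 4 ≤ Real.log x := by
  rw [Real.le_log_iff_exp_le (by linarith)]
  have h1 : Real.exp 4 = Real.exp 1 ^ 4 := by rw [← Real.exp_nat_mul]; norm_num
  rw [h1]
  have h2 := Real.exp_one_lt_d9.le
  calc Real.exp 1 ^ 4 ≤ 2.7182818286 ^ 4 := by gcongr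
    _ ≤ 100 := by norm_num
    _ ≤ x := hx

theorem Admissible.hundred_le (hp : Admissible S A pr) {k : ℕ} (hk : 1 ≤ k) :
    100 ≤ (Fintype.card A : ℝ) * Fintype.card S * k / pr.zeta := by
  have h1 : (1 : ℝ) ≤ (Fintype.card A : ℝ) * Fintype.card S * k :=
    one_le_mul_of_one_le_of_one_le (one_le_mul_of_one_le_of_one_le (one_le_card_cast A)
      (one_le_card_cast S)) (by exact_mod_cast hk)
  rw [le_div_iff₀ hp.zeta_pos]
  linarith [hp.zeta_le]

theorem Admissible.four_le_logTerm (hp : Admissible S A pr) {k : ℕ} (hk : 1 ≤ k) :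
    4 ≤ logTerm S A pr k :=
  four_le_log (hp.hundred_le hk)

theorem Admissible.logTerm_mono (hp : Admissible S A pr) {j k : ℕ} (hj : 1 ≤ j) (hjk : j ≤ k) :
    logTerm S A pr j ≤ logTerm S A pr k := by
  unfold logTerm
  have := hp.hundred_le hj
  have := hp.zeta_pos
  refine Real.log_le_log (by linarith) ?_
  gcongr

theorem Admissible.logTerm_succ_le (hp : Admissible S A pr) {k : ℕ} (hk : 1 ≤ k) :
    logTerm S A pr (k + 1) ≤ 2 * logTerm S A pr k := by
  have h0 := hp.hundred_le hk
  have h0' := hp.hundred_le (Nat.le_add_left 1 k)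
  have h1 : logTerm S A pr (k + 1) ≤ Real.log (2 * ((Fintype.card A : ℝ) * Fintype.card S * k /
      pr.zeta)) := by
    refine Real.log_le_log (by linarith) ?_
    rw [← mul_div_assoc]
    have := hp.zeta_pos
    refine div_le_div_of_nonneg_right ?_ this.le
    have h2 : ((k + 1 : ℕ) : ℝ) ≤ 2 * k := by
      have : (1 : ℝ) ≤ k := by exact_mod_cast hk
      push_cast; linarith
    calc (Fintype.card A : ℝ) * Fintype.card S * ((k + 1 : ℕ) : ℝ)
        ≤ (Fintype.card A : ℝ) * Fintype.card S * (2 * k) := by gcongr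
      _ = _ := by ring
  rw [Real.log_mul (by norm_num) (by linarith)] at h1
  have h3 : Real.log 2 ≤ 1 := by
    have := Real.log_two_lt_d9; linarith
  have h4 := hp.four_le_logTerm hk
  unfold logTerm at h4 ⊢
  unfold logTerm at h1
  linarith

theorem epStart_one (pr : Params) : epStart S A pr 1 = 1 := by simp [epStart]

theorem epStart_succ (pr : Params) {k : ℕ} (hk : 1 ≤ k) :
    epStart S A pr (k + 1) = epStart S A pr k + mixLen S pr k + statLen S A pr k := by
  unfold epStart
  rw [Finset.sum_Ico_succ_top hk]
  ring

theorem le_statLen (pr : Params) (k : ℕ) :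
    max 4 (√(k : ℝ)) * logTerm S A pr k / (pr.alpha * pr.delta) ≤ statLen S A pr k :=
  Nat.le_ceil _

theorem Admissible.sixteen_le (hp : Admissible S A pr) {k : ℕ} (hk : 1 ≤ k) :
    16 ≤ max 4 (√(k : ℝ)) * logTerm S A pr k / (pr.alpha * pr.delta) := by
  rw [le_div_iff₀ hp.mul_pos]
  have h1 := hp.four_le_logTerm hk
  have h2 : (4 : ℝ) ≤ max 4 (√(k : ℝ)) := le_max_left _ _
  nlinarith [hp.mul_le_half]

theorem Admissible.sixteen_le_statLen (hp : Admissible S A pr) {k : ℕ} (hk : 1 ≤ k) :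
    16 ≤ statLen S A pr k := by
  have := (hp.sixteen_le hk).trans (le_statLen (S := S) (A := A) pr k)
  exact_mod_cast this

theorem Admissible.statLen_le (hp : Admissible S A pr) {k : ℕ} (hk : 1 ≤ k) :
    (statLen S A pr k : ℝ) ≤
      max 4 (√(k : ℝ)) * logTerm S A pr k / (pr.alpha * pr.delta) + 1 :=
  (Nat.ceil_lt_add_one (by linarith [hp.sixteen_le hk])).le

theorem Admissible.statLen_succ_le (hp : Admissible S A pr) {k : ℕ} (hk : 1 ≤ k) :
    (statLen S A pr (k + 1) : ℝ) ≤ 4 * statLen S A pr k := by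
  have hk' : (1 : ℝ) ≤ k := by exact_mod_cast hk
  have h1 : max 4 (√((k + 1 : ℕ) : ℝ)) ≤ 3 / 2 * max 4 (√(k : ℝ)) := by
    refine max_le (by linarith [le_max_left 4 (√(k : ℝ))]) ?_
    refine le_trans ?_ (mul_le_mul_of_nonneg_left (le_max_right 4 (√(k : ℝ))) (by norm_num))
    rw [Real.sqrt_le_left (by positivity), mul_pow, Real.sq_sqrt (by positivity)]
    push_cast
    linarith
  have h2 := hp.logTerm_succ_le hk
  have h3 := hp.four_le_logTerm hk
  have h4 := hp.mul_pos
  have h5 : max 4 (√((k + 1 : ℕ) : ℝ)) * logTerm S A pr (k + 1) / (pr.alpha * pr.delta) ≤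
      3 * (max 4 (√(k : ℝ)) * logTerm S A pr k / (pr.alpha * pr.delta)) := by
    rw [← mul_div_assoc]
    gcongr ?_ / _
    calc _ ≤ (3 / 2 * max 4 (√(k : ℝ))) * (2 * logTerm S A pr k) := by
          refine mul_le_mul h1 h2 (by linarith [hp.four_le_logTerm (Nat.le_add_left 1 k)])
            (by positivity)
      _ = _ := by ring
  linarith [hp.statLen_le (Nat.le_add_left 1 k), le_statLen (S := S) (A := A) pr k, hp.sixteen_le hk]

theorem Admissible.statLen_mono (hp : Admissible S A pr) {j k : ℕ} (hj : 1 ≤ j) (hjk : j ≤ k) :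
    statLen S A pr j ≤ statLen S A pr k := by
  unfold statLen
  refine Nat.ceil_mono ?_
  have h1 := hp.logTerm_mono hj hjk
  have h2 := hp.four_le_logTerm hj
  have h3 := hp.mul_pos
  gcongr

theorem Admissible.mixLen_le_statLen (hp : Admissible S A pr) {k : ℕ} (hk : 1 ≤ k) :
    mixLen S pr k ≤ statLen S A pr k := by
  refine Nat.ceil_mono ?_
  have hk' : (1 : ℝ) ≤ k := by exact_mod_cast hk
  have hS := one_le_card_cast S
  have h1 : Real.log k ≤ logTerm S A pr k := by
    refine Real.log_le_log (by linarith) ?_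
    rw [le_div_iff₀ hp.zeta_pos]
    calc (k : ℝ) * pr.zeta ≤ k * 1 := by gcongr; linarith [hp.zeta_le]
      _ = 1 * 1 * k := by ring
      _ ≤ _ := by gcongr; exact one_le_card_cast A
  have h2 := hp.four_le_logTerm hk
  have h3 := hp.mul_pos
  refine div_le_div₀ (by positivity) ?_ h3 ?_
  · calc Real.log k ≤ 1 * logTerm S A pr k := by rw [one_mul]; exact h1
      _ ≤ _ := by gcongr; exact le_max_of_le_left (by norm_num)
  · have := hp.alpha_pos
    have := hp.delta_le_half
    gcongr
    linarith

theorem Admissible.mixLen_le (hp : Admissible S A pr) {k : ℕ} (hk : 1 ≤ k) :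
    (mixLen S pr k : ℝ) ≤ Real.log k / (pr.alpha * Fintype.card S) + 1 := by
  refine (Nat.ceil_lt_add_one ?_).le
  have := hp.alpha_pos
  have : (1 : ℝ) ≤ k := by exact_mod_cast hk
  have := Real.log_nonneg this
  positivity

theorem Admissible.epStart_lt_succ (hp : Admissible S A pr) {k : ℕ} (hk : 1 ≤ k) :
    epStart S A pr k < epStart S A pr (k + 1) := by
  have := hp.sixteen_le_statLen hk
  rw [epStart_succ pr hk]; omega

theorem epStart_mono (pr : Params) {j k : ℕ} (hjk : j ≤ k) :
    epStart S A pr j ≤ epStart S A pr k := by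
  unfold epStart
  have : Finset.Ico 1 j ⊆ Finset.Ico 1 k := Finset.Ico_subset_Ico le_rfl hjk
  exact Nat.add_le_add_left (Finset.sum_le_sum_of_subset this) 1

theorem one_le_epStart (pr : Params) (k : ℕ) : 1 ≤ epStart S A pr k := Nat.le_add_right _ _

theorem Admissible.le_epStart (hp : Admissible S A pr) {k : ℕ} (hk : 1 ≤ k) :
    k ≤ epStart S A pr k := by
  induction k, hk using Nat.le_induction with
  | base => simp [epStart_one]
  | succ k hk ih => have := hp.epStart_lt_succ hk; omega

/-- The number of rounds up to the end of episode `k`. -/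
noncomputable def epEnd (S A : Type*) [Fintype S] [Fintype A] (pr : Params) (k : ℕ) : ℝ :=
  (epStart S A pr (k + 1) : ℝ) - 1

theorem statLen_le_epEnd (pr : Params) {k : ℕ} (hk : 1 ≤ k) :
    (statLen S A pr k : ℝ) ≤ epEnd S A pr k := by
  unfold epEnd
  have h := epStart_succ (S := S) (A := A) pr hk
  have h1 := one_le_epStart (S := S) (A := A) pr k
  have h2 : 1 + statLen S A pr k ≤ epStart S A pr (k + 1) := by omega
  have : (1 : ℝ) + statLen S A pr k ≤ epStart S A pr (k + 1) := by exact_mod_cast h2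
  linarith

theorem Admissible.epEnd_pos (hp : Admissible S A pr) {k : ℕ} (hk : 1 ≤ k) :
    0 < epEnd S A pr k := by
  have h1 := statLen_le_epEnd (S := S) (A := A) pr hk
  have h2 : (16 : ℝ) ≤ statLen S A pr k := by exact_mod_cast hp.sixteen_le_statLen hk
  linarith

theorem Admissible.epStart_succ_le (hp : Admissible S A pr) (k : ℕ) :
    epStart S A pr (k + 1) ≤ 1 + 2 * k * statLen S A pr k := by
  have h : ∑ j ∈ Finset.Ico 1 (k + 1), (mixLen S pr j + statLen S A pr j) ≤
      ∑ _j ∈ Finset.Ico 1 (k + 1), 2 * statLen S A pr k := by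
    refine Finset.sum_le_sum fun j hj => ?_
    have hj' := Finset.mem_Ico.1 hj
    have h1 := hp.mixLen_le_statLen hj'.1
    have h2 := hp.statLen_mono hj'.1 (Nat.lt_succ_iff.1 hj'.2)
    omega
  unfold epStart
  refine Nat.add_le_add_left (h.trans (le_of_eq ?_)) 1
  simp
  ring

/-- A lower bound for `∑ √j` that suffices for the growth of the schedule. -/
theorem mul_sqrt_le_two_mul_sum (m : ℕ) :
    (m : ℝ) * √(m : ℝ) ≤ 2 * ∑ j ∈ Finset.Ico 1 (m + 1), √(j : ℝ) := by
  induction m with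
  | zero => simp
  | succ m ih =>
    rw [Finset.sum_Ico_succ_top (by omega)]
    set x := √(m : ℝ)
    set y := √((m + 1 : ℕ) : ℝ)
    have hx : x ^ 2 = m := Real.sq_sqrt (by positivity)
    have hy : y ^ 2 = m + 1 := by
      have := Real.sq_sqrt (show (0 : ℝ) ≤ ((m + 1 : ℕ) : ℝ) by positivity)
      push_cast at this; simpa [y] using this
    have hx0 : 0 ≤ x := Real.sqrt_nonneg _
    have hy0 : 0 ≤ y := Real.sqrt_nonneg _
    have hxy : x ≤ y := Real.sqrt_le_sqrt (by push_cast; linarith)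
    push_cast
    -- `m (y - x) ≤ y` because `(y - x) (y + x) = 1`
    have h1 : (m : ℝ) * (y - x) ≤ y := by
      have h2 : (y - x) * (y + x) = 1 := by nlinarith
      rw [← hx]
      nlinarith [mul_nonneg hx0 (sub_nonneg.2 hxy)]
    nlinarith

/-- There are at most `O((T α δ) ^ (2/3))` episodes up to round `T`. -/
theorem Admissible.mul_sqrt_le (hp : Admissible S A pr) {K T : ℕ}
    (hT : epStart S A pr (K + 1) ≤ T + 1) :
    (K : ℝ) * √(K : ℝ) ≤ T * (pr.alpha * pr.delta) := by
  have h1 : ∑ j ∈ Finset.Ico 1 (K + 1), statLen S A pr j ≤ T := by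
    have : ∑ j ∈ Finset.Ico 1 (K + 1), statLen S A pr j ≤
        ∑ j ∈ Finset.Ico 1 (K + 1), (mixLen S pr j + statLen S A pr j) :=
      Finset.sum_le_sum fun j _ => by omega
    unfold epStart at hT
    omega
  have h2 : ∑ j ∈ Finset.Ico 1 (K + 1), 2 * √(j : ℝ) / (pr.alpha * pr.delta) ≤ T := by
    refine le_trans (Finset.sum_le_sum fun j hj => ?_)
      (show ∑ j ∈ Finset.Ico 1 (K + 1), (statLen S A pr j : ℝ) ≤ T by exact_mod_cast h1)
    refine le_trans ?_ (le_statLen (S := S) (A := A) pr j)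
    have h3 := hp.four_le_logTerm (Finset.mem_Ico.1 hj).1
    have h4 := hp.mul_pos
    gcongr ?_ / _
    have h5 : √(j : ℝ) ≤ max 4 (√(j : ℝ)) := le_max_right _ _
    nlinarith [Real.sqrt_nonneg (j : ℝ)]
  rw [← Finset.sum_div, ← Finset.mul_sum, div_le_iff₀ hp.mul_pos] at h2
  exact (mul_sqrt_le_two_mul_sum K).trans h2

/-- The episode that contains the round `t`. -/
noncomputable def episode (S A : Type*) [Fintype S] [Fintype A] (pr : Params) (t : ℕ) : ℕ :=
  Nat.findGreatest (fun k => epStart S A pr k ≤ t) t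

theorem Admissible.episode_eq (hp : Admissible S A pr) {k t : ℕ} (hk : 1 ≤ k)
    (ht : t ∈ Finset.Ico (epStart S A pr k) (epStart S A pr (k + 1))) :
    episode S A pr t = k := by
  rw [Finset.mem_Ico] at ht
  have h1 : k ≤ episode S A pr t :=
    Nat.le_findGreatest ((hp.le_epStart hk).trans ht.1) ht.1
  have h2 : epStart S A pr (episode S A pr t) ≤ t :=
    Nat.findGreatest_spec (P := fun k => epStart S A pr k ≤ t)
      ((hp.le_epStart hk).trans ht.1) ht.1
  by_contra hne
  have : epStart S A pr (k + 1) ≤ epStart S A pr (episode S A pr t) :=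
    epStart_mono pr (by omega)
  omega

theorem Admissible.episode_spec (hp : Admissible S A pr) {t : ℕ} (ht : 1 ≤ t) :
    1 ≤ episode S A pr t ∧
      t ∈ Finset.Ico (epStart S A pr (episode S A pr t))
        (epStart S A pr (episode S A pr t + 1)) := by
  have h1 : 1 ≤ episode S A pr t :=
    Nat.le_findGreatest ht (by rw [epStart_one]; exact ht)
  have h2 : epStart S A pr (episode S A pr t) ≤ t :=
    Nat.findGreatest_spec (P := fun k => epStart S A pr k ≤ t) ht (by rw [epStart_one]; exact ht)
  refine ⟨h1, Finset.mem_Ico.2 ⟨h2, ?_⟩⟩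
  by_contra hcon
  have h3 : episode S A pr t + 1 ≤ t :=
    (hp.le_epStart (Nat.le_add_left 1 _)).trans (not_lt.1 hcon)
  have := Nat.le_findGreatest (P := fun k => epStart S A pr k ≤ t) h3 (not_lt.1 hcon)
  unfold episode at this
  omega

/-- The stationary phase of episode `k`, as far as it lies in the first `T` rounds. -/
noncomputable def phase (S A : Type*) [Fintype S] [Fintype A] (pr : Params) (T k : ℕ) : Finset ℕ :=
  Finset.Ico (min (epStart S A pr k + mixLen S pr k) (T + 1)) (min (epStart S A pr (k + 1)) (T + 1))

theorem mem_phase {T k t : ℕ} (ht : t ∈ phase S A pr T k) :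
    epStart S A pr k + mixLen S pr k ≤ t ∧ t < epStart S A pr (k + 1) ∧ t ≤ T := by
  unfold phase at ht
  rw [Finset.mem_Ico] at ht
  omega

/-- The rounds outside the stationary phases `2, …, K` are few, so a sum over the rounds is
determined by the sums over these phases. -/
theorem sum_ge_of_phase {T K : ℕ} (hK : 1 ≤ K)
    (hT : T < epStart S A pr (K + 1)) {w : ℕ → ℝ} {v B : ℝ} {c : ℕ → ℝ} (hB : 0 ≤ B)
    (hw : ∀ t ∈ Finset.Icc 1 T, -B ≤ w t) (hv : v ≤ B)
    (hc : ∀ k ∈ Finset.Icc 2 K,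
      (phase S A pr T k).card * v - c k ≤ ∑ t ∈ phase S A pr T k, w t) :
    T * v - ∑ k ∈ Finset.Icc 2 K, c k -
      2 * B * (epStart S A pr 2 + ∑ k ∈ Finset.Icc 2 K, (mixLen S pr k : ℝ)) ≤
      ∑ t ∈ Finset.Icc 1 T, w t := by
  -- each of the `m` rounds between two phases loses at most `v + B ≤ 2 B`
  have hfew : ∀ a b m : ℕ, 1 ≤ a → b ≤ T + 1 → b ≤ a + m →
      -(2 * B * m) ≤ ∑ t ∈ Finset.Ico a b, (w t - v) := by
    intro a b m ha hb hm
    calc -(2 * B * m) ≤ ∑ _t ∈ Finset.Ico a b, -(2 * B) := by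
          have : ((b - a : ℕ) : ℝ) ≤ m := by exact_mod_cast (by omega : b - a ≤ m)
          simp only [Finset.sum_const, Nat.card_Ico, nsmul_eq_mul]
          nlinarith
      _ ≤ _ := Finset.sum_le_sum fun t ht => by
          rw [Finset.mem_Ico] at ht
          have := hw t (Finset.mem_Icc.2 ⟨by omega, by omega⟩)
          linarith
  have key : ∀ K', 1 ≤ K' → K' ≤ K → -(∑ k ∈ Finset.Icc 2 K', c k) -
      2 * B * (epStart S A pr 2 + ∑ k ∈ Finset.Icc 2 K', (mixLen S pr k : ℝ)) ≤
      ∑ t ∈ Finset.Ico 1 (min (epStart S A pr (K' + 1)) (T + 1)), (w t - v) := by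
    intro K' hK'
    induction K', hK' using Nat.le_induction with
    | base =>
      intro _
      have := hfew 1 (min (epStart S A pr 2) (T + 1)) (epStart S A pr 2) le_rfl
        (min_le_right _ _) (by omega)
      simpa using this
    | succ k hk ih =>
      intro hkK
      have ih := ih (by omega)
      have hes := epStart_succ (S := S) (A := A) pr (Nat.le_add_left 1 k)
      have h1 := one_le_epStart (S := S) (A := A) pr (k + 1)
      rw [← Finset.sum_Ico_consecutive _
          (show 1 ≤ min (epStart S A pr (k + 1)) (T + 1) by omega)
          (show _ ≤ min (epStart S A pr (k + 1 + 1)) (T + 1) by omega),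
        ← Finset.sum_Ico_consecutive _
          (show min (epStart S A pr (k + 1)) (T + 1) ≤
            min (epStart S A pr (k + 1) + mixLen S pr (k + 1)) (T + 1) by omega)
          (show _ ≤ min (epStart S A pr (k + 1 + 1)) (T + 1) by omega)]
      have h2 := hfew (min (epStart S A pr (k + 1)) (T + 1))
        (min (epStart S A pr (k + 1) + mixLen S pr (k + 1)) (T + 1)) (mixLen S pr (k + 1))
        (by omega) (by omega) (by omega)
      have h3 := hc (k + 1) (Finset.mem_Icc.2 ⟨by omega, hkK⟩)
      have h4 : ∑ t ∈ phase S A pr T (k + 1), (w t - v) =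
          ∑ t ∈ phase S A pr T (k + 1), w t - (phase S A pr T (k + 1)).card * v := by
        simp [Finset.sum_sub_distrib]
      have h5 : ∑ t ∈ Finset.Ico (min (epStart S A pr (k + 1) + mixLen S pr (k + 1)) (T + 1))
          (min (epStart S A pr (k + 1 + 1)) (T + 1)), (w t - v) =
          ∑ t ∈ phase S A pr T (k + 1), (w t - v) := rfl
      rw [h5, h4, Finset.sum_Icc_succ_top (by omega), Finset.sum_Icc_succ_top (by omega)]
      linarith
  have h := key K hK le_rfl
  rw [min_eq_right (by omega)] at h
  have h6 : Finset.Ico 1 (T + 1) = Finset.Icc 1 T := by ext t; simp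
  rw [h6, Finset.sum_sub_distrib] at h
  simp only [Finset.sum_const, Nat.card_Icc, Nat.add_sub_cancel, nsmul_eq_mul] at h
  linarith

theorem card_phase_le (pr : Params) {T k : ℕ} (hk : 1 ≤ k) :
    (phase S A pr T k).card ≤ statLen S A pr k := by
  have := epStart_succ (S := S) (A := A) pr hk
  unfold phase
  rw [Nat.card_Ico]
  omega

theorem sum_card_phase_le (pr : Params) (T K : ℕ) :
    ∑ k ∈ Finset.Icc 2 K, ((phase S A pr T k).card : ℝ) ≤ T := by
  have key : ∀ K, ∑ k ∈ Finset.Icc 2 K, (phase S A pr T k).card ≤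
      min (epStart S A pr (K + 1)) (T + 1) - 1 := by
    intro K
    induction K with
    | zero => simp
    | succ K ih =>
      rcases Nat.eq_zero_or_pos K with rfl | hK
      · simp
      rw [Finset.sum_Icc_succ_top (by omega)]
      have := epStart_succ (S := S) (A := A) pr (Nat.le_add_left 1 K)
      have := one_le_epStart (S := S) (A := A) pr (K + 1)
      have h1 : (phase S A pr T (K + 1)).card ≤
          min (epStart S A pr (K + 1 + 1)) (T + 1) - min (epStart S A pr (K + 1)) (T + 1) := by
        unfold phase
        rw [Nat.card_Ico]
        omega
      omega
  exact_mod_cast (key K).trans (by omega)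

/-- Episode lengths grow slowly enough for the sum of `1 / √t` to be computed episode by
episode. -/
theorem Admissible.sum_card_phase_div_sqrt_le (hp : Admissible S A pr) (T K : ℕ) :
    ∑ k ∈ Finset.Icc 2 K, ((phase S A pr T k).card : ℝ) / √(epEnd S A pr (k - 1)) ≤ 4 * √T := by
  have key : ∀ K, ∑ k ∈ Finset.Icc 2 K,
      ((phase S A pr T k).card : ℝ) / √(epEnd S A pr (k - 1)) ≤
      4 * √((min (epStart S A pr (K + 1)) (T + 1) : ℕ) - 1 : ℝ) := by
    intro K
    induction K with
    | zero => simp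
    | succ K ih =>
      rcases Nat.eq_zero_or_pos K with rfl | hK
      · simp
      rw [Finset.sum_Icc_succ_top (by omega)]
      have hes := epStart_succ (S := S) (A := A) pr (Nat.le_add_left 1 K)
      have h1 := one_le_epStart (S := S) (A := A) pr (K + 1)
      have hpos := hp.epEnd_pos hK
      set a := epEnd S A pr K with ha
      rw [Nat.add_sub_cancel]
      rcases Nat.lt_or_ge T (epStart S A pr (K + 1) + mixLen S pr (K + 1)) with hT | hT
      · have h0 : phase S A pr T (K + 1) = ∅ := by
          unfold phase
          rw [Finset.Ico_eq_empty]; omega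
        rw [h0, Finset.card_empty, Nat.cast_zero, zero_div, add_zero]
        refine ih.trans ?_
        gcongr
        omega
      set l := (phase S A pr T (K + 1)).card with hl
      have hcard : l + epStart S A pr (K + 1) ≤ min (epStart S A pr (K + 1 + 1)) (T + 1) := by
        rw [hl]
        unfold phase
        rw [Nat.card_Ico]
        omega
      have h3 : (min (epStart S A pr (K + 1)) (T + 1) : ℕ) = epStart S A pr (K + 1) := by omega
      rw [h3] at ih
      -- a phase is at most four times as long as all episodes before it
      have hl4 : (l : ℝ) ≤ 4 * a := by
        have h5 : (l : ℝ) ≤ statLen S A pr (K + 1) := by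
          exact_mod_cast card_phase_le pr (Nat.le_add_left 1 K)
        linarith [hp.statLen_succ_le hK, statLen_le_epEnd (S := S) (A := A) pr hK]
      have hsq : √(a + l) ≤ √((min (epStart S A pr (K + 1 + 1)) (T + 1) : ℕ) - 1 : ℝ) := by
        refine Real.sqrt_le_sqrt ?_
        have : ((l + epStart S A pr (K + 1) : ℕ) : ℝ) ≤
            (min (epStart S A pr (K + 1 + 1)) (T + 1) : ℕ) := by exact_mod_cast hcard
        push_cast at this ⊢
        rw [ha, epEnd]
        linarith
      -- so the mean of `1 / √t` over the phase is comparable to its value `1 / √a` at the start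
      have hstep : √a + l / √a / 4 ≤ √(a + l) := by
        set x := √a
        have hx : x ^ 2 = a := Real.sq_sqrt hpos.le
        have hx0 : 0 < x := Real.sqrt_pos.2 hpos
        refine Real.le_sqrt_of_sq_le ?_
        have h6 : (x + l / x / 4) ^ 2 = x ^ 2 + l / 2 + l * (l / x ^ 2) / 16 := by
          field_simp; ring
        have h7 : (l : ℝ) / x ^ 2 ≤ 4 := by rw [hx, div_le_iff₀ hpos]; exact hl4
        rw [h6, hx]
        rw [hx] at h7
        nlinarith [Nat.cast_nonneg (α := ℝ) l]
      have ih' : ∑ k ∈ Finset.Icc 2 K, ((phase S A pr T k).card : ℝ) / √(epEnd S A pr (k - 1)) ≤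
          4 * √a := ih
      linarith
  refine (key K).trans ?_
  gcongr
  have : ((min (epStart S A pr (K + 1)) (T + 1) : ℕ) : ℝ) ≤ (T + 1 : ℕ) := by
    exact_mod_cast min_le_right _ _
  push_cast at this ⊢
  linarith

end Schedule

/-! ### The algorithm on a sample path with valid confidence sets -/

section Path

variable {S A : Type*} [Fintype S] [Fintype A] [Nonempty S] [Nonempty A] {n : ℕ} {pr : Params}
  {h : Observation S A n} {P : S → A → S → ℝ}

/-- The logarithm in the confidence radius for the rewards. -/
noncomputable def rewLog (S A : Type*) [Fintype S] [Fintype A] (pr : Params) (n k : ℕ) : ℝ :=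
  Real.log ((Fintype.card A : ℝ) * Fintype.card S * k * n / pr.zeta)

theorem Admissible.logTerm_le_rewLog (hp : Admissible S A pr) (hn : 1 ≤ n) {k : ℕ} (hk : 1 ≤ k) :
    logTerm S A pr k ≤ rewLog S A pr n k := by
  have h1 := hp.hundred_le hk
  have hn' : (1 : ℝ) ≤ n := by exact_mod_cast hn
  refine Real.log_le_log (by linarith) ?_
  have := hp.zeta_pos
  refine div_le_div_of_nonneg_right ?_ this.le
  exact le_mul_of_one_le_right (by positivity) hn'

theorem Admissible.four_le_rewLog (hp : Admissible S A pr) (hn : 1 ≤ n) {k : ℕ} (hk : 1 ≤ k) :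
    4 ≤ rewLog S A pr n k :=
  (hp.four_le_logTerm hk).trans (hp.logTerm_le_rewLog hn hk)

/-- The accuracy of all estimates at the end of episode `k`, up to constants. -/
noncomputable def precision (S A : Type*) [Fintype S] [Fintype A] (pr : Params) (n k : ℕ) : ℝ :=
  √(rewLog S A pr n k / (pr.alpha * pr.delta * epEnd S A pr k))

theorem precision_nonneg (pr : Params) (k : ℕ) : 0 ≤ precision S A pr n k := Real.sqrt_nonneg _

/-- The sample paths on which the confidence sets contain the truth. `Q` is the set of the players
whose reports are samples from a fixed law with mean function `m`. The bound on the visits is void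
in the first episodes. -/
structure GoodPath (pr : Params) (P : S → A → S → ℝ) (h : Observation S A n)
    (Q : Fin (n + 1) → Prop) (m : Fin (n + 1) → S → A → ℝ) : Prop where
  conf : ∀ k, P ∈ confSet pr h k
  visit : ∀ k ≥ 1, ∀ s a,
    pr.alpha * pr.delta * epEnd S A pr k ≤ 32 * logTerm S A pr k ∨
      pr.alpha * pr.delta * epEnd S A pr k / 8 ≤ visits pr h k s a
  report : ∀ t ≥ 1, ∀ j, h.report t j ∈ Set.Icc 0 (rewardCap pr.cmax j)
  est : ∀ k ≥ 1, ∀ j, Q j → ∀ s a, lcb pr h k j s a ≤ m j s a ∧ m j s a ≤ ucb pr h k j s a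

theorem sum_abs_le_of_le {x r : S → ℝ} (h0 : ∑ s, x s = 0) (hx : ∀ s, x s ≤ r s)
    (hr : ∀ s, 0 ≤ r s) : ∑ s, |x s| ≤ 2 * ∑ s, r s := by
  have h1 : ∀ s, |x s| ≤ 2 * r s - x s := fun s =>
    abs_le.2 ⟨by linarith [hr s, hx s], by linarith [hx s]⟩
  calc ∑ s, |x s| ≤ ∑ s, (2 * r s - x s) := Finset.sum_le_sum fun s _ => h1 s
    _ = 2 * ∑ s, r s := by rw [Finset.sum_sub_distrib, h0, sub_zero, Finset.mul_sum]

/-- Two distributions that exceed a third one by at most `r` are within `4 ∑ r` in total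
variation norm: upper bounds suffice, since all three have the same mass. -/
theorem abs_sum_sub_mul_le {p₁ p₂ p r f : S → ℝ} {H : ℝ} (h₁ : ∑ s, p₁ s = 1) (h₂ : ∑ s, p₂ s = 1)
    (hp : ∑ s, p s = 1) (hr₁ : ∀ s, p₁ s - p s ≤ r s) (hr₂ : ∀ s, p₂ s - p s ≤ r s)
    (hr : ∀ s, 0 ≤ r s) (hf : ∀ s, |f s| ≤ H) :
    |∑ s, (p₁ s - p₂ s) * f s| ≤ 4 * H * ∑ s, r s := by
  have hH : 0 ≤ H := by
    by_contra hcon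
    have : IsEmpty S := ⟨fun s => hcon ((abs_nonneg _).trans (hf s))⟩
    simp at h₁
  have e₁ := sum_abs_le_of_le (x := fun s => p₁ s - p s) (by simp [h₁, hp]) hr₁ hr
  have e₂ := sum_abs_le_of_le (x := fun s => p₂ s - p s) (by simp [h₂, hp]) hr₂ hr
  calc |∑ s, (p₁ s - p₂ s) * f s| ≤ ∑ s, |(p₁ s - p₂ s) * f s| := Finset.abs_sum_le_sum_abs _ _
    _ ≤ ∑ s, (|p₁ s - p s| + |p₂ s - p s|) * H := Finset.sum_le_sum fun s _ => by
        rw [abs_mul]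
        refine mul_le_mul ?_ (hf s) (abs_nonneg _) (by positivity)
        calc |p₁ s - p₂ s| = |(p₁ s - p s) - (p₂ s - p s)| := by ring_nf
          _ ≤ _ := abs_sub _ _
    _ ≤ _ := by
        rw [← Finset.sum_mul, Finset.sum_add_distrib]
        nlinarith

theorem sum_visitsTo (pr : Params) (h : Observation S A n) (k : ℕ) (s : S) (a : A) :
    ∑ s', visitsTo pr h k s a s' = visits pr h k s a := by
  classical
  unfold visits visitsTo
  rw [Finset.card_eq_sum_card_fiberwise (f := fun t => h.state (t + 1)) (t := Finset.univ)
    (fun _ _ => Finset.mem_coe.2 (Finset.mem_univ _))]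
  refine Finset.sum_congr rfl fun s' _ => ?_
  congr 1
  ext t
  simp only [Finset.mem_filter, and_assoc]

theorem sum_empTrans {k : ℕ} {s : S} {a : A} (hN : 1 ≤ visits pr h k s a) :
    ∑ s', empTrans pr h k s a s' = 1 := by
  have hN' : (1 : ℝ) ≤ visits pr h k s a := by exact_mod_cast hN
  unfold empTrans
  rw [← Finset.sum_div, max_eq_right hN', div_eq_one_iff_eq (by linarith)]
  exact_mod_cast sum_visitsTo pr h k s a

theorem empTrans_nonneg (k : ℕ) (s : S) (a : A) (s' : S) : 0 ≤ empTrans pr h k s a s' := by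
  unfold empTrans; positivity

theorem sum_sqrt_le {p : S → ℝ} (hp : ∀ s, 0 ≤ p s) (h1 : ∑ s, p s = 1) :
    ∑ s, √(p s) ≤ √(Fintype.card S) := by
  refine Real.le_sqrt_of_sq_le ?_
  refine (sq_sum_le_card_mul_sum_sq (s := Finset.univ) (f := fun s => √(p s))).trans ?_
  simp [Real.sq_sqrt (hp _), h1]

/-- The number of visits that enters the Bernstein radius. -/
noncomputable def effVisits (pr : Params) (h : Observation S A n) (k : ℕ) (s : S) (a : A) : ℝ :=
  max 1 ((visits pr h k s a : ℝ) - 1)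

theorem effVisits_pos (k : ℕ) (s : S) (a : A) : 0 < effVisits pr h k s a :=
  zero_lt_one.trans_le (le_max_left _ _)

theorem Admissible.transRadius_nonneg (hp : Admissible S A pr) {k : ℕ} (hk : 1 ≤ k) (s : S) (a : A)
    (s' : S) : 0 ≤ transRadius pr h k s a s' := by
  have := hp.four_le_logTerm hk
  unfold transRadius
  positivity

theorem Admissible.sum_transRadius_le (hp : Admissible S A pr) {k : ℕ} (hk : 1 ≤ k) {s : S} {a : A}
    (hN : 1 ≤ visits pr h k s a) :
    ∑ s', transRadius pr h k s a s' ≤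
      2 * √(Fintype.card S * logTerm S A pr k / effVisits pr h k s a) +
        14 / 3 * (Fintype.card S * logTerm S A pr k / effVisits pr h k s a) := by
  have hL := hp.four_le_logTerm hk
  have hM := effVisits_pos (pr := pr) (h := h) k s a
  unfold transRadius
  change ∑ s', (2 * √(empTrans pr h k s a s' * logTerm S A pr k / effVisits pr h k s a) +
    14 * logTerm S A pr k / (3 * effVisits pr h k s a)) ≤ _
  rw [Finset.sum_add_distrib, ← Finset.mul_sum]
  refine add_le_add (mul_le_mul_of_nonneg_left ?_ (by norm_num)) (le_of_eq ?_)
  · simp only [mul_div_assoc]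
    rw [Real.sqrt_mul (by positivity)]
    simp only [Real.sqrt_mul (empTrans_nonneg _ _ _ _)]
    rw [← Finset.sum_mul]
    exact mul_le_mul_of_nonneg_right (sum_sqrt_le (empTrans_nonneg _ _ _) (sum_empTrans hN))
      (Real.sqrt_nonneg _)
  · simp
    field_simp

theorem confSet_subset_simplex {k : ℕ} {P' : S → A → S → ℝ} (hP' : P' ∈ confSet pr h k) (s : S)
    (a : A) : P' s a ∈ stdSimplex ℝ S := by
  induction k with
  | zero => exact hP' s a
  | succ k ih => exact ih hP'.1

theorem confSet_radius {k : ℕ} (hk : 1 ≤ k) {P' : S → A → S → ℝ} (hP' : P' ∈ confSet pr h k) (s : S)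
    (a : A) (s' : S) : P' s a s' - empTrans pr h k s a s' ≤ transRadius pr h k s a s' := by
  obtain ⟨k, rfl⟩ := Nat.exists_eq_add_of_le' hk
  exact hP'.2 s a s'

/-- Two kernels in the confidence set are close, with a square-root rate also for few visits. -/
theorem Admissible.abs_sum_confSet_le (hp : Admissible S A pr) {k : ℕ} (hk : 1 ≤ k)
    {P₁ P₂ : S → A → S → ℝ} (h₁ : P₁ ∈ confSet pr h k) (h₂ : P₂ ∈ confSet pr h k) (s : S) (a : A)
    {f : S → ℝ} {H : ℝ} (hf : ∀ s, |f s| ≤ H) :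
    |∑ s', (P₁ s a s' - P₂ s a s') * f s'| ≤
      27 * H * √(Fintype.card S * logTerm S A pr k / effVisits pr h k s a) := by
  have hL := hp.four_le_logTerm hk
  have hS := one_le_card_cast S
  have hH : 0 ≤ H := by
    obtain ⟨s⟩ := ‹Nonempty S›
    exact (abs_nonneg _).trans (hf s)
  set x := √(Fintype.card S * logTerm S A pr k / effVisits pr h k s a) with hx
  have hx0 : 0 ≤ x := Real.sqrt_nonneg _
  -- this suffices if `1 ≤ x`
  have htriv : |∑ s', (P₁ s a s' - P₂ s a s') * f s'| ≤ 2 * H := by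
    have e₁ := abs_sum_mul_le Finset.univ (P₁ s a) f H
      (fun i _ => (confSet_subset_simplex h₁ s a).1 i) fun i _ => hf i
    have e₂ := abs_sum_mul_le Finset.univ (P₂ s a) f H
      (fun i _ => (confSet_subset_simplex h₂ s a).1 i) fun i _ => hf i
    rw [(confSet_subset_simplex h₁ s a).2] at e₁
    rw [(confSet_subset_simplex h₂ s a).2] at e₂
    simp only [sub_mul, Finset.sum_sub_distrib]
    exact (abs_sub _ _).trans (by linarith)
  by_cases hx1 : 1 ≤ x
  · nlinarith
  push Not at hx1
  have hxx : x ^ 2 = Fintype.card S * logTerm S A pr k / effVisits pr h k s a :=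
    Real.sq_sqrt (div_nonneg (by positivity) (effVisits_pos k s a).le)
  -- without visits, `x² = |S| logTerm ≥ 1`
  have hN : 1 ≤ visits pr h k s a := by
    by_contra hN
    have hN0 : visits pr h k s a = 0 := by omega
    have : effVisits pr h k s a = 1 := by simp [effVisits, hN0]
    rw [this, div_one] at hxx
    nlinarith
  have e := abs_sum_sub_mul_le (confSet_subset_simplex h₁ s a).2 (confSet_subset_simplex h₂ s a).2
    (sum_empTrans hN) (confSet_radius hk h₁ s a) (confSet_radius hk h₂ s a)
    (hp.transRadius_nonneg hk s a) hf
  have e' := hp.sum_transRadius_le hk hN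
  rw [← hx, ← hxx] at e'
  calc _ ≤ 4 * H * (2 * x + 14 / 3 * x ^ 2) := e.trans (by gcongr)
    _ ≤ 4 * H * (2 * x + 14 / 3 * x) := by gcongr; nlinarith
    _ ≤ 27 * H * x := by nlinarith [mul_nonneg hH hx0]

variable {Q : Fin (n + 1) → Prop} {m : Fin (n + 1) → S → A → ℝ}

theorem mul_card_eq (pr : Params) :
    pr.alpha * Fintype.card S = pr.alpha * √(Fintype.card S) * √(Fintype.card S) := by
  rw [mul_assoc, Real.mul_self_sqrt (by positivity)]

theorem Admissible.mul_sqrt_card_le_one (hp : Admissible S A pr) :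
    pr.alpha * √(Fintype.card S) ≤ 1 := by
  refine le_trans ?_ hp.alpha_mul_le
  rw [mul_card_eq]
  have := hp.alpha_pos
  exact le_mul_of_one_le_right (by positivity) (Real.one_le_sqrt.2 (one_le_card_cast S))

/-- In each episode, either the visits are numerous or the precision is void. -/
theorem GoodPath.visit_cases (hg : GoodPath pr P h Q m) (hp : Admissible S A pr) (hn : 1 ≤ n)
    {k : ℕ} (hk : 1 ≤ k) (s : S) (a : A) :
    1 / 6 ≤ precision S A pr n k ∨
      (rewLog S A pr n k / effVisits pr h k s a ≤ (4 * precision S A pr n k) ^ 2 ∧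
        rewLog S A pr n k / max 1 (visits pr h k s a : ℝ) ≤ 8 * precision S A pr n k ^ 2) := by
  have hy := mul_pos hp.mul_pos (hp.epEnd_pos hk)
  have hL := hp.four_le_rewLog hn hk
  have hsq : precision S A pr n k ^ 2 =
      rewLog S A pr n k / (pr.alpha * pr.delta * epEnd S A pr k) := Real.sq_sqrt (by positivity)
  rcases hg.visit k hk s a with h1 | h1
  · left
    have h2 : pr.alpha * pr.delta * epEnd S A pr k ≤ 32 * rewLog S A pr n k :=
      h1.trans (by linarith [hp.logTerm_le_rewLog hn hk])
    refine Real.le_sqrt_of_sq_le ?_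
    rw [le_div_iff₀ hy]
    linarith
  · right
    set y := pr.alpha * pr.delta * epEnd S A pr k
    have h2 : y / 16 ≤ effVisits pr h k s a := by
      unfold effVisits
      rcases le_or_gt y 16 with h3 | h3
      · exact le_max_of_le_left (by linarith)
      · exact le_max_of_le_right (by linarith)
    have h3 : y / 8 ≤ max 1 (visits pr h k s a : ℝ) := le_max_of_le_right h1
    constructor
    · rw [mul_pow, hsq]
      calc _ ≤ rewLog S A pr n k / (y / 16) := by gcongr
        _ = _ := by field_simp; norm_num
    · rw [hsq]
      calc _ ≤ rewLog S A pr n k / (y / 8) := by gcongr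
        _ = _ := by field_simp

/-- The value that a feasible `q` promises and the average payoff of its policy are close: they
differ by the effect of the kernel error on a bias of size `F / (α |S|)`. -/
theorem GoodPath.abs_pairing_sub_avgPayoff_le (hg : GoodPath pr P h Q m) (hp : Admissible S A pr)
    (hP : IsMixing P pr.alpha) (hn : 1 ≤ n) {k : ℕ} (hk : 1 ≤ k) (s₀ : S) {q : S → A → S → ℝ}
    {π : S → A → ℝ} (hq : q ∈ feasible pr h k) (hi : Induces q π) {f : S → A → ℝ} {F : ℝ}
    (hf : ∀ s a, |f s a| ≤ F) :
    |pairing q f - avgPayoff P s₀ π f| ≤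
      108 * F / (pr.alpha * √(Fintype.card S)) * precision S A pr n k := by
  obtain ⟨⟨P', hP', hqP'⟩, -⟩ := hq
  obtain ⟨b, hb, hbH⟩ := exists_bias hP hi.1 s₀ hf
  set H := F / (pr.alpha * Fintype.card S)
  have hα := hp.alpha_pos
  have hS := one_le_card_cast S
  have hF : 0 ≤ F := by
    obtain ⟨s⟩ := ‹Nonempty S›
    obtain ⟨a⟩ := ‹Nonempty A›
    exact (abs_nonneg _).trans (hf s a)
  have hH : 0 ≤ H := by positivity
  set x := precision S A pr n k
  have hx0 : 0 ≤ x := precision_nonneg pr k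
  have hL := hp.four_le_logTerm hk
  by_cases hx1 : 1 / 6 ≤ x
  -- void precision: both values are at most `F` in absolute value
  · have h1 := abs_le.1 (abs_pairing_le hqP'.1 hf)
    have h2 := abs_le.1 (abs_avgPayoff_le hP hi.1 s₀ hf)
    have h3 : F ≤ F / (pr.alpha * √(Fintype.card S)) := by
      rw [le_div_iff₀ (by positivity)]
      exact mul_le_of_le_one_right hF hp.mul_sqrt_card_le_one
    have h4 : 108 * F / (pr.alpha * √(Fintype.card S)) * x =
        108 * (F / (pr.alpha * √(Fintype.card S))) * x := by ring
    rw [h4, abs_le]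
    constructor <;> nlinarith
  · have hbound : ∀ s a, |∑ s', (P' s a s' - P s a s') * b s'| ≤
        108 * F / (pr.alpha * √(Fintype.card S)) * x := by
      intro s a
      refine (hp.abs_sum_confSet_le hk hP' (hg.conf k) s a hbH).trans ?_
      have h1 := ((hg.visit_cases hp hn hk s a).resolve_left hx1).1
      have h2 : √(logTerm S A pr k / effVisits pr h k s a) ≤ 4 * x := by
        refine (Real.sqrt_le_left (by positivity)).2 (le_trans ?_ h1)
        have := effVisits_pos (pr := pr) (h := h) k s a
        have := hp.logTerm_le_rewLog hn hk
        gcongr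
      rw [mul_div_assoc, Real.sqrt_mul (by positivity)]
      calc 27 * H * (√(Fintype.card S) * √(logTerm S A pr k / effVisits pr h k s a))
          ≤ 27 * H * (√(Fintype.card S) * (4 * x)) := by gcongr
        _ = 108 * F / (pr.alpha * √(Fintype.card S)) * x := by
          simp only [H]
          rw [mul_card_eq]
          have : 0 < √(Fintype.card S : ℝ) := by positivity
          field_simp
          ring
    rw [pairing_sub_avgPayoff hqP' hi hb]
    have h5 : ∑ s, ∑ a, saFreq q s a * ∑ s', (P' s a s' - P s a s') * b s' =
        pairing q fun s a => ∑ s', (P' s a s' - P s a s') * b s' := by rw [pairing_eq]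
    rw [h5]
    exact abs_pairing_le hqP'.1 hbound

theorem rewardCap_nonneg (hp : Admissible S A pr) (j : Fin (n + 1)) : 0 ≤ rewardCap pr.cmax j := by
  unfold rewardCap; split_ifs
  · exact hp.cmax_nonneg
  · norm_num

theorem GoodPath.empReward_mem (hg : GoodPath pr P h Q m) (k : ℕ) (j : Fin (n + 1)) (s : S)
    (a : A) : empReward pr h k j s a ∈ Set.Icc 0 (rewardCap pr.cmax j) := by
  classical
  have hmem : ∀ t ∈ Finset.Ico 1 (epStart S A pr (k + 1)),
      h.report t j ∈ Set.Icc 0 (rewardCap pr.cmax j) := fun t ht =>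
    hg.report t (Finset.mem_Ico.1 ht).1 j
  have hM : (0 : ℝ) < max 1 (visits pr h k s a : ℝ) := zero_lt_one.trans_le (le_max_left _ _)
  unfold empReward
  constructor
  · refine div_nonneg (Finset.sum_nonneg fun t ht => ?_) hM.le
    split_ifs
    · exact (hmem t ht).1
    · exact le_rfl
  · rw [div_le_iff₀ hM]
    have hc : 0 ≤ rewardCap pr.cmax j := (hg.report 1 le_rfl j).1.trans (hg.report 1 le_rfl j).2
    calc _ = ∑ t ∈ (Finset.Ico 1 (epStart S A pr (k + 1))).filter
          (fun t => h.state t = s ∧ h.action t = a), h.report t j := by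
          rw [Finset.sum_filter]
      _ ≤ ∑ _t ∈ (Finset.Ico 1 (epStart S A pr (k + 1))).filter
          (fun t => h.state t = s ∧ h.action t = a), rewardCap pr.cmax j :=
          Finset.sum_le_sum fun t ht => (hmem t (Finset.mem_filter.1 ht).1).2
      _ = visits pr h k s a * rewardCap pr.cmax j := by
          rw [Finset.sum_const, nsmul_eq_mul]
          unfold visits
          congr
      _ ≤ _ := by
          rw [mul_comm]
          exact mul_le_mul_of_nonneg_left (le_max_right _ _) hc

theorem rewardRadius_nonneg (k : ℕ) (s : S) (a : A) : 0 ≤ rewardRadius pr h k s a :=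
  Real.sqrt_nonneg _

theorem GoodPath.ucb_mem (hg : GoodPath pr P h Q m) (hp : Admissible S A pr) (k : ℕ)
    (j : Fin (n + 1)) (s : S) (a : A) : ucb pr h k j s a ∈ Set.Icc 0 (rewardCap pr.cmax j) := by
  have hc := rewardCap_nonneg hp j
  have h1 := hg.empReward_mem k j s a
  exact ⟨le_min hc (add_nonneg h1.1 (mul_nonneg hc (rewardRadius_nonneg k s a))), min_le_left _ _⟩

theorem GoodPath.lcb_mem (hg : GoodPath pr P h Q m) (hp : Admissible S A pr) (k : ℕ)
    (j : Fin (n + 1)) (s : S) (a : A) : lcb pr h k j s a ∈ Set.Icc 0 (rewardCap pr.cmax j) := by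
  have hc := rewardCap_nonneg hp j
  have h1 := hg.empReward_mem k j s a
  refine ⟨le_max_left _ _, max_le hc ?_⟩
  linarith [h1.2, mul_nonneg hc (rewardRadius_nonneg (pr := pr) (h := h) k s a)]

theorem GoodPath.ucb_sub_lcb_le (hg : GoodPath pr P h Q m) (hp : Admissible S A pr) (hn : 1 ≤ n)
    {k : ℕ} (hk : 1 ≤ k) (j : Fin (n + 1)) (s : S) (a : A) :
    ucb pr h k j s a - lcb pr h k j s a ≤ 8 * rewardCap pr.cmax j * precision S A pr n k := by
  have hc := rewardCap_nonneg hp j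
  have hx0 : 0 ≤ precision S A pr n k := precision_nonneg pr k
  rcases hg.visit_cases hp hn hk s a with h1 | ⟨-, h1⟩
  · have h2 := (hg.ucb_mem hp k j s a).2
    have h3 := (hg.lcb_mem hp k j s a).1
    nlinarith
  · have h2 : rewardRadius pr h k s a ≤ 4 * precision S A pr n k := by
      refine (Real.sqrt_le_left (by positivity)).2 ?_
      rw [mul_div_assoc]
      calc _ ≤ 2 * (8 * precision S A pr n k ^ 2) := by
            refine mul_le_mul_of_nonneg_left h1 (by norm_num)
        _ = _ := by ring
    have h3 : ucb pr h k j s a ≤ empReward pr h k j s a +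
        rewardCap pr.cmax j * rewardRadius pr h k s a := min_le_right _ _
    have h4 : empReward pr h k j s a - rewardCap pr.cmax j * rewardRadius pr h k s a ≤
        lcb pr h k j s a := le_max_right _ _
    nlinarith [mul_le_mul_of_nonneg_left h2 hc]

/-- The deviations of the visits in the rounds `I` from what the policy `π` and the kernel `P`
predict. -/
noncomputable def deviation (P : S → A → S → ℝ) (st : ℕ → S) (ac : ℕ → A) (π : S → A → ℝ)
    (I : Finset ℕ) : ℝ :=
  open Classical in
  ∑ s, ∑ a, |∑ t ∈ I, ((if st t = s ∧ ac t = a then 1 else 0) - if st t = s then π s a else 0)| +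
    ∑ s, |∑ t ∈ I, ((if st (t + 1) = s then 1 else 0) - P (st t) (ac t) s)|

/-- The average payoff over a segment on which a fixed policy is used. -/
theorem abs_sum_sub_le_deviation (hP : IsMixing P pr.alpha) {π : S → A → ℝ} (hπ : IsPolicy π)
    (s₀ : S) {f : S → A → ℝ} {F : ℝ} (hf : ∀ s a, |f s a| ≤ F) (st : ℕ → S) (ac : ℕ → A)
    (a b : ℕ) :
    |∑ t ∈ Finset.Ico a b, f (st t) (ac t) - (Finset.Ico a b).card * avgPayoff P s₀ π f| ≤
      4 * (F / (pr.alpha * Fintype.card S)) * (1 + deviation P st ac π (Finset.Ico a b)) := by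
  classical
  obtain ⟨v, hv, hvH⟩ := exists_bias hP hπ s₀ hf
  set g := avgPayoff P s₀ π f with hg
  set H := F / (pr.alpha * Fintype.card S) with hH
  have hF : 0 ≤ F := (abs_nonneg _).trans (hf s₀ (Classical.arbitrary A))
  have hH0 : 0 ≤ H := by
    have := hP.mul_card_pos
    positivity
  have hFH : F ≤ H := by
    rw [hH, le_div_iff₀ hP.mul_card_pos]
    exact mul_le_of_le_one_right hF hP.mul_card_le_one
  have hgF : |g| ≤ F := abs_avgPayoff_le hP hπ s₀ hf
  -- the advantage function, which has mean zero under `π` in each state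
  set adv : S → A → ℝ := fun s a => f s a + ∑ s', P s a s' * v s' - v s - g with hadv
  have hadvH : ∀ s a, |adv s a| ≤ 4 * H := by
    intro s a
    have h1 := abs_sum_mul_le Finset.univ (P s a) v H (fun i _ => (hP.mem s a).1 i)
      fun i _ => hvH i
    rw [(hP.mem s a).2, one_mul] at h1
    have h2 := abs_le.1 (hf s a)
    have h3 := abs_le.1 (hvH s)
    have h4 := abs_le.1 hgF
    have h5 := abs_le.1 h1
    simp only [hadv]
    exact abs_le.2 ⟨by linarith, by linarith⟩
  have hadv0 : ∀ s, ∑ a, π s a * adv s a = 0 := by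
    intro s
    have h1 : ∀ a, π s a * adv s a =
        π s a * (f s a + ∑ s', P s a s' * v s') - π s a * (g + v s) := fun a => by
      simp only [hadv]; ring
    simp only [h1, Finset.sum_sub_distrib, ← Finset.sum_mul, (hπ s).2, one_mul]
    rw [hv s, sub_self]
  set I := Finset.Ico a b
  -- the deviation of the actions
  have e1 : ∑ t ∈ I, adv (st t) (ac t) = ∑ s, ∑ a, (∑ t ∈ I,
      ((if st t = s ∧ ac t = a then 1 else 0) - if st t = s then π s a else 0)) * adv s a := by
    simp only [Finset.sum_mul]
    simp only [Finset.sum_comm (s := Finset.univ) (t := I)]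
    refine Finset.sum_congr rfl fun t _ => ?_
    have h1 : ∀ s, ∑ a, ((if st t = s ∧ ac t = a then (1 : ℝ) else 0) -
        if st t = s then π s a else 0) * adv s a = if st t = s then adv s (ac t) else 0 := by
      intro s
      by_cases hs : st t = s
      · simp [hs, sub_mul, hadv0]
      · simp [hs]
    simp [h1]
  -- the deviation of the transitions
  have e2 : ∑ t ∈ I, (v (st (t + 1)) - ∑ s', P (st t) (ac t) s' * v s') = ∑ s, (∑ t ∈ I,
      ((if st (t + 1) = s then 1 else 0) - P (st t) (ac t) s)) * v s := by
    simp only [Finset.sum_mul]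
    rw [Finset.sum_comm]
    refine Finset.sum_congr rfl fun t _ => ?_
    simp [sub_mul]
  -- the telescoping part
  have e3 : |∑ t ∈ I, (v (st t) - v (st (t + 1)))| ≤ 2 * H := by
    rcases le_total b a with hab | hab
    · simp only [I, Finset.Ico_eq_empty_of_le hab, Finset.sum_empty, abs_zero]; positivity
    · have h1 : ∑ t ∈ I, (v (st t) - v (st (t + 1))) = v (st a) - v (st b) := by
        have := Finset.sum_Ico_sub (fun t => v (st t)) hab
        rw [← neg_inj, ← Finset.sum_neg_distrib]
        simp only [neg_sub]
        exact this
      rw [h1]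
      exact (abs_sub _ _).trans (by linarith [hvH (st a), hvH (st b)])
  have e4 : ∑ t ∈ I, f (st t) (ac t) - I.card * g = ∑ t ∈ I, adv (st t) (ac t) +
      ∑ t ∈ I, (v (st (t + 1)) - ∑ s', P (st t) (ac t) s' * v s') +
      ∑ t ∈ I, (v (st t) - v (st (t + 1))) := by
    rw [← Finset.sum_add_distrib, ← Finset.sum_add_distrib, ← nsmul_eq_mul, ← Finset.sum_const,
      ← Finset.sum_sub_distrib]
    refine Finset.sum_congr rfl fun t _ => ?_
    simp only [hadv]
    ring
  rw [e4, e1, e2]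
  unfold deviation
  refine (abs_add_three _ _ _).trans ?_
  have b1 : |∑ s, ∑ a, (∑ t ∈ I,
      ((if st t = s ∧ ac t = a then (1 : ℝ) else 0) - if st t = s then π s a else 0)) * adv s a| ≤
      ∑ s, ∑ a, |∑ t ∈ I,
      ((if st t = s ∧ ac t = a then (1 : ℝ) else 0) - if st t = s then π s a else 0)| * (4 * H) := by
    refine (Finset.abs_sum_le_sum_abs _ _).trans (Finset.sum_le_sum fun s _ => ?_)
    refine (Finset.abs_sum_le_sum_abs _ _).trans (Finset.sum_le_sum fun a _ => ?_)
    rw [abs_mul]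
    exact mul_le_mul_of_nonneg_left (hadvH s a) (abs_nonneg _)
  have b2 : |∑ s, (∑ t ∈ I, ((if st (t + 1) = s then (1 : ℝ) else 0) - P (st t) (ac t) s)) * v s| ≤
      ∑ s, |∑ t ∈ I, ((if st (t + 1) = s then (1 : ℝ) else 0) - P (st t) (ac t) s)| * (4 * H) := by
    refine (Finset.abs_sum_le_sum_abs _ _).trans (Finset.sum_le_sum fun s _ => ?_)
    rw [abs_mul]
    exact mul_le_mul_of_nonneg_left ((hvH s).trans (by linarith)) (abs_nonneg _)
  simp only [← Finset.sum_mul] at b1 b2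
  linarith

end Path

/-! ### The compensated processes of an online auction -/

section Runs

variable {Ω : Type*} [mΩ : MeasurableSpace Ω] {μ : Measure Ω} [IsProbabilityMeasure μ]

/-- Multiplication by a predictable weight, such as the indicator of a visit to `(s, a)`, preserves
the compensator relation. -/
theorem IsCompensated.gate {F : ℕ → MeasurableSpace Ω} {Z p g : ℕ → Ω → ℝ}
    (h : IsCompensated μ F Z p) (hg : ∀ t ≥ 1, Measurable[F t] (g t))
    (hg01 : ∀ t ≥ 1, ∀ ω, g t ω ∈ Set.Icc (0 : ℝ) 1) :
    IsCompensated μ F (fun t ω => g t ω * Z t ω) (fun t ω => g t ω * p t ω) where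
  mono := h.mono
  le := h.le
  meas t ht := ((hg t ht).mono (h.mono t ht) le_rfl).mul (h.meas t ht)
  meas_comp t ht := (hg t ht).mul (h.meas_comp t ht)
  mem t ht := by
    filter_upwards [h.mem t ht] with ω hω
    exact ⟨mul_nonneg (hg01 t ht ω).1 hω.1, mul_le_one₀ (hg01 t ht ω).2 hω.1 hω.2⟩
  comp_mem t ht ω := ⟨mul_nonneg (hg01 t ht ω).1 (h.comp_mem t ht ω).1,
    mul_le_one₀ (hg01 t ht ω).2 (h.comp_mem t ht ω).1 (h.comp_mem t ht ω).2⟩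
  condExp t ht := by
    have hint : Integrable (g t * Z t) μ :=
      (h.integrable ht).bdd_mul (c := 1) ((hg t ht).mono (h.le t ht) le_rfl).aestronglyMeasurable
        (Eventually.of_forall fun ω => by
          rw [Real.norm_eq_abs, abs_of_nonneg (hg01 t ht ω).1]; exact (hg01 t ht ω).2)
    have h1 := condExp_mul_of_stronglyMeasurable_left (μ := μ) (hg t ht).stronglyMeasurable hint
      (h.integrable ht)
    filter_upwards [h1, h.condExp t ht] with ω h1 h2
    have h3 : (fun ω => g t ω * Z t ω) = g t * Z t := rfl
    rw [h3, h1, Pi.mul_apply, h2]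

variable {S A : Type*} [Fintype S] [Fintype A]

theorem measurable_eval_pair {m : MeasurableSpace Ω} {st : Ω → S} {ac : Ω → A}
    (hst : ∀ s, MeasurableSet[m] {ω | st ω = s}) (hac : ∀ a, MeasurableSet[m] {ω | ac ω = a})
    {f : Ω → S → A → ℝ} (hf : ∀ s a, Measurable[m] fun ω => f ω s a) :
    Measurable[m] fun ω => f ω (st ω) (ac ω) := by
  classical
  have h1 : (fun ω => f ω (st ω) (ac ω)) =
      fun ω => ∑ s, ∑ a, if st ω = s ∧ ac ω = a then f ω s a else 0 := by
    funext ω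
    simp [ite_and]
  rw [h1]
  refine Finset.measurable_fun_sum _ fun s _ => Finset.measurable_fun_sum _ fun a _ => ?_
  exact Measurable.ite ((hst s).inter (hac a)) (hf s a) measurable_const

theorem measurable_eval_state {m : MeasurableSpace Ω} {st : Ω → S}
    (hst : ∀ s, MeasurableSet[m] {ω | st ω = s}) {f : Ω → S → ℝ}
    (hf : ∀ s, Measurable[m] fun ω => f ω s) : Measurable[m] fun ω => f ω (st ω) := by
  classical
  have h1 : (fun ω => f ω (st ω)) = fun ω => ∑ s, if st ω = s then f ω s else 0 := by
    funext ω
    simp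
  rw [h1]
  exact Finset.measurable_fun_sum _ fun s _ => Measurable.ite (hst s) (hf s) measurable_const

theorem ae_mem_of_real_eq_one {β : Type*} [MeasurableSpace β] {ν : Measure β}
    [IsProbabilityMeasure ν] {E : Set β} (hE : MeasurableSet E) :
    ν.real E = 1 ↔ ∀ᵐ x ∂ν, x ∈ E := by
  have h : ν.real E = 1 ↔ ν E = 1 := by
    rw [measureReal_def, ENNReal.toReal_eq_one_iff]
  rw [h]
  exact (mem_ae_iff_prob_eq_one hE).symm

/-- A bounded random variable whose conditional law is `κ (st, ac)` has the mean of this law as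
its conditional expectation. -/
theorem condExp_of_condLaw {Ω : Type*} {m mΩ : MeasurableSpace Ω} {μ : Measure Ω}
    [IsProbabilityMeasure μ] (hm : m ≤ mΩ) {st : Ω → S} {ac : Ω → A}
    (hst : ∀ s, MeasurableSet[m] {ω | st ω = s}) (hac : ∀ a, MeasurableSet[m] {ω | ac ω = a})
    {Y : Ω → ℝ} (hY : Measurable Y) {c : ℝ} (hYc : ∀ᵐ ω ∂μ, |Y ω| ≤ c)
    {κ : S → A → Measure ℝ} (hκ : ∀ s a, IsProbabilityMeasure (κ s a))
    (hlaw : ∀ E : Set ℝ, MeasurableSet E →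
      μ⟦{ω | Y ω ∈ E} | m⟧ =ᵐ[μ] fun ω => (κ (st ω) (ac ω)).real E) :
    μ[Y | m] =ᵐ[μ] fun ω => ∫ x, x ∂(κ (st ω) (ac ω)) := by
  classical
  have hYint : Integrable Y μ := integrable_of_bounded hY hYc
  have hmean : Measurable[m] fun ω => ∫ x, x ∂(κ (st ω) (ac ω)) :=
    measurable_eval_pair (f := fun _ s a => ∫ x, x ∂(κ s a)) hst hac fun _ _ => measurable_const
  have hmeanint : Integrable (fun ω => ∫ x, x ∂(κ (st ω) (ac ω))) μ := by
    refine integrable_of_bounded (C := ∑ s, ∑ a, |∫ x, x ∂(κ s a)|) (hmean.mono hm le_rfl)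
      (Eventually.of_forall fun ω => ?_)
    exact (Finset.single_le_sum (f := fun a => |∫ x, x ∂(κ (st ω) a)|) (fun _ _ => abs_nonneg _)
        (Finset.mem_univ (ac ω))).trans
      (Finset.single_le_sum (f := fun s => ∑ a, |∫ x, x ∂(κ s a)|)
        (fun _ _ => Finset.sum_nonneg fun _ _ => abs_nonneg _) (Finset.mem_univ (st ω)))
  -- on a set `G` of the past on which the state and the action are constant
  have hcell : ∀ s a (G : Set Ω), MeasurableSet[m] G → G ⊆ {ω | st ω = s ∧ ac ω = a} →
      ∫ ω in G, Y ω ∂μ = μ.real G * ∫ x, x ∂(κ s a) := by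
    intro s a G hG hsub
    have hmap : (μ.restrict G).map Y = μ G • κ s a := by
      ext E hE
      rw [Measure.map_apply hY hE, Measure.restrict_apply (hY hE), Measure.smul_apply,
        smul_eq_mul]
      have h1 : ∫ ω in G, (μ⟦{ω | Y ω ∈ E} | m⟧) ω ∂μ =
          ∫ ω in G, ({ω | Y ω ∈ E}.indicator fun _ => (1 : ℝ)) ω ∂μ :=
        setIntegral_condExp hm ((integrable_const 1).indicator (hY hE)) hG
      have h2 : ∫ ω in G, (μ⟦{ω | Y ω ∈ E} | m⟧) ω ∂μ = ∫ ω in G, (κ s a).real E ∂μ := by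
        refine setIntegral_congr_ae (hm _ hG) ?_
        filter_upwards [hlaw E hE] with ω hω hωG
        rw [hω, (hsub hωG).1, (hsub hωG).2]
      have h3 : ∫ ω in G, ({ω | Y ω ∈ E}.indicator fun _ => (1 : ℝ)) ω ∂μ =
          μ.real (Y ⁻¹' E ∩ G) := by
        have hE' : MeasurableSet {ω | Y ω ∈ E} := hY hE
        rw [integral_indicator_const _ hE', smul_eq_mul, mul_one, measureReal_restrict_apply hE']
        rfl
      rw [h2, h3, integral_const, measureReal_restrict_apply_univ, smul_eq_mul] at h1
      rw [← ENNReal.toReal_eq_toReal_iff' (measure_ne_top _ _)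
        (ENNReal.mul_ne_top (measure_ne_top _ _) (measure_ne_top _ _)), ENNReal.toReal_mul]
      exact h1.symm
    have h4 : ∫ ω in G, Y ω ∂μ = ∫ x, x ∂((μ.restrict G).map Y) :=
      (integral_map hY.aemeasurable aestronglyMeasurable_id).symm
    rw [h4, hmap, integral_smul_measure]
    rfl
  refine (ae_eq_condExp_of_forall_setIntegral_eq hm hYint
    (fun _ _ _ => hmeanint.integrableOn) (fun G hG _ => ?_) hmean.aestronglyMeasurable).symm
  -- the cells partition `G`
  have hpart : ∀ f : Ω → ℝ, Integrable f μ → ∫ ω in G, f ω ∂μ =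
      ∑ s, ∑ a, ∫ ω in G ∩ ({ω | st ω = s} ∩ {ω | ac ω = a}), f ω ∂μ := by
    intro f hf
    have h1 : f = fun ω => ∑ s, ∑ a, ({ω | st ω = s} ∩ {ω | ac ω = a}).indicator f ω := by
      funext ω
      simp [Set.indicator_apply, ite_and]
    have hms : ∀ s a, MeasurableSet ({ω | st ω = s} ∩ {ω | ac ω = a}) := fun s a =>
      hm _ ((hst s).inter (hac a))
    have h2 : ∀ s a, Integrable (({ω | st ω = s} ∩ {ω | ac ω = a}).indicator f)
        (μ.restrict G) := fun s a => hf.integrableOn.indicator (hms s a)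
    conv_lhs => rw [h1]
    rw [integral_finsetSum _ fun s _ => integrable_finsetSum _ fun a _ => h2 s a]
    refine Finset.sum_congr rfl fun s _ => ?_
    rw [integral_finsetSum _ fun a _ => h2 s a]
    exact Finset.sum_congr rfl fun a _ => setIntegral_indicator (hms s a)
  rw [hpart _ hmeanint, hpart _ hYint]
  refine Finset.sum_congr rfl fun s _ => Finset.sum_congr rfl fun a _ => ?_
  have hG' : MeasurableSet[m] (G ∩ ({ω | st ω = s} ∩ {ω | ac ω = a})) :=
    MeasurableSet.inter hG (MeasurableSet.inter (hst s) (hac a))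
  rw [hcell s a _ hG' fun ω hω => hω.2]
  rw [setIntegral_congr_fun (g := fun _ => ∫ x, x ∂(κ s a)) (hm _ hG') fun ω hω => ?_]
  · rw [integral_const, measureReal_restrict_apply_univ, smul_eq_mul]
  · have h5 : st ω = s := hω.2.1
    have h6 : ac ω = a := hω.2.2
    simp only [h5, h6]

variable {n : ℕ} {cmax : ℝ} {M : AuctionMDP S A n cmax} {X : OnlineProcess S A n Ω}

theorem IsOnlineAuction.pre_mono (hX : IsOnlineAuction M μ X) (t : ℕ) : X.pre t ≤ X.pre (t + 1) :=
  (hX.pre_le_mid t).trans ((hX.mid_le_post t).trans (hX.post_le_pre t))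

theorem IsOnlineAuction.mid_mono (hX : IsOnlineAuction M μ X) (t : ℕ) : X.mid t ≤ X.mid (t + 1) :=
  (hX.mid_le_post t).trans ((hX.post_le_pre t).trans (hX.pre_le_mid (t + 1)))

theorem IsOnlineAuction.post_mono (hX : IsOnlineAuction M μ X) (t : ℕ) :
    X.post t ≤ X.post (t + 1) :=
  (hX.post_le_pre t).trans ((hX.pre_le_mid (t + 1)).trans (hX.mid_le_post (t + 1)))

theorem IsOnlineAuction.mid_le (hX : IsOnlineAuction M μ X) (t : ℕ) : X.mid t ≤ mΩ :=
  (hX.mid_le_post t).trans (hX.post_le t)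

theorem IsOnlineAuction.pre_le (hX : IsOnlineAuction M μ X) (t : ℕ) : X.pre t ≤ mΩ :=
  (hX.pre_le_mid t).trans (hX.mid_le t)

theorem IsOnlineAuction.state_mid (hX : IsOnlineAuction M μ X) {t : ℕ} (ht : 1 ≤ t) (s : S) :
    MeasurableSet[X.mid t] {ω | X.state t ω = s} :=
  hX.pre_le_mid t _ (hX.state_meas t ht s)

open Classical in
theorem IsOnlineAuction.isCompensated_next (hX : IsOnlineAuction M μ X) (s' : S) :
    IsCompensated μ X.post (fun t ω => if X.state (t + 1) ω = s' then 1 else 0)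
      (fun t ω => M.trans (X.state t ω) (X.action t ω) s') where
  mono t _ := hX.post_mono t
  le t _ := hX.post_le t
  meas t ht := Measurable.ite
    (hX.mid_le_post _ _ (hX.state_mid (by omega) s')) measurable_const measurable_const
  meas_comp t ht := measurable_eval_pair (f := fun _ s a => M.trans s a s')
    (fun s => hX.mid_le_post t _ (hX.state_mid ht s))
    (fun a => hX.mid_le_post t _ (hX.action_meas t ht a)) fun _ _ => measurable_const
  mem t _ := Eventually.of_forall fun ω => by split_ifs <;> simp
  comp_mem t _ ω := ⟨(M.trans_mem _ _).1 s', by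
    rw [← (M.trans_mem (X.state t ω) (X.action t ω)).2]
    exact Finset.single_le_sum (fun i _ => (M.trans_mem _ _).1 i) (Finset.mem_univ s')⟩
  condExp t ht := by
    have h := hX.state_law t ht s'
    have h2 : (fun ω => if X.state (t + 1) ω = s' then (1 : ℝ) else 0) =
        {ω | X.state (t + 1) ω = s'}.indicator fun _ => 1 := by
      funext ω; simp [Set.indicator_apply]
    rw [h2]
    exact h

variable [Nonempty S] [Nonempty A] {pr : Params}

theorem alloc_meas_episode (hX : IsOnlineAuction M μ X) (hf : FollowsIHMDPVCG pr μ X)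
    (hp : Admissible S A pr) {t : ℕ} (ht : 1 ≤ t) (s : S) (a : A) :
    Measurable[X.pre t] fun ω => X.alloc (episode S A pr t) ω s a := by
  obtain ⟨h1, h2⟩ := hp.episode_spec ht
  refine (hf.alloc_meas _ h1 s a).mono ?_ le_rfl
  exact monotone_nat_of_le_succ hX.pre_mono (Finset.mem_Ico.1 h2).1

open Classical in
theorem isCompensated_action (hX : IsOnlineAuction M μ X) (hf : FollowsIHMDPVCG pr μ X)
    (hp : Admissible S A pr) (a : A) :
    IsCompensated μ X.pre (fun t ω => if X.action t ω = a then 1 else 0)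
      (fun t ω => X.alloc (episode S A pr t) ω (X.state t ω) a) where
  mono t _ := hX.pre_mono t
  le t _ := hX.pre_le t
  meas t ht := Measurable.ite
    (((hX.mid_le_post t).trans (hX.post_le_pre t)) _ (hX.action_meas t ht a))
    measurable_const measurable_const
  meas_comp t ht := measurable_eval_state (f := fun ω s => X.alloc (episode S A pr t) ω s a)
    (hX.state_meas t ht) fun s => alloc_meas_episode hX hf hp ht s a
  mem t _ := Eventually.of_forall fun ω => by split_ifs <;> simp
  comp_mem t ht ω := by
    have h := (hf.alloc_induced _ (hp.episode_spec ht).1 ω).1 (X.state t ω)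
    refine ⟨h.1 a, ?_⟩
    rw [← h.2]
    exact Finset.single_le_sum (fun i _ => h.1 i) (Finset.mem_univ a)
  condExp t ht := by
    obtain ⟨h1, h3⟩ := hp.episode_spec ht
    have h := hf.action_law _ h1 t h3 a
    have h2 : (fun ω => if X.action t ω = a then (1 : ℝ) else 0) =
        {ω | X.action t ω = a}.indicator fun _ => 1 := by
      funext ω; simp [Set.indicator_apply]
    rw [h2]
    exact h

/-- In each round, `Y t ∈ [0, c]` is revealed together with the rewards, and its conditional mean
is `m (s, a)`. -/
structure HasMean (μ : Measure Ω) (X : OnlineProcess S A n Ω) (Y : ℕ → Ω → ℝ) (c : ℝ)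
    (m : S → A → ℝ) : Prop where
  nonneg : 0 ≤ c
  meas : ∀ t ≥ 1, Measurable[X.post t] (Y t)
  mem : ∀ t ≥ 1, ∀ᵐ ω ∂μ, Y t ω ∈ Set.Icc 0 c
  mean_mem : ∀ s a, m s a ∈ Set.Icc 0 c
  condExp : ∀ t ≥ 1, μ[Y t | X.mid t] =ᵐ[μ] fun ω => m (X.state t ω) (X.action t ω)

theorem HasMean.isCompensated {Y : ℕ → Ω → ℝ} {c : ℝ} {m : S → A → ℝ} (h : HasMean μ X Y c m)
    (hX : IsOnlineAuction M μ X) :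
    IsCompensated μ X.mid (fun t ω => c⁻¹ * Y t ω)
      (fun t ω => c⁻¹ * m (X.state t ω) (X.action t ω)) where
  mono t _ := hX.mid_mono t
  le t _ := hX.mid_le t
  meas t ht := ((h.meas t ht).mono ((hX.post_le_pre t).trans (hX.pre_le_mid _)) le_rfl).const_mul _
  meas_comp t ht := (measurable_eval_pair (f := fun _ s a => m s a) (hX.state_mid ht)
    (hX.action_meas t ht) fun _ _ => measurable_const).const_mul _
  mem t ht := by
    filter_upwards [h.mem t ht] with ω hω
    refine ⟨mul_nonneg (inv_nonneg.2 h.nonneg) hω.1, ?_⟩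
    rw [mul_comm, ← div_eq_mul_inv]
    exact div_le_one_of_le₀ hω.2 h.nonneg
  comp_mem t ht ω := by
    have hω := h.mean_mem (X.state t ω) (X.action t ω)
    refine ⟨mul_nonneg (inv_nonneg.2 h.nonneg) hω.1, ?_⟩
    rw [mul_comm, ← div_eq_mul_inv]
    exact div_le_one_of_le₀ hω.2 h.nonneg
  condExp t ht := by
    have h1 := condExp_smul (μ := μ) c⁻¹ (Y t) (X.mid t)
    have h2 : (fun ω => c⁻¹ * Y t ω) = c⁻¹ • Y t := rfl
    rw [h2]
    filter_upwards [h1, h.condExp t ht] with ω h1 h2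
    rw [h1, Pi.smul_apply, h2, smul_eq_mul]

theorem rewardCap_nonneg' (hc : 0 ≤ cmax) (j : Fin (n + 1)) : 0 ≤ rewardCap cmax j := by
  unfold rewardCap; split_ifs
  · exact hc
  · norm_num

theorem AuctionMDP.reward_mem (M : AuctionMDP S A n cmax) (j : Fin (n + 1))
    (s : S) (a : A) : M.reward j s a ∈ Set.Icc 0 (rewardCap cmax j) := by
  have := M.rewardLaw_prob j s a
  have hs := M.rewardLaw_supp j s a
  constructor
  · exact integral_nonneg_of_ae (by filter_upwards [hs] with x hx using hx.1)
  · have hint : Integrable (fun x : ℝ => x) (M.rewardLaw j s a) := by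
      refine integrable_of_bounded (C := rewardCap cmax j) measurable_id ?_
      filter_upwards [hs] with x hx
      rw [abs_of_nonneg hx.1]; exact hx.2
    calc M.reward j s a ≤ ∫ _, rewardCap cmax j ∂(M.rewardLaw j s a) :=
          integral_mono_ae hint (integrable_const _) (by filter_upwards [hs] with x hx using hx.2)
      _ = _ := by simp

theorem IsOnlineAuction.reward_marginal (hX : IsOnlineAuction M μ X) {t : ℕ} (ht : 1 ≤ t)
    (j : Fin (n + 1)) {E : Set ℝ} (hE : MeasurableSet E) :
    μ⟦{ω | X.reward t j ω ∈ E} | X.mid t⟧ =ᵐ[μ]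
      fun ω => (M.rewardLaw j (X.state t ω) (X.action t ω)).real E := by
  have h := hX.reward_law t ht ((fun x => x j) ⁻¹' E) (measurable_pi_apply j hE)
  filter_upwards [h] with ω hω
  have := fun i => M.rewardLaw_prob i (X.state t ω) (X.action t ω)
  have h1 := (measurePreserving_eval
    (fun i => M.rewardLaw i (X.state t ω) (X.action t ω)) j).measure_preimage hE.nullMeasurableSet
  have h2 : (Measure.pi fun i => M.rewardLaw i (X.state t ω) (X.action t ω)).real
      ((fun x => x j) ⁻¹' E) = (M.rewardLaw j (X.state t ω) (X.action t ω)).real E :=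
    congrArg ENNReal.toReal h1
  rw [← h2, ← hω]
  rfl

theorem IsOnlineAuction.reward_mem (hX : IsOnlineAuction M μ X) {t : ℕ} (ht : 1 ≤ t)
    (j : Fin (n + 1)) : ∀ᵐ ω ∂μ, X.reward t j ω ∈ Set.Icc 0 (rewardCap cmax j) := by
  have h := hX.reward_marginal ht j (measurableSet_Icc (a := 0) (b := rewardCap cmax j))
  have hmeas : MeasurableSet {ω | X.reward t j ω ∈ Set.Icc 0 (rewardCap cmax j)} :=
    ((hX.reward_meas t ht j).mono (hX.post_le t) le_rfl) measurableSet_Icc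
  have h1 : (fun ω => (M.rewardLaw j (X.state t ω) (X.action t ω)).real
      (Set.Icc 0 (rewardCap cmax j))) = fun _ => 1 := by
    funext ω
    have := M.rewardLaw_prob j (X.state t ω) (X.action t ω)
    rw [ae_mem_of_real_eq_one measurableSet_Icc]
    exact M.rewardLaw_supp j _ _
  rw [h1] at h
  have h2 := integral_congr_ae h
  rw [integral_condExp (hX.mid_le t), integral_indicator_const _ hmeas] at h2
  simp only [smul_eq_mul, mul_one, integral_const, probReal_univ] at h2
  rw [ae_mem_of_real_eq_one hmeas] at h2
  exact h2

theorem IsOnlineAuction.hasMean_reward (hX : IsOnlineAuction M μ X) (hc : 0 ≤ cmax)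
    (j : Fin (n + 1)) :
    HasMean μ X (fun t ω => X.reward t j ω) (rewardCap cmax j) (M.reward j) where
  nonneg := rewardCap_nonneg' hc j
  meas t ht := hX.reward_meas t ht j
  mem t ht := hX.reward_mem ht j
  mean_mem s a := M.reward_mem j s a
  condExp t ht := by
    refine condExp_of_condLaw (c := rewardCap cmax j) (hX.mid_le t) (hX.state_mid ht)
      (hX.action_meas t ht) ((hX.reward_meas t ht j).mono (hX.post_le t) le_rfl) ?_
      (M.rewardLaw_prob j) fun E hE => hX.reward_marginal ht j hE
    filter_upwards [hX.reward_mem ht j] with ω hω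
    rw [abs_of_nonneg hω.1]; exact hω.2

/-- The report of player `j` in round `t`. -/
def report (X : OnlineProcess S A n Ω) (j : Fin (n + 1)) (t : ℕ) (ω : Ω) : ℝ :=
  (X.obs ω).report t j

theorem report_succ (i : Fin n) (t : ℕ) (ω : Ω) : report X i.succ t ω = X.bid t i ω := rfl

theorem IsOnlineAuction.report_meas (hX : IsOnlineAuction M μ X) {t : ℕ} (ht : 1 ≤ t)
    (j : Fin (n + 1)) : Measurable[X.post t] (report X j t) := by
  induction j using Fin.cases with
  | zero => exact hX.reward_meas t ht 0
  | succ i => exact hX.bid_meas t ht i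

theorem IsOnlineAuction.report_mem (hX : IsOnlineAuction M μ X) {t : ℕ} (ht : 1 ≤ t)
    (j : Fin (n + 1)) : ∀ᵐ ω ∂μ, report X j t ω ∈ Set.Icc 0 (rewardCap cmax j) := by
  induction j using Fin.cases with
  | zero => exact hX.reward_mem ht 0
  | succ i =>
    filter_upwards [hX.bid_mem t ht i] with ω hω
    simpa [report_succ, rewardCap] using hω

theorem IsOnlineAuction.hasMean_report_zero (hX : IsOnlineAuction M μ X) (hc : 0 ≤ cmax) :
    HasMean μ X (report X 0) (rewardCap cmax (0 : Fin (n + 1))) (M.reward 0) :=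
  hX.hasMean_reward hc 0

theorem IsOnlineAuction.hasMean_report_truthful (hX : IsOnlineAuction M μ X) (hc : 0 ≤ cmax)
    {i : Fin n} (hi : IsTruthful X i) :
    HasMean μ X (report X i.succ) (rewardCap cmax i.succ) (M.reward i.succ) := by
  have h := hX.hasMean_reward hc i.succ
  have he : ∀ t ≥ 1, report X i.succ t = X.reward t i.succ := fun t ht => funext fun ω => hi t ht ω
  refine ⟨h.nonneg, fun t ht => ?_, fun t ht => ?_, h.mean_mem, fun t ht => ?_⟩
  · rw [he t ht]; exact h.meas t ht
  · rw [he t ht]; exact h.mem t ht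
  · rw [he t ht]; exact h.condExp t ht

theorem IsOnlineAuction.law_mem_of_stationary (hX : IsOnlineAuction M μ X) {i : Fin n}
    {B : S → A → Measure ℝ} (hB : ∀ s a, IsProbabilityMeasure (B s a))
    (hi : IsStationaryBidder μ X i B) {t : ℕ} (ht : 1 ≤ t) :
    ∀ᵐ ω ∂μ, ∀ᵐ x ∂(B (X.state t ω) (X.action t ω)), x ∈ Set.Icc (0 : ℝ) 1 := by
  have h := hi t ht (Set.Icc 0 1) measurableSet_Icc
  have hbid := hX.bid_mem t ht i
  have hone : ({ω | X.bid t i ω ∈ Set.Icc (0 : ℝ) 1}.indicator fun _ => (1 : ℝ)) =ᵐ[μ]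
      fun _ => 1 := by
    filter_upwards [hbid] with ω hω
    exact Set.indicator_of_mem (s := {ω | X.bid t i ω ∈ Set.Icc (0 : ℝ) 1}) hω _
  have h1 := condExp_congr_ae (m := X.mid t) hone
  rw [condExp_const (hX.mid_le t)] at h1
  filter_upwards [h, h1] with ω h2 h3
  rw [h3] at h2
  have := hB (X.state t ω) (X.action t ω)
  exact (ae_mem_of_real_eq_one measurableSet_Icc).1 h2.symm

/-- The mean bid of a stationary bidder, truncated to `[0, 1]` to be harmless in the state-action
pairs that are never visited. -/
noncomputable def meanBid (B : S → A → Measure ℝ) (s : S) (a : A) : ℝ :=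
  max 0 (min 1 (∫ x, x ∂(B s a)))

theorem IsOnlineAuction.hasMean_report_stationary (hX : IsOnlineAuction M μ X) {i : Fin n}
    {B : S → A → Measure ℝ} (hB : ∀ s a, IsProbabilityMeasure (B s a))
    (hi : IsStationaryBidder μ X i B) :
    HasMean μ X (report X i.succ) (rewardCap cmax i.succ) (meanBid B) where
  nonneg := by simp [rewardCap]
  meas t ht := hX.report_meas ht _
  mem t ht := hX.report_mem ht _
  mean_mem s a := by
    simp only [rewardCap, Fin.succ_ne_zero, if_false, meanBid]
    exact ⟨le_max_left _ _, max_le zero_le_one (min_le_left _ _)⟩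
  condExp t ht := by
    have h1 := condExp_of_condLaw (c := 1) (hX.mid_le t) (hX.state_mid ht)
      (hX.action_meas t ht) ((hX.bid_meas t ht i).mono (hX.post_le t) le_rfl)
      (by filter_upwards [hX.bid_mem t ht i] with ω hω
          rw [abs_of_nonneg hω.1]; exact hω.2) hB fun E hE => hi t ht E hE
    filter_upwards [h1, hX.law_mem_of_stationary hB hi ht] with ω h2 h3
    have := hB (X.state t ω) (X.action t ω)
    have h4 : 0 ≤ ∫ x, x ∂(B (X.state t ω) (X.action t ω)) :=
      integral_nonneg_of_ae (by filter_upwards [h3] with x hx using hx.1)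
    have h5 : ∫ x, x ∂(B (X.state t ω) (X.action t ω)) ≤ 1 := by
      have hint : Integrable (fun x : ℝ => x) (B (X.state t ω) (X.action t ω)) := by
        refine integrable_of_bounded (C := 1) measurable_id ?_
        filter_upwards [h3] with x hx
        rw [abs_of_nonneg hx.1]; exact hx.2
      calc _ ≤ ∫ _, (1 : ℝ) ∂(B (X.state t ω) (X.action t ω)) :=
            integral_mono_ae hint (integrable_const _) (by filter_upwards [h3] with x hx using hx.2)
        _ = _ := by simp
    rw [meanBid, min_eq_right h5, max_eq_right h4]
    exact h2

end Runs

/-! ### The probability of the good sample paths -/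

section GoodEvent

/-- Inversion of `N P - X ≤ 2 √(L N P)` into a bound with the empirical frequency `X / N` under the
square root. -/
theorem sub_div_le_of_sub_le_two_mul_sqrt {N X P L : ℝ} (hN : N = 0 ∨ 1 ≤ N) (hX : 0 ≤ X)
    (hP : P ∈ Set.Icc (0 : ℝ) 1) (hL : 1 ≤ L)
    (h : 1 ≤ N * P → N * P - X ≤ 2 * √(L * (N * P))) :
    P - X / max 1 N ≤
      2 * √(X / max 1 N * L / max 1 (N - 1)) + 14 * L / (3 * max 1 (N - 1)) := by
  have hs0 := Real.sqrt_nonneg (X / max 1 N * L / max 1 (N - 1))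
  have hM1 : 1 ≤ max 1 (N - 1) := le_max_left _ _
  rcases hN with rfl | hN
  · have h0 : (0 : ℝ) ≤ X / max 1 0 := by positivity
    have h1 : max (1 : ℝ) (0 - 1) = 1 := max_eq_left (by norm_num)
    rw [h1] at hs0 ⊢
    linarith [hP.2]
  have hMN : max 1 (N - 1) ≤ N := max_le hN (by linarith)
  rw [max_eq_right hN] at hs0 ⊢
  have hN0 : 0 < N := by linarith
  have hM0 : 0 < max 1 (N - 1) := by linarith
  have hXN : 0 ≤ X / N := by positivity
  by_cases hV : 1 ≤ N * P
  -- with `x = √(N P)` and `l = √L`, solve the quadratic inequality `x² - 2 l x ≤ X`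
  · have h1 := h hV
    set x := √(N * P) with hx
    have hx2 : x ^ 2 = N * P := Real.sq_sqrt (by linarith)
    have hx0 : 0 ≤ x := Real.sqrt_nonneg _
    set l := √L with hl
    have hl2 : l ^ 2 = L := Real.sq_sqrt (by linarith)
    have hl0 : 0 ≤ l := Real.sqrt_nonneg _
    rw [Real.sqrt_mul (by linarith), ← hl, ← hx, ← hx2] at h1
    set y := √X with hy
    have hy2 : y ^ 2 = X := Real.sq_sqrt hX
    have hy0 : 0 ≤ y := Real.sqrt_nonneg _
    have h2 : x ≤ 2 * l + y := by
      by_contra hcon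
      push Not at hcon
      nlinarith [mul_nonneg hl0 hy0]
    have h3 : N * P ≤ X + 4 * L + 2 * (l * y) := by
      rw [← hx2, ← hy2, ← hl2]
      rw [← hy2] at h1
      nlinarith
    have h4 : P ≤ (X + 4 * L + 2 * (l * y)) / N := by
      rw [le_div_iff₀ hN0]; linarith
    have h5 : (l * y) / N ≤ √(X / N * L / max 1 (N - 1)) := by
      apply Real.le_sqrt_of_sq_le
      have : (l * y / N) ^ 2 = X / N * L / N := by
        rw [div_pow, mul_pow, hl2, hy2]; field_simp
      rw [this]
      exact div_le_div_of_nonneg_left (by positivity) hM0 hMN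
    have h6 : 4 * L / N ≤ 14 * L / (3 * max 1 (N - 1)) := by
      rw [div_le_div_iff₀ hN0 (by positivity)]
      nlinarith
    have h7 : (X + 4 * L + 2 * (l * y)) / N = X / N + 4 * L / N + 2 * (l * y / N) := by
      field_simp
    linarith
  -- if `N P < 1`, the linear term of the radius exceeds `P`
  · push Not at hV
    have h1 : P ≤ 1 / max 1 (N - 1) := by
      rw [le_div_iff₀ hM0]
      nlinarith [hP.1]
    have h2 : 1 / max 1 (N - 1) ≤ 14 * L / (3 * max 1 (N - 1)) := by
      rw [div_le_div_iff₀ hM0 (by positivity)]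
      nlinarith
    linarith

/-- Hoeffding's bound for the sum `X` of `N` samples in `[0, c]` with mean `m`, as a bound for the
empirical mean. -/
theorem abs_sub_div_le_of_abs_le_sqrt {N X c m L : ℝ}
    (hm : m ∈ Set.Icc 0 c) (hX : X ∈ Set.Icc 0 (c * N)) (hL : 4 ≤ L)
    (h : 1 ≤ N / 4 → |N * m - X| ≤ c * (2 * √(L * (N / 4)))) :
    |m - X / max 1 N| ≤ c * √(2 * L / max 1 N) := by
  have hc : 0 ≤ c := hm.1.trans hm.2
  have hmain : ∀ {x : ℝ}, 1 ≤ x → |m - X / max 1 N| ≤ c → |m - X / max 1 N| ≤ c * x := by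
    intro x hx h
    nlinarith
  have hM : 0 < max 1 N := lt_of_lt_of_le one_pos (le_max_left _ _)
  have habs : |m - X / max 1 N| ≤ c := by
    have h1 : X / max 1 N ≤ c := by
      rw [div_le_iff₀ hM]
      exact hX.2.trans (mul_le_mul_of_nonneg_left (le_max_right _ _) hc)
    have h2 : 0 ≤ X / max 1 N := div_nonneg hX.1 hM.le
    rw [abs_le]; constructor <;> linarith [hm.1, hm.2]
  by_cases hV : 1 ≤ N / 4
  · have hN1 : 1 ≤ N := by linarith
    have hN0 : 0 < N := by linarith
    rw [max_eq_right hN1]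
    have h1 := h hV
    have h2 : m - X / N = (N * m - X) / N := by field_simp
    rw [h2, abs_div, abs_of_pos hN0, div_le_iff₀ hN0, mul_assoc]
    refine h1.trans (mul_le_mul_of_nonneg_left ?_ hc)
    have h3 : √(2 * L / N) * N = √(2 * L * N) := by
      rw [show 2 * L * N = (2 * L / N) * N ^ 2 by field_simp, Real.sqrt_mul (by positivity),
        Real.sqrt_sq hN0.le]
    have h4 : 2 * √(L * (N / 4)) = √(L * N) := by
      rw [show L * N = 2 ^ 2 * (L * (N / 4)) by ring,
        Real.sqrt_mul (by norm_num : (0 : ℝ) ≤ 2 ^ 2), Real.sqrt_sq (by norm_num)]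
    rw [h3, h4]
    exact Real.sqrt_le_sqrt (by nlinarith)
  -- for fewer than `4` visits the radius is at least `c`
  · push Not at hV
    refine hmain ?_ habs
    rw [Real.one_le_sqrt, le_div_iff₀ hM, one_mul]
    exact max_le (by linarith) (by linarith)

variable {Ω : Type*} [mΩ : MeasurableSpace Ω] {μ : Measure Ω} [IsProbabilityMeasure μ]
variable {S A : Type*} [Fintype S] [Fintype A] [Nonempty S] [Nonempty A] {n : ℕ} {pr : Params}
  {M : AuctionMDP S A n pr.cmax} {X : OnlineProcess S A n Ω}

open Classical in
/-- The indicator of a visit to `(s, a)` in round `t`. -/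
noncomputable def atPair (X : OnlineProcess S A n Ω) (s : S) (a : A) (t : ℕ) (ω : Ω) : ℝ :=
  if X.state t ω = s ∧ X.action t ω = a then 1 else 0

theorem atPair_zero_or_one (s : S) (a : A) (t : ℕ) (ω : Ω) :
    atPair X s a t ω = 0 ∨ atPair X s a t ω = 1 := by
  unfold atPair; split_ifs <;> simp

theorem atPair_mem (s : S) (a : A) (t : ℕ) (ω : Ω) : atPair X s a t ω ∈ Set.Icc (0 : ℝ) 1 := by
  unfold atPair; split_ifs <;> simp

theorem atPair_mul (s : S) (a : A) (t : ℕ) (ω : Ω) (f : S → A → ℝ) :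
    atPair X s a t ω * f (X.state t ω) (X.action t ω) = atPair X s a t ω * f s a := by
  unfold atPair; split_ifs with h
  · rw [h.1, h.2]
  · simp

theorem IsOnlineAuction.atPair_meas (hX : IsOnlineAuction M μ X) (s : S) (a : A) {t : ℕ}
    (ht : 1 ≤ t) : Measurable[X.mid t] (atPair X s a t) :=
  Measurable.ite (MeasurableSet.inter (hX.state_mid ht s) (hX.action_meas t ht a))
    measurable_const measurable_const

theorem sum_atPair (k : ℕ) (s : S) (a : A) (ω : Ω) :
    ∑ t ∈ Finset.Ico 1 (epStart S A pr (k + 1)), atPair X s a t ω =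
      visits pr (X.obs ω) k s a := by
  classical
  simp only [atPair, Finset.sum_boole, visits]
  rfl

theorem visits_le (h : Observation S A n) (k : ℕ) (s : S) (a : A) :
    (visits pr h k s a : ℝ) ≤ epStart S A pr (k + 1) := by
  classical
  have h1 : visits pr h k s a ≤ (Finset.Ico 1 (epStart S A pr (k + 1))).card :=
    Finset.card_filter_le _ _
  rw [Nat.card_Ico] at h1
  exact_mod_cast h1.trans (Nat.sub_le _ _)

theorem visits_zero_or_one_le (h : Observation S A n) (k : ℕ) (s : S) (a : A) :
    (visits pr h k s a : ℝ) = 0 ∨ 1 ≤ (visits pr h k s a : ℝ) := by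
  rcases Nat.eq_zero_or_pos (visits pr h k s a) with h | h
  · left; exact_mod_cast h
  · right; exact_mod_cast h

/-- The probability that one of the deviations controlled by peeling is exceeded. -/
noncomputable def peelProb (L T : ℝ) : ℝ := scaleCount L T * Real.exp (-(2 * L - 1 / 2))

/-- Peeling for the transitions, with the compensator `V = N P (s' | s, a)` of the number of
transitions from `(s, a)` to `s'`. -/
theorem measure_transRadius_fail_le (hX : IsOnlineAuction M μ X) (hp : Admissible S A pr) {k : ℕ}
    (hk : 1 ≤ k) (s : S) (a : A) (s' : S) :
    μ.real {ω | ¬ M.trans s a s' - empTrans pr (X.obs ω) k s a s' ≤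
      transRadius pr (X.obs ω) k s a s'} ≤
      peelProb (logTerm S A pr k) (epStart S A pr (k + 1)) := by
  classical
  have hL : 1 ≤ logTerm S A pr k := by linarith [hp.four_le_logTerm hk]
  have hcomp := (hX.isCompensated_next s').gate (g := atPair X s a)
    (fun t ht => (hX.atPair_meas s a ht).mono (hX.mid_le_post t) le_rfl)
    (fun t _ ω => atPair_mem s a t ω)
  have hV : ∀ ω, ∑ t ∈ Finset.Ico 1 (epStart S A pr (k + 1)),
      atPair X s a t ω * M.trans (X.state t ω) (X.action t ω) s' =
        visits pr (X.obs ω) k s a * M.trans s a s' := by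
    intro ω
    rw [← sum_atPair, Finset.sum_mul]
    exact Finset.sum_congr rfl fun t _ => atPair_mul s a t ω fun s a => M.trans s a s'
  have hZ : ∀ ω, ∑ t ∈ Finset.Ico 1 (epStart S A pr (k + 1)),
      atPair X s a t ω * (if X.state (t + 1) ω = s' then 1 else 0) =
        visitsTo pr (X.obs ω) k s a s' := by
    intro ω
    have : ∀ t, atPair X s a t ω * (if X.state (t + 1) ω = s' then 1 else 0) =
        if X.state t ω = s ∧ X.action t ω = a ∧ X.state (t + 1) ω = s' then (1 : ℝ) else 0 := by
      intro t
      unfold atPair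
      by_cases h1 : X.state t ω = s <;> by_cases h2 : X.action t ω = a <;> simp [h1, h2]
    simp only [this, Finset.sum_boole, visitsTo]
    rfl
  refine le_trans (measureReal_mono ?_ (measure_ne_top _ _)) (measure_two_mul_sqrt_lt_le hL
    (fun lam hlam u => hcomp.measure_chernoff_le hlam.le (epStart S A pr (k + 1)) u))
  intro ω hω
  simp only [Set.mem_ofPred_eq] at hω ⊢
  rw [Finset.sum_sub_distrib, hV, hZ]
  by_contra hcon
  refine hω (sub_div_le_of_sub_le_two_mul_sqrt (visits_zero_or_one_le _ k s a)
    (Nat.cast_nonneg _) ⟨(M.trans_mem s a).1 s', ?_⟩ hL fun h1 => ?_)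
  · rw [← (M.trans_mem s a).2]
    exact Finset.single_le_sum (fun i _ => (M.trans_mem s a).1 i) (Finset.mem_univ s')
  · by_contra h2
    push Not at h2
    refine hcon ⟨⟨h1, ?_⟩, h2⟩
    have h3 : M.trans s a s' ≤ 1 := by
      rw [← (M.trans_mem s a).2]
      exact Finset.single_le_sum (fun i _ => (M.trans_mem s a).1 i) (Finset.mem_univ s')
    have h4 := visits_le (pr := pr) (X.obs ω) k s a
    nlinarith [Nat.cast_nonneg (α := ℝ) (visits pr (X.obs ω) k s a)]

/-- Peeling for the reports, with `V = N / 4`. This needs all reports of `j` in the allowed range,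
which holds almost surely. -/
theorem measure_estimate_fail_le (hX : IsOnlineAuction M μ X) (hp : Admissible S A pr)
    (hn : 1 ≤ n) {k : ℕ} (hk : 1 ≤ k) {j : Fin (n + 1)} {m : S → A → ℝ}
    (hm : HasMean μ X (report X j) (rewardCap pr.cmax j) m) (s : S) (a : A) :
    μ.real {ω | (∀ t ≥ 1, report X j t ω ∈ Set.Icc 0 (rewardCap pr.cmax j)) ∧
      ¬ (lcb pr (X.obs ω) k j s a ≤ m s a ∧ m s a ≤ ucb pr (X.obs ω) k j s a)} ≤
      2 * peelProb (rewLog S A pr n k) (epStart S A pr (k + 1)) := by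
  classical
  set c := rewardCap pr.cmax j with hc
  have hc0 : 0 ≤ c := hm.nonneg
  have hL : 4 ≤ rewLog S A pr n k := hp.four_le_rewLog hn hk
  have hcomp := (hm.isCompensated hX).gate (g := atPair X s a)
    (fun t ht => hX.atPair_meas s a ht) (fun t _ ω => atPair_mem s a t ω)
  set T := epStart S A pr (k + 1) with hT
  set D : Ω → ℝ := fun ω => ∑ t ∈ Finset.Ico 1 T,
    (atPair X s a t ω * (c⁻¹ * m (X.state t ω) (X.action t ω)) -
      atPair X s a t ω * (c⁻¹ * report X j t ω)) with hD
  have htail : ∀ lam u : ℝ, μ.real {ω | u ≤ lam * D ω - lam ^ 2 / 2 *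
      ((visits pr (X.obs ω) k s a : ℝ) / 4)} ≤ Real.exp (-u) := by
    intro lam u
    have h := hcomp.measure_hoeffding_le (g := atPair X s a) (fun t ht => hX.atPair_meas s a ht)
      (fun t _ ω => atPair_zero_or_one s a t ω) (fun t _ ω h => by rw [h, zero_mul]) lam T u
    refine le_trans (le_of_eq ?_) h
    congr 1
    ext ω
    simp only [Set.mem_ofPred_eq, hT, sum_atPair, hD]
    rw [show ∀ x : ℝ, lam ^ 2 / 2 * (x / 4) = lam ^ 2 / 8 * x from fun x => by ring]
  have h1 := measure_two_mul_sqrt_lt_le (μ := μ) (T := T) (by linarith : 1 ≤ rewLog S A pr n k)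
    (D := D) (V := fun ω => (visits pr (X.obs ω) k s a : ℝ) / 4) fun lam _ u => htail lam u
  have h2 := measure_two_mul_sqrt_lt_le (μ := μ) (T := T) (by linarith : 1 ≤ rewLog S A pr n k)
    (D := fun ω => -D ω) (V := fun ω => (visits pr (X.obs ω) k s a : ℝ) / 4)
    fun lam _ u => by simpa using htail (-lam) u
  rw [two_mul]
  refine le_trans ?_ (add_le_add h1 h2)
  refine le_trans (measureReal_mono ?_ (measure_ne_top _ _)) (measureReal_union_le _ _)
  rintro ω ⟨hrep, hω⟩
  by_contra hcon
  simp only [Set.mem_union, Set.mem_ofPred_eq, not_or, not_and, not_lt] at hcon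
  refine hω ?_
  set N : ℝ := (visits pr (X.obs ω) k s a : ℝ) with hN
  set Y : ℝ := ∑ t ∈ Finset.Ico 1 T, atPair X s a t ω * report X j t ω with hY
  have hN0 : 0 ≤ N := Nat.cast_nonneg _
  have hDeq : c * D ω = N * m s a - Y := by
    rw [hN, ← sum_atPair, hD, hY, Finset.mul_sum, Finset.sum_mul, ← Finset.sum_sub_distrib]
    refine Finset.sum_congr rfl fun t ht => ?_
    rw [atPair_mul s a t ω fun s a => c⁻¹ * m s a]
    -- also correct for `c = 0`, since then the mean and the reports vanish
    have h3 : ∀ x ∈ Set.Icc 0 c, c * (c⁻¹ * x) = x := by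
      intro x hx
      rcases eq_or_ne c 0 with h0 | h0
      · rw [h0] at hx ⊢
        have : x = 0 := le_antisymm hx.2 hx.1
        simp [this]
      · rw [mul_inv_cancel_left₀ h0]
    have h4 := h3 _ (hm.mean_mem s a)
    have h5 := h3 _ (hrep t (Finset.mem_Ico.1 ht).1)
    linear_combination (atPair X s a t ω) * h4 - atPair X s a t ω * h5
  have hemp : empReward pr (X.obs ω) k j s a = Y / max 1 N := by
    unfold empReward
    congr 1
    refine Finset.sum_congr rfl fun t _ => ?_
    unfold atPair report
    simp only [ite_mul, one_mul, zero_mul]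
    rfl
  have hYm : Y ∈ Set.Icc 0 (c * N) := by
    constructor
    · exact Finset.sum_nonneg fun t ht =>
        mul_nonneg (atPair_mem s a t ω).1 (hrep t (Finset.mem_Ico.1 ht).1).1
    · rw [hN, ← sum_atPair, Finset.mul_sum]
      refine Finset.sum_le_sum fun t ht => ?_
      rw [mul_comm]
      exact mul_le_mul_of_nonneg_right (hrep t (Finset.mem_Ico.1 ht).1).2 (atPair_mem s a t ω).1
  have hmem : 1 ≤ N / 4 → N / 4 ∈ Set.Icc 1 (T : ℝ) := fun h => ⟨h, by
    have := visits_le (pr := pr) (X.obs ω) k s a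
    linarith⟩
  have hkey := abs_sub_div_le_of_abs_le_sqrt (hm.mean_mem s a) hYm hL fun h => by
      rw [← hDeq, abs_mul, abs_of_nonneg hc0]
      refine mul_le_mul_of_nonneg_left ?_ hc0
      have h6 := hcon.1 (hmem h)
      have h7 := hcon.2 (hmem h)
      rw [abs_le]; constructor <;> linarith
  have hrad : rewardRadius pr (X.obs ω) k s a = √(2 * rewLog S A pr n k / max 1 N) := rfl
  rw [← hemp, ← hrad, abs_le] at hkey
  unfold lcb ucb
  rw [← hc]
  constructor
  · exact max_le (hm.mean_mem s a).1 (by linarith [hkey.1])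
  · exact le_min (hm.mean_mem s a).2 (by linarith [hkey.2])

/-- Every policy that is used takes each action with probability at least `δ`: the first one is
uniform, and the later ones come from occupancy measures with `δ ≤ ρ(s, a)`, whose state
frequencies are at most `1`. -/
theorem delta_le_alloc (hf : FollowsIHMDPVCG pr μ X) (hp : Admissible S A pr)
    (hP : IsMixing M.trans pr.alpha) {ω : Ω} (hconf : ∀ k, M.trans ∈ confSet pr (X.obs ω) k)
    {k : ℕ} (hk : 1 ≤ k) (s : S) (a : A) : pr.delta ≤ X.alloc k ω s a := by
  have hA := one_le_card_cast A
  have hS := one_le_card_cast S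
  obtain ⟨hpol, hind⟩ := hf.alloc_induced k hk ω
  obtain ⟨k, rfl⟩ : ∃ j, k = j + 1 := ⟨k - 1, by omega⟩
  rcases Nat.eq_zero_or_pos k with rfl | hk
  · have hq : ∀ s a, saFreq (X.occup 1 ω) s a = 1 / (Fintype.card A * Fintype.card S) := by
      intro s a
      simp only [saFreq, hf.occup_one, Finset.sum_const, Finset.card_univ, nsmul_eq_mul]
      field_simp
    have hν : stateFreq (X.occup 1 ω) s = 1 / Fintype.card S := by
      simp only [stateFreq, hq, Finset.sum_const, Finset.card_univ, nsmul_eq_mul]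
      field_simp
    have h1 := hind s a (by rw [zero_add, hν]; positivity)
    rw [zero_add, hq, hν] at h1
    rw [zero_add, h1]
    have h2 : 1 / (Fintype.card A * Fintype.card S : ℝ) / (1 / Fintype.card S) =
        1 / Fintype.card A := by field_simp
    rw [h2]
    refine hp.delta_le.trans ?_
    rw [div_le_div_iff₀ (by positivity) (by positivity)]
    nlinarith [hp.alpha_le_one, hp.alpha_pos]
  · obtain ⟨s₀⟩ := ‹Nonempty S›
    have : Nonempty S := ⟨s₀⟩
    have hunif : IsPolicy fun (_ : S) (_ : A) => 1 / (Fintype.card A : ℝ) := fun s =>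
      ⟨fun _ => by positivity, by simp⟩
    have hne : (feasible pr (X.obs ω) k).Nonempty := by
      obtain ⟨q', hq', -⟩ := exists_mem_shrunkOcc hP (hconf k) hp.delta_le hp.delta_pos.le
        hp.delta_le (policyOcc_mem hP hunif s₀) fun s a => by
          rw [sub_self]; exact saFreq_nonneg (policyOcc_mem hP hunif s₀).1 s a
      exact ⟨q', hq'⟩
    obtain ⟨⟨⟨P', hP', hq⟩, hδ⟩, -⟩ := (hf.occup_succ k hk ω).2 hne
    have hν1 : stateFreq (X.occup (k + 1) ω) s ≤ 1 := by
      rw [← sum_saFreq hq.1]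
      exact Finset.single_le_sum (f := fun s => ∑ a, saFreq (X.occup (k + 1) ω) s a)
        (fun s _ => Finset.sum_nonneg fun a _ => saFreq_nonneg hq.1 s a) (Finset.mem_univ s)
    have hν0 : 0 < stateFreq (X.occup (k + 1) ω) s :=
      lt_of_lt_of_le (hp.delta_pos.trans_le (hδ s a))
        (Finset.single_le_sum (f := fun a => saFreq (X.occup (k + 1) ω) s a)
          (fun a _ => saFreq_nonneg hq.1 s a) (Finset.mem_univ a))
    rw [hind s a hν0.ne', le_div_iff₀ hν0]
    nlinarith [hδ s a, hp.delta_pos]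

open Classical in
/-- The compensator of the number of visits to the state `s` exceeds twice this number by at least
`4 logTerm`. -/
def stateShortfall (M : AuctionMDP S A n pr.cmax) (X : OnlineProcess S A n Ω) (k : ℕ) (s : S) :
    Set Ω :=
  {ω | 2 * logTerm S A pr k ≤ 1 * ∑ t ∈ Finset.Ico 1 (epStart S A pr (k + 1)),
    (M.trans (X.state t ω) (X.action t ω) s - (if X.state (t + 1) ω = s then 1 else 0)) -
      1 ^ 2 / 2 * ∑ t ∈ Finset.Ico 1 (epStart S A pr (k + 1)),
        M.trans (X.state t ω) (X.action t ω) s}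

open Classical in
/-- The compensator of the number of visits to `(s, a)`, given the visits to `s`, exceeds twice this
number by at least `4 logTerm`. -/
def actionShortfall (pr : Params) (X : OnlineProcess S A n Ω) (k : ℕ) (s : S) (a : A) : Set Ω :=
  {ω | 2 * logTerm S A pr k ≤ 1 * ∑ t ∈ Finset.Ico 1 (epStart S A pr (k + 1)),
    ((if X.state t ω = s then 1 else 0) * X.alloc (episode S A pr t) ω (X.state t ω) a -
        (if X.state t ω = s then 1 else 0) * (if X.action t ω = a then 1 else 0)) -
      1 ^ 2 / 2 * ∑ t ∈ Finset.Ico 1 (epStart S A pr (k + 1)),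
        (if X.state t ω = s then 1 else 0) * X.alloc (episode S A pr t) ω (X.state t ω) a}

theorem measure_stateShortfall_le (hX : IsOnlineAuction M μ X) (k : ℕ) (s : S) :
    μ.real (stateShortfall M X k s) ≤ Real.exp (-(2 * logTerm S A pr k)) :=
  (hX.isCompensated_next s).measure_chernoff_le zero_le_one _ _

theorem measure_actionShortfall_le (hX : IsOnlineAuction M μ X) (hf : FollowsIHMDPVCG pr μ X)
    (hp : Admissible S A pr) (k : ℕ) (s : S) (a : A) :
    μ.real (actionShortfall pr X k s a) ≤ Real.exp (-(2 * logTerm S A pr k)) := by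
  classical
  exact ((isCompensated_action hX hf hp a).gate (g := fun t ω => if X.state t ω = s then 1 else 0)
    (fun t ht => Measurable.ite (hX.state_meas t ht s) measurable_const measurable_const)
    (fun t _ ω => by split_ifs <;> simp)).measure_chernoff_le zero_le_one _ _

/-- Visits to each state occur at rate at least `α`, and the action `a` is then taken with
probability at least `δ`; outside the shortfall events half of each rate is realized. -/
theorem visits_of_notMem_shortfall (hf : FollowsIHMDPVCG pr μ X) (hp : Admissible S A pr)
    (hP : IsMixing M.trans pr.alpha) {ω : Ω} (hconf : ∀ k, M.trans ∈ confSet pr (X.obs ω) k)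
    {k : ℕ} (hk : 1 ≤ k) (s : S) (a : A) (h1 : ω ∉ stateShortfall M X k s)
    (h2 : ω ∉ actionShortfall pr X k s a) :
    pr.alpha * pr.delta * epEnd S A pr k ≤ 32 * logTerm S A pr k ∨
      pr.alpha * pr.delta * epEnd S A pr k / 8 ≤ visits pr (X.obs ω) k s a := by
  classical
  have hL := hp.four_le_logTerm hk
  set L := logTerm S A pr k with hLdef
  set T := epStart S A pr (k + 1) with hT
  have hT1 : 1 ≤ T := one_le_epStart pr (k + 1)
  simp only [stateShortfall, actionShortfall, Set.mem_ofPred_eq, not_le, one_mul, one_pow,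
    Finset.sum_sub_distrib, ← hT, ← hLdef] at h1 h2
  -- the visits to `s` in the rounds `1, ..., T - 1`, up to the shift by one round
  have hshift : ∑ t ∈ Finset.Ico 1 T, (if X.state (t + 1) ω = s then (1 : ℝ) else 0) ≤
      ∑ t ∈ Finset.Ico 1 T, (if X.state t ω = s then (1 : ℝ) else 0) + 1 := by
    rw [Finset.sum_Ico_add' (fun t => if X.state t ω = s then (1 : ℝ) else 0) 1 T 1]
    have h3 : ∑ t ∈ Finset.Ico (1 + 1) (T + 1), (if X.state t ω = s then (1 : ℝ) else 0) ≤
        ∑ t ∈ Finset.Ico 1 (T + 1), (if X.state t ω = s then (1 : ℝ) else 0) :=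
      Finset.sum_le_sum_of_subset_of_nonneg (Finset.Ico_subset_Ico_left (by omega))
        fun t _ _ => by split_ifs <;> norm_num
    rw [Finset.sum_Ico_succ_top hT1] at h3
    have h4 : (if X.state T ω = s then (1 : ℝ) else 0) ≤ 1 := by split_ifs <;> norm_num
    linarith
  have hcompS : pr.alpha * epEnd S A pr k ≤
      ∑ t ∈ Finset.Ico 1 T, M.trans (X.state t ω) (X.action t ω) s := by
    have h3 : ((Finset.Ico 1 T).card : ℝ) = epEnd S A pr k := by
      rw [Nat.card_Ico, Nat.cast_sub hT1, epEnd, Nat.cast_one]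
    rw [← h3, mul_comm, ← nsmul_eq_mul]
    exact Finset.card_nsmul_le_sum _ _ _ fun t _ => hP.le _ _ _
  have hcompA : pr.delta * ∑ t ∈ Finset.Ico 1 T, (if X.state t ω = s then (1 : ℝ) else 0) ≤
      ∑ t ∈ Finset.Ico 1 T, (if X.state t ω = s then (1 : ℝ) else 0) *
        X.alloc (episode S A pr t) ω (X.state t ω) a := by
    rw [Finset.mul_sum]
    refine Finset.sum_le_sum fun t ht => ?_
    rw [mul_comm]
    exact mul_le_mul_of_nonneg_left (delta_le_alloc hf hp hP hconf
      (hp.episode_spec (Finset.mem_Ico.1 ht).1).1 _ a) (by split_ifs <;> norm_num)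
  have hN : ∑ t ∈ Finset.Ico 1 T, (if X.state t ω = s then (1 : ℝ) else 0) *
      (if X.action t ω = a then 1 else 0) = visits pr (X.obs ω) k s a := by
    rw [← sum_atPair]
    refine Finset.sum_congr rfl fun t _ => ?_
    unfold atPair
    by_cases h3 : X.state t ω = s <;> by_cases h4 : X.action t ω = a <;> simp [h3, h4]
  rw [hN] at h2
  by_contra hcon
  push Not at hcon
  have hδ := hp.delta_le_half
  have hδ0 := hp.delta_pos
  have h5 : pr.delta * (pr.alpha * epEnd S A pr k / 2 - 2 * L - 1) ≤
      pr.delta * ∑ t ∈ Finset.Ico 1 T, (if X.state t ω = s then (1 : ℝ) else 0) :=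
    mul_le_mul_of_nonneg_left (by linarith) hδ0.le
  nlinarith [hcon.1, hcon.2]

end GoodEvent

/-! ### The union bound over all episodes -/

section UnionBound

theorem one_add_log_le {x : ℝ} (hx : 1 ≤ x) : 1 + Real.log x ≤ 4 * √(√x) := by
  have h0 : 0 < √(√x) := Real.sqrt_pos.2 (Real.sqrt_pos.2 (by linarith))
  have h1 := Real.log_le_sub_one_of_pos h0
  rw [Real.log_sqrt (Real.sqrt_nonneg _), Real.log_sqrt (by linarith)] at h1
  linarith

theorem one_add_log_sq_le {x : ℝ} (hx : 1 ≤ x) : (1 + Real.log x) ^ 2 ≤ 16 * √x := by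
  have h1 := one_add_log_le hx
  have h2 : 0 ≤ Real.log x := Real.log_nonneg hx
  have h3 : √(√x) ^ 2 = √x := Real.sq_sqrt (Real.sqrt_nonneg _)
  nlinarith [Real.sqrt_nonneg (√x)]

variable {S A : Type*} [Fintype S] [Fintype A] [Nonempty S] [Nonempty A] {n : ℕ} {pr : Params}

/-- The logarithmic size of the parameters, apart from `ζ`. -/
noncomputable def sizeLog (S A : Type*) [Fintype S] [Fintype A] (pr : Params) : ℝ :=
  Real.log ((Fintype.card A : ℝ) * Fintype.card S / (pr.alpha * pr.delta))

theorem one_le_card_mul_card (S A : Type*) [Fintype S] [Fintype A] [Nonempty S] [Nonempty A] :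
    1 ≤ (Fintype.card A : ℝ) * Fintype.card S :=
  one_le_mul_of_one_le_of_one_le (one_le_card_cast A) (one_le_card_cast S)

theorem Admissible.log_card_le (hp : Admissible S A pr) :
    Real.log ((Fintype.card A : ℝ) * Fintype.card S) ≤ sizeLog S A pr := by
  have h1 := one_le_card_mul_card S A
  refine Real.log_le_log (by linarith) ?_
  rw [le_div_iff₀ hp.mul_pos]
  nlinarith [hp.mul_le_half]

theorem Admissible.log_inv_mul_le (hp : Admissible S A pr) :
    Real.log (1 / (pr.alpha * pr.delta)) ≤ sizeLog S A pr := by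
  have h1 := one_le_card_mul_card S A
  exact Real.log_le_log (one_div_pos.2 hp.mul_pos) (div_le_div_of_nonneg_right h1 hp.mul_pos.le)

theorem Admissible.sizeLog_nonneg (hp : Admissible S A pr) : 0 ≤ sizeLog S A pr :=
  (Real.log_nonneg (one_le_card_mul_card S A)).trans hp.log_card_le

theorem Admissible.one_le_inv_zeta (hp : Admissible S A pr) : 1 ≤ 1 / pr.zeta := by
  rw [le_div_iff₀ hp.zeta_pos]; linarith [hp.zeta_le]

theorem Admissible.logTerm_eq (hp : Admissible S A pr) {k : ℕ} (hk : 1 ≤ k) :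
    logTerm S A pr k = Real.log ((Fintype.card A : ℝ) * Fintype.card S) + Real.log k +
      Real.log (1 / pr.zeta) := by
  have h1 := one_le_card_mul_card S A
  have hk' : (0 : ℝ) < k := by exact_mod_cast hk
  have hz := hp.zeta_pos
  rw [logTerm, div_eq_mul_one_div, Real.log_mul (by positivity) (by positivity),
    Real.log_mul (by positivity) (by positivity)]

theorem Admissible.rewLog_eq (hp : Admissible S A pr) (hn : 1 ≤ n) {k : ℕ} (hk : 1 ≤ k) :
    rewLog S A pr n k = logTerm S A pr k + Real.log n := by
  have h1 := one_le_card_mul_card S A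
  have hk' : (0 : ℝ) < k := by exact_mod_cast hk
  have hn' : (0 : ℝ) < n := by exact_mod_cast hn
  have hz := hp.zeta_pos
  rw [logTerm, rewLog, ← Real.log_mul (by positivity) (by positivity)]
  congr 1; ring

/-- A common bound for the logarithms that enter the failure probability of episode `k`. -/
noncomputable def logBound (S A : Type*) [Fintype S] [Fintype A] (pr : Params) (k : ℕ) : ℝ :=
  (1 + sizeLog S A pr) * (1 + Real.log k) * (1 + Real.log (1 / pr.zeta))

theorem Admissible.sum_le_logBound (hp : Admissible S A pr) {k : ℕ} (hk : 1 ≤ k) :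
    1 + sizeLog S A pr + Real.log k + Real.log (1 / pr.zeta) ≤ logBound S A pr k := by
  have h1 := hp.sizeLog_nonneg
  have h2 : 0 ≤ Real.log k := Real.log_nonneg (by exact_mod_cast hk)
  have h3 := Real.log_nonneg hp.one_le_inv_zeta
  unfold logBound
  nlinarith [mul_nonneg h1 h2, mul_nonneg h1 h3, mul_nonneg h2 h3,
    mul_nonneg (mul_nonneg h1 h2) h3]

theorem Admissible.one_le_logBound (hp : Admissible S A pr) {k : ℕ} (hk : 1 ≤ k) :
    1 ≤ logBound S A pr k := by
  have h1 := hp.sizeLog_nonneg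
  have h2 : 0 ≤ Real.log k := Real.log_nonneg (by exact_mod_cast hk)
  have h3 := Real.log_nonneg hp.one_le_inv_zeta
  linarith [hp.sum_le_logBound hk]

theorem Admissible.logTerm_le_logBound (hp : Admissible S A pr) {k : ℕ} (hk : 1 ≤ k) :
    logTerm S A pr k ≤ logBound S A pr k := by
  rw [hp.logTerm_eq hk]
  linarith [hp.sum_le_logBound hk, hp.log_card_le]

theorem Admissible.epStart_succ_le_mul (hp : Admissible S A pr) {k : ℕ} (hk : 1 ≤ k) :
    (epStart S A pr (k + 1) : ℝ) ≤
      11 * k ^ 2 * logTerm S A pr k * (1 / (pr.alpha * pr.delta)) := by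
  have hk' : (1 : ℝ) ≤ k := by exact_mod_cast hk
  have hL := hp.four_le_logTerm hk
  have h1 : (epStart S A pr (k + 1) : ℝ) ≤ 1 + 2 * k * statLen S A pr k := by
    exact_mod_cast hp.epStart_succ_le k
  have h2 := hp.statLen_le hk
  have h3 : max 4 √(k : ℝ) ≤ 4 * k :=
    max_le (by linarith) (by rw [Real.sqrt_le_left (by positivity)]; nlinarith)
  have h4 : 1 ≤ 1 / (pr.alpha * pr.delta) := by
    rw [le_div_iff₀ hp.mul_pos]; linarith [hp.mul_le_half]
  set b := 1 / (pr.alpha * pr.delta) with hb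
  have h5 : max 4 √(k : ℝ) * logTerm S A pr k / (pr.alpha * pr.delta) =
      max 4 √(k : ℝ) * logTerm S A pr k * b := by rw [hb, mul_one_div]
  rw [h5] at h2
  have h6 : 1 ≤ logTerm S A pr k * b := by nlinarith
  have h7 : max 4 √(k : ℝ) * logTerm S A pr k * b ≤ 4 * k * (logTerm S A pr k * b) := by
    rw [mul_assoc]; exact mul_le_mul_of_nonneg_right h3 (by linarith)
  have h8 : 2 * (k : ℝ) * statLen S A pr k ≤ 2 * k * (4 * k * (logTerm S A pr k * b) + 1) :=
    mul_le_mul_of_nonneg_left (by linarith) (by linarith)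
  nlinarith [mul_le_mul_of_nonneg_left h6 (by positivity : (0 : ℝ) ≤ k ^ 2)]

/-- The number of rounds is polynomial in the parameters and in `k`. -/
theorem Admissible.log_epStart_le (hp : Admissible S A pr) {k : ℕ} (hk : 1 ≤ k) :
    Real.log (epStart S A pr (k + 1)) ≤ 10 * logBound S A pr k := by
  have hk' : (1 : ℝ) ≤ k := by exact_mod_cast hk
  have hk0 : (0 : ℝ) < k := by linarith
  have hL := hp.four_le_logTerm hk
  have h0 : (0 : ℝ) < epStart S A pr (k + 1) := by
    exact_mod_cast (one_le_epStart pr (k + 1))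
  have h1 := Real.log_le_log h0 (hp.epStart_succ_le_mul hk)
  have hb : 0 < 1 / (pr.alpha * pr.delta) := one_div_pos.2 hp.mul_pos
  rw [Real.log_mul (by positivity) hb.ne', Real.log_mul (by positivity) (by positivity),
    Real.log_mul (by norm_num) (by positivity), Real.log_pow] at h1
  have h2 := Real.log_le_sub_one_of_pos (by norm_num : (0 : ℝ) < 11)
  have h3 := Real.log_le_sub_one_of_pos (by linarith : 0 < logTerm S A pr k)
  have h4 := hp.logTerm_eq hk
  have h5 := hp.log_inv_mul_le
  have h6 := hp.log_card_le
  have h7 := hp.sum_le_logBound hk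
  have h8 := Real.log_nonneg hk'
  have h9 := Real.log_nonneg hp.one_le_inv_zeta
  have h10 := hp.sizeLog_nonneg
  push_cast at h1
  linarith

theorem scaleCount_le {L T y z : ℝ} (hz : √L ≤ z) (hT : Real.log T ≤ 10 * y) (hT1 : 1 ≤ T)
    (hy : 1 ≤ y) (hz1 : 1 ≤ z) : (scaleCount L T : ℝ) ≤ 22 * y * z := by
  have hl := Real.log_nonneg hT1
  have h1 := Nat.ceil_lt_add_one (a := 2 * √L * Real.log T) (by positivity)
  have h2 : 2 * √L * Real.log T ≤ 2 * z * (10 * y) := by gcongr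
  have h3 : 1 ≤ y * z := one_le_mul_of_one_le_of_one_le hy hz1
  rw [scaleCount]
  push_cast
  nlinarith

theorem exp_half_le : Real.exp (1 / 2) ≤ 2 := by
  have h1 : Real.exp (1 / 2) ^ 2 = Real.exp 1 := by rw [← Real.exp_nat_mul]; norm_num
  have h2 := Real.exp_one_lt_d9
  nlinarith [Real.exp_pos (1 / 2)]

theorem exp_neg_two_mul_log {x : ℝ} (hx : 0 < x) : Real.exp (-(2 * Real.log x)) = 1 / x ^ 2 := by
  rw [Real.exp_neg, ← Real.log_rpow hx, Real.exp_log (by positivity), one_div]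
  norm_cast

theorem peelProb_nonneg (L T : ℝ) : 0 ≤ peelProb L T :=
  mul_nonneg (Nat.cast_nonneg _) (Real.exp_pos _).le

theorem peelProb_log_le {x T y z : ℝ} (hx : 0 < x) (hz : √(Real.log x) ≤ z)
    (hT : Real.log T ≤ 10 * y) (hT1 : 1 ≤ T) (hy : 1 ≤ y) (hz1 : 1 ≤ z) :
    peelProb (Real.log x) T ≤ 44 * y * z / x ^ 2 := by
  have h1 := scaleCount_le hz hT hT1 hy hz1
  have h2 : Real.exp (-(2 * Real.log x - 1 / 2)) ≤ 2 * (1 / x ^ 2) := by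
    rw [show -(2 * Real.log x - 1 / 2) = 1 / 2 + -(2 * Real.log x) by ring, Real.exp_add,
      exp_neg_two_mul_log hx]
    exact mul_le_mul_of_nonneg_right exp_half_le (by positivity)
  calc peelProb (Real.log x) T ≤ (22 * y * z) * (2 * (1 / x ^ 2)) := by
        unfold peelProb; gcongr
    _ = _ := by ring

/-- One factor `ζ` absorbs the logarithms of `1 / ζ`, and `√k` absorbs those of `k`. -/
theorem Admissible.zeta_sq_mul_logBound_sq_le (hp : Admissible S A pr) {k : ℕ} (hk : 1 ≤ k) :
    pr.zeta ^ 2 * logBound S A pr k ^ 2 ≤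
      256 * (pr.zeta * (1 + sizeLog S A pr) ^ 2) * √k := by
  have hz := hp.zeta_pos
  have h4 := one_add_log_sq_le (x := k) (by exact_mod_cast hk)
  have h5 := one_add_log_sq_le hp.one_le_inv_zeta
  have h6 : pr.zeta ^ 2 * √(1 / pr.zeta) ≤ pr.zeta := by
    have : √(1 / pr.zeta) ≤ 1 / pr.zeta := by
      rw [Real.sqrt_le_left (by positivity)]
      nlinarith [hp.one_le_inv_zeta]
    calc pr.zeta ^ 2 * √(1 / pr.zeta) ≤ pr.zeta ^ 2 * (1 / pr.zeta) := by gcongr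
      _ = pr.zeta := by field_simp
  calc pr.zeta ^ 2 * logBound S A pr k ^ 2 = (1 + sizeLog S A pr) ^ 2 * (1 + Real.log k) ^ 2 *
        (pr.zeta ^ 2 * (1 + Real.log (1 / pr.zeta)) ^ 2) := by rw [logBound]; ring
    _ ≤ (1 + sizeLog S A pr) ^ 2 * (16 * √k) * (pr.zeta ^ 2 * (16 * √(1 / pr.zeta))) := by
        gcongr
    _ = (1 + sizeLog S A pr) ^ 2 * (16 * √k) * 16 * (pr.zeta ^ 2 * √(1 / pr.zeta)) := by ring
    _ ≤ (1 + sizeLog S A pr) ^ 2 * (16 * √k) * 16 * pr.zeta := by gcongr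
    _ = _ := by ring

/-- The arithmetic of the union bound, with `a = |A|`, `s = |S|`, `N = n`, `z = ζ` and the
logarithmic bound `y`. -/
theorem sum_failure_le {a s k N z y x p₁ p₂ p₃ : ℝ} (ha : 1 ≤ a) (hs : 1 ≤ s) (hk : 1 ≤ k)
    (hN : 1 ≤ N) (hz : 0 < z) (hy : 1 ≤ y) (hx : x = a * s * k / z) (h0 : 0 ≤ p₁) (h0' : 0 ≤ p₂)
    (h1 : p₁ ≤ 44 * y * y / x ^ 2) (h2 : p₂ ≤ 44 * y * (2 * N * y) / (x * N) ^ 2)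
    (h3 : p₃ = 1 / x ^ 2) :
    s * a * s * p₁ + (N + 1) * (s * a) * (2 * p₂) + (s + s * a) * p₃ ≤
      398 * (z ^ 2 * y ^ 2) / k ^ 2 := by
  have has : 1 ≤ a * s := one_le_mul_of_one_le_of_one_le ha hs
  have hx0 : 0 < x := by rw [hx]; positivity
  have e0 : a * s ≤ (a * s) ^ 2 := by nlinarith
  have e1 : s * a * s ≤ (a * s) ^ 2 := by
    calc s * a * s = a * s * s * 1 := by ring
      _ ≤ a * s * s * a := by gcongr
      _ = _ := by ring
  have e2 : (N + 1) * (s * a) ≤ 2 * N * (a * s) ^ 2 := by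
    rw [mul_comm s a]
    exact mul_le_mul (by linarith) e0 (by positivity) (by positivity)
  have e3 : s + s * a ≤ 2 * (a * s) ^ 2 := by nlinarith
  have hy2 : 1 ≤ y ^ 2 := by nlinarith
  calc _ ≤ (a * s) ^ 2 * (44 * y * y / x ^ 2) +
        2 * N * (a * s) ^ 2 * (2 * (44 * y * (2 * N * y) / (x * N) ^ 2)) +
          2 * (a * s) ^ 2 * (1 / x ^ 2) := by
        rw [h3]
        gcongr
    _ = (396 * (z ^ 2 * y ^ 2) + 2 * z ^ 2) / k ^ 2 := by
        rw [hx]; field_simp; ring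
    _ ≤ _ := by
        gcongr
        nlinarith [sq_nonneg z]

/-- The bound for the failure probability of episode `k`. -/
theorem Admissible.failure_le (hp : Admissible S A pr) (hn : 1 ≤ n) {k : ℕ} (hk : 1 ≤ k) :
    (Fintype.card S * Fintype.card A * Fintype.card S) *
        peelProb (logTerm S A pr k) (epStart S A pr (k + 1)) +
      (n + 1) * (Fintype.card S * Fintype.card A) *
        (2 * peelProb (rewLog S A pr n k) (epStart S A pr (k + 1))) +
      (Fintype.card S + Fintype.card S * Fintype.card A) *
        Real.exp (-(2 * logTerm S A pr k)) ≤
    110000 * (pr.zeta * (1 + sizeLog S A pr) ^ 2) * (1 / (k * √k)) := by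
  have hk' : (1 : ℝ) ≤ k := by exact_mod_cast hk
  have hn' : (1 : ℝ) ≤ n := by exact_mod_cast hn
  have hS := one_le_card_cast S
  have hA := one_le_card_cast A
  have hz := hp.zeta_pos
  have hy := hp.one_le_logBound hk
  have hT := hp.log_epStart_le hk
  have hT1 : (1 : ℝ) ≤ epStart S A pr (k + 1) := by
    exact_mod_cast (one_le_epStart pr (k + 1))
  have hx0 : 0 < (Fintype.card A : ℝ) * Fintype.card S * k / pr.zeta := by positivity
  have hLy := hp.logTerm_le_logBound hk
  have h1 : peelProb (logTerm S A pr k) (epStart S A pr (k + 1)) ≤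
      44 * logBound S A pr k * logBound S A pr k /
        ((Fintype.card A : ℝ) * Fintype.card S * k / pr.zeta) ^ 2 := by
    refine peelProb_log_le hx0 ?_ hT hT1 hy hy
    rw [Real.sqrt_le_left (by linarith)]
    exact hLy.trans (by nlinarith)
  have h2 : peelProb (rewLog S A pr n k) (epStart S A pr (k + 1)) ≤
      44 * logBound S A pr k * (2 * n * logBound S A pr k) /
        ((Fintype.card A : ℝ) * Fintype.card S * k / pr.zeta * n) ^ 2 := by
    have h3 : rewLog S A pr n k =
        Real.log ((Fintype.card A : ℝ) * Fintype.card S * k / pr.zeta * n) := by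
      rw [rewLog]; congr 1; ring
    -- `log n ≤ n` is absorbed by the factor `n²` in the denominator
    have h4 : rewLog S A pr n k ≤ logBound S A pr k + n := by
      rw [hp.rewLog_eq hn hk]
      linarith [Real.log_le_sub_one_of_pos (by linarith : (0 : ℝ) < n)]
    rw [h3] at h4 ⊢
    refine peelProb_log_le (by positivity) ?_ hT hT1 hy (by nlinarith)
    rw [Real.sqrt_le_left (by positivity)]
    have h5 : logBound S A pr k + n ≤ 2 * n * logBound S A pr k := by nlinarith
    have h6 : 1 ≤ 2 * n * logBound S A pr k := by nlinarith
    exact h4.trans (h5.trans (by nlinarith))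
  have h3 : Real.exp (-(2 * logTerm S A pr k)) = 1 / _ ^ 2 := exp_neg_two_mul_log hx0
  refine (sum_failure_le hA hS hk' hn' hz hy rfl (peelProb_nonneg _ _) (peelProb_nonneg _ _) h1 h2
    h3).trans ?_
  have h4 : √(k : ℝ) / k ^ 2 = 1 / (k * √k) := by
    have h9 : √(k : ℝ) * √k = k := Real.mul_self_sqrt (by linarith)
    have h10 : 0 < √(k : ℝ) := Real.sqrt_pos.2 (by linarith)
    rw [div_eq_div_iff (by positivity) (by positivity)]
    calc √(k : ℝ) * (k * √k) = k * (√k * √k) := by ring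
      _ = 1 * k ^ 2 := by rw [h9]; ring
  calc _ ≤ (398 * (256 * (pr.zeta * (1 + sizeLog S A pr) ^ 2) * √k)) / (k : ℝ) ^ 2 := by
        refine div_le_div_of_nonneg_right ?_ (by positivity)
        exact mul_le_mul_of_nonneg_left (hp.zeta_sq_mul_logBound_sq_le hk) (by norm_num)
    _ = 101888 * (pr.zeta * (1 + sizeLog S A pr) ^ 2) * (1 / (k * √k)) := by rw [← h4]; ring
    _ ≤ _ := by gcongr; norm_num

variable {Ω : Type*} [mΩ : MeasurableSpace Ω] {μ : Measure Ω} [IsProbabilityMeasure μ]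
  {M : AuctionMDP S A n pr.cmax} {X : OnlineProcess S A n Ω}

/-- The sample paths with reports in the allowed range on which some confidence bound fails at the
end of episode `k`. -/
def badStep (M : AuctionMDP S A n pr.cmax) (X : OnlineProcess S A n Ω) (Q : Fin (n + 1) → Prop)
    (m : Fin (n + 1) → S → A → ℝ) (k : ℕ) : Set Ω :=
  (⋃ x : S × A × S, {ω | ¬ M.trans x.1 x.2.1 x.2.2 - empTrans pr (X.obs ω) k x.1 x.2.1 x.2.2 ≤
      transRadius pr (X.obs ω) k x.1 x.2.1 x.2.2}) ∪
    (⋃ x : Fin (n + 1) × S × A, {ω | Q x.1 ∧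
      (∀ t ≥ 1, report X x.1 t ω ∈ Set.Icc 0 (rewardCap pr.cmax x.1)) ∧
      ¬ (lcb pr (X.obs ω) k x.1 x.2.1 x.2.2 ≤ m x.1 x.2.1 x.2.2 ∧
        m x.1 x.2.1 x.2.2 ≤ ucb pr (X.obs ω) k x.1 x.2.1 x.2.2)}) ∪
    (⋃ s : S, stateShortfall M X k s) ∪ (⋃ x : S × A, actionShortfall pr X k x.1 x.2)

theorem measureReal_iUnion_le_card_mul {ι : Type*} [Fintype ι] {E : ι → Set Ω} {c : ℝ}
    (h : ∀ i, μ.real (E i) ≤ c) : μ.real (⋃ i, E i) ≤ Fintype.card ι * c := by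
  refine (measureReal_iUnion_fintype_le E).trans ?_
  rw [← nsmul_eq_mul, ← Finset.card_univ]
  exact Finset.sum_le_card_nsmul _ _ _ fun i _ => h i

theorem measure_badStep_le (hX : IsOnlineAuction M μ X) (hf : FollowsIHMDPVCG pr μ X)
    (hp : Admissible S A pr) (hn : 1 ≤ n) {Q : Fin (n + 1) → Prop} {m : Fin (n + 1) → S → A → ℝ}
    (hm : ∀ j, Q j → HasMean μ X (report X j) (rewardCap pr.cmax j) (m j)) {k : ℕ} (hk : 1 ≤ k) :
    μ.real (badStep M X Q m k) ≤
      110000 * (pr.zeta * (1 + sizeLog S A pr) ^ 2) * (1 / (k * √k)) := by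
  refine le_trans ?_ (hp.failure_le hn hk)
  have h1 := measureReal_iUnion_le_card_mul (μ := μ) (ι := S × A × S) fun x =>
    measure_transRadius_fail_le hX hp hk x.1 x.2.1 x.2.2
  have h2 := measureReal_iUnion_le_card_mul (μ := μ) (ι := Fin (n + 1) × S × A)
    (E := fun x => {ω | Q x.1 ∧
      (∀ t ≥ 1, report X x.1 t ω ∈ Set.Icc 0 (rewardCap pr.cmax x.1)) ∧
      ¬ (lcb pr (X.obs ω) k x.1 x.2.1 x.2.2 ≤ m x.1 x.2.1 x.2.2 ∧
        m x.1 x.2.1 x.2.2 ≤ ucb pr (X.obs ω) k x.1 x.2.1 x.2.2)})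
    (c := 2 * peelProb (rewLog S A pr n k) (epStart S A pr (k + 1))) fun x => by
      by_cases hQ : Q x.1
      · refine le_trans (measureReal_mono ?_ (measure_ne_top _ _))
          (measure_estimate_fail_le hX hp hn hk (hm _ hQ) x.2.1 x.2.2)
        exact fun ω hω => hω.2
      · simp only [hQ, false_and, Set.ofPred_false, measureReal_empty]
        exact mul_nonneg zero_le_two (peelProb_nonneg _ _)
  have h3 := measureReal_iUnion_le_card_mul (μ := μ) fun s =>
    measure_stateShortfall_le (M := M) hX k s
  have h4 := measureReal_iUnion_le_card_mul (μ := μ) (ι := S × A) fun x =>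
    measure_actionShortfall_le hX hf hp k x.1 x.2
  simp only [Fintype.card_prod, Fintype.card_fin, Nat.cast_mul, Nat.cast_add, Nat.cast_one] at h1 h2 h3 h4
  have h5 : μ.real (badStep M X Q m k) ≤ _ := (measureReal_union_le _ _).trans
    (add_le_add ((measureReal_union_le _ _).trans (add_le_add ((measureReal_union_le _ _).trans
      (add_le_add h1 h2)) h3)) h4)
  refine h5.trans (le_of_eq ?_)
  ring

theorem goodPath_of_notMem_badStep (hf : FollowsIHMDPVCG pr μ X) (hp : Admissible S A pr)
    (hP : IsMixing M.trans pr.alpha) {Q : Fin (n + 1) → Prop} {m : Fin (n + 1) → S → A → ℝ} {ω : Ω}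
    (hrep : ∀ t ≥ 1, ∀ j, report X j t ω ∈ Set.Icc 0 (rewardCap pr.cmax j))
    (hω : ∀ k ≥ 1, ω ∉ badStep M X Q m k) : GoodPath pr M.trans (X.obs ω) Q m := by
  simp only [badStep, Set.mem_union, Set.mem_iUnion, Set.mem_ofPred_eq, not_or, not_exists,
    not_not, Prod.forall] at hω
  have hconf : ∀ k, M.trans ∈ confSet pr (X.obs ω) k := by
    intro k
    induction k with
    | zero => exact M.trans_mem
    | succ k ih => exact ⟨ih, fun s a s' => (hω (k + 1) (by omega)).1.1.1 s a s'⟩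
  exact ⟨hconf, fun k hk s a => visits_of_notMem_shortfall hf hp hP hconf hk s a
    ((hω k hk).1.2 s) ((hω k hk).2 s a), hrep, fun k hk j hj s a =>
    not_not.1 fun hcon =>
      (hω k hk).1.1.2 j s a ⟨hj, fun t ht => hrep t ht j, hcon⟩⟩

/-- The constant in the bound for the probability that some confidence bound ever fails. -/
noncomputable def failConst : ℝ := 110000 * ∑' k : ℕ, 1 / ((k : ℝ) * √k)

theorem summable_one_div_mul_sqrt : Summable fun k : ℕ => 1 / ((k : ℝ) * √k) := by
  have h := Real.summable_one_div_nat_rpow.2 (by norm_num : (1 : ℝ) < 3 / 2)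
  refine h.congr fun k => ?_
  rcases Nat.eq_zero_or_pos k with rfl | hk
  · norm_num
  · have hk' : (0 : ℝ) < k := by exact_mod_cast hk
    rw [Real.sqrt_eq_rpow, show (3 / 2 : ℝ) = 1 + 1 / 2 by norm_num, Real.rpow_add hk',
      Real.rpow_one]

theorem failConst_nonneg : 0 ≤ failConst :=
  mul_nonneg (by norm_num) (tsum_nonneg fun k => by positivity)

/-- All confidence bounds of all episodes hold with probability `1 - O(ζ)`, up to logarithms: the
failure probability of episode `k` is of the order `k ^ (-3/2)`. -/
theorem measure_not_goodPath_le (hX : IsOnlineAuction M μ X) (hf : FollowsIHMDPVCG pr μ X)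
    (hp : Admissible S A pr) (hP : IsMixing M.trans pr.alpha) (hn : 1 ≤ n)
    {Q : Fin (n + 1) → Prop} {m : Fin (n + 1) → S → A → ℝ}
    (hm : ∀ j, Q j → HasMean μ X (report X j) (rewardCap pr.cmax j) (m j)) :
    μ.real {ω | ¬ GoodPath pr M.trans (X.obs ω) Q m} ≤
      failConst * (pr.zeta * (1 + sizeLog S A pr) ^ 2) := by
  set b := pr.zeta * (1 + sizeLog S A pr) ^ 2 with hb
  have hb0 : 0 ≤ b := mul_nonneg hp.zeta_pos.le (sq_nonneg _)
  have hrep : ∀ᵐ ω ∂μ, ∀ t ≥ 1, ∀ j, report X j t ω ∈ Set.Icc 0 (rewardCap pr.cmax j) := by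
    rw [ae_all_iff]; intro t
    by_cases ht : 1 ≤ t
    · filter_upwards [ae_all_iff.2 fun j => hX.report_mem ht j] with ω hω _ using hω
    · exact Eventually.of_forall fun ω h => absurd h ht
  have hsub : {ω | ¬ GoodPath pr M.trans (X.obs ω) Q m} ≤ᵐ[μ]
      (⋃ k : ℕ, badStep M X Q m (k + 1) : Set Ω) := by
    filter_upwards [hrep] with ω hω hbad
    by_contra hcon
    refine hbad (goodPath_of_notMem_badStep hf hp hP hω fun k hk hmem => hcon ?_)
    obtain ⟨k, rfl⟩ : ∃ j, k = j + 1 := ⟨k - 1, by omega⟩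
    exact Set.mem_iUnion.2 ⟨k, hmem⟩
  have hsum : Summable fun k : ℕ => 110000 * b * (1 / (((k + 1 : ℕ) : ℝ) * √((k + 1 : ℕ) : ℝ))) :=
    ((summable_nat_add_iff 1).2 summable_one_div_mul_sqrt).mul_left _
  have hle : μ {ω | ¬ GoodPath pr M.trans (X.obs ω) Q m} ≤ ENNReal.ofReal (failConst * b) := by
    calc _ ≤ μ (⋃ k : ℕ, badStep M X Q m (k + 1)) := measure_mono_ae hsub
      _ ≤ ∑' k, μ (badStep M X Q m (k + 1)) := measure_iUnion_le _
      _ ≤ ∑' k : ℕ, ENNReal.ofReal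
          (110000 * b * (1 / (((k + 1 : ℕ) : ℝ) * √((k + 1 : ℕ) : ℝ)))) := by
          refine ENNReal.tsum_le_tsum fun k => ?_
          rw [← ofReal_measureReal (measure_ne_top _ _)]
          exact ENNReal.ofReal_le_ofReal (measure_badStep_le hX hf hp hn hm (by omega))
      _ = ENNReal.ofReal (∑' k : ℕ,
          110000 * b * (1 / (((k + 1 : ℕ) : ℝ) * √((k + 1 : ℕ) : ℝ)))) :=
          (ENNReal.ofReal_tsum_of_nonneg (fun k => by positivity) hsum).symm
      _ = ENNReal.ofReal (failConst * b) := by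
          congr 1
          rw [tsum_mul_left, failConst, summable_one_div_mul_sqrt.tsum_eq_zero_add]
          norm_num
          ring
  exact ENNReal.toReal_le_of_le_ofReal (mul_nonneg failConst_nonneg hb0) hle

end UnionBound

/-! ### From sample paths to expectations -/

section Expectation

variable {Ω : Type*} [mΩ : MeasurableSpace Ω] {μ : Measure Ω} [IsProbabilityMeasure μ]

theorem integrable_cond {f : Ω → ℝ} (hf : Integrable f μ) {G : Set Ω} :
    Integrable f μ[|G] := by
  by_cases h0 : μ G = 0
  · rw [cond_eq_zero_of_meas_eq_zero h0]; exact integrable_zero_measure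
  · exact (hf.restrict).smul_measure (ENNReal.inv_ne_top.2 h0)

/-- Conditioning on an event of probability at least `1 / 2` at most doubles the expectation of a
nonnegative variable. -/
theorem integral_cond_le {f : Ω → ℝ} (hf : Integrable f μ) (h0 : ∀ ω, 0 ≤ f ω) {G : Set Ω}
    (hG : 1 / 2 ≤ μ.real G) : ∫ ω, f ω ∂μ[|G] ≤ 2 * ∫ ω, f ω ∂μ := by
  have h1 : ∫ ω, f ω ∂μ[|G] = (μ.real G)⁻¹ * ∫ ω in G, f ω ∂μ := by
    rw [ProbabilityTheory.cond, integral_smul_measure, ENNReal.toReal_inv, smul_eq_mul]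
    rfl
  have h2 : ∫ ω in G, f ω ∂μ ≤ ∫ ω, f ω ∂μ :=
    setIntegral_le_integral hf (Eventually.of_forall h0)
  have h3 : 0 ≤ ∫ ω in G, f ω ∂μ := integral_nonneg h0
  have h4 : (μ.real G)⁻¹ ≤ 2 := by
    rw [inv_le_comm₀ (by linarith) (by norm_num)]; linarith
  rw [h1]
  exact mul_le_mul h4 h2 h3 (by norm_num)

variable {S A : Type*} [Fintype S] [Fintype A] [Nonempty S] [Nonempty A] {n : ℕ}

theorem HasMean.ae_sum_eq {X : OnlineProcess S A n Ω}
    {Y : ℕ → Ω → ℝ} {c : ℝ} {m : S → A → ℝ} (h : HasMean μ X Y c m) (b : ℕ) :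
    ∀ᵐ ω ∂μ, ∑ t ∈ Finset.Ico 1 b, (Y t ω - m (X.state t ω) (X.action t ω)) =
      c * ∑ t ∈ Finset.Ico 1 b, (c⁻¹ * Y t ω - c⁻¹ * m (X.state t ω) (X.action t ω)) := by
  have h1 : ∀ᵐ ω ∂μ, ∀ t, 1 ≤ t → Y t ω ∈ Set.Icc 0 c := by
    rw [ae_all_iff]; intro t
    by_cases ht : 1 ≤ t
    · filter_upwards [h.mem t ht] with ω hω _ using hω
    · exact Eventually.of_forall fun ω h => absurd h ht
  filter_upwards [h1] with ω hω
  rw [Finset.mul_sum]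
  refine Finset.sum_congr rfl fun t ht => ?_
  have hY := hω t (Finset.mem_Ico.1 ht).1
  have hm := h.mean_mem (X.state t ω) (X.action t ω)
  rcases eq_or_ne c 0 with rfl | hc
  · rw [le_antisymm hY.2 hY.1, le_antisymm hm.2 hm.1]; simp
  · field_simp

theorem HasMean.integral_abs_sum_le {cmax : ℝ} {M : AuctionMDP S A n cmax}
    {X : OnlineProcess S A n Ω} (hX : IsOnlineAuction M μ X)
    {Y : ℕ → Ω → ℝ} {c : ℝ} {m : S → A → ℝ} (h : HasMean μ X Y c m) (T : ℕ) :
    Integrable (fun ω => |∑ t ∈ Finset.Ico 1 (T + 1),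
      (Y t ω - m (X.state t ω) (X.action t ω))|) μ ∧
    ∫ ω, |∑ t ∈ Finset.Ico 1 (T + 1), (Y t ω - m (X.state t ω) (X.action t ω))| ∂μ ≤ c * √T := by
  have hc := h.isCompensated hX
  have h1 : (fun ω => |∑ t ∈ Finset.Ico 1 (T + 1), (Y t ω - m (X.state t ω) (X.action t ω))|) =ᵐ[μ]
      fun ω => c * |∑ t ∈ Finset.Ico 1 (T + 1),
        (c⁻¹ * Y t ω - c⁻¹ * m (X.state t ω) (X.action t ω))| := by
    filter_upwards [h.ae_sum_eq (T + 1)] with ω hω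
    rw [hω, abs_mul, abs_of_nonneg h.nonneg]
  refine ⟨((hc.integrable_abs_sum le_rfl (T + 1)).const_mul c).congr h1.symm, ?_⟩
  rw [integral_congr_ae h1, integral_const_mul]
  refine mul_le_mul_of_nonneg_left ?_ h.nonneg
  simpa using hc.integral_abs_sum_le le_rfl (T + 1)

variable {pr : Params} {M : AuctionMDP S A n pr.cmax}
  {X : OnlineProcess S A n Ω}

theorem deviation_nonneg (P : S → A → S → ℝ) (st : ℕ → S) (ac : ℕ → A) (π : S → A → ℝ)
    (I : Finset ℕ) : 0 ≤ deviation P st ac π I := by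
  unfold deviation; positivity

/-- The expected deviations within a phase are of the order of the square root of its length. -/
theorem integral_deviation_le (hX : IsOnlineAuction M μ X) (hf : FollowsIHMDPVCG pr μ X)
    (hp : Admissible S A pr) (T : ℕ) {k : ℕ} (hk : 1 ≤ k) :
    Integrable (fun ω => deviation M.trans (X.state · ω) (X.action · ω) (X.alloc k ω)
      (phase S A pr T k)) μ ∧
    ∫ ω, deviation M.trans (X.state · ω) (X.action · ω) (X.alloc k ω) (phase S A pr T k) ∂μ ≤
      2 * Fintype.card S * Fintype.card A * √(phase S A pr T k).card := by
  classical
  have hS := one_le_card_cast S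
  have hA := one_le_card_cast A
  set a₀ := min (epStart S A pr k + mixLen S pr k) (T + 1) with ha₀
  set b₀ := min (epStart S A pr (k + 1)) (T + 1) with hb₀
  have hphase : phase S A pr T k = Finset.Ico a₀ b₀ := rfl
  have h1a : 1 ≤ a₀ := by
    have := one_le_epStart (S := S) (A := A) pr k
    omega
  have hcard : (phase S A pr T k).card = b₀ - a₀ := by rw [hphase, Nat.card_Ico]
  have hcompA : ∀ s a, IsCompensated μ X.pre
      (fun t ω => (if X.state t ω = s then 1 else 0) * (if X.action t ω = a then 1 else 0))
      (fun t ω => (if X.state t ω = s then 1 else 0) *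
        X.alloc (episode S A pr t) ω (X.state t ω) a) := fun s a =>
    (isCompensated_action hX hf hp a).gate (g := fun t ω => if X.state t ω = s then 1 else 0)
      (fun t ht => Measurable.ite (hX.state_meas t ht s) measurable_const measurable_const)
      (fun t _ ω => by split_ifs <;> simp)
  -- Throughout the phase the current policy is that of episode `k`.
  have heq : ∀ ω, deviation M.trans (X.state · ω) (X.action · ω) (X.alloc k ω)
      (phase S A pr T k) =
      ∑ s, ∑ a, |∑ t ∈ Finset.Ico a₀ b₀,
        ((if X.state t ω = s then 1 else 0) * (if X.action t ω = a then 1 else 0) -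
          (if X.state t ω = s then 1 else 0) *
            X.alloc (episode S A pr t) ω (X.state t ω) a)| +
      ∑ s, |∑ t ∈ Finset.Ico a₀ b₀, ((if X.state (t + 1) ω = s then 1 else 0) -
        M.trans (X.state t ω) (X.action t ω) s)| := by
    intro ω
    unfold deviation
    congr 1
    · refine Finset.sum_congr rfl fun s _ => Finset.sum_congr rfl fun a _ => ?_
      congr 1
      refine Finset.sum_congr hphase fun t ht => ?_
      obtain ⟨h1, h2, -⟩ := mem_phase (S := S) (A := A) (pr := pr) (T := T) (k := k)
        (by rw [hphase]; exact ht)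
      rw [hp.episode_eq hk (Finset.mem_Ico.2 ⟨by omega, h2⟩)]
      by_cases h3 : X.state t ω = s <;> by_cases h4 : X.action t ω = a <;> simp [h3, h4]
  simp only [heq]
  have hi1 : ∀ s a, Integrable (fun ω => |∑ t ∈ Finset.Ico a₀ b₀,
        ((if X.state t ω = s then 1 else 0) * (if X.action t ω = a then 1 else 0) -
          (if X.state t ω = s then 1 else 0) *
            X.alloc (episode S A pr t) ω (X.state t ω) a)|) μ := fun s a =>
    (hcompA s a).integrable_abs_sum h1a b₀
  have hi2 : ∀ s, Integrable (fun ω => |∑ t ∈ Finset.Ico a₀ b₀,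
      ((if X.state (t + 1) ω = s then 1 else 0) - M.trans (X.state t ω) (X.action t ω) s)|) μ :=
    fun s => (hX.isCompensated_next s).integrable_abs_sum h1a b₀
  have hi3 := integrable_finsetSum Finset.univ fun s _ =>
    integrable_finsetSum Finset.univ fun a _ => hi1 s a
  have hi4 := integrable_finsetSum Finset.univ fun s _ => hi2 s
  refine ⟨hi3.add hi4, ?_⟩
  rw [integral_add hi3 hi4, integral_finsetSum _ fun s _ =>
    integrable_finsetSum Finset.univ fun a _ => hi1 s a, integral_finsetSum _ fun s _ => hi2 s]
  have e1 : ∑ s : S, ∫ ω, ∑ a : A, |∑ t ∈ Finset.Ico a₀ b₀,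
        ((if X.state t ω = s then 1 else 0) * (if X.action t ω = a then 1 else 0) -
          (if X.state t ω = s then 1 else 0) *
            X.alloc (episode S A pr t) ω (X.state t ω) a)| ∂μ ≤
      ∑ _s : S, ∑ _a : A, √((b₀ - a₀ : ℕ) : ℝ) := by
    refine Finset.sum_le_sum fun s _ => ?_
    rw [integral_finsetSum _ fun a _ => hi1 s a]
    exact Finset.sum_le_sum fun a _ => (hcompA s a).integral_abs_sum_le h1a b₀
  have e2 : ∑ s : S, ∫ ω, |∑ t ∈ Finset.Ico a₀ b₀, ((if X.state (t + 1) ω = s then 1 else 0) -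
        M.trans (X.state t ω) (X.action t ω) s)| ∂μ ≤ ∑ _s : S, √((b₀ - a₀ : ℕ) : ℝ) :=
    Finset.sum_le_sum fun s _ => (hX.isCompensated_next s).integral_abs_sum_le h1a b₀
  rw [hcard]
  simp only [Finset.sum_const, Finset.card_univ, nsmul_eq_mul] at e1 e2
  have h5 := Real.sqrt_nonneg ((b₀ - a₀ : ℕ) : ℝ)
  have h6 : (Fintype.card S : ℝ) * √((b₀ - a₀ : ℕ) : ℝ) ≤
      Fintype.card S * (Fintype.card A * √((b₀ - a₀ : ℕ) : ℝ)) := by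
    gcongr; nlinarith
  linarith

/-- The regret that is accumulated in `T` rounds, in units of the range of the payoffs: the
estimation errors, the random fluctuations within the phases, the mixing phases, the first
episode, and the random fluctuations of the rewards. -/
noncomputable def learnErr (S A : Type*) [Fintype S] [Fintype A] (pr : Params) (n T : ℕ) : ℝ :=
  √(rewLog S A pr n (episode S A pr T) * T / (pr.alpha * pr.delta)) /
      (pr.alpha * √(Fintype.card S)) +
    Fintype.card A * √(episode S A pr T * T) / pr.alpha +
    episode S A pr T * (1 + Real.log (episode S A pr T)) / (pr.alpha * Fintype.card S) +
    epStart S A pr 2 + √T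

/-- The Cauchy-Schwarz inequality for the lengths of the stationary phases up to round `T`. -/
theorem sum_sqrt_card_phase_le (pr : Params) (T K : ℕ) :
    ∑ k ∈ Finset.Icc 2 K, √((phase S A pr T k).card : ℝ) ≤ √(K * T) := by
  have h1 := Finset.sum_mul_sq_le_sq_mul_sq (Finset.Icc 2 K) (fun _ => (1 : ℝ))
    fun k => √((phase S A pr T k).card : ℝ)
  simp only [one_mul, one_pow, Finset.sum_const, nsmul_eq_mul, mul_one, Nat.card_Icc] at h1
  have h2 : ∑ k ∈ Finset.Icc 2 K, √((phase S A pr T k).card : ℝ) ^ 2 ≤ T := by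
    refine le_trans (le_of_eq ?_) (sum_card_phase_le (S := S) (A := A) pr T K)
    exact Finset.sum_congr rfl fun k _ => Real.sq_sqrt (Nat.cast_nonneg _)
  have h3 : ((K + 1 - 2 : ℕ) : ℝ) ≤ K := by exact_mod_cast (by omega : K + 1 - 2 ≤ K)
  apply Real.le_sqrt_of_sq_le
  refine h1.trans (mul_le_mul h3 h2 (by positivity) (Nat.cast_nonneg _))

theorem Admissible.sum_card_mul_precision_le (hp : Admissible S A pr) (hn : 1 ≤ n) (T K : ℕ) :
    ∑ k ∈ Finset.Icc 2 K, ((phase S A pr T k).card : ℝ) * precision S A pr n (k - 1) ≤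
      4 * √(rewLog S A pr n K * T / (pr.alpha * pr.delta)) := by
  have hαδ := hp.mul_pos
  have h1 : ∀ k ∈ Finset.Icc 2 K,
      ((phase S A pr T k).card : ℝ) * precision S A pr n (k - 1) ≤
        √(rewLog S A pr n K / (pr.alpha * pr.delta)) *
          (((phase S A pr T k).card : ℝ) / √(epEnd S A pr (k - 1))) := by
    intro k hk
    rw [Finset.mem_Icc] at hk
    have h2 : rewLog S A pr n (k - 1) ≤ rewLog S A pr n K := by
      rw [hp.rewLog_eq hn (by omega), hp.rewLog_eq hn (by omega)]
      linarith [hp.logTerm_mono (j := k - 1) (k := K) (by omega) (by omega)]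
    have h3 := hp.epEnd_pos (k := k - 1) (by omega)
    have h4 : precision S A pr n (k - 1) ≤
        √(rewLog S A pr n K / (pr.alpha * pr.delta)) / √(epEnd S A pr (k - 1)) := by
      rw [precision, ← Real.sqrt_div' _ h3.le, div_div]
      exact Real.sqrt_le_sqrt (div_le_div_of_nonneg_right h2 (by positivity))
    calc _ ≤ ((phase S A pr T k).card : ℝ) *
          (√(rewLog S A pr n K / (pr.alpha * pr.delta)) / √(epEnd S A pr (k - 1))) := by gcongr
      _ = _ := by ring
  refine (Finset.sum_le_sum h1).trans ?_
  rw [← Finset.mul_sum]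
  have h5 := hp.sum_card_phase_div_sqrt_le T K
  calc _ ≤ √(rewLog S A pr n K / (pr.alpha * pr.delta)) * (4 * √T) := by gcongr
    _ = 4 * (√(rewLog S A pr n K / (pr.alpha * pr.delta)) * √T) := by ring
    _ = _ := by
      rw [← Real.sqrt_mul' _ (Nat.cast_nonneg _)]
      congr 2; ring

theorem Admissible.sum_mixLen_le (hp : Admissible S A pr) {K : ℕ} (hK : 1 ≤ K) :
    ∑ k ∈ Finset.Icc 2 K, (mixLen S pr k : ℝ) ≤
      K * (1 + Real.log K) / (pr.alpha * Fintype.card S) := by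
  have hS := one_le_card_cast S
  have hα : 0 < pr.alpha * Fintype.card S := _root_.mul_pos hp.alpha_pos (by linarith)
  have h1 : ∀ k ∈ Finset.Icc 2 K,
      (mixLen S pr k : ℝ) ≤ (1 + Real.log K) / (pr.alpha * Fintype.card S) := by
    intro k hk
    rw [Finset.mem_Icc] at hk
    have h2 := hp.mixLen_le (k := k) (by omega)
    have h3 : Real.log k ≤ Real.log K :=
      Real.log_le_log (by exact_mod_cast (by omega : 0 < k)) (by exact_mod_cast hk.2)
    rw [add_div]
    have h4 : Real.log k / (pr.alpha * Fintype.card S) ≤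
      Real.log K / (pr.alpha * Fintype.card S) := by gcongr
    have h5 : 1 ≤ 1 / (pr.alpha * Fintype.card S) := by
      rw [le_div_iff₀ hα]; linarith [hp.alpha_mul_le]
    linarith
  have hlog : 0 ≤ Real.log K := Real.log_nonneg (by exact_mod_cast hK)
  refine (Finset.sum_le_card_nsmul _ _ _ h1).trans ?_
  rw [nsmul_eq_mul, Nat.card_Icc, mul_div_assoc]
  have h3 : ((K + 1 - 2 : ℕ) : ℝ) ≤ K := by exact_mod_cast (by omega : K + 1 - 2 ≤ K)
  gcongr

/-- The expected payoff in `T` rounds is at least `T v`, up to learning errors, if the allocation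
policy of each episode has an average payoff of at least `v`, up to the precision of the estimates
that it is based on. The payoff in round `t` is `w t`, except that the realized rewards have been
replaced in it by their means. -/
theorem integral_sum_ge (hX : IsOnlineAuction M μ X) (hf : FollowsIHMDPVCG pr μ X)
    (hp : Admissible S A pr) (hP : IsMixing M.trans pr.alpha) (hn : 1 ≤ n) (s₀ : S) {G : Set Ω}
    (hGm : MeasurableSet G) (hG : 1 / 2 ≤ μ.real G) {w : ℕ → Ω → ℝ} {κ : Fin (n + 1) → ℝ}
    {B E v : ℝ} (hE : 0 ≤ E) (hκ : ∑ j, |κ j| * rewardCap pr.cmax j ≤ B)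
    (hwm : ∀ t ≥ 1, Measurable (w t)) (hwB : ∀ ω ∈ G, ∀ t ≥ 1, |w t ω| ≤ B) (hv : v ≤ B)
    (f : ℕ → Ω → S → A → ℝ) (c : ℕ → Ω → ℝ)
    (hfB : ∀ ω ∈ G, ∀ k ≥ 2, ∀ s a, |f k ω s a| ≤ B)
    (hw : ∀ ω ∈ G, ∀ k ≥ 2, ∀ t ∈ Finset.Ico (epStart S A pr k + mixLen S pr k)
      (epStart S A pr (k + 1)), w t ω = f k ω (X.state t ω) (X.action t ω) + c k ω)
    (hval : ∀ ω ∈ G, ∀ k ≥ 2, v - E * (B / (pr.alpha * √(Fintype.card S))) *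
      precision S A pr n (k - 1) ≤ avgPayoff M.trans s₀ (X.alloc k ω) (f k ω) + c k ω)
    {T : ℕ} (hT : 1 ≤ T) :
    T * v - (4 * E + 16) * B * learnErr S A pr n T ≤
      ∫ ω, ∑ t ∈ Finset.Icc 1 T, (w t ω +
        ∑ j, κ j * (X.reward t j ω - M.reward j (X.state t ω) (X.action t ω))) ∂μ[|G] := by
  have hS := one_le_card_cast S
  have hA := one_le_card_cast A
  have hα := hp.alpha_pos
  have hB : 0 ≤ B := (Finset.sum_nonneg fun j _ =>
    mul_nonneg (abs_nonneg _) (rewardCap_nonneg hp j)).trans hκ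
  have hμG : μ G ≠ 0 := by
    intro h0
    rw [measureReal_def, h0] at hG
    norm_num at hG
  have : IsProbabilityMeasure μ[|G] := cond_isProbabilityMeasure hμG
  set ν := μ[|G] with hν
  have hνG : ∀ᵐ ω ∂ν, ω ∈ G := ae_cond_mem hGm
  set K := episode S A pr T with hK
  obtain ⟨hK1, hKT⟩ := hp.episode_spec hT
  rw [← hK] at hK1 hKT
  rw [Finset.mem_Ico] at hKT
  set dev : ℕ → Ω → ℝ := fun k ω => deviation M.trans (X.state · ω) (X.action · ω) (X.alloc k ω)
      (phase S A pr T k) with hdev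
  set rdev : Fin (n + 1) → Ω → ℝ := fun j ω => |∑ t ∈ Finset.Ico 1 (T + 1),
      (X.reward t j ω - M.reward j (X.state t ω) (X.action t ω))| with hrdev
  have hdevint : ∀ k ∈ Finset.Icc 2 K, Integrable (dev k) μ := fun k hk =>
    (integral_deviation_le hX hf hp T (by rw [Finset.mem_Icc] at hk; omega)).1
  have hrint : ∀ j, Integrable (rdev j) μ := fun j =>
    ((hX.hasMean_reward hp.cmax_nonneg j).integral_abs_sum_le hX T).1
  set H := B / (pr.alpha * Fintype.card S) with hH
  have hH0 : 0 ≤ H := by positivity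
  set E' := E * (B / (pr.alpha * √(Fintype.card S))) with hE'
  have hE'0 : 0 ≤ E' := by positivity
  set R₀ : ℝ := E' * ∑ k ∈ Finset.Icc 2 K, ((phase S A pr T k).card : ℝ) *
    precision S A pr n (k - 1) + 4 * H * K +
    2 * B * (epStart S A pr 2 + ∑ k ∈ Finset.Icc 2 K, (mixLen S pr k : ℝ)) with hR₀
  have hIco : Finset.Ico 1 (T + 1) = Finset.Icc 1 T := by ext t; simp
  -- The estimate holds on each path in `G`; expectations are taken afterwards.
  have hpath : ∀ ω ∈ G, T * v - (R₀ + 4 * H * ∑ k ∈ Finset.Icc 2 K, dev k ω +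
      ∑ j, |κ j| * rdev j ω) ≤ ∑ t ∈ Finset.Icc 1 T, (w t ω +
        ∑ j, κ j * (X.reward t j ω - M.reward j (X.state t ω) (X.action t ω))) := by
    intro ω hω
    have h1 := sum_ge_of_phase (S := S) (A := A) (pr := pr) (w := fun t => w t ω) hK1 hKT.2 hB
      (fun t ht => (abs_le.1 (hwB ω hω t (Finset.mem_Icc.1 ht).1)).1) hv
      (c := fun k => E' * (((phase S A pr T k).card : ℝ) * precision S A pr n (k - 1)) +
        4 * H * (1 + dev k ω)) fun k hk => by
        rw [Finset.mem_Icc] at hk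
        have hπ := (hf.alloc_induced k (by omega) ω).1
        have h2 := abs_sum_sub_le_deviation hP hπ s₀ (hfB ω hω k hk.1) (X.state · ω)
          (X.action · ω) (min (epStart S A pr k + mixLen S pr k) (T + 1))
          (min (epStart S A pr (k + 1)) (T + 1))
        have h3 : ∑ t ∈ phase S A pr T k, w t ω =
            ∑ t ∈ phase S A pr T k, f k ω (X.state t ω) (X.action t ω) +
              (phase S A pr T k).card * c k ω := by
          rw [← nsmul_eq_mul, ← Finset.sum_const, ← Finset.sum_add_distrib]
          refine Finset.sum_congr rfl fun t ht => ?_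
          obtain ⟨h4, h5, -⟩ := mem_phase ht
          exact hw ω hω k hk.1 t (Finset.mem_Ico.2 ⟨h4, h5⟩)
        have h4 := mul_le_mul_of_nonneg_left (hval ω hω k hk.1)
          (Nat.cast_nonneg (α := ℝ) (phase S A pr T k).card)
        have h5 := (abs_le.1 h2).1
        change -(4 * H * (1 + dev k ω)) ≤ ∑ t ∈ phase S A pr T k,
          f k ω (X.state t ω) (X.action t ω) - (phase S A pr T k).card *
            avgPayoff M.trans s₀ (X.alloc k ω) (f k ω) at h5
        rw [h3]
        linarith
    have h2 : ∑ k ∈ Finset.Icc 2 K, (E' * (((phase S A pr T k).card : ℝ) *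
        precision S A pr n (k - 1)) + 4 * H * (1 + dev k ω)) ≤
        E' * ∑ k ∈ Finset.Icc 2 K, ((phase S A pr T k).card : ℝ) *
          precision S A pr n (k - 1) + 4 * H * K + 4 * H * ∑ k ∈ Finset.Icc 2 K, dev k ω := by
      rw [Finset.sum_add_distrib, ← Finset.mul_sum, ← Finset.mul_sum, Finset.sum_add_distrib]
      simp only [Finset.sum_const, nsmul_eq_mul, mul_one, Nat.card_Icc]
      have h3 : ((K + 1 - 2 : ℕ) : ℝ) ≤ K := by exact_mod_cast (by omega : K + 1 - 2 ≤ K)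
      nlinarith
    have h3 : -∑ j, |κ j| * rdev j ω ≤ ∑ t ∈ Finset.Icc 1 T,
        ∑ j, κ j * (X.reward t j ω - M.reward j (X.state t ω) (X.action t ω)) := by
      rw [Finset.sum_comm, ← Finset.sum_neg_distrib]
      refine Finset.sum_le_sum fun j _ => ?_
      rw [← Finset.mul_sum, ← hIco, hrdev]
      simp only
      rw [← abs_mul]
      exact neg_abs_le _
    rw [Finset.sum_add_distrib]
    linarith
  -- Under the conditional measure, deviations are no longer sums of martingale differences, but
  -- their first moments are at most twice those under `μ`.
  have hdν : ∀ k ∈ Finset.Icc 2 K, Integrable (dev k) ν := fun k hk => integrable_cond (hdevint k hk)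
  have hrν : ∀ j, Integrable (fun ω => |κ j| * rdev j ω) ν := fun j =>
    (integrable_cond (hrint j)).const_mul _
  have hi1 : Integrable (fun ω => 4 * H * ∑ k ∈ Finset.Icc 2 K, dev k ω) ν :=
    (integrable_finsetSum _ hdν).const_mul _
  have hi2 : Integrable (fun ω => ∑ j, |κ j| * rdev j ω) ν :=
    integrable_finsetSum _ fun j _ => hrν j
  have hi3 : Integrable (fun ω => R₀ + 4 * H * ∑ k ∈ Finset.Icc 2 K, dev k ω) ν :=
    (integrable_const _).add hi1
  have hi4 : Integrable (fun ω => R₀ + 4 * H * ∑ k ∈ Finset.Icc 2 K, dev k ω +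
      ∑ j, |κ j| * rdev j ω) ν := hi3.add hi2
  have hUint : Integrable (fun ω => ∑ t ∈ Finset.Icc 1 T, (w t ω +
        ∑ j, κ j * (X.reward t j ω - M.reward j (X.state t ω) (X.action t ω)))) ν := by
    refine integrable_finsetSum _ fun t ht => ?_
    have ht1 := (Finset.mem_Icc.1 ht).1
    refine Integrable.add ?_ (integrable_finsetSum _ fun j _ => ?_)
    · refine integrable_of_bounded (C := B) (hwm t ht1) ?_
      filter_upwards [hνG] with ω hω using hwB ω hω t ht1
    · refine integrable_cond (Integrable.const_mul (Integrable.sub ?_ ?_) _)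
      · refine integrable_of_bounded (C := rewardCap pr.cmax j)
          ((hX.reward_meas t ht1 j).mono (hX.post_le t) le_rfl) ?_
        filter_upwards [hX.reward_mem ht1 j] with ω hω
        rw [abs_of_nonneg hω.1]; exact hω.2
      · refine integrable_of_bounded (C := rewardCap pr.cmax j)
          ((measurable_eval_pair (f := fun _ s a => M.reward j s a) (hX.state_mid ht1)
            (hX.action_meas t ht1) fun _ _ => measurable_const).mono (hX.mid_le t) le_rfl)
          (Eventually.of_forall fun ω => ?_)
        have h := M.reward_mem j (X.state t ω) (X.action t ω)
        rw [abs_of_nonneg h.1]; exact h.2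
  have hi5 : Integrable (fun ω => T * v - (R₀ + 4 * H * ∑ k ∈ Finset.Icc 2 K, dev k ω +
      ∑ j, |κ j| * rdev j ω)) ν := (integrable_const _).sub hi4
  have hmono := integral_mono_ae hi5 hUint (by filter_upwards [hνG] with ω hω using hpath ω hω)
  refine le_trans ?_ hmono
  rw [integral_sub (integrable_const _) hi4, integral_add hi3 hi2,
    integral_add (integrable_const _) hi1, integral_const_mul (4 * H), integral_finsetSum _ hdν,
    integral_finsetSum _ fun j _ => hrν j]
  simp only [integral_const, probReal_univ, one_smul]
  have hb1 : ∑ k ∈ Finset.Icc 2 K, ∫ ω, dev k ω ∂ν ≤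
      4 * Fintype.card S * Fintype.card A * √(K * T) := by
    have h1 : ∀ k ∈ Finset.Icc 2 K, ∫ ω, dev k ω ∂ν ≤
        4 * Fintype.card S * Fintype.card A * √((phase S A pr T k).card : ℝ) := fun k hk => by
      have h2 := (integral_deviation_le hX hf hp T (k := k)
        (by rw [Finset.mem_Icc] at hk; omega)).2
      have h3 := integral_cond_le (hdevint k hk) (fun ω => deviation_nonneg _ _ _ _ _) hG
      linarith
    refine (Finset.sum_le_sum h1).trans ?_
    rw [← Finset.mul_sum]
    exact mul_le_mul_of_nonneg_left (sum_sqrt_card_phase_le pr T K) (by positivity)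
  have hb2 : ∑ j, ∫ ω, |κ j| * rdev j ω ∂ν ≤ 2 * B * √T := by
    have h1 : ∀ j, ∫ ω, |κ j| * rdev j ω ∂ν ≤ (|κ j| * rewardCap pr.cmax j) * (2 * √T) := fun j => by
      rw [integral_const_mul, mul_assoc]
      refine mul_le_mul_of_nonneg_left ?_ (abs_nonneg _)
      have h2 := ((hX.hasMean_reward hp.cmax_nonneg j).integral_abs_sum_le hX T).2
      have h3 := integral_cond_le (hrint j) (fun ω => abs_nonneg _) hG
      linarith
    refine (Finset.sum_le_sum fun j _ => h1 j).trans ?_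
    rw [← Finset.sum_mul]
    nlinarith [Real.sqrt_nonneg (T : ℝ)]
  have hb3 := hp.sum_card_mul_precision_le hn T K
  have hb4 := hp.sum_mixLen_le hK1
  have hlogK : 0 ≤ Real.log K := Real.log_nonneg (by exact_mod_cast hK1)
  set t1 := √(rewLog S A pr n K * T / (pr.alpha * pr.delta)) with ht1
  set t3 := K * (1 + Real.log K) / (pr.alpha * Fintype.card S) with ht3
  set t2 := √((K : ℝ) * T) with ht2
  have hlearn : learnErr S A pr n T = t1 / (pr.alpha * √(Fintype.card S)) +
    Fintype.card A * t2 / pr.alpha + t3 + epStart S A pr 2 + √T := rfl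
  have ht10 : 0 ≤ t1 := Real.sqrt_nonneg _
  have ht20 : 0 ≤ t2 := Real.sqrt_nonneg _
  have ht30 : 0 ≤ t3 := by positivity
  have hep0 : (0 : ℝ) ≤ epStart S A pr 2 := Nat.cast_nonneg _
  have hT0 := Real.sqrt_nonneg (T : ℝ)
  -- Each error is compared with its part of `learnErr`.
  have hx1 : E' * ∑ k ∈ Finset.Icc 2 K, ((phase S A pr T k).card : ℝ) *
      precision S A pr n (k - 1) ≤ 4 * E * (B * (t1 / (pr.alpha * √(Fintype.card S)))) := by
    refine (mul_le_mul_of_nonneg_left hb3 hE'0).trans (le_of_eq ?_)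
    rw [hE']; ring
  have hx2 : 4 * H * K ≤ 4 * (B * t3) := by
    have h1 : H * K = B * (K * 1 / (pr.alpha * Fintype.card S)) := by rw [hH]; ring
    have h2 : (K : ℝ) * 1 / (pr.alpha * Fintype.card S) ≤ t3 := by
      rw [ht3]; gcongr; linarith
    have h3 := mul_le_mul_of_nonneg_left h2 hB
    linarith
  have hx3 : 4 * H * ∑ k ∈ Finset.Icc 2 K, ∫ ω, dev k ω ∂ν ≤
      16 * (B * (Fintype.card A * t2 / pr.alpha)) := by
    refine (mul_le_mul_of_nonneg_left hb1 (by positivity)).trans (le_of_eq ?_)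
    rw [hH]; field_simp; ring
  have hx4 : 2 * B * (epStart S A pr 2 + ∑ k ∈ Finset.Icc 2 K, (mixLen S pr k : ℝ)) ≤
      2 * B * (epStart S A pr 2 + t3) :=
    mul_le_mul_of_nonneg_left (by linarith) (by linarith)
  have hy1 : 0 ≤ B * (t1 / (pr.alpha * √(Fintype.card S))) := by positivity
  have hy2 : 0 ≤ B * (Fintype.card A * t2 / pr.alpha) := by positivity
  have hy3 := mul_nonneg hB ht30
  have hy4 := mul_nonneg hB hep0
  have hy5 := mul_nonneg hB hT0
  rw [hlearn]
  have hz2 := mul_nonneg hE hy2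
  have hz3 := mul_nonneg hE hy3
  have hz4 := mul_nonneg hE hy4
  have hz5 := mul_nonneg hE hy5
  rw [hR₀]
  linarith

end Expectation

/-! ### The linear programs on a good sample path -/

section LinearPrograms

variable {S A : Type*} [Fintype S] [Fintype A] {n : ℕ}

theorem total_eq (g : Fin (n + 1) → S → A → ℝ) (i : Fin n) (s : S) (a : A) :
    total g s a = g i.succ s a + totalExcept g i s a :=
  (Finset.add_sum_erase _ (fun j => g j s a) (Finset.mem_univ i.succ)).symm

/-- A bound for the sum of the rewards of all players in a round. -/
noncomputable def payoffCap (n : ℕ) (cmax : ℝ) : ℝ := (cmax + 1) * n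

theorem sum_rewardCap_le {cmax : ℝ} (hc : 0 ≤ cmax) (hn : 1 ≤ n) :
    ∑ j : Fin (n + 1), rewardCap cmax j ≤ payoffCap n cmax := by
  have hn' : (1 : ℝ) ≤ n := by exact_mod_cast hn
  simp only [Fin.sum_univ_succ, rewardCap, Fin.succ_ne_zero, if_true, if_false,
    Finset.sum_const, Finset.card_univ, Fintype.card_fin, nsmul_eq_mul, mul_one, payoffCap]
  nlinarith

theorem total_mem {cmax x : ℝ} (hc : 0 ≤ cmax) (hn : 1 ≤ n) (hx : 0 ≤ x)
    {g : Fin (n + 1) → S → A → ℝ} {s : S} {a : A}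
    (hg : ∀ j, g j s a ∈ Set.Icc 0 (x * rewardCap cmax j)) :
    total g s a ∈ Set.Icc 0 (x * payoffCap n cmax) := by
  refine ⟨Finset.sum_nonneg fun j _ => (hg j).1, ?_⟩
  refine (Finset.sum_le_sum fun j _ => (hg j).2).trans ?_
  rw [← Finset.mul_sum]
  exact mul_le_mul_of_nonneg_left (sum_rewardCap_le hc hn) hx

theorem totalExcept_mem {cmax x : ℝ} (hc : 0 ≤ cmax) (hn : 1 ≤ n) (hx : 0 ≤ x)
    {g : Fin (n + 1) → S → A → ℝ} {i : Fin n} {s : S} {a : A}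
    (hg : ∀ j ≠ i.succ, g j s a ∈ Set.Icc 0 (x * rewardCap cmax j)) :
    totalExcept g i s a ∈ Set.Icc 0 (x * payoffCap n cmax) := by
  refine ⟨Finset.sum_nonneg fun j hj => (hg j (Finset.ne_of_mem_erase hj)).1, ?_⟩
  refine (Finset.sum_le_sum fun j hj => (hg j (Finset.ne_of_mem_erase hj)).2).trans ?_
  rw [← Finset.mul_sum]
  refine mul_le_mul_of_nonneg_left (le_trans ?_ (sum_rewardCap_le hc hn)) hx
  exact Finset.sum_le_sum_of_subset_of_nonneg (Finset.erase_subset _ _)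
    fun j _ _ => rewardCap_nonneg' hc j

theorem one_le_payoffCap {cmax : ℝ} (hc : 0 ≤ cmax) (hn : 1 ≤ n) : 1 ≤ payoffCap n cmax := by
  have hn' : (1 : ℝ) ≤ n := by exact_mod_cast hn
  unfold payoffCap; nlinarith

variable [Nonempty S] [Nonempty A] {pr : Params} {P : S → A → S → ℝ} {h : Observation S A n}
  {Q : Fin (n + 1) → Prop} {m : Fin (n + 1) → S → A → ℝ}

theorem GoodPath.shrunkOcc_subset (hg : GoodPath pr P h Q m) (k : ℕ) :
    shrunkOcc pr.delta {P} ⊆ feasible pr h k := by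
  rintro q ⟨⟨P', rfl, hq⟩, hδ⟩
  exact ⟨⟨P', hg.conf k, hq⟩, hδ⟩

/-- Some `q` in the polytope for the true kernel attains, for all rewards at once, the average payoff
of the policy `π`, except for a loss that is due to the constraint `δ ≤ ρ(s, a)`. -/
theorem exists_shrunkOcc_ge_avgPayoff (hp : Admissible S A pr)
    (hP : IsMixing P pr.alpha) {π : S → A → ℝ} (hπ : IsPolicy π) (s₀ : S) :
    ∃ q ∈ shrunkOcc pr.delta {P}, ∀ (r : S → A → ℝ) (F : ℝ), (∀ s a, |r s a| ≤ F) →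
      avgPayoff P s₀ π r - 4 * Fintype.card A / pr.alpha * pr.delta * F ≤ pairing q r := by
  obtain ⟨q, hq, h1⟩ := exists_mem_shrunkOcc hP (Set.mem_singleton P) hp.delta_le hp.delta_pos.le
    hp.delta_le (policyOcc_mem hP hπ s₀) fun s a => by
      rw [sub_self]; exact saFreq_nonneg (policyOcc_mem hP hπ s₀).1 s a
  refine ⟨q, hq, fun r F hr => ?_⟩
  have h2 := h1 r F hr
  rwa [pairing_policyOcc hP hπ s₀] at h2

theorem exists_isPolicy (S A : Type*) [Fintype A] [Nonempty A] :
    ∃ π : S → A → ℝ, IsPolicy π :=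
  ⟨fun _ _ => 1 / Fintype.card A, fun _ => ⟨fun _ => by positivity, by simp⟩⟩

theorem shrunkOcc_nonempty (hp : Admissible S A pr) (hP : IsMixing P pr.alpha) :
    (shrunkOcc pr.delta {P}).Nonempty := by
  obtain ⟨π, hπ⟩ := exists_isPolicy S A
  obtain ⟨s₀⟩ := ‹Nonempty S›
  have : Nonempty S := ⟨s₀⟩
  obtain ⟨q, hq, -⟩ := exists_shrunkOcc_ge_avgPayoff hp hP hπ s₀
  exact ⟨q, hq⟩

/-- On a good path the programs are feasible, as the true kernel is never excluded. Hence the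
seller never has to resort to an arbitrary choice. -/
theorem GoodPath.lpChoice (hg : GoodPath pr P h Q m) (hp : Admissible S A pr)
    (hP : IsMixing P pr.alpha) {k : ℕ} {r : S → A → ℝ} {q : S → A → S → ℝ}
    (hq : IsLPChoice (feasible pr h k) r q) :
    q ∈ feasible pr h k ∧ ∀ q' ∈ feasible pr h k, pairing q' r ≤ pairing q r :=
  hq.2 ((shrunkOcc_nonempty hp hP).mono (hg.shrunkOcc_subset k))

theorem mem_occ_of_feasible {k : ℕ} {q : S → A → S → ℝ} (hq : q ∈ feasible pr h k) :
    q ∈ occ S A := by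
  obtain ⟨⟨_, -, h⟩, -⟩ := hq
  exact h.1

/-- The constraint `δ ≤ ρ(s, a)` makes all states recurrent, so that the policy of `q` is
determined everywhere. -/
theorem exists_induces (hp : Admissible S A pr) {k : ℕ} {q : S → A → S → ℝ}
    (hq : q ∈ feasible pr h k) : ∃ π, Induces q π := by
  have h0 := mem_occ_of_feasible hq
  have hν : ∀ s, 0 < stateFreq q s := fun s =>
    Finset.sum_pos (fun a _ => hp.delta_pos.trans_le (hq.2 s a)) Finset.univ_nonempty
  refine ⟨fun s a => saFreq q s a / stateFreq q s, fun s => ⟨fun a =>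
    div_nonneg (saFreq_nonneg h0 s a) (hν s).le, ?_⟩, fun s a _ => rfl⟩
  rw [← Finset.sum_div]
  exact div_self (hν s).ne'

/-- The maximum of `⟨q, r⟩` over `Δ_δ({P})`. -/
noncomputable def shrunkValue (P : S → A → S → ℝ) (δ : ℝ) (r : S → A → ℝ) : ℝ :=
  sSup ((fun q => pairing q r) '' shrunkOcc δ {P})

theorem mem_occ_of_shrunkOcc {δ : ℝ} {K : Set (S → A → S → ℝ)} {q : S → A → S → ℝ}
    (hq : q ∈ shrunkOcc δ K) : q ∈ occ S A := by
  obtain ⟨⟨_, -, h⟩, -⟩ := hq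
  exact h.1

theorem pairing_le_shrunkValue {δ : ℝ} {r : S → A → ℝ} {F : ℝ} (hr : ∀ s a, r s a ≤ F)
    {q : S → A → S → ℝ} (hq : q ∈ shrunkOcc δ {P}) : pairing q r ≤ shrunkValue P δ r := by
  refine le_csSup ⟨F, ?_⟩ ⟨q, hq, rfl⟩
  rintro _ ⟨q', hq', rfl⟩
  exact pairing_le (mem_occ_of_shrunkOcc hq') hr

theorem shrunkValue_mem (hp : Admissible S A pr) (hP : IsMixing P pr.alpha) {r : S → A → ℝ} {F : ℝ}
    (hr : ∀ s a, r s a ∈ Set.Icc 0 F) : shrunkValue P pr.delta r ∈ Set.Icc 0 F := by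
  obtain ⟨q, hq⟩ := shrunkOcc_nonempty hp hP
  constructor
  · exact (le_pairing (mem_occ_of_shrunkOcc hq) fun s a => (hr s a).1).trans
      (pairing_le_shrunkValue (fun s a => (hr s a).2) hq)
  · refine csSup_le ⟨_, q, hq, rfl⟩ ?_
    rintro _ ⟨q', hq', rfl⟩
    exact pairing_le (mem_occ_of_shrunkOcc hq') fun s a => (hr s a).2

/-- Optimism: the value of the program solved by the seller is not below the value for the true
kernel and smaller rewards. -/
theorem GoodPath.shrunkValue_le (hg : GoodPath pr P h Q m) (hp : Admissible S A pr)
    (hP : IsMixing P pr.alpha) {k : ℕ} {r r' : S → A → ℝ} {q : S → A → S → ℝ}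
    (hq : IsLPChoice (feasible pr h k) r' q) (hr : ∀ s a, r s a ≤ r' s a) :
    shrunkValue P pr.delta r ≤ pairing q r' := by
  refine csSup_le ((shrunkOcc_nonempty hp hP).image _) ?_
  rintro _ ⟨q', hq', rfl⟩
  exact (pairing_mono (mem_occ_of_shrunkOcc hq') hr).trans
    ((hg.lpChoice hp hP hq).2 q' (hg.shrunkOcc_subset k hq'))

/-- Optimism with respect to the average payoff of an arbitrary policy. -/
theorem GoodPath.avgPayoff_le_pairing (hg : GoodPath pr P h Q m) (hp : Admissible S A pr)
    (hP : IsMixing P pr.alpha) {k : ℕ} {r r' : S → A → ℝ} {q : S → A → S → ℝ}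
    (hq : IsLPChoice (feasible pr h k) r' q) (hr : ∀ s a, r s a ≤ r' s a) {F : ℝ}
    (hrF : ∀ s a, r s a ∈ Set.Icc 0 F) {π : S → A → ℝ} (hπ : IsPolicy π) (s₀ : S) :
    avgPayoff P s₀ π r - 4 * Fintype.card A / pr.alpha * pr.delta * F ≤ pairing q r' := by
  obtain ⟨q', hq', h1⟩ := exists_shrunkOcc_ge_avgPayoff hp hP hπ s₀
  have h2 := h1 r F fun s a => by rw [abs_of_nonneg (hrF s a).1]; exact (hrF s a).2
  exact h2.trans ((pairing_mono (mem_occ_of_shrunkOcc hq') hr).trans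
    ((hg.lpChoice hp hP hq).2 q' (hg.shrunkOcc_subset k hq')))

theorem Admissible.le_div_mul_sqrt (hp : Admissible S A pr) {x : ℝ} (hx : 0 ≤ x) :
    x ≤ x / (pr.alpha * √(Fintype.card S)) := by
  have hS := one_le_card_cast S
  have h1 := hp.mul_sqrt_card_le_one
  have h2 : 0 < pr.alpha * √(Fintype.card S) :=
    _root_.mul_pos hp.alpha_pos (Real.sqrt_pos.2 (by linarith))
  rw [le_div_iff₀ h2]
  nlinarith

/-- The policy of a feasible occupancy measure almost satisfies the constraint `δ ≤ ρ(s, a)` for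
the true kernel, so that its payoff can hardly exceed the value of the constrained program. -/
theorem GoodPath.avgPayoff_le_shrunkValue (hg : GoodPath pr P h Q m) (hp : Admissible S A pr)
    (hP : IsMixing P pr.alpha) (hn : 1 ≤ n) {k : ℕ} (hk : 1 ≤ k) (s₀ : S) {q : S → A → S → ℝ}
    {π : S → A → ℝ} (hq : q ∈ feasible pr h k) (hi : Induces q π) {r : S → A → ℝ} {F : ℝ}
    (hr : ∀ s a, r s a ∈ Set.Icc 0 F) :
    avgPayoff P s₀ π r ≤ shrunkValue P pr.delta r +
      432 * Fintype.card A / pr.alpha * (F / (pr.alpha * √(Fintype.card S))) *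
        precision S A pr n k := by
  classical
  have hA := one_le_card_cast A
  have hα := hp.alpha_pos
  have hF : 0 ≤ F := by
    obtain ⟨s⟩ := ‹Nonempty S›
    obtain ⟨a⟩ := ‹Nonempty A›
    exact (hr s a).1.trans (hr s a).2
  -- The true occupancy measure of `π` satisfies `δ - κ ≤ ρ(s, a)`. This is seen by applying the
  -- estimate for average payoffs to the indicator function of `(s, a)`.
  set κ := 108 * 1 / (pr.alpha * √(Fintype.card S)) * precision S A pr n k with hκ
  have hκ0 : 0 ≤ κ := mul_nonneg (by positivity) (precision_nonneg pr k)
  have herr : 432 * Fintype.card A / pr.alpha * (F / (pr.alpha * √(Fintype.card S))) *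
        precision S A pr n k = 4 * Fintype.card A / pr.alpha * κ * F := by
    rw [hκ]; ring
  rw [herr]
  by_cases hκ1 : κ ≤ pr.alpha / (2 * Fintype.card A)
  · have h1 : ∀ s a, pr.delta - κ ≤ saFreq (policyOcc P s₀ π) s a := by
      intro s a
      have h2 := hg.abs_pairing_sub_avgPayoff_le hp hP hn hk s₀ hq hi
        (f := fun x b => if x = s ∧ b = a then 1 else 0) (F := 1)
        fun x b => by split_ifs <;> simp
      rw [← saFreq_policyOcc hP s₀] at h2
      have h3 : pairing q (fun x b => if x = s ∧ b = a then 1 else 0) = saFreq q s a := by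
        rw [pairing_eq]; simp [ite_and]
      rw [h3] at h2
      have h4 := hq.2 s a
      have h5 := (abs_le.1 h2).2
      linarith
    obtain ⟨q', hq', h2⟩ := exists_mem_shrunkOcc hP (Set.mem_singleton P) hp.delta_le hκ0 hκ1
      (policyOcc_mem hP hi.1 s₀) h1
    have h3 := h2 r F fun s a => by rw [abs_of_nonneg (hr s a).1]; exact (hr s a).2
    rw [pairing_policyOcc hP hi.1 s₀] at h3
    have h4 := pairing_le_shrunkValue (fun s a => (hr s a).2) hq'
    linarith
  -- If `κ` is large, then the claimed error exceeds the range of the payoffs.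
  · push Not at hκ1
    have h1 : avgPayoff P s₀ π r ≤ F := avgPayoff_le hP hi.1 s₀ fun s a => (hr s a).2
    have h2 := (shrunkValue_mem hp hP hr).1
    have h3 : 2 ≤ 4 * Fintype.card A / pr.alpha * κ := by
      have h4 : 4 * Fintype.card A / pr.alpha * (pr.alpha / (2 * Fintype.card A)) ≤
        4 * Fintype.card A / pr.alpha * κ := mul_le_mul_of_nonneg_left hκ1.le (by positivity)
      refine le_trans (le_of_eq ?_) h4
      field_simp; norm_num
    nlinarith

/-- The unit in which the estimation errors after episode `k` are measured. -/
noncomputable def estErr (S A : Type*) [Fintype S] [Fintype A] (pr : Params) (n k : ℕ) : ℝ :=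
  payoffCap n pr.cmax / (pr.alpha * √(Fintype.card S)) * precision S A pr n k

theorem Admissible.payoffCap_nonneg (hp : Admissible S A pr) : 0 ≤ payoffCap n pr.cmax :=
  mul_nonneg (by linarith [hp.cmax_nonneg]) (Nat.cast_nonneg _)

theorem Admissible.estErr_nonneg (hp : Admissible S A pr) (k : ℕ) : 0 ≤ estErr S A pr n k := by
  have h1 : 0 ≤ payoffCap n pr.cmax := hp.payoffCap_nonneg
  have h2 := hp.alpha_pos
  exact mul_nonneg (by positivity) (precision_nonneg _ _)

theorem Admissible.payoffCap_mul_precision_le (hp : Admissible S A pr) (k : ℕ) :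
    payoffCap n pr.cmax * precision S A pr n k ≤ estErr S A pr n k :=
  mul_le_mul_of_nonneg_right (hp.le_div_mul_sqrt hp.payoffCap_nonneg) (precision_nonneg _ _)

/-- The value of a feasible occupancy measure is close to the average payoff of its policy under the
true kernel. -/
theorem GoodPath.abs_pairing_sub_le (hg : GoodPath pr P h Q m) (hp : Admissible S A pr)
    (hP : IsMixing P pr.alpha) (hn : 1 ≤ n) {k : ℕ} (hk : 1 ≤ k) (s₀ : S) {q : S → A → S → ℝ}
    {π : S → A → ℝ} (hq : q ∈ feasible pr h k) (hi : Induces q π) {r : S → A → ℝ}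
    (hr : ∀ s a, r s a ∈ Set.Icc 0 (payoffCap n pr.cmax)) :
    |pairing q r - avgPayoff P s₀ π r| ≤ 108 * estErr S A pr n k := by
  refine (hg.abs_pairing_sub_avgPayoff_le hp hP hn hk s₀ hq hi (F := payoffCap n pr.cmax)
    fun s a => ?_).trans (le_of_eq ?_)
  · rw [abs_of_nonneg (hr s a).1]; exact (hr s a).2
  · rw [estErr]; ring

theorem GoodPath.total_ucb_mem (hg : GoodPath pr P h Q m) (hp : Admissible S A pr) (hn : 1 ≤ n)
    (k : ℕ) (s : S) (a : A) : total (ucb pr h k) s a ∈ Set.Icc 0 (payoffCap n pr.cmax) := by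
  have := total_mem (x := 1) hp.cmax_nonneg hn zero_le_one (g := ucb pr h k) (s := s) (a := a)
    fun j => by rw [one_mul]; exact hg.ucb_mem hp k j s a
  rwa [one_mul] at this

theorem GoodPath.totalExcept_ucb_mem (hg : GoodPath pr P h Q m) (hp : Admissible S A pr)
    (hn : 1 ≤ n) (k : ℕ) (i : Fin n) (s : S) (a : A) :
    totalExcept (ucb pr h k) i s a ∈ Set.Icc 0 (payoffCap n pr.cmax) := by
  have := totalExcept_mem (x := 1) hp.cmax_nonneg hn zero_le_one (g := ucb pr h k) (i := i)
    (s := s) (a := a) fun j _ => by rw [one_mul]; exact hg.ucb_mem hp k j s a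
  rwa [one_mul] at this

theorem GoodPath.totalExcept_lcb_mem (hg : GoodPath pr P h Q m) (hp : Admissible S A pr)
    (hn : 1 ≤ n) (k : ℕ) (i : Fin n) (s : S) (a : A) :
    totalExcept (lcb pr h k) i s a ∈ Set.Icc 0 (payoffCap n pr.cmax) := by
  have := totalExcept_mem (x := 1) hp.cmax_nonneg hn zero_le_one (g := lcb pr h k) (i := i)
    (s := s) (a := a) fun j _ => by rw [one_mul]; exact hg.lcb_mem hp k j s a
  rwa [one_mul] at this

theorem GoodPath.total_ucb_le (hg : GoodPath pr P h Q m) (hp : Admissible S A pr) (hn : 1 ≤ n)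
    {k : ℕ} (hk : 1 ≤ k) (s : S) (a : A) :
    total (ucb pr h k) s a ≤ total (lcb pr h k) s a + 8 * estErr S A pr n k := by
  have h1 : total (ucb pr h k) s a - total (lcb pr h k) s a ≤
      8 * precision S A pr n k * payoffCap n pr.cmax := by
    unfold total
    rw [← Finset.sum_sub_distrib]
    refine (Finset.sum_le_sum fun j _ => hg.ucb_sub_lcb_le hp hn hk j s a).trans ?_
    have h2 := mul_le_mul_of_nonneg_left (sum_rewardCap_le hp.cmax_nonneg hn)
      (by linarith [precision_nonneg (S := S) (A := A) (n := n) pr k] :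
        0 ≤ 8 * precision S A pr n k)
    rw [Finset.mul_sum] at h2
    refine le_trans (le_of_eq ?_) h2
    exact Finset.sum_congr rfl fun j _ => by ring
  have h2 := hp.payoffCap_mul_precision_le (n := n) k
  linarith

theorem GoodPath.lcb_le_ucb (hg : GoodPath pr P h Q m) (hp : Admissible S A pr) (k : ℕ)
    (j : Fin (n + 1)) (s : S) (a : A) : lcb pr h k j s a ≤ ucb pr h k j s a := by
  have h1 := hg.empReward_mem k j s a
  have h2 : 0 ≤ rewardCap pr.cmax j * rewardRadius pr h k s a :=
    mul_nonneg (rewardCap_nonneg hp j) (rewardRadius_nonneg k s a)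
  unfold lcb ucb
  refine max_le (le_min (rewardCap_nonneg hp j) (by linarith [h1.1])) (le_min ?_ ?_) <;>
    linarith [h1.2]

theorem GoodPath.totalExcept_ucb_le (hg : GoodPath pr P h Q m) (hp : Admissible S A pr)
    (hn : 1 ≤ n) {k : ℕ} (hk : 1 ≤ k) (i : Fin n) (s : S) (a : A) :
    totalExcept (ucb pr h k) i s a ≤
      totalExcept (lcb pr h k) i s a + 8 * estErr S A pr n k := by
  have h1 := hg.total_ucb_le hp hn hk s a
  rw [total_eq _ i, total_eq _ i] at h1
  linarith [hg.lcb_le_ucb hp k i.succ s a]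

end LinearPrograms

/-! ### Payments and payoffs in the stationary phases -/

section Payments

variable {Ω : Type*} [mΩ : MeasurableSpace Ω] {μ : Measure Ω} [IsProbabilityMeasure μ]
  {S A : Type*} [Fintype S] [Fintype A] [Nonempty S] [Nonempty A] {n : ℕ} {pr : Params}
  {M : AuctionMDP S A n pr.cmax} {X : OnlineProcess S A n Ω}

theorem IsOnlineAuction.visits_meas (hX : IsOnlineAuction M μ X) (k : ℕ) (s : S) (a : A) :
    Measurable fun ω => (visits pr (X.obs ω) k s a : ℝ) := by
  simp only [← sum_atPair]
  exact Finset.measurable_fun_sum _ fun t ht =>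
    (hX.atPair_meas s a (Finset.mem_Ico.1 ht).1).mono (hX.mid_le t) le_rfl

theorem IsOnlineAuction.empReward_meas (hX : IsOnlineAuction M μ X) (k : ℕ) (j : Fin (n + 1))
    (s : S) (a : A) : Measurable fun ω => empReward pr (X.obs ω) k j s a := by
  unfold empReward
  refine Measurable.div (Finset.measurable_fun_sum _ fun t ht => ?_)
    (measurable_const.max (hX.visits_meas k s a))
  have ht1 := (Finset.mem_Ico.1 ht).1
  exact Measurable.ite (MeasurableSet.inter (hX.mid_le t _ (hX.state_mid ht1 s))
    (hX.mid_le t _ (hX.action_meas t ht1 a)))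
    ((hX.report_meas ht1 j).mono (hX.post_le t) le_rfl) measurable_const

theorem IsOnlineAuction.rewardRadius_meas (hX : IsOnlineAuction M μ X) (k : ℕ)
    (s : S) (a : A) : Measurable fun ω => rewardRadius pr (X.obs ω) k s a :=
  (measurable_const.div (measurable_const.max (hX.visits_meas k s a))).sqrt

theorem IsOnlineAuction.ucb_meas (hX : IsOnlineAuction M μ X) (k : ℕ) (j : Fin (n + 1))
    (s : S) (a : A) : Measurable fun ω => ucb pr (X.obs ω) k j s a :=
  measurable_const.min ((hX.empReward_meas k j s a).add ((hX.rewardRadius_meas k s a).const_mul _))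

theorem IsOnlineAuction.lcb_meas (hX : IsOnlineAuction M μ X) (k : ℕ) (j : Fin (n + 1))
    (s : S) (a : A) : Measurable fun ω => lcb pr (X.obs ω) k j s a :=
  measurable_const.max ((hX.empReward_meas k j s a).sub ((hX.rewardRadius_meas k s a).const_mul _))

/-- There are three kinds of rounds: those of the mixing phases, those of the first stationary
phase, and those of the later stationary phases. -/
theorem pay_cases (hf : FollowsIHMDPVCG pr μ X) (hp : Admissible S A pr) {t : ℕ} (ht : 1 ≤ t) :
    (∀ i ω, X.pay t i ω = 0) ∨ (∀ i ω, X.pay t i ω = 1) ∨ ∃ k ≥ 1, ∀ i ω, X.pay t i ω =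
      pairing (X.occupEx (k + 1) i ω) (totalExcept (ucb pr (X.obs ω) k) i) -
        totalExcept (lcb pr (X.obs ω) k) i (X.state t ω) (X.action t ω) := by
  obtain ⟨h1, h2⟩ := hp.episode_spec ht
  set k := episode S A pr t
  rw [Finset.mem_Ico] at h2
  by_cases hmix : t < epStart S A pr k + mixLen S pr k
  · exact Or.inl (hf.pay_mixing k h1 t (Finset.mem_Ico.2 ⟨h2.1, hmix⟩))
  push Not at hmix
  rcases Nat.lt_or_ge 1 k with hk | hk
  · obtain ⟨j, hj⟩ : ∃ j, k = j + 1 := ⟨k - 1, by omega⟩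
    rw [hj] at hmix h2
    exact Or.inr (Or.inr ⟨j, by omega, hf.pay_succ j (by omega) t (Finset.mem_Ico.2 ⟨hmix, h2.2⟩)⟩)
  · obtain hj : k = 1 := by omega
    rw [hj] at hmix h2
    exact Or.inr (Or.inl (hf.pay_first t (Finset.mem_Ico.2 ⟨hmix, h2.2⟩)))

theorem pay_meas (hX : IsOnlineAuction M μ X) (hf : FollowsIHMDPVCG pr μ X)
    (hp : Admissible S A pr) {t : ℕ} (ht : 1 ≤ t) (i : Fin n) : Measurable (X.pay t i) := by
  rcases pay_cases hf hp ht with h | h | ⟨k, hk, h⟩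
  · rw [funext (h i)]; exact measurable_const
  · rw [funext (h i)]; exact measurable_const
  · rw [funext (h i)]
    refine Measurable.sub ?_ ?_
    · unfold pairing
      refine Finset.measurable_fun_sum _ fun s _ => Finset.measurable_fun_sum _ fun a _ =>
        Finset.measurable_fun_sum _ fun s' _ => ?_
      refine Measurable.mul ((hf.occupEx_meas (k + 1) (by omega) i s a s').mono (hX.pre_le _) le_rfl)
        (Finset.measurable_fun_sum _ fun j _ => hX.ucb_meas k j s a)
    · exact measurable_eval_pair (f := fun ω => totalExcept (lcb pr (X.obs ω) k) i)
        (fun s => hX.mid_le t _ (hX.state_mid ht s)) (fun a => hX.mid_le t _ (hX.action_meas t ht a))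
        fun s a => Finset.measurable_fun_sum _ fun j _ => hX.lcb_meas k j s a

/-- A run of the auction, together with an event on which all confidence bounds hold. -/
structure GoodRun (μ : Measure Ω) (M : AuctionMDP S A n pr.cmax) (X : OnlineProcess S A n Ω)
    (Q : Fin (n + 1) → Prop) (m : Fin (n + 1) → S → A → ℝ) (G : Set Ω) : Prop where
  auction : IsOnlineAuction M μ X
  follows : FollowsIHMDPVCG pr μ X
  admissible : Admissible S A pr
  mixing : IsMixing M.trans pr.alpha
  players : 1 ≤ n
  meas : MeasurableSet G
  half : 1 / 2 ≤ μ.real G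
  good : ∀ ω ∈ G, GoodPath pr M.trans (X.obs ω) Q m

variable {Q : Fin (n + 1) → Prop} {m : Fin (n + 1) → S → A → ℝ} {G : Set Ω}

theorem GoodRun.abs_pay_le (hr : GoodRun μ M X Q m G) {ω : Ω} (hω : ω ∈ G) {t : ℕ} (ht : 1 ≤ t)
    (i : Fin n) : |X.pay t i ω| ≤ payoffCap n pr.cmax := by
  have hp := hr.admissible
  have h1 := one_le_payoffCap hp.cmax_nonneg hr.players
  have hg := hr.good ω hω
  rcases pay_cases hr.follows hp ht with h | h | ⟨k, hk, h⟩
  · rw [h]; simpa using by linarith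
  · rw [h]; simpa using h1
  · rw [h]
    have h2 := hg.lpChoice hp hr.mixing (hr.follows.occupEx_succ k hk i ω)
    have h3 := hg.totalExcept_ucb_mem hp hr.players k i
    have h4 := pairing_le (mem_occ_of_feasible h2.1) fun s a => (h3 s a).2
    have h5 := le_pairing (mem_occ_of_feasible h2.1) fun s a => (h3 s a).1
    have h6 := hg.totalExcept_lcb_mem hp hr.players k i (X.state t ω) (X.action t ω)
    rw [abs_le]; constructor <;> linarith [h6.1, h6.2]

/-- The allocation policy of an episode nearly attains the optimistic value of the program that it
comes from, even with pessimistic rewards. -/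
theorem GoodRun.pairing_occup_le (hr : GoodRun μ M X Q m G) {ω : Ω} (hω : ω ∈ G) {k : ℕ}
    (hk : 1 ≤ k) (s₀ : S) :
    pairing (X.occup (k + 1) ω) (total (ucb pr (X.obs ω) k)) - 116 * estErr S A pr n k ≤
      avgPayoff M.trans s₀ (X.alloc (k + 1) ω) (total (lcb pr (X.obs ω) k)) := by
  have hp := hr.admissible
  have hg := hr.good ω hω
  have hi := hr.follows.alloc_induced (k + 1) (by omega) ω
  obtain ⟨hq, -⟩ := hg.lpChoice hp hr.mixing (hr.follows.occup_succ k hk ω)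
  have h1 := hg.abs_pairing_sub_le hp hr.mixing hr.players hk s₀ hq hi
    (hg.total_ucb_mem hp hr.players k)
  have h2 := avgPayoff_mono hr.mixing hi.1 s₀ (hg.total_ucb_le hp hr.players hk)
  rw [avgPayoff_add hr.mixing hi.1 s₀ _ fun _ _ => 8 * estErr S A pr n k,
    avgPayoff_const hr.mixing hi.1 s₀] at h2
  linarith [(abs_le.1 h1).2]

theorem GoodRun.lcb_add_le (hr : GoodRun μ M X Q m G) {ω : Ω} (hω : ω ∈ G) {k : ℕ}
    (hk : 1 ≤ k) {i : Fin n} (hi : Q i.succ) (s : S) (a : A) :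
    total (lcb pr (X.obs ω) k) s a ≤
      m i.succ s a + totalExcept (lcb pr (X.obs ω) k) i s a := by
  rw [total_eq _ i]
  linarith [((hr.good ω hω).est k hk i.succ hi s a).1]

/-- The optimistic value without bidder `i` does not exceed the one with her. This is what keeps
the charge of a truthful bidder below her value. -/
theorem GoodRun.pairing_occupEx_le_pairing_occup (hr : GoodRun μ M X Q m G) {ω : Ω} (hω : ω ∈ G)
    {k : ℕ} (hk : 1 ≤ k) (i : Fin n) :
    pairing (X.occupEx (k + 1) i ω) (totalExcept (ucb pr (X.obs ω) k) i) ≤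
      pairing (X.occup (k + 1) ω) (total (ucb pr (X.obs ω) k)) := by
  have hp := hr.admissible
  have hg := hr.good ω hω
  obtain ⟨hq, hmax⟩ := hg.lpChoice hp hr.mixing (hr.follows.occup_succ k hk ω)
  obtain ⟨hq', -⟩ := hg.lpChoice hp hr.mixing (hr.follows.occupEx_succ k hk i ω)
  refine (pairing_mono (mem_occ_of_feasible hq') fun s a => ?_).trans (hmax _ hq')
  rw [total_eq _ i]
  linarith [(hg.ucb_mem hp k i.succ s a).1]

/-- The optimistic value of the others is attained by some policy, up to estimation errors. -/
theorem GoodRun.exists_pairing_occupEx_le (hr : GoodRun μ M X Q m G) {ω : Ω} (hω : ω ∈ G)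
    {k : ℕ} (hk : 1 ≤ k) (s₀ : S) {i : Fin n} (hQ : ∀ j ≠ i.succ, Q j) :
    ∃ π, Induces (X.occupEx (k + 1) i ω) π ∧
      pairing (X.occupEx (k + 1) i ω) (totalExcept (ucb pr (X.obs ω) k) i) ≤
        avgPayoff M.trans s₀ π (totalExcept m i) + 116 * estErr S A pr n k := by
  have hp := hr.admissible
  have hg := hr.good ω hω
  obtain ⟨hq, -⟩ := hg.lpChoice hp hr.mixing (hr.follows.occupEx_succ k hk i ω)
  obtain ⟨π, hπ⟩ := exists_induces hp hq
  refine ⟨π, hπ, ?_⟩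
  have h1 := hg.abs_pairing_sub_le hp hr.mixing hr.players hk s₀ hq hπ
    (hg.totalExcept_ucb_mem hp hr.players k i)
  have h2 : avgPayoff M.trans s₀ π (totalExcept (ucb pr (X.obs ω) k) i) ≤
      avgPayoff M.trans s₀ π fun s a => totalExcept m i s a + 8 * estErr S A pr n k := by
    refine avgPayoff_mono hr.mixing hπ.1 s₀ fun s a => ?_
    have h3 : totalExcept (lcb pr (X.obs ω) k) i s a ≤ totalExcept m i s a :=
      Finset.sum_le_sum fun j hj => (hg.est k hk j (hQ j (Finset.ne_of_mem_erase hj)) s a).1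
    linarith [hg.totalExcept_ucb_le hp hr.players hk i s a]
  rw [avgPayoff_add hr.mixing hπ.1 s₀ _ fun _ _ => 8 * estErr S A pr n k,
    avgPayoff_const hr.mixing hπ.1 s₀] at h2
  linarith [(abs_le.1 h1).2]

theorem AuctionMDP.total_reward_mem (M : AuctionMDP S A n pr.cmax) (hp : Admissible S A pr)
    (hn : 1 ≤ n) (s : S) (a : A) : total M.reward s a ∈ Set.Icc 0 (payoffCap n pr.cmax) := by
  have := total_mem (x := 1) hp.cmax_nonneg hn zero_le_one (g := M.reward)
    (s := s) (a := a) fun j => by rw [one_mul]; exact M.reward_mem j s a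
  rwa [one_mul] at this

theorem AuctionMDP.totalExcept_reward_mem (M : AuctionMDP S A n pr.cmax) (hp : Admissible S A pr)
    (hn : 1 ≤ n) (i : Fin n) (s : S) (a : A) :
    totalExcept M.reward i s a ∈ Set.Icc 0 (payoffCap n pr.cmax) := by
  have := DynVCG.totalExcept_mem (x := 1) hp.cmax_nonneg hn zero_le_one (g := M.reward)
    (i := i) (s := s) (a := a) fun j _ => by rw [one_mul]; exact M.reward_mem j s a
  rwa [one_mul] at this

/-- The loss from the constraint `δ ≤ ρ(s, a)` in the linear programs. -/
noncomputable def shrinkLoss (A : Type*) [Fintype A] (pr : Params) (n : ℕ) : ℝ :=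
  4 * Fintype.card A / pr.alpha * pr.delta * payoffCap n pr.cmax

theorem Admissible.shrinkLoss_nonneg (hp : Admissible S A pr) : 0 ≤ shrinkLoss A pr n := by
  have h1 : 0 ≤ payoffCap n pr.cmax := hp.payoffCap_nonneg
  have h2 := hp.alpha_pos
  have h3 := hp.delta_pos
  unfold shrinkLoss; positivity

theorem GoodRun.state_action_meas (hr : GoodRun μ M X Q m G) (f : S → A → ℝ) {t : ℕ} (ht : 1 ≤ t) :
    Measurable fun ω => f (X.state t ω) (X.action t ω) :=
  (measurable_eval_pair (f := fun _ => f) (hr.auction.state_mid ht)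
    (hr.auction.action_meas t ht) fun _ _ => measurable_const).mono (hr.auction.mid_le t) le_rfl

/-- The master estimate in the form in which it is applied, with payoffs bounded by `N` times
`payoffCap`. -/
theorem GoodRun.integral_sum_ge (hr : GoodRun μ M X Q m G) (s₀ : S) {w : ℕ → Ω → ℝ}
    {κ : Fin (n + 1) → ℝ} {N E v : ℝ} (hE : 0 ≤ E) (hN : 1 ≤ N) (hκ : ∀ j, |κ j| ≤ 1)
    (hwm : ∀ t ≥ 1, Measurable (w t))
    (hwB : ∀ ω ∈ G, ∀ t ≥ 1, |w t ω| ≤ N * payoffCap n pr.cmax) (hv : v ≤ N * payoffCap n pr.cmax)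
    (f : ℕ → Ω → S → A → ℝ) (c : ℕ → Ω → ℝ)
    (hfB : ∀ ω ∈ G, ∀ k ≥ 1, ∀ s a, |f k ω s a| ≤ N * payoffCap n pr.cmax)
    (hw : ∀ ω ∈ G, ∀ k ≥ 1, ∀ t ∈ Finset.Ico (epStart S A pr (k + 1) + mixLen S pr (k + 1))
      (epStart S A pr (k + 2)), w t ω = f k ω (X.state t ω) (X.action t ω) + c k ω)
    (hval : ∀ ω ∈ G, ∀ k ≥ 1, v - E * N * estErr S A pr n k ≤
      avgPayoff M.trans s₀ (X.alloc (k + 1) ω) (f k ω) + c k ω)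
    {T : ℕ} (hT : 1 ≤ T) :
    T * v - (4 * E + 16) * N * payoffCap n pr.cmax * learnErr S A pr n T ≤
      ∫ ω, ∑ t ∈ Finset.Icc 1 T, (w t ω +
        ∑ j, κ j * (X.reward t j ω - M.reward j (X.state t ω) (X.action t ω))) ∂μ[|G] := by
  have hp := hr.admissible
  have hF : 0 ≤ payoffCap n pr.cmax := hp.payoffCap_nonneg
  have h := DynVCG.integral_sum_ge hr.auction hr.follows hp hr.mixing hr.players s₀ hr.meas hr.half
    (w := w) (κ := κ) (B := N * payoffCap n pr.cmax) (v := v) hE ?_ hwm hwB hv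
    (fun k => f (k - 1)) (fun k => c (k - 1)) (fun ω hω k hk => hfB ω hω (k - 1) (by omega)) ?_ ?_ hT
  · rwa [← mul_assoc] at h
  · calc ∑ j, |κ j| * rewardCap pr.cmax j ≤ ∑ j, 1 * rewardCap pr.cmax j :=
        Finset.sum_le_sum fun j _ => mul_le_mul_of_nonneg_right (hκ j) (rewardCap_nonneg hp j)
      _ ≤ payoffCap n pr.cmax := by
        simp only [one_mul]; exact sum_rewardCap_le hp.cmax_nonneg hr.players
      _ ≤ N * payoffCap n pr.cmax := by nlinarith
  · intro ω hω k hk t ht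
    obtain ⟨k, rfl⟩ : ∃ j, k = j + 1 := ⟨k - 1, by omega⟩
    exact hw ω hω k (by omega) t ht
  · intro ω hω k hk
    obtain ⟨k, rfl⟩ : ∃ j, k = j + 1 := ⟨k - 1, by omega⟩
    refine le_trans (le_of_eq ?_) (hval ω hω k (by omega))
    simp only [Nat.add_sub_cancel, estErr]
    ring

end Payments

/-! ### Regret and utility bounds for a fixed number of rounds -/

section Bounds

variable {Ω : Type*} [mΩ : MeasurableSpace Ω] {μ : Measure Ω} [IsProbabilityMeasure μ]
  {S A : Type*} [Fintype S] [Fintype A] [Nonempty S] [Nonempty A] {n : ℕ} {pr : Params}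
  {M : AuctionMDP S A n pr.cmax} {X : OnlineProcess S A n Ω}
  {Q : Fin (n + 1) → Prop} {m : Fin (n + 1) → S → A → ℝ} {G : Set Ω}

theorem sum_totalExcept (g : Fin (n + 1) → S → A → ℝ) (s : S) (a : A) :
    ∑ i : Fin n, totalExcept g i s a = (n - 1) * total g s a + g 0 s a := by
  have h1 : ∀ i : Fin n, totalExcept g i s a = total g s a - g i.succ s a := fun i => by
    rw [total_eq g i]; ring
  have h2 : total g s a = g 0 s a + ∑ i : Fin n, g i.succ s a := by
    unfold total; rw [Fin.sum_univ_succ]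
  simp only [h1, Finset.sum_sub_distrib, Finset.sum_const, Finset.card_univ, Fintype.card_fin,
    nsmul_eq_mul]
  linarith

theorem AuctionMDP.reward_le_payoffCap (M : AuctionMDP S A n pr.cmax) (hp : Admissible S A pr)
    (hn : 1 ≤ n) (j : Fin (n + 1)) (s : S) (a : A) : M.reward j s a ≤ payoffCap n pr.cmax :=
  ((M.reward_mem j s a).2.trans (Finset.single_le_sum
    (f := fun j : Fin (n + 1) => rewardCap pr.cmax j) (fun j _ => rewardCap_nonneg hp j)
    (Finset.mem_univ j))).trans (sum_rewardCap_le hp.cmax_nonneg hn)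

/-- The policy of each episode almost attains the welfare of every other policy, even if rewards are
valued at their lower confidence bounds. -/
theorem GoodRun.welfare_ge (hr : GoodRun μ M X Q M.reward G) (hQ : ∀ j, Q j) (s₀ : S)
    {π : S → A → ℝ} (hπ : IsPolicy π) {ω : Ω} (hω : ω ∈ G) {k : ℕ} (hk : 1 ≤ k) :
    avgPayoff M.trans s₀ π (total M.reward) - shrinkLoss A pr n - 116 * estErr S A pr n k ≤
      avgPayoff M.trans s₀ (X.alloc (k + 1) ω) (total (lcb pr (X.obs ω) k)) := by
  have hp := hr.admissible
  have hg := hr.good ω hω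
  have h1 := hr.pairing_occup_le hω hk s₀
  have h2 := hg.avgPayoff_le_pairing (r := total M.reward) hp hr.mixing (hr.follows.occup_succ k hk ω)
    (fun s a => Finset.sum_le_sum fun j _ => (hg.est k hk j (hQ j) s a).2)
    (M.total_reward_mem hp hr.players) hπ s₀
  unfold shrinkLoss
  linarith

theorem GoodRun.regSW_le (hr : GoodRun μ M X Q M.reward G) (hQ : ∀ j, Q j) {s₀ : S}
    {π : S → A → ℝ} (hπ : IsOptimalPolicy M.trans s₀ (total M.reward) π) {T : ℕ} (hT : 1 ≤ T) :
    regSW μ[|G] X M s₀ π T ≤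
      T * shrinkLoss A pr n + 480 * payoffCap n pr.cmax * learnErr S A pr n T := by
  have hp := hr.admissible
  have hR := M.total_reward_mem hp hr.players
  have hloss : 0 ≤ shrinkLoss A pr n := hp.shrinkLoss_nonneg
  have habs : ∀ s a, |total M.reward s a| ≤ 1 * payoffCap n pr.cmax := fun s a => by
    rw [one_mul, abs_of_nonneg (hR s a).1]; exact (hR s a).2
  have h := hr.integral_sum_ge s₀ (w := fun t ω => total M.reward (X.state t ω) (X.action t ω))
    (κ := fun _ => 1) (N := 1) (E := 116)
    (v := avgPayoff M.trans s₀ π (total M.reward) - shrinkLoss A pr n)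
    (by norm_num) le_rfl (fun _ => by simp) (fun t ht => hr.state_action_meas _ ht)
    (fun ω _ t _ => habs _ _)
    (by have := avgPayoff_le hr.mixing hπ.1 s₀ fun s a => (hR s a).2
        linarith)
    (fun _ _ => total M.reward) (fun _ _ => 0) (fun _ _ _ _ => habs)
    (fun ω _ k _ t _ => (add_zero _).symm)
    (fun ω hω k hk => by
      have h1 := hr.welfare_ge hQ s₀ hπ.1 hω hk
      have h2 : avgPayoff M.trans s₀ (X.alloc (k + 1) ω) (total (lcb pr (X.obs ω) k)) ≤
          avgPayoff M.trans s₀ (X.alloc (k + 1) ω) (total M.reward) :=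
        avgPayoff_mono hr.mixing (hr.follows.alloc_induced (k + 1) (by omega) ω).1 s₀ fun s a =>
          Finset.sum_le_sum fun j _ => ((hr.good ω hω).est k hk j (hQ j) s a).1
      linarith) hT
  have heq : ∀ ω, ∑ t ∈ Finset.Icc 1 T, (total M.reward (X.state t ω) (X.action t ω) +
      ∑ j, 1 * (X.reward t j ω - M.reward j (X.state t ω) (X.action t ω))) =
      ∑ t ∈ Finset.Icc 1 T, ∑ i, X.reward t i ω := fun ω =>
    Finset.sum_congr rfl fun t _ => by
      simp only [one_mul, Finset.sum_sub_distrib, total]; ring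
  simp only [heq] at h
  unfold regSW
  linarith

/-- The charges are built from upper confidence bounds for the welfare of the others and from lower
confidence bounds for their rewards. Both err in favour of the seller, so his utility is never below
the target because of the precision of the estimates. -/
theorem GoodRun.regSELL_le (hr : GoodRun μ M X Q M.reward G) (hQ : ∀ j, Q j) {s₀ : S}
    {π : S → A → ℝ} {πEx : Fin n → S → A → ℝ} {p : Fin n → S → A → ℝ}
    (hvcg : IsOfflineVCG M s₀ π πEx p) {T : ℕ} (hT : 1 ≤ T) :
    regSELL μ[|G] X M s₀ π p T ≤ T * (n * shrinkLoss A pr n) +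
      32 * n * payoffCap n pr.cmax * learnErr S A pr n T := by
  have hp := hr.admissible
  have hn : (1 : ℝ) ≤ n := by exact_mod_cast hr.players
  set F := payoffCap n pr.cmax with hF
  have hF1 : 1 ≤ F := one_le_payoffCap hp.cmax_nonneg hr.players
  have hπ := hvcg.alloc.1
  have hloss : 0 ≤ shrinkLoss A pr n := hp.shrinkLoss_nonneg
  set W := avgPayoff M.trans s₀ π (total M.reward) with hW
  set V : Fin n → ℝ := fun i => avgPayoff M.trans s₀ (πEx i) (totalExcept M.reward i) with hV
  have hW0 : 0 ≤ W := avgPayoff_nonneg hr.mixing hπ s₀ fun s a =>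
    (M.total_reward_mem hp hr.players s a).1
  have hVF : ∑ i, V i ≤ n * F := by
    refine (Finset.sum_le_card_nsmul _ _ F fun i _ => avgPayoff_le hr.mixing (hvcg.allocEx i).1 s₀
      fun s a => (M.totalExcept_reward_mem hp hr.players i s a).2).trans ?_
    simp
  -- The constant parts of the offline charges add up to `∑ i, V i`, and the discounts, together
  -- with the reward of the seller, to `-(n - 1)` times the welfare.
  have htarget : avgPayoff M.trans s₀ π (fun s a => M.reward 0 s a + ∑ i, p i s a) =
      ∑ i, V i - (n - 1) * W := by
    have h1 : (fun s a => M.reward 0 s a + ∑ i, p i s a) =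
        fun s a => ∑ i, V i - (n - 1) * total M.reward s a := by
      funext s a
      simp only [hvcg.pay, Finset.sum_sub_distrib, sum_totalExcept, hV]
      ring
    rw [h1, avgPayoff_sub hr.mixing hπ s₀ (fun _ _ => ∑ i, V i),
      avgPayoff_const hr.mixing hπ s₀, avgPayoff_mul hr.mixing hπ s₀]
  have hlcb : ∀ ω ∈ G, ∀ k i s a, totalExcept (lcb pr (X.obs ω) k) i s a ∈ Set.Icc 0 F :=
    fun ω hω k i s a => (hr.good ω hω).totalExcept_lcb_mem hp hr.players k i s a
  have hsum : ∀ {x : Fin n → ℝ}, (∀ i, |x i| ≤ F) → |∑ i, x i| ≤ n * F := fun {x} hx => by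
    refine (Finset.abs_sum_le_sum_abs _ _).trans ?_
    refine (Finset.sum_le_card_nsmul _ _ F fun i _ => hx i).trans ?_
    simp
  have hr0 : ∀ s a, |M.reward 0 s a| ≤ F := fun s a => by
    rw [abs_of_nonneg (M.reward_mem 0 s a).1]; exact M.reward_le_payoffCap hp hr.players 0 s a
  have h := hr.integral_sum_ge s₀
    (w := fun t ω => M.reward 0 (X.state t ω) (X.action t ω) + ∑ i, X.pay t i ω)
    (κ := fun j => if j = 0 then 1 else 0) (N := 2 * n) (E := 0)
    (v := ∑ i, V i - (n - 1) * W - n * shrinkLoss A pr n)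
    le_rfl (by linarith) (fun j => by split_ifs <;> simp)
    (fun t ht => (hr.state_action_meas _ ht).add
      (Finset.measurable_fun_sum _ fun i _ => pay_meas hr.auction hr.follows hp ht i))
    (fun ω hω t ht => by
      refine (abs_add_le _ _).trans ?_
      have h1 := hsum fun i => hr.abs_pay_le hω ht i
      nlinarith [hr0 (X.state t ω) (X.action t ω)])
    (by nlinarith [mul_nonneg (by linarith : (0 : ℝ) ≤ n - 1) hW0])
    (fun k ω s a => M.reward 0 s a - ∑ i, totalExcept (lcb pr (X.obs ω) k) i s a)
    (fun k ω => ∑ i, pairing (X.occupEx (k + 1) i ω) (totalExcept (ucb pr (X.obs ω) k) i))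
    (fun ω hω k _ s a => by
      refine (abs_sub _ _).trans ?_
      have h1 := hsum (x := fun i => totalExcept (lcb pr (X.obs ω) k) i s a) fun i => by
        rw [abs_of_nonneg (hlcb ω hω k i s a).1]; exact (hlcb ω hω k i s a).2
      nlinarith [hr0 s a])
    (fun ω hω k hk t ht => by
      simp only [hr.follows.pay_succ k hk t ht, Finset.sum_sub_distrib]
      ring)
    (fun ω hω k hk => by
      have hg := hr.good ω hω
      have hpol := (hr.follows.alloc_induced (k + 1) (by omega) ω).1
      have h1 : ∀ i, V i - shrinkLoss A pr n ≤
          pairing (X.occupEx (k + 1) i ω) (totalExcept (ucb pr (X.obs ω) k) i) := fun i =>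
        hg.avgPayoff_le_pairing hp hr.mixing (hr.follows.occupEx_succ k hk i ω)
          (fun s a => Finset.sum_le_sum fun j _ => (hg.est k hk j (hQ j) s a).2)
          (M.totalExcept_reward_mem hp hr.players i) (hvcg.allocEx i).1 s₀
      have h2 := Finset.sum_le_sum fun i (_ : i ∈ Finset.univ) => h1 i
      simp only [Finset.sum_sub_distrib, Finset.sum_const, Finset.card_univ, Fintype.card_fin,
        nsmul_eq_mul] at h2
      -- Lower confidence bounds only increase the charge.
      have h3 : avgPayoff M.trans s₀ (X.alloc (k + 1) ω)
          (fun s a => -(n - 1) * total M.reward s a) ≤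
          avgPayoff M.trans s₀ (X.alloc (k + 1) ω)
            (fun s a => M.reward 0 s a - ∑ i, totalExcept (lcb pr (X.obs ω) k) i s a) := by
        refine avgPayoff_mono hr.mixing hpol s₀ fun s a => ?_
        have h4 : ∑ i, totalExcept (lcb pr (X.obs ω) k) i s a ≤
            ∑ i, totalExcept M.reward i s a :=
          Finset.sum_le_sum fun i _ => Finset.sum_le_sum fun j _ => (hg.est k hk j (hQ j) s a).1
        rw [sum_totalExcept M.reward] at h4
        linarith
      rw [avgPayoff_mul hr.mixing hpol s₀] at h3
      have h5 := hvcg.alloc.2 _ hpol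
      have h6 := mul_le_mul_of_nonneg_left h5 (by linarith : (0 : ℝ) ≤ n - 1)
      linarith) hT
  have heq : ∀ ω, ∑ t ∈ Finset.Icc 1 T, (M.reward 0 (X.state t ω) (X.action t ω) +
      ∑ i, X.pay t i ω + ∑ j : Fin (n + 1), (if j = 0 then 1 else 0) *
        (X.reward t j ω - M.reward j (X.state t ω) (X.action t ω))) =
      ∑ t ∈ Finset.Icc 1 T, sellerUtil X t ω := fun ω =>
    Finset.sum_congr rfl fun t _ => by
      simp only [ite_mul, one_mul, zero_mul, Finset.sum_ite_eq', Finset.mem_univ, if_true,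
        sellerUtil]
      ring
  simp only [heq] at h
  unfold regSELL
  rw [htarget]
  linarith

/-- The charge for an episode, apart from the discount for the reported rewards of the others. -/
theorem GoodRun.pairing_occupEx_le (hr : GoodRun μ M X Q M.reward G) (hQ : ∀ j, Q j) {s₀ : S}
    {i : Fin n} {πEx : S → A → ℝ} (hπ : IsOptimalPolicy M.trans s₀ (totalExcept M.reward i) πEx)
    {ω : Ω} (hω : ω ∈ G) {k : ℕ} (hk : 1 ≤ k) :
    pairing (X.occupEx (k + 1) i ω) (totalExcept (ucb pr (X.obs ω) k) i) ≤
      avgPayoff M.trans s₀ πEx (totalExcept M.reward i) + 116 * estErr S A pr n k := by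
  obtain ⟨π', hπ', h1⟩ := hr.exists_pairing_occupEx_le hω hk s₀ (i := i) fun j _ => hQ j
  linarith [hπ.2 π' hπ'.1]

/-- The payoff of bidder `i` in a stationary phase, apart from the constant part of her charge. -/
noncomputable def netReward (M : AuctionMDP S A n pr.cmax) (X : OnlineProcess S A n Ω) (i : Fin n)
    (k : ℕ) (ω : Ω) (s : S) (a : A) : ℝ :=
  M.reward i.succ s a + totalExcept (lcb pr (X.obs ω) k) i s a

theorem GoodRun.netReward_mem (hr : GoodRun μ M X Q m G) {ω : Ω} (hω : ω ∈ G) (i : Fin n) (k : ℕ)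
    (s : S) (a : A) : netReward M X i k ω s a ∈ Set.Icc 0 (2 * payoffCap n pr.cmax) := by
  have hp := hr.admissible
  have h1 := (hr.good ω hω).totalExcept_lcb_mem hp hr.players k i s a
  have h2 := (M.reward_mem i.succ s a).1
  have h3 := M.reward_le_payoffCap hp hr.players i.succ s a
  unfold netReward
  constructor <;> linarith [h1.1, h1.2]

theorem GoodRun.reward_sub_pay_eq (hr : GoodRun μ M X Q m G) (i : Fin n) {k t : ℕ} (hk : 1 ≤ k)
    (ht : t ∈ Finset.Ico (epStart S A pr (k + 1) + mixLen S pr (k + 1)) (epStart S A pr (k + 2)))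
    (ω : Ω) : M.reward i.succ (X.state t ω) (X.action t ω) - X.pay t i ω =
      netReward M X i k ω (X.state t ω) (X.action t ω) -
        pairing (X.occupEx (k + 1) i ω) (totalExcept (ucb pr (X.obs ω) k) i) := by
  rw [hr.follows.pay_succ k hk t ht, netReward]
  ring

theorem GoodRun.abs_reward_sub_pay_le (hr : GoodRun μ M X Q m G) {ω : Ω} (hω : ω ∈ G) {t : ℕ}
    (ht : 1 ≤ t) (i : Fin n) :
    |M.reward i.succ (X.state t ω) (X.action t ω) - X.pay t i ω| ≤ 2 * payoffCap n pr.cmax := by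
  have hp := hr.admissible
  have h1 := hr.abs_pay_le hω ht i
  have h2 := (M.reward_mem i.succ (X.state t ω) (X.action t ω)).1
  have h3 := M.reward_le_payoffCap hp hr.players i.succ (X.state t ω) (X.action t ω)
  rw [abs_le] at h1 ⊢
  constructor <;> linarith

/-- A truthful bidder obtains at least the optimistic value of the program, up to estimation
errors, before she is charged. -/
theorem GoodRun.pairing_occup_le_netReward (hr : GoodRun μ M X Q m G) {i : Fin n} (hi : Q i.succ)
    (hm : m i.succ = M.reward i.succ) (s₀ : S) {ω : Ω} (hω : ω ∈ G) {k : ℕ} (hk : 1 ≤ k) :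
    pairing (X.occup (k + 1) ω) (total (ucb pr (X.obs ω) k)) - 116 * estErr S A pr n k ≤
      avgPayoff M.trans s₀ (X.alloc (k + 1) ω) (netReward M X i k ω) := by
  refine (hr.pairing_occup_le hω hk s₀).trans ?_
  refine avgPayoff_mono hr.mixing (hr.follows.alloc_induced (k + 1) (by omega) ω).1 s₀ fun s a => ?_
  have h := hr.lcb_add_le hω hk hi s a
  rwa [hm] at h

/-- Two estimates enter for each bidder: her payoff before she is charged is close to the welfare
(`GoodRun.pairing_occup_le_netReward`), and the constant part of her charge is close to that of the
offline charge (`GoodRun.pairing_occupEx_le`). -/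
theorem GoodRun.regBID_le (hr : GoodRun μ M X Q M.reward G) (hQ : ∀ j, Q j) {s₀ : S}
    {π : S → A → ℝ} {πEx : Fin n → S → A → ℝ} {p : Fin n → S → A → ℝ}
    (hvcg : IsOfflineVCG M s₀ π πEx p) {T : ℕ} (hT : 1 ≤ T) :
    regBID μ[|G] X M s₀ π p T ≤ T * (n * shrinkLoss A pr n) +
      960 * n * payoffCap n pr.cmax * learnErr S A pr n T := by
  have hp := hr.admissible
  have hn : (1 : ℝ) ≤ n := by exact_mod_cast hr.players
  set F := payoffCap n pr.cmax with hF
  have hF1 : 1 ≤ F := one_le_payoffCap hp.cmax_nonneg hr.players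
  have hπ := hvcg.alloc.1
  have hloss : 0 ≤ shrinkLoss A pr n := hp.shrinkLoss_nonneg
  set W := avgPayoff M.trans s₀ π (total M.reward) with hW
  set V : Fin n → ℝ := fun i => avgPayoff M.trans s₀ (πEx i) (totalExcept M.reward i) with hV
  have hWF : W ≤ F := avgPayoff_le hr.mixing hπ s₀ fun s a =>
    (M.total_reward_mem hp hr.players s a).2
  have hV0 : 0 ≤ ∑ i, V i := Finset.sum_nonneg fun i _ =>
    avgPayoff_nonneg hr.mixing (hvcg.allocEx i).1 s₀ fun s a =>
      (M.totalExcept_reward_mem hp hr.players i s a).1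
  -- In the offline outcome, the bidder obtains what she adds to the welfare.
  have htarget : ∑ i : Fin n, avgPayoff M.trans s₀ π (fun s a => M.reward i.succ s a - p i s a) =
      n * W - ∑ i, V i := by
    have h1 : ∀ i : Fin n, avgPayoff M.trans s₀ π (fun s a => M.reward i.succ s a - p i s a) =
        W - V i := fun i => by
      have h2 : (fun s a => M.reward i.succ s a - p i s a) =
          fun s a => total M.reward s a - V i := by
        funext s a
        rw [hvcg.pay, total_eq _ i]
        ring
      rw [h2, avgPayoff_sub hr.mixing hπ s₀ (total M.reward) fun _ _ => V i,
        avgPayoff_const hr.mixing hπ s₀]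
    simp [h1, Finset.sum_sub_distrib]
  have hsum : ∀ {x : Fin n → ℝ}, (∀ i, |x i| ≤ 2 * F) → |∑ i, x i| ≤ 2 * n * F := fun {x} hx => by
    refine (Finset.abs_sum_le_sum_abs _ _).trans ?_
    refine (Finset.sum_le_card_nsmul _ _ (2 * F) fun i _ => hx i).trans (le_of_eq ?_)
    simp only [Finset.card_univ, Fintype.card_fin, nsmul_eq_mul]; ring
  have h := hr.integral_sum_ge s₀
    (w := fun t ω => ∑ i : Fin n, (M.reward i.succ (X.state t ω) (X.action t ω) - X.pay t i ω))
    (κ := fun j => if j = 0 then 0 else 1) (N := 2 * n) (E := 116)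
    (v := n * W - ∑ i, V i - n * shrinkLoss A pr n)
    (by norm_num) (by linarith) (fun j => by split_ifs <;> simp)
    (fun t ht => Finset.measurable_fun_sum _ fun i _ => (hr.state_action_meas _ ht).sub
      (pay_meas hr.auction hr.follows hp ht i))
    (fun ω hω t ht => hsum fun i => hr.abs_reward_sub_pay_le hω ht i)
    (by nlinarith)
    (fun k ω s a => ∑ i, netReward M X i k ω s a)
    (fun k ω => -∑ i, pairing (X.occupEx (k + 1) i ω) (totalExcept (ucb pr (X.obs ω) k) i))
    (fun ω hω k _ s a => hsum fun i => by
      have h1 := hr.netReward_mem hω i k s a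
      rw [abs_of_nonneg h1.1]; exact h1.2)
    (fun ω hω k hk t ht => by
      simp only [hr.reward_sub_pay_eq _ hk ht ω, Finset.sum_sub_distrib]
      ring)
    (fun ω hω k hk => by
      have hpol := (hr.follows.alloc_induced (k + 1) (by omega) ω).1
      rw [avgPayoff_sum hr.mixing hpol s₀, ← sub_eq_add_neg, ← Finset.sum_sub_distrib]
      have h1 : ∀ i ∈ (Finset.univ : Finset (Fin n)),
          W - V i - shrinkLoss A pr n - 232 * estErr S A pr n k ≤
          avgPayoff M.trans s₀ (X.alloc (k + 1) ω) (netReward M X i k ω) -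
            pairing (X.occupEx (k + 1) i ω) (totalExcept (ucb pr (X.obs ω) k) i) := by
        intro i _
        have h2 := hr.pairing_occup_le_netReward (hQ i.succ) rfl s₀ hω hk
        have h3 := hr.pairing_occupEx_le hQ (hvcg.allocEx i) hω hk
        have hg := hr.good ω hω
        have h4 := hg.avgPayoff_le_pairing (r := total M.reward) hp hr.mixing (hr.follows.occup_succ k hk ω)
          (fun s a => Finset.sum_le_sum fun j _ => (hg.est k hk j (hQ j) s a).2)
          (M.total_reward_mem hp hr.players) hπ s₀
        unfold shrinkLoss
        linarith
      refine le_trans (le_of_eq ?_) (Finset.sum_le_sum h1)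
      simp only [Finset.sum_sub_distrib, Finset.sum_const, Finset.card_univ, Fintype.card_fin,
        nsmul_eq_mul]
      ring) hT
  have heq : ∀ ω, ∑ t ∈ Finset.Icc 1 T,
      (∑ i : Fin n, (M.reward i.succ (X.state t ω) (X.action t ω) - X.pay t i ω) +
        ∑ j : Fin (n + 1), (if j = 0 then 0 else 1) *
          (X.reward t j ω - M.reward j (X.state t ω) (X.action t ω))) =
      ∑ t ∈ Finset.Icc 1 T, ∑ i, bidderUtil X t i ω := fun ω =>
    Finset.sum_congr rfl fun t _ => by
      rw [Fin.sum_univ_succ]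
      simp only [if_true, zero_mul, zero_add, Fin.succ_ne_zero, if_false, one_mul, bidderUtil,
        Finset.sum_sub_distrib]
      ring
  simp only [heq] at h
  unfold regBID
  rw [htarget]
  linarith

/-- The expected utility of a bidder, in terms of a lower bound for her payoff in the stationary
phases. -/
theorem GoodRun.bidderUtil_ge (hr : GoodRun μ M X Q m G) (i : Fin n) (s₀ : S) {E v : ℝ}
    (hE : 0 ≤ E) (hv : v ≤ 2 * payoffCap n pr.cmax)
    (hval : ∀ ω ∈ G, ∀ k ≥ 1, v - E * estErr S A pr n k ≤
      avgPayoff M.trans s₀ (X.alloc (k + 1) ω) (netReward M X i k ω) -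
        pairing (X.occupEx (k + 1) i ω) (totalExcept (ucb pr (X.obs ω) k) i))
    {T : ℕ} (hT : 1 ≤ T) :
    T * v - (4 * E + 16) * 2 * payoffCap n pr.cmax * learnErr S A pr n T ≤
      ∫ ω, ∑ t ∈ Finset.Icc 1 T, bidderUtil X t i ω ∂μ[|G] := by
  have hp := hr.admissible
  have h := hr.integral_sum_ge s₀
    (w := fun t ω => M.reward i.succ (X.state t ω) (X.action t ω) - X.pay t i ω)
    (κ := fun j => if j = i.succ then 1 else 0) (N := 2) (E := E) (v := v)
    hE (by norm_num) (fun j => by split_ifs <;> simp)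
    (fun t ht => (hr.state_action_meas _ ht).sub (pay_meas hr.auction hr.follows hp ht i))
    (fun ω hω t ht => hr.abs_reward_sub_pay_le hω ht i) hv
    (fun k ω => netReward M X i k ω)
    (fun k ω => -pairing (X.occupEx (k + 1) i ω) (totalExcept (ucb pr (X.obs ω) k) i))
    (fun ω hω k _ s a => by
      have h1 := hr.netReward_mem hω i k s a
      rw [abs_of_nonneg h1.1]; exact h1.2)
    (fun ω hω k hk t ht => by rw [hr.reward_sub_pay_eq _ hk ht ω, sub_eq_add_neg])
    (fun ω hω k hk => by
      have h1 := hval ω hω k hk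
      have h2 : 0 ≤ estErr S A pr n k := hp.estErr_nonneg k
      nlinarith [mul_nonneg hE h2]) hT
  refine h.trans (le_of_eq (integral_congr_ae (Eventually.of_forall fun ω =>
    Finset.sum_congr rfl fun t _ => ?_)))
  simp only [ite_mul, one_mul, zero_mul, Finset.sum_ite_eq', Finset.mem_univ, if_true, bidderUtil]
  ring

/-- The expected utility of a bidder, in terms of an upper bound for her payoff in the stationary
phases. -/
theorem GoodRun.bidderUtil_le (hr : GoodRun μ M X Q m G) (i : Fin n) (s₀ : S) {E v : ℝ}
    (hE : 0 ≤ E) (hv : -v ≤ 2 * payoffCap n pr.cmax)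
    (hval : ∀ ω ∈ G, ∀ k ≥ 1, avgPayoff M.trans s₀ (X.alloc (k + 1) ω) (netReward M X i k ω) -
        pairing (X.occupEx (k + 1) i ω) (totalExcept (ucb pr (X.obs ω) k) i) ≤
          v + E * estErr S A pr n k)
    {T : ℕ} (hT : 1 ≤ T) :
    ∫ ω, ∑ t ∈ Finset.Icc 1 T, bidderUtil X t i ω ∂μ[|G] ≤
      T * v + (4 * E + 16) * 2 * payoffCap n pr.cmax * learnErr S A pr n T := by
  have hp := hr.admissible
  have h := hr.integral_sum_ge s₀
    (w := fun t ω => -(M.reward i.succ (X.state t ω) (X.action t ω) - X.pay t i ω))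
    (κ := fun j => if j = i.succ then -1 else 0) (N := 2) (E := E) (v := -v)
    hE (by norm_num) (fun j => by split_ifs <;> simp)
    (fun t ht => ((hr.state_action_meas _ ht).sub (pay_meas hr.auction hr.follows hp ht i)).neg)
    (fun ω hω t ht => by rw [abs_neg]; exact hr.abs_reward_sub_pay_le hω ht i) hv
    (fun k ω s a => -1 * netReward M X i k ω s a)
    (fun k ω => pairing (X.occupEx (k + 1) i ω) (totalExcept (ucb pr (X.obs ω) k) i))
    (fun ω hω k _ s a => by
      have h1 := hr.netReward_mem hω i k s a
      rw [abs_mul, abs_neg, abs_one, one_mul, abs_of_nonneg h1.1]; exact h1.2)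
    (fun ω hω k hk t ht => by rw [hr.reward_sub_pay_eq _ hk ht ω]; ring)
    (fun ω hω k hk => by
      rw [avgPayoff_mul hr.mixing (hr.follows.alloc_induced (k + 1) (by omega) ω).1 s₀]
      have h1 := hval ω hω k hk
      have h2 : 0 ≤ estErr S A pr n k := hp.estErr_nonneg k
      nlinarith [mul_nonneg hE h2]) hT
  have heq : ∀ ω, ∑ t ∈ Finset.Icc 1 T,
      (-(M.reward i.succ (X.state t ω) (X.action t ω) - X.pay t i ω) +
        ∑ j : Fin (n + 1), (if j = i.succ then -1 else 0) *
          (X.reward t j ω - M.reward j (X.state t ω) (X.action t ω))) =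
      -∑ t ∈ Finset.Icc 1 T, bidderUtil X t i ω := fun ω => by
    rw [← Finset.sum_neg_distrib]
    refine Finset.sum_congr rfl fun t _ => ?_
    simp only [ite_mul, neg_mul, one_mul, zero_mul, Finset.sum_ite_eq', Finset.mem_univ, if_true,
      bidderUtil]
    ring
  simp only [heq, integral_neg] at h
  linarith

/-- A truthful bidder does not lose, up to learning errors, whatever the others do. -/
theorem GoodRun.bidderUtil_nonneg (hr : GoodRun μ M X Q m G) {i : Fin n} (hi : Q i.succ)
    (hm : m i.succ = M.reward i.succ) {T : ℕ} (hT : 1 ≤ T) :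
    -(960 * payoffCap n pr.cmax * learnErr S A pr n T) ≤
      ∫ ω, ∑ t ∈ Finset.Icc 1 T, bidderUtil X t i ω ∂μ[|G] := by
  have hp := hr.admissible
  obtain ⟨s₀⟩ := ‹Nonempty S›
  have : Nonempty S := ⟨s₀⟩
  have hF : 0 ≤ payoffCap n pr.cmax := hp.payoffCap_nonneg
  have h := hr.bidderUtil_ge i s₀ (E := 116) (v := 0) (by norm_num) (by linarith)
    (fun ω hω k hk => by
      have h1 := hr.pairing_occup_le_netReward hi hm s₀ hω hk
      have h2 := hr.pairing_occupEx_le_pairing_occup hω hk i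
      linarith) hT
  linarith

/-- The utility of a bidder in the limit, if the reports of all others have the means `m` and she
is truthful. It is the externality in the constrained program for the true kernel. -/
noncomputable def externality (M : AuctionMDP S A n pr.cmax) (m : Fin (n + 1) → S → A → ℝ)
    (i : Fin n) : ℝ :=
  shrunkValue M.trans pr.delta (total m) - shrunkValue M.trans pr.delta (totalExcept m i)

theorem total_mem_of_ne {F : ℝ} {i : Fin n} (hm : m i.succ = M.reward i.succ)
    (h : ∀ j ≠ i.succ, ∀ s a, m j s a ∈ Set.Icc 0 (rewardCap pr.cmax j)) (hc : 0 ≤ pr.cmax)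
    (hn : 1 ≤ n) (hF : F = payoffCap n pr.cmax) (s : S) (a : A) :
    total m s a ∈ Set.Icc 0 F ∧ totalExcept m i s a ∈ Set.Icc 0 F := by
  have h1 : ∀ j, m j s a ∈ Set.Icc 0 (1 * rewardCap pr.cmax j) := fun j => by
    rw [one_mul]
    by_cases hj : j = i.succ
    · rw [hj, hm]; exact M.reward_mem _ s a
    · exact h j hj s a
  have h2 := total_mem hc hn zero_le_one h1
  have h3 := totalExcept_mem hc hn zero_le_one (i := i) fun j _ => h1 j
  rw [one_mul] at h2 h3
  rw [hF]
  exact ⟨h2, h3⟩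

/-- The means `m j` are only known through the confidence intervals, which hold on the nonempty
event `G`. -/
theorem GoodRun.mean_mem (hr : GoodRun μ M X Q m G) {j : Fin (n + 1)} (hj : Q j) (s : S) (a : A) :
    m j s a ∈ Set.Icc 0 (rewardCap pr.cmax j) := by
  have hG : G.Nonempty := by
    by_contra hcon
    have := hr.half
    rw [Set.not_nonempty_iff_eq_empty.1 hcon, measureReal_empty] at this
    norm_num at this
  obtain ⟨ω, hω⟩ := hG
  have hg := hr.good ω hω
  have h1 := hg.est 1 le_rfl j hj s a
  exact ⟨(hg.lcb_mem hr.admissible 1 j s a).1.trans h1.1,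
    h1.2.trans (hg.ucb_mem hr.admissible 1 j s a).2⟩

/-- A truthful bidder attains the externality, up to learning errors. -/
theorem GoodRun.externality_le (hr : GoodRun μ M X Q m G) {i : Fin n} (hQ : ∀ j, Q j)
    (hm : m i.succ = M.reward i.succ) {T : ℕ} (hT : 1 ≤ T) :
    T * externality M m i - (4 * (232 + 432 * Fintype.card A / pr.alpha) + 16) * 2 *
        payoffCap n pr.cmax * learnErr S A pr n T ≤
      ∫ ω, ∑ t ∈ Finset.Icc 1 T, bidderUtil X t i ω ∂μ[|G] := by
  have hp := hr.admissible
  obtain ⟨s₀⟩ := ‹Nonempty S›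
  have : Nonempty S := ⟨s₀⟩
  have hα := hp.alpha_pos
  have hmem := total_mem_of_ne hm (fun j _ => hr.mean_mem (hQ j)) hp.cmax_nonneg hr.players rfl
  have h1 := shrunkValue_mem hp hr.mixing fun s a => (hmem s a).1
  have h2 := shrunkValue_mem hp hr.mixing fun s a => (hmem s a).2
  refine hr.bidderUtil_ge i s₀ (by positivity)
    (by unfold externality; linarith [h1.1, h1.2, h2.1, h2.2]) (fun ω hω k hk => ?_) hT
  have hg := hr.good ω hω
  have h3 := hr.pairing_occup_le_netReward (hQ i.succ) hm s₀ hω hk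
  have h4 : shrunkValue M.trans pr.delta (total m) ≤ _ :=
    hg.shrunkValue_le hp hr.mixing (hr.follows.occup_succ k hk ω)
      fun s a => Finset.sum_le_sum fun j _ => (hg.est k hk j (hQ j) s a).2
  obtain ⟨π', hπ', h5⟩ := hr.exists_pairing_occupEx_le hω hk s₀ (i := i) fun j _ => hQ j
  have h6 := hg.avgPayoff_le_shrunkValue hp hr.mixing hr.players hk s₀
    (hg.lpChoice hp hr.mixing (hr.follows.occupEx_succ k hk i ω)).1 hπ' fun s a => (hmem s a).2
  rw [mul_assoc (432 * (Fintype.card A : ℝ) / pr.alpha)] at h6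
  unfold externality
  change _ ≤ _ + _ * estErr S A pr n k at h6
  linarith

/-- No behaviour of bidder `i` is worth more than the externality, up to learning errors. The
accuracy of the estimates is needed for the other players only: for a given policy, the reports of
`i` do not enter her utility, and her charge is bounded from below by optimism for the others. -/
theorem GoodRun.le_externality (hr : GoodRun μ M X Q m G) {i : Fin n} (hQ : ∀ j ≠ i.succ, Q j)
    (hm : m i.succ = M.reward i.succ) {T : ℕ} (hT : 1 ≤ T) :
    ∫ ω, ∑ t ∈ Finset.Icc 1 T, bidderUtil X t i ω ∂μ[|G] ≤
      T * externality M m i + (4 * (432 * Fintype.card A / pr.alpha) + 16) * 2 *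
        payoffCap n pr.cmax * learnErr S A pr n T := by
  have hp := hr.admissible
  obtain ⟨s₀⟩ := ‹Nonempty S›
  have : Nonempty S := ⟨s₀⟩
  have hα := hp.alpha_pos
  have hmem := total_mem_of_ne hm (fun j hj => hr.mean_mem (hQ j hj)) hp.cmax_nonneg
    hr.players rfl
  have h1 := shrunkValue_mem hp hr.mixing fun s a => (hmem s a).1
  have h2 := shrunkValue_mem hp hr.mixing fun s a => (hmem s a).2
  refine hr.bidderUtil_le i s₀ (by positivity)
    (by unfold externality; linarith [h1.1, h1.2, h2.1, h2.2]) (fun ω hω k hk => ?_) hT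
  have hg := hr.good ω hω
  have hi := hr.follows.alloc_induced (k + 1) (by omega) ω
  -- This is where the reports of `i` disappear: `netReward` contains her true reward.
  have h3 : avgPayoff M.trans s₀ (X.alloc (k + 1) ω) (netReward M X i k ω) ≤
      avgPayoff M.trans s₀ (X.alloc (k + 1) ω) (total m) := by
    refine avgPayoff_mono hr.mixing hi.1 s₀ fun s a => ?_
    rw [total_eq m i, netReward, hm]
    gcongr
    exact Finset.sum_le_sum fun j hj => (hg.est k hk j (hQ j (Finset.ne_of_mem_erase hj)) s a).1
  have h4 := hg.avgPayoff_le_shrunkValue hp hr.mixing hr.players hk s₀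
    (hg.lpChoice hp hr.mixing (hr.follows.occup_succ k hk ω)).1 hi fun s a => (hmem s a).1
  have h5 : shrunkValue M.trans pr.delta (totalExcept m i) ≤ _ :=
    hg.shrunkValue_le hp hr.mixing (hr.follows.occupEx_succ k hk i ω)
      fun s a => Finset.sum_le_sum fun j hj => (hg.est k hk j (hQ j (Finset.ne_of_mem_erase hj)) s a).2
  rw [mul_assoc (432 * (Fintype.card A : ℝ) / pr.alpha)] at h4
  unfold externality
  change _ ≤ _ + _ * estErr S A pr n k at h4
  linarith

theorem GoodRun.integrable_bidderUtil (hr : GoodRun μ M X Q m G) (i : Fin n) (T : ℕ) :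
    Integrable (fun ω => ∑ t ∈ Finset.Icc 1 T, bidderUtil X t i ω) μ[|G] := by
  have hp := hr.admissible
  have hμG : μ G ≠ 0 := by
    intro h0
    have hG := hr.half
    rw [measureReal_def, h0] at hG
    norm_num at hG
  have : IsProbabilityMeasure μ[|G] := cond_isProbabilityMeasure hμG
  refine integrable_finsetSum _ fun t ht => ?_
  have ht1 := (Finset.mem_Icc.1 ht).1
  refine Integrable.sub (integrable_cond ?_) ?_
  · refine integrable_of_bounded (C := rewardCap pr.cmax i.succ)
      ((hr.auction.reward_meas t ht1 i.succ).mono (hr.auction.post_le t) le_rfl) ?_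
    filter_upwards [hr.auction.reward_mem ht1 i.succ] with ω hω
    rw [abs_of_nonneg hω.1]; exact hω.2
  · refine integrable_of_bounded (C := payoffCap n pr.cmax)
      (pay_meas hr.auction hr.follows hp ht1 i) ?_
    filter_upwards [ae_cond_mem hr.meas] with ω hω using hr.abs_pay_le hω ht1 i

end Bounds

/-! ### The rate of the learning error -/

section Rate

variable {S A : Type*} [Fintype S] [Fintype A] [Nonempty S] [Nonempty A] {n : ℕ} {pr : Params}

/-- The rate `α ^ (-4/3) δ ^ (-1/3) |S| ^ (-1/2) T ^ (2/3)`, in terms of `v = (T α δ) ^ (1/3)`. -/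
noncomputable def baseRate (S : Type*) [Fintype S] (pr : Params) (v : ℝ) : ℝ :=
  v ^ 2 / (pr.alpha ^ 2 * pr.delta * √(Fintype.card S))

theorem Admissible.baseRate_eq (hp : Admissible S A pr) (T : ℕ) :
    baseRate S pr ((T * (pr.alpha * pr.delta)) ^ (1 / 3 : ℝ)) =
      pr.alpha ^ (-(4 / 3) : ℝ) * pr.delta ^ (-(1 / 3) : ℝ) *
        (Fintype.card S : ℝ) ^ (-(1 / 2) : ℝ) * (T : ℝ) ^ (2 / 3 : ℝ) := by
  have hα := hp.alpha_pos
  have hδ := hp.delta_pos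
  have hS : (0 : ℝ) < Fintype.card S := zero_lt_one.trans_le (one_le_card_cast S)
  have hT : (0 : ℝ) ≤ T := Nat.cast_nonneg T
  have h1 : ((T * (pr.alpha * pr.delta)) ^ (1 / 3 : ℝ)) ^ 2 =
      (T : ℝ) ^ (2 / 3 : ℝ) * (pr.alpha ^ (2 / 3 : ℝ) * pr.delta ^ (2 / 3 : ℝ)) := by
    rw [← Real.rpow_natCast, ← Real.rpow_mul (by positivity), Real.mul_rpow hT (by positivity),
      Real.mul_rpow hα.le hδ.le]
    norm_num
  have h2 : pr.alpha ^ (-(4 / 3) : ℝ) = pr.alpha ^ (2 / 3 : ℝ) / pr.alpha ^ 2 := by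
    rw [← Real.rpow_natCast, ← Real.rpow_sub hα]; norm_num
  have h3 : pr.delta ^ (-(1 / 3) : ℝ) = pr.delta ^ (2 / 3 : ℝ) / pr.delta := by
    rw [← Real.rpow_sub_one hδ.ne']; norm_num
  have h4 : (Fintype.card S : ℝ) ^ (-(1 / 2) : ℝ) = 1 / √(Fintype.card S) := by
    rw [Real.rpow_neg hS.le, Real.sqrt_eq_rpow, one_div, one_div]
  rw [baseRate, h1, h2, h3, h4]
  field_simp

/-- The number of episodes is of order `v ^ 2`, where `v = (T α δ) ^ (1/3)`. -/
theorem Admissible.sqrt_episode_le (hp : Admissible S A pr) {T : ℕ} (hT : 1 ≤ T) {v : ℝ}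
    (hv : 1 ≤ v) (hv3 : v ^ 3 = T * (pr.alpha * pr.delta)) :
    √(episode S A pr T : ℝ) ≤ 2 * v := by
  obtain ⟨hK, hmem⟩ := hp.episode_spec hT
  rw [Finset.mem_Ico] at hmem
  set K := episode S A pr T with hKdef
  obtain ⟨j, hj⟩ : ∃ j, K = j + 1 := ⟨K - 1, by omega⟩
  rw [hj] at hmem ⊢
  rcases Nat.eq_zero_or_pos j with rfl | hj0
  · simp only [zero_add, Nat.cast_one, Real.sqrt_one]; linarith
  have h1 := hp.mul_sqrt_le (K := j) (T := T) (by omega)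
  rw [← hv3] at h1
  set x := √(j : ℝ) with hx
  have hx0 : 0 ≤ x := Real.sqrt_nonneg _
  have hxx : x ^ 2 = j := Real.sq_sqrt (Nat.cast_nonneg j)
  have h2 : x ≤ v := by
    refine le_of_not_gt fun hcon => ?_
    have : v ^ 3 < x ^ 3 := pow_lt_pow_left₀ hcon (by linarith) (by norm_num)
    rw [← hxx] at h1
    nlinarith
  rw [Real.sqrt_le_left (by linarith)]
  have hj1 : (1 : ℝ) ≤ j := by exact_mod_cast hj0
  push_cast
  nlinarith

/-- Of the five parts of the learning error, only the fluctuations within the phases are of a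
larger order than the base rate. -/
theorem Admissible.learnErr_le (hp : Admissible S A pr) (hn : 1 ≤ n) {T : ℕ} (hT : 1 ≤ T) {v : ℝ}
    (hv : 1 ≤ v) (hv3 : v ^ 3 = T * (pr.alpha * pr.delta)) :
    learnErr S A pr n T ≤ 2 * (Fintype.card A * v * √T / pr.alpha) +
      12 * ((1 + rewLog S A pr n T) * baseRate S pr v) := by
  obtain ⟨hK, hmem⟩ := hp.episode_spec hT
  rw [Finset.mem_Ico] at hmem
  have hKT : episode S A pr T ≤ T := (hp.le_epStart hK).trans hmem.1
  have hsqrtK := hp.sqrt_episode_le hT hv hv3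
  set K := episode S A pr T with hKdef
  have hα := hp.alpha_pos
  have hδ := hp.delta_pos
  have hζ := hp.zeta_pos
  have hαδ := hp.mul_pos
  have hαδ1 := hp.mul_le_half
  have hS := one_le_card_cast S
  have hA := one_le_card_cast A
  have hsS : 1 ≤ √(Fintype.card S : ℝ) := Real.one_le_sqrt.2 hS
  have hαS := hp.mul_sqrt_card_le_one
  have hn' : (1 : ℝ) ≤ n := by exact_mod_cast hn
  have hK' : (1 : ℝ) ≤ K := by exact_mod_cast hK
  have hT' : (1 : ℝ) ≤ T := by exact_mod_cast hT
  have hKT' : (K : ℝ) ≤ T := by exact_mod_cast hKT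
  set U := baseRate S pr v with hU
  set L := 1 + rewLog S A pr n T with hL
  have hrewK : rewLog S A pr n K ≤ rewLog S A pr n T := by
    unfold rewLog
    exact Real.log_le_log (by positivity) (by gcongr)
  have hlogK : Real.log K ≤ rewLog S A pr n T := by
    refine (Real.log_le_log (by positivity) hKT').trans ?_
    unfold rewLog
    refine Real.log_le_log (by positivity) ?_
    rw [le_div_iff₀ hζ]
    have h1 : (1 : ℝ) ≤ Fintype.card A * Fintype.card S := one_le_mul_of_one_le_of_one_le hA hS
    have h2 : (T : ℝ) * pr.zeta ≤ T := mul_le_of_le_one_right (by linarith)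
      (hp.zeta_le.trans (by norm_num))
    have h3 : (T : ℝ) ≤ Fintype.card A * Fintype.card S * T := le_mul_of_one_le_left (by linarith) h1
    exact (h2.trans h3).trans (le_mul_of_one_le_right (by positivity) hn')
  have hrew4 := hp.four_le_rewLog hn hK
  have hlog1 : logTerm S A pr 1 ≤ rewLog S A pr n T :=
    (hp.logTerm_le_rewLog hn le_rfl).trans <| Real.log_le_log (by positivity) (by gcongr)
  have hL1 : 1 ≤ L := by linarith
  have hU1 : 1 / (pr.alpha * pr.delta) ≤ U := by
    rw [hU, baseRate, div_le_div_iff₀ hαδ (by positivity)]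
    have h1 : pr.alpha ^ 2 * pr.delta * √(Fintype.card S) =
        (pr.alpha * √(Fintype.card S)) * (pr.alpha * pr.delta) := by ring
    rw [h1, one_mul]
    gcongr
    nlinarith
  have hU2 : 2 ≤ U := le_trans (by rw [le_div_iff₀ hαδ]; linarith) hU1
  have hLU : U ≤ L * U := le_mul_of_one_le_left (by linarith) hL1
  -- the estimation errors
  have t1 : √(rewLog S A pr n K * T / (pr.alpha * pr.delta)) /
      (pr.alpha * √(Fintype.card S)) ≤ L * U := by
    have h1 : √(rewLog S A pr n K * T / (pr.alpha * pr.delta)) ≤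
        L * v ^ 2 / (pr.alpha * pr.delta) := by
      refine Real.sqrt_le_iff.2 ⟨by positivity, ?_⟩
      have h2 : rewLog S A pr n K * T / (pr.alpha * pr.delta) =
          rewLog S A pr n K * v ^ 3 / (pr.alpha * pr.delta) ^ 2 := by
        rw [hv3]; field_simp
      rw [h2, div_pow]
      gcongr
      have h3 : rewLog S A pr n K ≤ L ^ 2 := by nlinarith
      have h4 : v ^ 3 ≤ v ^ 4 := pow_le_pow_right₀ hv (by norm_num)
      calc rewLog S A pr n K * v ^ 3 ≤ L ^ 2 * v ^ 4 := by gcongr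
        _ = _ := by ring
    calc _ ≤ L * v ^ 2 / (pr.alpha * pr.delta) / (pr.alpha * √(Fintype.card S)) := by gcongr
      _ = L * U := by rw [hU, baseRate]; field_simp
  -- the fluctuations within the phases
  have t2 : Fintype.card A * √(K * T) / pr.alpha ≤ 2 * (Fintype.card A * v * √T / pr.alpha) := by
    rw [Real.sqrt_mul (by linarith)]
    calc Fintype.card A * (√K * √T) / pr.alpha ≤
        Fintype.card A * (2 * v * √T) / pr.alpha := by gcongr
      _ = _ := by ring
  -- the mixing phases
  have t3 : K * (1 + Real.log K) / (pr.alpha * Fintype.card S) ≤ 4 * (L * U) := by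
    have h1 : (K : ℝ) ≤ 4 * v ^ 2 := by
      rw [Real.sqrt_le_left (by linarith)] at hsqrtK
      linarith
    have h2 : (K : ℝ) * (1 + Real.log K) ≤ 4 * v ^ 2 * L := by
      have := Real.log_nonneg hK'
      gcongr
      linarith
    have h3 : pr.alpha ^ 2 * pr.delta * √(Fintype.card S) ≤ pr.alpha * Fintype.card S := by
      have h4 : √(Fintype.card S : ℝ) ≤ Fintype.card S := by
        rw [Real.sqrt_le_left (by linarith)]; nlinarith
      calc pr.alpha ^ 2 * pr.delta * √(Fintype.card S) =
          (pr.alpha * pr.delta) * (pr.alpha * √(Fintype.card S)) := by ring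
        _ ≤ 1 * (pr.alpha * Fintype.card S) := by gcongr; linarith
        _ = _ := one_mul _
    calc _ ≤ 4 * v ^ 2 * L / (pr.alpha ^ 2 * pr.delta * √(Fintype.card S)) := by gcongr
      _ = 4 * (L * U) := by rw [hU, baseRate]; ring
  -- the first episode
  have t4 : (epStart S A pr 2 : ℝ) ≤ 5 * (L * U) := by
    have h1 : epStart S A pr 2 = epStart S A pr 1 + mixLen S pr 1 + statLen S A pr 1 :=
      epStart_succ pr le_rfl
    have h2 : mixLen S pr 1 = 0 := by simp [mixLen]
    have h3 := hp.statLen_le le_rfl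
    have h4 : max 4 (√((1 : ℕ) : ℝ)) = 4 := by norm_num
    rw [epStart_one, h2] at h1
    rw [h4, mul_div_assoc] at h3
    rw [h1]
    push_cast
    have h5 : logTerm S A pr 1 / (pr.alpha * pr.delta) ≤ L * U := by
      rw [div_eq_mul_one_div]
      gcongr
      linarith
    rw [mul_div_assoc] at *
    linarith
  -- the fluctuations of the rewards
  have t5 : √(T : ℝ) ≤ L * U := by
    refine le_trans (Real.sqrt_le_iff.2 ⟨by linarith, ?_⟩) hLU
    have h1 : (T : ℝ) = v ^ 3 * (1 / (pr.alpha * pr.delta)) := by rw [hv3]; field_simp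
    have h2 : v ^ 2 * (1 / (pr.alpha * pr.delta)) ≤ U := by
      rw [hU, baseRate, mul_one_div]
      refine div_le_div_of_nonneg_left (by positivity) (by positivity) ?_
      calc pr.alpha ^ 2 * pr.delta * √(Fintype.card S) =
          (pr.alpha * √(Fintype.card S)) * (pr.alpha * pr.delta) := by ring
        _ ≤ 1 * (pr.alpha * pr.delta) := by gcongr
        _ = _ := one_mul _
    have h3 : 1 ≤ 1 / (pr.alpha * pr.delta) := by rw [le_div_iff₀ hαδ]; linarith
    calc (T : ℝ) = v ^ 3 * (1 / (pr.alpha * pr.delta)) := h1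
      _ ≤ v ^ 4 * (1 / (pr.alpha * pr.delta)) ^ 2 := by
        exact mul_le_mul (pow_le_pow_right₀ hv (by norm_num)) (le_self_pow₀ h3 two_ne_zero)
          (by positivity) (by positivity)
      _ = (v ^ 2 * (1 / (pr.alpha * pr.delta))) ^ 2 := by ring
      _ ≤ U ^ 2 := by gcongr
  unfold learnErr
  rw [← hKdef]
  linarith

/-- The choice of `δ` makes the fluctuations within the phases a lower order term. -/
theorem Admissible.learnErr_le_rate (hp : Admissible S A pr) (hn : 1 ≤ n) {ε : ℝ} (hε : 0 < ε)
    (hε1 : ε ≤ 1) (hδ : pr.delta ≤ (ε / (Fintype.card S * Fintype.card A)) ^ 2) {T : ℕ}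
    (hT : 8 / (pr.alpha * pr.delta) * Real.log (Fintype.card A * Fintype.card S / pr.zeta) ≤ T) :
    learnErr S A pr n T ≤ ε * T + 13 * ((1 + rewLog S A pr n T) *
      baseRate S pr ((T * (pr.alpha * pr.delta)) ^ (1 / 3 : ℝ))) := by
  have hα := hp.alpha_pos
  have hδ0 := hp.delta_pos
  have hαδ := hp.mul_pos
  have hαδ1 := hp.mul_le_half
  have hS := one_le_card_cast S
  have hA := one_le_card_cast A
  have hsS : 1 ≤ √(Fintype.card S : ℝ) := Real.one_le_sqrt.2 hS
  have hy : 32 ≤ T * (pr.alpha * pr.delta) := by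
    have h1 := hp.four_le_logTerm (k := 1) le_rfl
    simp only [logTerm, Nat.cast_one, mul_one] at h1
    rw [div_mul_eq_mul_div, div_le_iff₀ hαδ] at hT
    linarith
  have hT0 : (1 : ℝ) ≤ T := by nlinarith [Nat.cast_nonneg (α := ℝ) T]
  have hT1 : 1 ≤ T := by exact_mod_cast hT0
  set v := (T * (pr.alpha * pr.delta)) ^ (1 / 3 : ℝ) with hvdef
  have hv : 1 ≤ v := Real.one_le_rpow (by linarith) (by norm_num)
  have hv3 : v ^ 3 = T * (pr.alpha * pr.delta) := by
    rw [hvdef, ← Real.rpow_natCast, ← Real.rpow_mul (by positivity)]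
    norm_num
  refine (hp.learnErr_le hn hT1 hv hv3).trans ?_
  have hU0 : 0 ≤ baseRate S pr v := by unfold baseRate; positivity
  have hlog : 0 ≤ rewLog S A pr n T := by linarith [hp.four_le_rewLog hn hT1]
  have h1 : (Fintype.card A * v / pr.alpha) ^ 2 ≤ ε * baseRate S pr v := by
    have h2 : (Fintype.card A : ℝ) ^ 2 * (pr.delta * √(Fintype.card S)) ≤ ε := by
      have h4 : √(Fintype.card S : ℝ) ≤ Fintype.card S ^ 2 := by
        rw [Real.sqrt_le_left (by positivity)]
        exact (le_self_pow₀ hS (by norm_num : 4 ≠ 0)).trans (le_of_eq (by ring))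
      calc (Fintype.card A : ℝ) ^ 2 * (pr.delta * √(Fintype.card S)) ≤
          (Fintype.card A : ℝ) ^ 2 * ((ε / (Fintype.card S * Fintype.card A)) ^ 2 *
            Fintype.card S ^ 2) := by gcongr
        _ = ε ^ 2 := by field_simp
        _ ≤ ε := by nlinarith
    rw [baseRate, div_pow, mul_div_assoc', div_le_div_iff₀ (by positivity) (by positivity)]
    calc ((Fintype.card A : ℝ) * v) ^ 2 * (pr.alpha ^ 2 * pr.delta * √(Fintype.card S)) =
        (Fintype.card A ^ 2 * (pr.delta * √(Fintype.card S))) * (v ^ 2 * pr.alpha ^ 2) := by ring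
      _ ≤ ε * (v ^ 2 * pr.alpha ^ 2) := by gcongr
      _ = _ := by ring
  -- the geometric mean of `ε T` and the base rate
  have h2 : 2 * (Fintype.card A * v * √T / pr.alpha) ≤ ε * T + baseRate S pr v := by
    have h3 : Fintype.card A * v * √T / pr.alpha = (Fintype.card A * v / pr.alpha) * √T := by ring
    have h4 : (Fintype.card A * v / pr.alpha * √T) ^ 2 ≤ ε * T * baseRate S pr v := by
      rw [mul_pow, Real.sq_sqrt (by linarith)]
      nlinarith
    rw [h3]
    refine abs_le_of_sq_le_sq' ?_ (by positivity) |>.2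
    nlinarith [sq_nonneg (ε * T - baseRate S pr v)]
  nlinarith [mul_nonneg hlog hU0]

theorem Admissible.tendsto_learnErr (hp : Admissible S A pr) (hn : 1 ≤ n) :
    Tendsto (fun T : ℕ => 1 / (T : ℝ) * learnErr S A pr n T) atTop (𝓝 0) := by
  have hα := hp.alpha_pos
  have hδ := hp.delta_pos
  have hζ := hp.zeta_pos
  have hαδ := hp.mul_pos
  have hS := one_le_card_cast S
  have hA := one_le_card_cast A
  have hn' : (1 : ℝ) ≤ n := by exact_mod_cast hn
  set θ := (pr.alpha * pr.delta) ^ (1 / 3 : ℝ) with hθ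
  set c := Real.log (Fintype.card A * Fintype.card S * n / pr.zeta) with hc
  -- up to constants, the bounds for the two parts of the error, divided by the number of rounds
  have hlim : Tendsto (fun x : ℝ => 2 * (Fintype.card A * θ / pr.alpha) * x ^ (-(1 / 6) : ℝ) +
      12 * baseRate S pr θ * ((1 + c) * x ^ (-(1 / 3) : ℝ) + Real.log x * x ^ (-(1 / 3) : ℝ)))
      atTop (𝓝 0) := by
    have h1 : Tendsto (fun x : ℝ => x ^ (-(1 / 6) : ℝ)) atTop (𝓝 0) :=
      tendsto_rpow_neg_atTop (by norm_num)
    have h2 : Tendsto (fun x : ℝ => x ^ (-(1 / 3) : ℝ)) atTop (𝓝 0) :=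
      tendsto_rpow_neg_atTop (by norm_num)
    have h3 : Tendsto (fun x : ℝ => Real.log x * x ^ (-(1 / 3) : ℝ)) atTop (𝓝 0) := by
      refine ((isLittleO_log_rpow_atTop (by norm_num : (0 : ℝ) < 1 / 3)).tendsto_div_nhds_zero).congr'
        ?_
      filter_upwards [eventually_gt_atTop 0] with x hx
      rw [Real.rpow_neg hx.le, div_eq_mul_inv]
    have h4 := (h1.const_mul (2 * (Fintype.card A * θ / pr.alpha))).add
      (((h2.const_mul (1 + c)).add h3).const_mul (12 * baseRate S pr θ))
    simpa using h4
  have hlim' := hlim.comp (tendsto_natCast_atTop_atTop (R := ℝ))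
  have hev : ∀ᶠ T : ℕ in atTop, 1 ≤ T * (pr.alpha * pr.delta) := by
    have := (tendsto_natCast_atTop_atTop (R := ℝ)).eventually_ge_atTop (1 / (pr.alpha * pr.delta))
    filter_upwards [this] with T hT
    rwa [div_le_iff₀ hαδ] at hT
  refine squeeze_zero' (g := fun T : ℕ =>
      2 * (Fintype.card A * θ / pr.alpha) * (T : ℝ) ^ (-(1 / 6) : ℝ) +
      12 * baseRate S pr θ * ((1 + c) * (T : ℝ) ^ (-(1 / 3) : ℝ) +
        Real.log T * (T : ℝ) ^ (-(1 / 3) : ℝ))) ?_ ?_ hlim'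
  · filter_upwards with T
    have h1 := Real.log_natCast_nonneg (episode S A pr T)
    unfold learnErr
    positivity
  · filter_upwards [hev, eventually_ge_atTop 1] with T hy hT
    have hT0 : (0 : ℝ) < T := by exact_mod_cast hT
    set v := (T * (pr.alpha * pr.delta)) ^ (1 / 3 : ℝ) with hvdef
    have hv : 1 ≤ v := Real.one_le_rpow hy (by norm_num)
    have hv3 : v ^ 3 = T * (pr.alpha * pr.delta) := by
      rw [hvdef, ← Real.rpow_natCast, ← Real.rpow_mul (by positivity)]
      norm_num
    have hvθ : v = (T : ℝ) ^ (1 / 3 : ℝ) * θ := by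
      rw [hvdef, Real.mul_rpow hT0.le hαδ.le]
    have hlog : rewLog S A pr n T = c + Real.log T := by
      rw [rewLog, hc, ← Real.log_mul (by positivity) hT0.ne']
      congr 1
      field_simp
    have h1 := hp.learnErr_le hn hT hv hv3
    have h2 : 1 / (T : ℝ) * ((T : ℝ) ^ (1 / 3 : ℝ) * √T) = (T : ℝ) ^ (-(1 / 6) : ℝ) := by
      rw [Real.sqrt_eq_rpow, ← Real.rpow_add hT0, one_div, ← Real.rpow_neg_one,
        ← Real.rpow_add hT0]
      norm_num
    have h3 : 1 / (T : ℝ) * baseRate S pr v = baseRate S pr θ * (T : ℝ) ^ (-(1 / 3) : ℝ) := by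
      have h4 : 1 / (T : ℝ) * ((T : ℝ) ^ (1 / 3 : ℝ)) ^ 2 = (T : ℝ) ^ (-(1 / 3) : ℝ) := by
        rw [← Real.rpow_natCast, ← Real.rpow_mul hT0.le, one_div, ← Real.rpow_neg_one,
          ← Real.rpow_add hT0]
        norm_num
      rw [← h4, baseRate, baseRate, hvθ]
      ring
    calc 1 / (T : ℝ) * learnErr S A pr n T ≤
        1 / (T : ℝ) * (2 * (Fintype.card A * v * √T / pr.alpha) +
          12 * ((1 + rewLog S A pr n T) * baseRate S pr v)) := by gcongr
      _ = 2 * (Fintype.card A * θ / pr.alpha) * (1 / (T : ℝ) * ((T : ℝ) ^ (1 / 3 : ℝ) * √T)) +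
          12 * (1 + rewLog S A pr n T) * (1 / (T : ℝ) * baseRate S pr v) := by
        rw [hvθ]; ring
      _ = _ := by rw [h2, h3, hlog]; ring

/-- The loss from the constraint on the occupancy measures is of order `ε`. -/
theorem Admissible.shrinkLoss_le (hp : Admissible S A pr) {ε : ℝ}
    (hε : 0 < ε) (hε1 : ε ≤ 1) (hδ : pr.delta ≤ (ε * pr.alpha / Fintype.card A) ^ 2) :
    shrinkLoss A pr n ≤ 4 * payoffCap n pr.cmax * ε := by
  have hα := hp.alpha_pos
  have hα1 := hp.alpha_le_one
  have hA := one_le_card_cast A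
  have hF : 0 ≤ payoffCap n pr.cmax := hp.payoffCap_nonneg
  have h1 : Fintype.card A / pr.alpha * pr.delta ≤ ε := by
    calc Fintype.card A / pr.alpha * pr.delta ≤
        Fintype.card A / pr.alpha * (ε * pr.alpha / Fintype.card A) ^ 2 := by gcongr
      _ = ε * (ε * pr.alpha / Fintype.card A) := by field_simp
      _ ≤ ε * 1 := by
        gcongr
        rw [div_le_one (by linarith)]
        nlinarith
      _ = ε := mul_one ε
  calc shrinkLoss A pr n = 4 * payoffCap n pr.cmax * (Fintype.card A / pr.alpha * pr.delta) := by
        rw [shrinkLoss]; ring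
    _ ≤ _ := by gcongr

end Rate

/-! ### The guarantees of the mechanism -/

section Guarantees

variable {Ω : Type*} [mΩ : MeasurableSpace Ω] {μ : Measure Ω} [IsProbabilityMeasure μ]
  {S A : Type*} [Fintype S] [Fintype A] [Nonempty S] [Nonempty A] {n : ℕ} {pr : Params}
  {M : AuctionMDP S A n pr.cmax} {X Y : OnlineProcess S A n Ω}
  {Q : Fin (n + 1) → Prop} {m : Fin (n + 1) → S → A → ℝ} {G : Set Ω}

/-- The set of bad outcomes need not be measurable, so the event is the complement of its measurable
hull. -/
theorem exists_good_event (hX : IsOnlineAuction M μ X) (hf : FollowsIHMDPVCG pr μ X)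
    (hp : Admissible S A pr) (hP : IsMixing M.trans pr.alpha) (hn : 1 ≤ n)
    (hm : ∀ j, Q j → HasMean μ X (report X j) (rewardCap pr.cmax j) (m j)) :
    ∃ G : Set Ω, MeasurableSet G ∧
      1 - failConst * (pr.zeta * (1 + sizeLog S A pr) ^ 2) ≤ μ.real G ∧
      ∀ ω ∈ G, GoodPath pr M.trans (X.obs ω) Q m := by
  refine ⟨(toMeasurable μ {ω | ¬ GoodPath pr M.trans (X.obs ω) Q m})ᶜ,
    (measurableSet_toMeasurable _ _).compl, ?_, fun ω hω => ?_⟩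
  · have h := measure_not_goodPath_le hX hf hp hP hn hm
    rw [probReal_compl_eq_one_sub (measurableSet_toMeasurable _ _), measureReal_def,
      measure_toMeasurable, ← measureReal_def]
    linarith
  · by_contra hcon
    exact hω (subset_toMeasurable μ _ hcon)

/-- The factor four leaves room for two runs and makes the probability of the event at least
`1 / 2`. -/
theorem exists_goodRun (hX : IsOnlineAuction M μ X) (hf : FollowsIHMDPVCG pr μ X)
    (hp : Admissible S A pr) (hP : IsMixing M.trans pr.alpha) (hn : 1 ≤ n)
    (hm : ∀ j, Q j → HasMean μ X (report X j) (rewardCap pr.cmax j) (m j)) {x : ℝ} (hx : x < 1)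
    (hfail : 4 * (failConst * (pr.zeta * (1 + sizeLog S A pr) ^ 2)) ≤ x) :
    ∃ G : Set Ω, 1 - x ≤ μ.real G ∧ GoodRun μ M X Q m G := by
  obtain ⟨G, hG, hG1, hgood⟩ := exists_good_event hX hf hp hP hn hm
  have h0 : 0 ≤ failConst * (pr.zeta * (1 + sizeLog S A pr) ^ 2) :=
    mul_nonneg failConst_nonneg (mul_nonneg hp.zeta_pos.le (sq_nonneg _))
  exact ⟨G, by linarith, hX, hf, hp, hP, hn, hG, by linarith, hgood⟩

/-- A common event for two runs on the same probability space, in which the reports have the same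
means `m`. -/
theorem exists_goodRun_pair {Q' : Fin (n + 1) → Prop}
    (hX : IsOnlineAuction M μ X) (hf : FollowsIHMDPVCG pr μ X)
    (hY : IsOnlineAuction M μ Y) (hf' : FollowsIHMDPVCG pr μ Y)
    (hp : Admissible S A pr) (hP : IsMixing M.trans pr.alpha) (hn : 1 ≤ n)
    (hm : ∀ j, Q j → HasMean μ X (report X j) (rewardCap pr.cmax j) (m j))
    (hm' : ∀ j, Q' j → HasMean μ Y (report Y j) (rewardCap pr.cmax j) (m j)) {x : ℝ} (hx : x < 1)
    (hfail : 4 * (failConst * (pr.zeta * (1 + sizeLog S A pr) ^ 2)) ≤ x) :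
    ∃ G : Set Ω, 1 - x ≤ μ.real G ∧ GoodRun μ M X Q m G ∧ GoodRun μ M Y Q' m G := by
  obtain ⟨G₁, hG₁, h₁, hgood₁⟩ := exists_good_event hX hf hp hP hn hm
  obtain ⟨G₂, hG₂, h₂, hgood₂⟩ := exists_good_event hY hf' hp hP hn hm'
  have h0 : 0 ≤ failConst * (pr.zeta * (1 + sizeLog S A pr) ^ 2) :=
    mul_nonneg failConst_nonneg (mul_nonneg hp.zeta_pos.le (sq_nonneg _))
  have h3 : 1 - 2 * (failConst * (pr.zeta * (1 + sizeLog S A pr) ^ 2)) ≤ μ.real (G₁ ∩ G₂) := by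
    have h4 := measureReal_union_add_inter (μ := μ) (s := G₁) hG₂
    have h5 : μ.real (G₁ ∪ G₂) ≤ 1 := measureReal_le_one
    linarith
  exact ⟨G₁ ∩ G₂, by linarith,
    ⟨hX, hf, hp, hP, hn, hG₁.inter hG₂, by linarith, fun ω hω => hgood₁ ω hω.1⟩,
    ⟨hY, hf', hp, hP, hn, hG₁.inter hG₂, by linarith, fun ω hω => hgood₂ ω hω.2⟩⟩

theorem Admissible.eventually_learnErr_le (hp : Admissible S A pr) (hn : 1 ≤ n) (B : ℝ) {η : ℝ}
    (hη : 0 < η) : ∀ᶠ T : ℕ in atTop, 1 ≤ T ∧ B * learnErr S A pr n T ≤ η * T := by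
  have h := ((hp.tendsto_learnErr hn).const_mul B).eventually_le_const
    (u := η) (by rw [mul_zero]; exact hη)
  filter_upwards [h, eventually_ge_atTop 1] with T hT hT1
  have hT0 : (0 : ℝ) < T := by exact_mod_cast hT1
  refine ⟨hT1, ?_⟩
  rw [← div_le_iff₀ hT0]
  refine le_trans (le_of_eq ?_) hT
  ring

/-- The loss from the constraint on the occupancy measures and the learning error, in terms of the
rate of the theorem. -/
theorem Admissible.rate_le (hp : Admissible S A pr) (hn : 1 ≤ n) {ε : ℝ} (hε : 0 < ε)
    (hε1 : ε ≤ 1) (hδ : pr.delta ≤ (ε * pr.alpha / (Fintype.card S * Fintype.card A)) ^ 2) {T : ℕ}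
    (hT : 8 / (pr.alpha * pr.delta) * Real.log (Fintype.card A * Fintype.card S / pr.zeta) ≤ T)
    {k B : ℝ} (hk : 0 ≤ k) (hB0 : 0 ≤ B) (hB : B ≤ 960) :
    T * (k * shrinkLoss A pr n) + B * k * payoffCap n pr.cmax * learnErr S A pr n T ≤
      20000 * (pr.cmax + 1) * (1 + rewLog S A pr n T) ^ 2 *
        regretRate S ε pr.alpha pr.delta T (k * n) := by
  have hα := hp.alpha_pos
  have hα1 := hp.alpha_le_one
  have hδ0 := hp.delta_pos
  have hS := one_le_card_cast S
  have hA := one_le_card_cast A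
  have hF : 0 ≤ payoffCap n pr.cmax := hp.payoffCap_nonneg
  have h1 := hp.shrinkLoss_le (n := n) hε hε1 (hδ.trans (by
    gcongr
    exact le_mul_of_one_le_left (by linarith) hS))
  have h2 := hp.learnErr_le_rate hn hε hε1 (hδ.trans (by
    gcongr
    exact mul_le_of_le_one_right hε.le hα1)) hT
  have hT1 : (0 : ℝ) ≤ T := Nat.cast_nonneg T
  have hL0 : 0 ≤ rewLog S A pr n T := by
    rcases Nat.eq_zero_or_pos T with rfl | h
    · simp [rewLog]
    · linarith [hp.four_le_rewLog hn h]
  set U := baseRate S pr ((T * (pr.alpha * pr.delta)) ^ (1 / 3 : ℝ)) with hU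
  have hU0 : 0 ≤ U := by rw [hU, baseRate]; positivity
  set L := 1 + rewLog S A pr n T with hL
  have hrate : regretRate S ε pr.alpha pr.delta T (k * n) = (ε * T + U) * (k * n) := by
    rw [regretRate, hU, hp.baseRate_eq T]; ring
  have h3 : learnErr S A pr n T ≤ 13 * L ^ 2 * (ε * T + U) := by
    have h4 : 1 ≤ L ^ 2 := one_le_pow₀ (by linarith)
    have h5 : L ≤ L ^ 2 := le_self_pow₀ (by linarith) (by norm_num)
    have h6 : ε * T ≤ L ^ 2 * (ε * T) := le_mul_of_one_le_left (by positivity) h4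
    have h7 : L * U ≤ L ^ 2 * U := by gcongr
    have h8 : 0 ≤ L ^ 2 * (ε * T) := by positivity
    linarith
  have h9 : T * shrinkLoss A pr n ≤ 4 * payoffCap n pr.cmax * (L ^ 2 * (ε * T + U)) := by
    have h4 : 1 ≤ L ^ 2 := one_le_pow₀ (by linarith)
    calc T * shrinkLoss A pr n ≤ T * (4 * payoffCap n pr.cmax * ε) := by gcongr
      _ = 4 * payoffCap n pr.cmax * (ε * T) := by ring
      _ ≤ _ := by
        refine mul_le_mul_of_nonneg_left ?_ (by positivity)
        exact (le_add_of_nonneg_right hU0).trans (le_mul_of_one_le_left (by positivity) h4)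
  rw [hrate]
  calc _ = k * (T * shrinkLoss A pr n) +
        B * (k * payoffCap n pr.cmax * learnErr S A pr n T) := by ring
    _ ≤ k * (4 * payoffCap n pr.cmax * (L ^ 2 * (ε * T + U))) +
        B * (k * payoffCap n pr.cmax * (13 * L ^ 2 * (ε * T + U))) := by gcongr
    _ ≤ k * (4 * payoffCap n pr.cmax * (L ^ 2 * (ε * T + U))) +
        960 * (k * payoffCap n pr.cmax * (13 * L ^ 2 * (ε * T + U))) := by gcongr
    _ = 12484 * (payoffCap n pr.cmax * L ^ 2 * ((ε * T + U) * k)) := by ring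
    _ ≤ 20000 * (payoffCap n pr.cmax * L ^ 2 * ((ε * T + U) * k)) := by gcongr; norm_num
    _ = _ := by rw [payoffCap]; ring

theorem GoodRun.approxEfficient (hr : GoodRun μ M X Q M.reward G) (hQ : ∀ j, Q j) {s₀ : S}
    {π : S → A → ℝ} (hπ : IsOptimalPolicy M.trans s₀ (total M.reward) π) :
    ApproxEfficient μ[|G] X M s₀ π (shrinkLoss A pr n) := by
  intro η hη
  filter_upwards [hr.admissible.eventually_learnErr_le hr.players
    (480 * payoffCap n pr.cmax) hη] with T hT
  have hT0 : (0 : ℝ) < T := by exact_mod_cast hT.1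
  have h := hr.regSW_le hQ hπ hT.1
  rw [one_div_mul_eq_div, div_le_iff₀ hT0]
  linarith [hT.2]

theorem GoodRun.approxRational (hr : GoodRun μ M X Q m G) {i : Fin n} (hi : Q i.succ)
    (hm : m i.succ = M.reward i.succ) : ApproxRational μ[|G] X i := by
  intro η hη
  filter_upwards [hr.admissible.eventually_learnErr_le hr.players
    (960 * payoffCap n pr.cmax) hη] with T hT
  have hT0 : (0 : ℝ) < T := by exact_mod_cast hT.1
  have h := hr.bidderUtil_nonneg hi hm hT.1
  rw [one_div_mul_eq_div, le_div_iff₀ hT0]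
  linarith [hT.2]

/-- If the reports of all others have the same means in both runs, then a truthful bidder attains
the externality in the limit, and no other behaviour is worth more. -/
theorem GoodRun.approxTruthful {Q' : Fin (n + 1) → Prop} {i : Fin n}
    (hr : GoodRun μ M X Q m G) (hQ : ∀ j, Q j) (hr' : GoodRun μ M Y Q' m G)
    (hQ' : ∀ j ≠ i.succ, Q' j) (hm : m i.succ = M.reward i.succ) :
    ApproxTruthful μ[|G] X Y i := by
  intro η hη
  filter_upwards [hr.admissible.eventually_learnErr_le hr.players
    ((4 * (232 + 432 * Fintype.card A / pr.alpha) + 16) * 2 * payoffCap n pr.cmax +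
      (4 * (432 * Fintype.card A / pr.alpha) + 16) * 2 * payoffCap n pr.cmax) hη] with T hT
  have hT0 : (0 : ℝ) < T := by exact_mod_cast hT.1
  have h1 := hr.externality_le hQ hm hT.1
  have h2 := hr'.le_externality hQ' hm hT.1
  simp only [Finset.sum_sub_distrib]
  rw [integral_sub (hr'.integrable_bidderUtil i T) (hr.integrable_bidderUtil i T),
    one_div_mul_eq_div, div_le_iff₀ hT0]
  linarith [hT.2]

/-- The constraints on `δ` and on the failure probability make the parameters admissible: if the
failure probability is below one, then `ζ` is small. -/
theorem admissible_of_lt_one {C ε : ℝ} (hC : 100 ≤ C) (hε : 0 < ε) (hε1 : ε ≤ 1)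
    (hα : 0 < pr.alpha) (hαS : pr.alpha * Fintype.card S ≤ 1) (hδ0 : 0 < pr.delta)
    (hδ : pr.delta ≤ (ε * pr.alpha / (128 * (Fintype.card S * Fintype.card A * n))) ^ 2)
    (hn : 1 ≤ n) (hζ : 0 < pr.zeta) (hc : 0 ≤ pr.cmax)
    (hx : C * pr.zeta * (1 + sizeLog S A pr) ^ 2 < 1) : Admissible S A pr := by
  have hS := one_le_card_cast S
  have hA := one_le_card_cast A
  have hn' : (1 : ℝ) ≤ n := by exact_mod_cast hn
  have hα1 : pr.alpha ≤ 1 := (le_mul_of_one_le_right hα.le hS).trans hαS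
  have hδα : pr.delta ≤ pr.alpha / (2 * Fintype.card A) := by
    refine hδ.trans ?_
    have h1 : ε * pr.alpha / (128 * (Fintype.card S * Fintype.card A * n)) ≤
        pr.alpha / (2 * Fintype.card A) := by
      gcongr ?_ / ?_
      · exact mul_le_of_le_one_left hα.le hε1
      · have h2 : (Fintype.card A : ℝ) ≤ Fintype.card S * Fintype.card A * n :=
          (le_mul_of_one_le_left (by linarith) hS).trans
            (le_mul_of_one_le_right (by positivity) hn')
        linarith
    have h2 : pr.alpha / (2 * Fintype.card A) ≤ 1 := by
      rw [div_le_one (by linarith)]; linarith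
    have h3 : 0 ≤ ε * pr.alpha / (128 * (Fintype.card S * Fintype.card A * n)) := by positivity
    nlinarith
  have hsize : 0 ≤ sizeLog S A pr := by
    refine Real.log_nonneg ?_
    have h1 : pr.alpha / (2 * Fintype.card A) ≤ 1 := by
      rw [div_le_one (by linarith)]; linarith
    rw [one_le_div (by positivity)]
    nlinarith
  refine ⟨hα, hαS, hδ0, hδα, hζ, ?_, hc⟩
  have h2 : 1 ≤ (1 + sizeLog S A pr) ^ 2 := one_le_pow₀ (by linarith)
  have h3 : C * pr.zeta ≤ C * pr.zeta * (1 + sizeLog S A pr) ^ 2 :=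
    le_mul_of_one_le_right (by positivity) h2
  nlinarith

end Guarantees

end DynVCG

theorem mainTheorem2 :
    ∃ D : ℚ≥0 × ℚ≥0 × ℕ × ℕ × ℕ → ℚ≥0, PolyTimeComputable D ∧
    ∀ cmax : ℝ, 0 ≤ cmax → ∃ C : ℝ, 0 < C ∧ ∃ m : ℕ,
    ∀ (S A : Type*) [Fintype S] [Fintype A] [Nonempty S] [Nonempty A] (n : ℕ), 1 ≤ n →
    ∀ (ε α ζ : ℝ), 0 < ε → ε < 1 → 0 < α → 0 < ζ → ζ < 1 →
    ∀ (ε₀ α₀ : ℚ≥0), 0 < ε₀ → (ε₀ : ℝ) ≤ ε → 0 < α₀ → (α₀ : ℝ) ≤ α →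
    ∀ δ : ℝ, δ = (D (ε₀, α₀, Fintype.card S, Fintype.card A, n) : ℝ) →
    -- the failure probability
    ∀ x : ℝ, x = C * ζ * (1 + Real.log (Fintype.card A * Fintype.card S / (α * δ))) ^ m →
    ∀ M : AuctionMDP S A n cmax, (∀ s a s', α ≤ M.trans s a s') →
    (0 < δ ∧ δ < 1) ∧
    -- all bidders truthful: the three regrets, and approximate efficiency
    (∀ (Ω : Type*) [MeasurableSpace Ω] (μ : Measure Ω) [IsProbabilityMeasure μ]
      (X : OnlineProcess S A n Ω), IsOnlineAuction M μ X → FollowsIHMDPVCG ⟨α, δ, ζ, cmax⟩ μ X →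
      (∀ i, IsTruthful X i) →
      WithFailure μ x fun ν => ∀ s₀ π πEx p, IsOfflineVCG M s₀ π πEx p →
        (∀ T : ℕ, 8 / (α * δ) * Real.log (Fintype.card A * Fintype.card S / ζ) ≤ T →
          ∀ L : ℝ, L = (1 + Real.log (Fintype.card A * Fintype.card S * T * n / ζ)) ^ m →
            regSW ν X M s₀ π T ≤ C * L * regretRate S ε α δ T n ∧
            regSELL ν X M s₀ π p T ≤ C * L * regretRate S ε α δ T (n ^ 2) ∧
            regBID ν X M s₀ π p T ≤ C * L * regretRate S ε α δ T (n ^ 2)) ∧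
        ApproxEfficient ν X M s₀ π (C * n * ε)) ∧
    -- bidder `i` truthful, the others arbitrary: approximate individual rationality
    (∀ (Ω : Type*) [MeasurableSpace Ω] (μ : Measure Ω) [IsProbabilityMeasure μ]
      (X : OnlineProcess S A n Ω), IsOnlineAuction M μ X → FollowsIHMDPVCG ⟨α, δ, ζ, cmax⟩ μ X →
      ∀ i, IsTruthful X i → WithFailure μ x fun ν => ApproxRational ν X i) ∧
    -- bidder `i` truthful in `X` and arbitrary in `Y`, the others stationary, with the same
    -- strategies in both runs: approximate truthfulness
    (∀ (Ω : Type*) [MeasurableSpace Ω] (μ : Measure Ω) [IsProbabilityMeasure μ]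
      (X Y : OnlineProcess S A n Ω),
      IsOnlineAuction M μ X → FollowsIHMDPVCG ⟨α, δ, ζ, cmax⟩ μ X →
      IsOnlineAuction M μ Y → FollowsIHMDPVCG ⟨α, δ, ζ, cmax⟩ μ Y →
      ∀ i, IsTruthful X i →
      ∀ B : Fin n → S → A → Measure ℝ, (∀ j s a, IsProbabilityMeasure (B j s a)) →
      (∀ j, j ≠ i → IsStationaryBidder μ X j (B j) ∧ IsStationaryBidder μ Y j (B j)) →
      WithFailure μ x fun ν => ApproxTruthful ν X Y i) := by
  refine ⟨threshold, polyTimeComputable_threshold, fun cmax hc => ?_⟩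
  have hf0 := failConst_nonneg
  refine ⟨20000 * (cmax + 1) + 4 * failConst, by positivity, 2, ?_⟩
  intro S A _ _ _ _ n hn ε α ζ hε hε1 hα hζ hζ1 ε₀ α₀ hε₀ hε₀ε hα₀ hα₀α δ hδ x hx M hM
  have hS := one_le_card_cast S
  have hA := one_le_card_cast A
  have hn' : (1 : ℝ) ≤ n := by exact_mod_cast hn
  set C : ℝ := 20000 * (cmax + 1) + 4 * failConst with hC
  set pr : Params := ⟨α, δ, ζ, cmax⟩ with hpr
  have hαS : α * Fintype.card S ≤ 1 := by
    obtain ⟨s⟩ := ‹Nonempty S›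
    obtain ⟨a⟩ := ‹Nonempty A›
    rw [← (M.trans_mem s a).2]
    refine le_trans (le_of_eq ?_) (Finset.sum_le_sum fun s' _ => hM s a s')
    simp [mul_comm]
  have hα1 : α ≤ 1 := (le_mul_of_one_le_right hα.le hS).trans hαS
  have hδ0 : 0 < δ := hδ ▸ threshold_pos _
  have hδ1 : δ ≤ (ε * α / (128 * (Fintype.card S * Fintype.card A * n))) ^ 2 := by
    rw [hδ]
    refine (threshold_le ε₀ α₀ _ _ n hε₀ hα₀ Fintype.card_pos Fintype.card_pos hn).trans ?_
    gcongr
  have hδ2 : δ ≤ (ε * α / (Fintype.card S * Fintype.card A)) ^ 2 := by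
    refine hδ1.trans ?_
    have h1 : (Fintype.card S * Fintype.card A : ℝ) ≤
        128 * (Fintype.card S * Fintype.card A * n) := by
      have h2 : (0 : ℝ) ≤ Fintype.card S * Fintype.card A := by positivity
      nlinarith
    gcongr
  have hδ3 : δ < 1 := by
    refine hδ2.trans_lt ?_
    have h1 : (1 : ℝ) ≤ Fintype.card S * Fintype.card A := one_le_mul_of_one_le_of_one_le hS hA
    have h2 : ε * α / (Fintype.card S * Fintype.card A) < 1 := by
      rw [div_lt_one (by linarith)]
      nlinarith
    exact pow_lt_one₀ (by positivity) h2 two_ne_zero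
  have hP : IsMixing M.trans pr.alpha := ⟨M.trans_mem, hα, hM⟩
  have hx' : x = C * pr.zeta * (1 + sizeLog S A pr) ^ 2 := hx
  -- A failure probability below one forces `ζ` to be small.
  have hadm : x < 1 → Admissible S A pr := fun hlt =>
    admissible_of_lt_one (C := C) (by linarith) hε hε1.le hα hαS hδ0 hδ1 hn hζ hc (hx' ▸ hlt)
  have hfail : 4 * (failConst * (pr.zeta * (1 + sizeLog S A pr) ^ 2)) ≤ x := by
    have h1 : 0 ≤ pr.zeta * (1 + sizeLog S A pr) ^ 2 := mul_nonneg hζ.le (sq_nonneg _)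
    rw [hx', hC]
    nlinarith [mul_nonneg hc h1]
  refine ⟨⟨hδ0, hδ3⟩, ?_, ?_, ?_⟩
  · -- All reports are truthful, so their means are the mean rewards.
    intro Ω _ μ _ X hX hf hT hlt
    have hp := hadm hlt
    obtain ⟨G, hG, hr⟩ := exists_goodRun (pr := pr) (Q := fun _ => True) (m := M.reward)
      hX hf hp hP hn (fun j _ => by
        induction j using Fin.cases with
        | zero => exact hX.hasMean_report_zero hc
        | succ i => exact hX.hasMean_report_truthful hc (hT i)) hlt hfail
    refine ⟨G, hr.meas, hG, fun s₀ π πEx p hvcg => ⟨fun T hTge L hL => ?_, ?_⟩⟩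
    · -- The lower bound for `T` is positive.
      have hT1 : 1 ≤ T := by
        rw [Nat.one_le_iff_ne_zero]
        rintro rfl
        have h1 := hp.four_le_logTerm (k := 1) le_rfl
        simp only [logTerm, Nat.cast_one, mul_one] at h1
        have h2 : 0 < 8 / (α * δ) := by positivity
        have h3 := mul_pos h2 (by linarith :
          0 < Real.log ((Fintype.card A : ℝ) * Fintype.card S / ζ))
        rw [Nat.cast_zero] at hTge
        linarith
      have hL2 : L = (1 + rewLog S A pr n T) ^ 2 := hL
      have hrate : ∀ {k B r N : ℝ}, 0 ≤ k → 0 ≤ B → B ≤ 960 → N = k * n →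
          r ≤ T * (k * shrinkLoss A pr n) + B * k * payoffCap n pr.cmax * learnErr S A pr n T →
          r ≤ C * L * regretRate S ε α δ T N := fun {k B r N} hk hB0 hB hN hr => by
        have hreg : 0 ≤ regretRate S ε α δ T N := by
          rw [hN]; unfold regretRate; positivity
        refine (hr.trans (hp.rate_le hn hε hε1.le hδ2 hTge hk hB0 hB)).trans ?_
        rw [← hN, ← hL2]
        have hL0 : 0 ≤ L := hL2 ▸ sq_nonneg _
        gcongr
        change 20000 * (cmax + 1) ≤ C
        linarith
      have hSW := hr.regSW_le (fun _ => trivial) hvcg.alloc hT1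
      have hSELL := hr.regSELL_le (fun _ => trivial) hvcg hT1
      have hBID := hr.regBID_le (fun _ => trivial) hvcg hT1
      exact ⟨hrate (k := 1) (B := 480) (by norm_num) (by norm_num) (by norm_num) (by ring)
          (by rw [one_mul, mul_one]; exact hSW),
        hrate (k := n) (B := 32) (by positivity) (by norm_num) (by norm_num) (by ring) hSELL,
        hrate (k := n) (B := 960) (by positivity) (by norm_num) (by norm_num) (by ring) hBID⟩
    · intro η hη
      filter_upwards [hr.approxEfficient (fun _ => trivial) hvcg.alloc η hη] with T hTη
      refine hTη.trans ?_
      have h1 : shrinkLoss A pr n ≤ 4 * payoffCap n pr.cmax * ε :=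
        hp.shrinkLoss_le hε hε1.le (hδ2.trans (by
          gcongr
          exact le_mul_of_one_le_left (by linarith) hS))
      have h2 : 4 * payoffCap n pr.cmax * ε ≤ C * n * ε := by
        rw [payoffCap, ← mul_assoc]
        gcongr
        change 4 * (cmax + 1) ≤ C
        linarith
      linarith
  · -- Only the reports of bidder `i` are known to have the right means.
    intro Ω _ μ _ X hX hf i hi hlt
    obtain ⟨G, hG, hr⟩ := exists_goodRun (pr := pr) (Q := fun j => j = i.succ) (m := M.reward)
      hX hf (hadm hlt) hP hn
      (fun j hj => by rw [hj]; exact hX.hasMean_report_truthful hc hi) hlt hfail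
    exact ⟨G, hr.meas, hG, hr.approxRational rfl rfl⟩
  · -- The means of the reports are the mean rewards for the seller and bidder `i`, and those of
    -- the stationary strategies for the others. In the second run, nothing is known about `i`.
    intro Ω _ μ _ X Y hX hf hY hf' i hi B hB hstat hlt
    set m : Fin (n + 1) → S → A → ℝ := Fin.cons (M.reward 0) fun j =>
      if j = i then M.reward i.succ else meanBid (B j) with hm
    have hmi : m i.succ = M.reward i.succ := by simp [hm]
    have hmj : ∀ j, j ≠ i → m j.succ = meanBid (B j) := fun j hj => by simp [hm, hj]
    obtain ⟨G, hG, hr, hr'⟩ := exists_goodRun_pair (pr := pr) (Q := fun _ => True)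
      (Q' := fun j => j ≠ i.succ) (m := m) hX hf hY hf' (hadm hlt) hP hn
      (fun j _ => by
        induction j using Fin.cases with
        | zero => exact hX.hasMean_report_zero hc
        | succ j =>
          by_cases hj : j = i
          · rw [hj, hmi]; exact hX.hasMean_report_truthful hc hi
          · rw [hmj j hj]; exact hX.hasMean_report_stationary (hB j) (hstat j hj).1)
      (fun j hne => by
        induction j using Fin.cases with
        | zero => exact hY.hasMean_report_zero hc
        | succ j =>
          have hj : j ≠ i := fun h => hne (by rw [h])
          rw [hmj j hj]; exact hY.hasMean_report_stationary (hB j) (hstat j hj).2) hlt hfail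
    exact ⟨G, hr.meas, hG, hr.approxTruthful (fun _ => trivial) hr' (fun _ h => h) hmi⟩
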